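/- **Setting.** Let $p\ge 1$ be an integer and $\gamma\in(0,1)$. Let $\Omega\subset\mathbb R^2$ be an open set (slits allowed) with a finite conforming partition $\mathcal T_n$ into open simple polygons $K$: every side $e$ of an element either lies on $\partial\Omega$ (a boundary edge; the two lips of a slit are different edges) or runs inside $\Omega$ and is also a side of a second element (an internal edge). Write $h_K=\operatorname{diam}K$, $h=\max_K h_K$, $h_e$ for the length of $e$, $\mathbf n_e$ for a unit normal of $e$, and $x_K$ for the barycenter of $K$. Assume, for all elements $K,K'$ and all sides $e$ of $K$: * (A0) $\gamma h_K\le h_{K'}\le\gamma^{-1}h_K$; * (A1) $K$ is star-shaped with respect to a ball of radius at least $\gamma h_K$; * (A2) $h_e\ge\gamma h_K$. Let $\mathbf A\in\mathbb R^2$ and $\widetilde\gamma>0$. The first layer $\mathcal T_n^1$ consists of the elements $K$ with $\mathbf A\in\overline K$ or $\operatorname{dist}(\mathbf A,x_K)\le\widetilde\gamma\operatorname{diam}\Omega$. Let $r$ be the distance from $\mathbf A$, and let $\theta$ be a continuous determination of the polar angle at $\mathbf A$ (with respect to some reference direction) on the part of $\Omega$ covered by the closed elements of $\mathcal T_n^1$.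 Let $S_{\mathbf A}(r,\theta)$ be either $r^\alpha\sin(\alpha\theta)$ with a real $\alpha>0$, or $r^\alpha(\log r\,\sin(\alpha\theta)+\theta\cos(\alpha\theta))$ with an integer $1\le\alpha\le p$. Put $S_{\mathbf A}^K=S_{\mathbf A}(r/h_K,\theta)$ and $S_{\mathbf A}^e=S_{\mathbf A}(r/h_e,\theta)$. Let $\mathbb P_{-1}=\{0\}$, and define * $\widetilde{\mathbb P}_p(K)=\mathbb P_p(K)+\operatorname{span}S^K_{\mathbf A}$ if $K\in\mathcal T_n^1$, and $\widetilde{\mathbb P}_p(K)=\mathbb P_p(K)$ otherwise; * $\widetilde{\mathbb P}_{p-1}(e)=\mathbb P_{p-1}(e)+\operatorname{span}(\mathbf n_e\cdot\nabla S^e_{\mathbf A}|_e)$ if $e$ is an edge of an element of $\mathcal T_n^1$ (the gradient being taken as a limit from inside that element), and $\widetilde{\mathbb P}_{p-1}(e)=\mathbb P_{p-1}(e)$ otherwise; * $V_n(K)=\{v\in H^1(K):\Delta v\in\mathbb P_{p-2}(K),\ \mathbf n_e\cdot\nabla v|_e\in\widetilde{\mathbb P}_{p-1}(e)\text{ for all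 edges } e \text{ of } K\}$, with Laplacian and normal derivative in the sense of Green's formula; * $V_n^{\mathrm{free}}$: the functions $v$ with $v|_K\in V_n(K)$ for all $K$ whose jump across each internal edge $e$ is orthogonal in $L^2(e)$ pairing to $\widetilde{\mathbb P}_{p-1}(e)$; * $V_n\subset V_n^{\mathrm{free}}$: the subspace in which, moreover, the trace on each boundary edge $e$ is orthogonal to $\widetilde{\mathbb P}_{p-1}(e)$. Let $|v|_{1,\mathcal T_n}^2=\sum_{K}|v|_{1,K}^2$. For $u\in H^1(\Omega)$, a degree-of-freedom interpolant $u_I$ of $u$ is a function with $u_I|_K\in V_n(K)$ for all $K$ that satisfies $\int_K(u-u_I)\,q=0$ for all $q\in\mathbb P_{p-2}(K)$ and all $K$, and $\int_e(u-u_I|_K)\,m=0$ for all $m\in\widetilde{\mathbb P}_{p-1}(e)$, all $K$ and all edges $e$ of $K$. A seminorm $|v|_{p+1,K}$ is $+\infty$ if the weak derivatives of order $p+1$ of $v$ are not all in $L^2(K)$. **Statement.** There is a constant $c>0$, depending only on $p$ and $\gamma$, such that the following holds in every such setting. 1. Let $u\in H^1(\Omega)$. Then $u$ has a degree-of-freedom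 interpolant. Every such interpolant $u_I$ belongs to $V_n^{\mathrm{free}}$, it belongs to $V_n$ if $u\in H^1_0(\Omega)$, and $$|u-u_I|_{1,\mathcal T_n}\le|u-u_\pi|_{1,\mathcal T_n}\qquad\text{for all } u_\pi \text{ with } u_\pi|_K\in\widetilde{\mathbb P}_p(K) \text{ for all } K.$$ 2. Let $u\in H^1_0(\Omega)$ and $u=u_0+S_{\mathbf A}$ a.e. on the elements of $\mathcal T_n^1$. (This includes the case of a weak solution $u\in H^1_0(\Omega)$ of $-\Delta u=f$ with $u=u_0+S_{\mathbf A}$ in $\Omega$ and $u_0$ analytic on $\overline\Omega$.) Then there are $u_\pi$, piecewise in $\widetilde{\mathbb P}_p(K)$, and $u_I\in V_n$, a degree-of-freedom interpolant of $u$, such that, with the same constant $c$, both $|u-u_\pi|_{1,\mathcal T_n}$ and $|u-u_I|_{1,\mathcal T_n}$ are at most $$c\,h^p\left\{\left(\sum_{K\in\mathcal T_n^1}|u_0|_{p+1,K}^2\right)^{1/2}+\left(\sum_{K\in\mathcal T_n\setminus\mathcal T_n^1}|u|_{p+1,K}^2\right)^{1/2}\right\}.$$ -/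

import Mathlib

open MeasureTheory Filter Topology Set
open scoped ENNReal ContDiff

namespace EVEM

noncomputable section

/-! ## Sobolev spaces on open subsets of the plane -/

/-- The Euclidean plane. -/
abbrev Plane : Type := EuclideanSpace ℝ (Fin 2)

/-- The classical partial derivative `∂^(i + j) φ / ∂x₀^i ∂x₁^j` of a smooth function. -/
def mixedPartial (i j : ℕ) (φ : Plane → ℝ) (x : Plane) : ℝ :=
  iteratedFDeriv ℝ (i + j) φ x
    (fun k : Fin (i + j) =>
      if (k : ℕ) < i then EuclideanSpace.single (0 : Fin 2) (1 : ℝ)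
      else EuclideanSpace.single (1 : Fin 2) (1 : ℝ))

/-- `φ` is a test function on the open set `D`, that is `φ ∈ C_c^∞(D)`. -/
def IsTestFunction (D : Set Plane) (φ : Plane → ℝ) : Prop :=
  ContDiff ℝ ∞ φ ∧ HasCompactSupport φ ∧ tsupport φ ⊆ D

/-- `g` is the weak partial derivative of order `(i, j)` of `u` on the open set `D`. -/
def HasWeakPartial (D : Set Plane) (i j : ℕ) (u g : Plane → ℝ) : Prop :=
  LocallyIntegrableOn u D ∧ LocallyIntegrableOn g D ∧
    ∀ φ : Plane → ℝ, IsTestFunction D φ →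
      ∫ x in D, u x * mixedPartial i j φ x = (-1 : ℝ) ^ (i + j) * ∫ x in D, g x * φ x

/-- The square `|u|_{m,D}^2 = ∑_{i+j=m} ‖∂^(i,j) u‖_{L²(D)}^2` of the Sobolev seminorm of order
`m`.  Weak derivatives are unique almost everywhere, so that the infimum picks the only
candidate; it is `∞` if some weak derivative of order `m` does not exist or is not in `L²(D)`. -/
def sobolevSeminormSq (m : ℕ) (D : Set Plane) (u : Plane → ℝ) : ℝ≥0∞ :=
  ∑ β ∈ Finset.HasAntidiagonal.antidiagonal m,
    ⨅ (g : Plane → ℝ) (_ : HasWeakPartial D β.1 β.2 u g), ∫⁻ x in D, ‖g x‖ₑ ^ 2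

/-- The square of the norm of `H^1(D)`. -/
def h1NormSq (D : Set Plane) (u : Plane → ℝ) : ℝ≥0∞ :=
  (∫⁻ x in D, ‖u x‖ₑ ^ 2) + sobolevSeminormSq 1 D u

/-- `u ∈ H^1(D)`. -/
def MemH1 (D : Set Plane) (u : Plane → ℝ) : Prop :=
  MemLp u 2 (volume.restrict D) ∧ sobolevSeminormSq 1 D u < ⊤

/-- `u ∈ H^1_0(D)`, the closure of the test functions in `H^1(D)`. -/
def MemH10 (D : Set Plane) (u : Plane → ℝ) : Prop :=
  MemH1 D u ∧ ∃ φ : ℕ → Plane → ℝ, (∀ n, IsTestFunction D (φ n)) ∧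
    Tendsto (fun n => h1NormSq D (u - φ n)) atTop (𝓝 0)

/-- `G` is the weak gradient of `u` on `D`, and it is square integrable. -/
def HasWeakGradient (D : Set Plane) (u : Plane → ℝ) (G : Plane → Plane) : Prop :=
  MemLp G 2 (volume.restrict D) ∧
    HasWeakPartial D 1 0 u (fun x => G x 0) ∧ HasWeakPartial D 0 1 u (fun x => G x 1)

/-- Arc length on the segment from `a` to `b`. -/
def arcLength (a b : Plane) : Measure Plane :=
  ENNReal.ofReal (dist a b) •
    Measure.map (fun t : ℝ => AffineMap.lineMap a b t) (volume.restrict (Icc (0 : ℝ) 1))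

/-- `t` is the trace of `v ∈ H^1(D)` on a segment in the boundary of `D`, with arc length `μ`: the
limit in `L²(μ)` of the restrictions of smooth functions that converge to `v` in `H^1(D)`. -/
def HasTrace (D : Set Plane) (μ : Measure Plane) (v t : Plane → ℝ) : Prop :=
  MemLp t 2 μ ∧ ∃ φ : ℕ → Plane → ℝ, (∀ n, ContDiff ℝ ∞ (φ n)) ∧
    Tendsto (fun n => h1NormSq D (v - φ n)) atTop (𝓝 0) ∧
    Tendsto (fun n => eLpNorm (t - φ n) 2 μ) atTop (𝓝 0)

/-- Bivariate polynomials of total degree `< m`, as functions on the plane.  Thus `ℙ_p` is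
`polyLT (p + 1)`, `ℙ_{p-1}` is `polyLT p`, and `ℙ_{p-2}` is `polyLT (p - 1)`, which is `{0}` if
`p = 1`.  The polynomials of degree `≤ p - 1` on an edge are the restrictions to the edge of
functions in `polyLT p`. -/
def polyLT (m : ℕ) : Submodule ℝ (Plane → ℝ) :=
  Submodule.span ℝ
    {f : Plane → ℝ | ∃ a b : ℕ, a + b < m ∧ f = fun x : Plane => x 0 ^ a * x 1 ^ b}

/-! ## Polygonal meshes -/

/-- An open polygon: the bounded region enclosed by a simple closed polygonal curve.
Consecutive sides may be collinear, so that hanging nodes are allowed. -/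
structure PolygonalCell where
  /-- The number of sides is `m + 3`. -/
  m : ℕ
  /-- The vertices, in cyclic order: the index `i + 1` is taken modulo `m + 3`. -/
  vert : Fin (m + 3) → Plane
  vert_injective : Function.Injective vert
  simple : ∀ i j : Fin (m + 3), i ≠ j →
    segment ℝ (vert i) (vert (i + 1)) ∩ segment ℝ (vert j) (vert (j + 1)) ⊆
      {vert i, vert (i + 1)} ∩ {vert j, vert (j + 1)}
  /-- The open region itself. -/
  body : Set Plane
  isOpen_body : IsOpen body
  isConnected_body : IsConnected body
  isBounded_body : Bornology.IsBounded body
  frontier_body : frontier body = ⋃ i, segment ℝ (vert i) (vert (i + 1))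

/-- The diameter `h_K`. -/
def PolygonalCell.diam (K : PolygonalCell) : ℝ := Metric.diam K.body

/-- The barycenter `x_K`. -/
def PolygonalCell.barycenter (K : PolygonalCell) : Plane := ⨍ x in K.body, x

/-- A conforming partition of the open set `Ω` into polygons.  Each side of an element lies on
the boundary of `Ω`, or it runs inside `Ω` and is also a side of a second element.  The set `Ω` may
have slits: both lips of a slit are then covered by boundary sides. -/
structure Mesh (Ω : Set Plane) (ι : Type) where
  elem : ι → PolygonalCell
  body_subset : ∀ k, (elem k).body ⊆ Ω
  disjoint_body : Pairwise fun k l => Disjoint (elem k).body (elem l).body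
  closure_eq : closure Ω = ⋃ k, closure (elem k).body
  side_cases : ∀ (k : ι) (i : Fin ((elem k).m + 3)),
    openSegment ℝ ((elem k).vert i) ((elem k).vert (i + 1)) ⊆ frontier Ω ∨
    (openSegment ℝ ((elem k).vert i) ((elem k).vert (i + 1)) ⊆ Ω ∧
      ∃ (l : ι) (j : Fin ((elem l).m + 3)), l ≠ k ∧
        segment ℝ ((elem l).vert j) ((elem l).vert (j + 1)) =
          segment ℝ ((elem k).vert i) ((elem k).vert (i + 1)))

/-- The data of the enrichment: the singular point `A`, the parameter of the first layer, a
singular function `σ(r, θ)` in polar coordinates, and a determination `θ` of the polar angle at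
`A`. -/
structure Enrichment where
  A : Plane
  γt : ℝ
  σ : ℝ → ℝ → ℝ
  θ : Plane → ℝ

/-- The singular function on the plane with scaling parameter `h`: `x ↦ σ(r / h, θ)`. -/
def Enrichment.scaled (S : Enrichment) (h : ℝ) (x : Plane) : ℝ :=
  S.σ (dist x S.A / h) (S.θ x)

namespace Mesh

variable {Ω : Set Plane} {ι : Type}

/-- A side of an element of the mesh: the element together with the index of the side. -/
abbrev Side (M : Mesh Ω ι) : Type := Σ k : ι, Fin ((M.elem k).m + 3)

/-- The first end point of a side. -/
def sideA (M : Mesh Ω ι) (s : M.Side) : Plane := (M.elem s.1).vert s.2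

/-- The second end point of a side. -/
def sideB (M : Mesh Ω ι) (s : M.Side) : Plane := (M.elem s.1).vert (s.2 + 1)

/-- The length `h_e` of a side. -/
def sideLength (M : Mesh Ω ι) (s : M.Side) : ℝ := dist (M.sideA s) (M.sideB s)

/-- A unit normal vector of a side.  Only its span matters below, not its orientation. -/
def sideNormal (M : Mesh Ω ι) (s : M.Side) : Plane :=
  (M.sideLength s)⁻¹ • !₂[M.sideB s 1 - M.sideA s 1, -(M.sideB s 0 - M.sideA s 0)]

/-- Arc length on a side. -/
def sideMeasure (M : Mesh Ω ι) (s : M.Side) : Measure Plane :=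
  arcLength (M.sideA s) (M.sideB s)

/-- Two sides are the same edge of the mesh: they are equal, or they are the two sides of an
internal edge.  The two lips of a slit in `Ω` are different edges. -/
def SameEdge (M : Mesh Ω ι) (s s' : M.Side) : Prop :=
  s = s' ∨ (openSegment ℝ (M.sideA s) (M.sideB s) ⊆ Ω ∧
    segment ℝ (M.sideA s) (M.sideB s) = segment ℝ (M.sideA s') (M.sideB s'))

/-- The regularity assumptions on the mesh, with constant `γ`. -/
structure Regular (M : Mesh Ω ι) (γ : ℝ) : Prop where
  /-- The elements have comparable sizes. -/
  size : ∀ k l, γ * (M.elem k).diam ≤ (M.elem l).diam ∧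
    (M.elem l).diam ≤ γ⁻¹ * (M.elem k).diam
  /-- Each element is star-shaped with respect to every point of a ball of radius at least
  `γ * h_K`. -/
  star : ∀ k, ∃ (z : Plane) (ρ : ℝ), γ * (M.elem k).diam ≤ ρ ∧
    ∀ y ∈ Metric.ball z ρ, StarConvex ℝ y (M.elem k).body
  /-- The sides are not short. -/
  side : ∀ s : M.Side, γ * (M.elem s.1).diam ≤ M.sideLength s

/-- The mesh size `h`, the largest diameter of an element. -/
def size (M : Mesh Ω ι) : ℝ := ⨆ k, (M.elem k).diam

/-- The first layer: the elements that abut or contain `A`, and those whose barycenter is close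
to `A`.  All other elements form the second and the third layer. -/
def firstLayer (M : Mesh Ω ι) (S : Enrichment) : Set ι :=
  {k | S.A ∈ closure (M.elem k).body ∨
    dist S.A (M.elem k).barycenter ≤ S.γt * Metric.diam Ω}

/-- The part of `Ω` that is covered by the closed elements of the first layer. -/
def firstPatch (M : Mesh Ω ι) (S : Enrichment) : Set Plane :=
  Ω ∩ ⋃ k ∈ M.firstLayer S, closure (M.elem k).body

open Classical in
/-- The enriched polynomials `ℙ_p(K) ⊕ S_A^K` on an element of the first layer, and `ℙ_p(K)` on the
other elements. -/
def enrichedPoly (M : Mesh Ω ι) (S : Enrichment) (p : ℕ) (k : ι) : Submodule ℝ (Plane → ℝ) :=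
  polyLT (p + 1) ⊔
    (if k ∈ M.firstLayer S then Submodule.span ℝ {S.scaled (M.elem k).diam} else ⊥)

/-- The normal derivative on the side `s` of the singular function with scaling parameter `h_e`, as
a limit from the inside of the element to which `s` belongs. -/
def singularFlux (M : Mesh Ω ι) (S : Enrichment) (s : M.Side) (x : Plane) : ℝ :=
  inner ℝ (M.sideNormal s)
    (limUnder (𝓝[(M.elem s.1).body] x) (gradient (S.scaled (M.sideLength s))))

/-- The enriched polynomials on an edge: `ℙ_{p-1}(e)`, to which the normal derivative of the
singular function is added if the edge belongs to an element of the first layer.  Only the values on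
the edge matter. -/
def enrichedEdge (M : Mesh Ω ι) (S : Enrichment) (p : ℕ) (s : M.Side) :
    Submodule ℝ (Plane → ℝ) :=
  polyLT p ⊔ Submodule.span ℝ
    {g | ∃ s' : M.Side, M.SameEdge s s' ∧ s'.1 ∈ M.firstLayer S ∧ g = M.singularFlux S s'}

/-- The local space `V_n(K)`: functions `v ∈ H^1(K)` with `Δ v = q ∈ ℙ_{p-2}(K)` and with normal
derivative `g i` on the `i`-th side in the enriched polynomial space of that side.  Laplacian and
outer normal derivative are those given by Green's formula. -/
def MemLocal (M : Mesh Ω ι) (S : Enrichment) (p : ℕ) (k : ι) (v : Plane → ℝ) : Prop :=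
  MemH1 (M.elem k).body v ∧
    ∃ G : Plane → Plane, HasWeakGradient (M.elem k).body v G ∧
    ∃ q ∈ polyLT (p - 1), ∃ g : Fin ((M.elem k).m + 3) → Plane → ℝ,
      (∀ i, g i ∈ M.enrichedEdge S p ⟨k, i⟩) ∧
      ∀ φ : Plane → ℝ, ContDiff ℝ ∞ φ →
        ∫ x in (M.elem k).body, inner ℝ (G x) (gradient φ x) =
          -(∫ x in (M.elem k).body, q x * φ x) +
            ∑ i, ∫ x, g i x * φ x ∂(M.sideMeasure ⟨k, i⟩)

/-- The nonconforming enriched virtual element space without boundary conditions: the enriched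
moments of the jumps across the internal edges vanish. -/
def MemVnFree (M : Mesh Ω ι) (S : Enrichment) (p : ℕ) (v : Plane → ℝ) : Prop :=
  (∀ k, M.MemLocal S p k v) ∧
    ∀ s s' : M.Side, s ≠ s' → M.SameEdge s s' →
      ∃ t t' : Plane → ℝ, HasTrace (M.elem s.1).body (M.sideMeasure s) v t ∧
        HasTrace (M.elem s'.1).body (M.sideMeasure s) v t' ∧
        ∀ m ∈ M.enrichedEdge S p s, ∫ x, (t x - t' x) * m x ∂(M.sideMeasure s) = 0

/-- The space `V_n`: in addition, the enriched moments on the boundary edges vanish. -/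
def MemVn (M : Mesh Ω ι) (S : Enrichment) (p : ℕ) (v : Plane → ℝ) : Prop :=
  M.MemVnFree S p v ∧
    ∀ s : M.Side, openSegment ℝ (M.sideA s) (M.sideB s) ⊆ frontier Ω →
      ∃ t : Plane → ℝ, HasTrace (M.elem s.1).body (M.sideMeasure s) v t ∧
        ∀ m ∈ M.enrichedEdge S p s, ∫ x, t x * m x ∂(M.sideMeasure s) = 0

/-- `uI` is piecewise in the local virtual element spaces, and it has the same degrees of freedom
as `u`: the same moments against `ℙ_{p-2}(K)` on every element `K`, and the same moments
against the enriched polynomials on every edge. -/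
def IsDofInterpolant (M : Mesh Ω ι) (S : Enrichment) (p : ℕ) (u uI : Plane → ℝ) : Prop :=
  (∀ k, M.MemLocal S p k uI) ∧
    (∀ k, ∀ q ∈ polyLT (p - 1), ∫ x in (M.elem k).body, (u x - uI x) * q x = 0) ∧
    ∀ s : M.Side, ∃ t : Plane → ℝ,
      HasTrace (M.elem s.1).body (M.sideMeasure s) (u - uI) t ∧
        ∀ m ∈ M.enrichedEdge S p s, ∫ x, t x * m x ∂(M.sideMeasure s) = 0

/-- `w` is piecewise an enriched polynomial. -/
def IsPiecewiseEnriched (M : Mesh Ω ι) (S : Enrichment) (p : ℕ) (w : Plane → ℝ) : Prop :=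
  ∀ k, ∃ f ∈ M.enrichedPoly S p k, EqOn w f (M.elem k).body

/-- The broken seminorm `|v|_{1,T_n}`. -/
def brokenSeminorm [Fintype ι] (M : Mesh Ω ι) (v : Plane → ℝ) : ℝ≥0∞ :=
  (∑ k, sobolevSeminormSq 1 (M.elem k).body v) ^ (1 / 2 : ℝ)

open Classical in
/-- The quantity
`(∑_{K in the first layer} |u₀|_{p+1,K}²)^(1/2) + (∑_{other K} |u|_{p+1,K}²)^(1/2)`. -/
def layeredSeminorm [Fintype ι] (M : Mesh Ω ι) (S : Enrichment) (p : ℕ) (u₀ u : Plane → ℝ) :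
    ℝ≥0∞ :=
  (∑ k with k ∈ M.firstLayer S, sobolevSeminormSq (p + 1) (M.elem k).body u₀) ^ (1 / 2 : ℝ) +
    (∑ k with k ∉ M.firstLayer S, sobolevSeminormSq (p + 1) (M.elem k).body u) ^ (1 / 2 : ℝ)

end Mesh

/-- The singular functions in polar coordinates: `r^α sin(α θ)` with `α > 0`, or, for an integer
exponent `1 ≤ n ≤ p`, `r^n (log r sin(n θ) + θ cos(n θ))`.  Replacing `r` by `r / h` multiplies the
first kind by a constant, and the second kind by a constant up to adding a multiple of the
polynomial `r^n sin(n θ)` of degree `n ≤ p`. -/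
def IsSingularProfile (p : ℕ) (σ : ℝ → ℝ → ℝ) : Prop :=
  (∃ α : ℝ, 0 < α ∧ σ = fun r θ => r ^ α * Real.sin (α * θ)) ∨
  (∃ n : ℕ, 1 ≤ n ∧ n ≤ p ∧
    σ = fun r θ => r ^ n * (Real.log r * Real.sin (n * θ) + θ * Real.cos (n * θ)))

/-- `θ` is a continuous determination on `U` of the polar angle at `A`, measured from some
reference direction `β`. -/
def IsPolarAngle (A : Plane) (U : Set Plane) (θ : Plane → ℝ) : Prop :=
  ContinuousOn θ U ∧ ∃ β : ℝ, ∀ x ∈ U,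
    x = A + dist x A • !₂[Real.cos (β + θ x), Real.sin (β + θ x)]

end

end EVEM

/-! The heart of the matter is orthogonality on each element. Testing the definition of $V_n(K)$
with functions $w\in H^1(K)$ shows that $\int_K\nabla v\cdot\nabla w=0$ for $v\in V_n(K)$ as soon as
all degrees of freedom of $w$ vanish (`Mesh.Admissible.integral_inner_eq_zero`). So a
degree-of-freedom interpolant is the projection of $u$ onto $V_n(K)$ in the $H^1$ seminorm, and it
beats every competitor in $V_n(K)$ with constant one, by Pythagoras. Quasi-optimality is therefore
reduced to the inclusion $\widetilde{\mathbb P}_p(K)\subset V_n(K)$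
(`Mesh.Admissible.memLocal_enrichedPoly`).

Existence uses the same structure backwards (`Mesh.Admissible.exists_local_interpolant`). Let $N_0$
be the smooth functions with vanishing degrees of freedom, and let $\nabla w$ be the $L^2$
projection of $\nabla u$ onto the closure of $\nabla N_0$. A Poincaré inequality for functions with
mean value zero on a side makes $w$ an $H^1$ function. The functional
$\varphi\mapsto\int_K\nabla(u-w)\cdot\nabla\varphi$ vanishes on $N_0$, hence is a combination of the
finitely many degrees of freedom, and this is Green's formula for $u-w\in V_n(K)$. Membership in
$V_n^{\mathrm{free}}$ and $V_n$ then follows from facts about $u$ alone: its traces from both sides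
of an internal edge agree (`HasTrace.ae_eq_of_subset`), and they vanish on the boundary if $u\in
H^1_0(\Omega)$.

The inclusion of the singular function needs care, because its gradient may blow up at $\mathbf A$,
which may lie on the boundary of an element. Since $\theta$ is continuous, $\mathbf A$ is not inside
an element of the first layer. Star-shapedness then puts $\overline K\setminus\{\mathbf A\}$ into a
plane slit along a half-line from $\mathbf A$, on which the singular function is the imaginary part
of a holomorphic function with $|\nabla S|\le C r^{-\gamma'}$ for some $\gamma'<1$
(`IsStarDomain.exists_isSingularOn`). Green's formula holds for such functions by exhausting $K$
with shrunken copies and dominated convergence (`PolygonalCell.green_singular`). The flux need not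
be in $L^2(e)$, so its pairing with traces rests on the weighted inequality $\int_e
r^{-\beta}|f|^2\le C\|f\|_{H^1(K)}^2$ for $\beta<1$ (`PolygonalCell.weighted_trace`). Scaling by
$h_K$ or by $h_e$ is harmless by `IsSingularProfile.rescale`: it changes the singular function by a
factor and a polynomial of degree at most $p$.

For the error bound, subtract the singular function on the first layer and approximate $u_0$ there,
and $u$ elsewhere, by polynomials. The Bramble–Hilbert lemma (`IsStarDomain.exists_poly`) has an
explicit constant in terms of the ratio of the diameter to the radius of the ball, obtained by
iterating the Poincaré inequality `IsStarDomain.poincare`. It is the only estimate that must be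
uniform in the mesh; the trace constants may depend on the element. The bound for $u_I$ follows from
the one for $u_\pi$ by quasi-optimality. -/

namespace EVEM

noncomputable section

section

/-! ## Partial derivatives -/

/-- The `i`-th standard unit vector of the plane. -/
abbrev unitVec (i : Fin 2) : Plane := EuclideanSpace.single i (1 : ℝ)

/-- The classical `i`-th partial derivative. -/
def pd (i : Fin 2) (f : Plane → ℝ) (x : Plane) : ℝ := fderiv ℝ f x (unitVec i)

lemma contDiff_pd {f : Plane → ℝ} (hf : ContDiff ℝ ∞ f) (i : Fin 2) : ContDiff ℝ ∞ (pd i f) := by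
  unfold pd
  exact (hf.fderiv_right (m := ∞) (by simp)).clm_apply contDiff_const

lemma contDiff_pd_iterate {f : Plane → ℝ} (hf : ContDiff ℝ ∞ f) (i : Fin 2) (n : ℕ) :
    ContDiff ℝ ∞ ((pd i)^[n] f) := by
  induction n with
  | zero => exact hf
  | succ n ih => rw [Function.iterate_succ_apply']; exact contDiff_pd ih i

/-- The directions are ordered with all $x_0$ first, so peeling off the first slot removes the
outermost derivative. All later calculations with `mixedPartial` go through this iterated form. -/
lemma iteratedFDeriv_eq_pd {f : Plane → ℝ} (hf : ContDiff ℝ ∞ f) (n : ℕ) : ∀ (i : ℕ), i ≤ n →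
    ∀ x, iteratedFDeriv ℝ n f x (fun k : Fin n => if (k : ℕ) < i then unitVec 0 else unitVec 1) =
      (pd 0)^[i] ((pd 1)^[n - i] f) x := by
  induction n with
  | zero => intro i hi x; obtain rfl : i = 0 := by omega
            simp
  | succ n ih =>
    intro i hi x
    have hd : DifferentiableAt ℝ (iteratedFDeriv ℝ n f) x :=
      (hf.differentiable_iteratedFDeriv (m := n) (by exact_mod_cast ENat.natCast_lt_top n)) x
    -- Evaluation at fixed vectors is continuous and linear, hence commutes with differentiation.
    have key : ∀ (v : Plane) (m : Fin n → Plane),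
        fderiv ℝ (iteratedFDeriv ℝ n f) x v m =
          fderiv ℝ (fun y => iteratedFDeriv ℝ n f y m) x v := by
      intro v m
      have := (ContinuousMultilinearMap.apply ℝ (fun _ : Fin n => Plane) ℝ m).hasFDerivAt.comp x
        hd.hasFDerivAt
      exact (congrArg (fun L => L v) this.fderiv).symm
    rw [iteratedFDeriv_succ_apply_left, key]
    rcases i with _ | i
    · have h1 : (Fin.tail fun k : Fin (n + 1) => if (k : ℕ) < 0 then unitVec 0 else unitVec 1) =
        fun k : Fin n => if (k : ℕ) < 0 then unitVec 0 else unitVec 1 := by ext; simp [Fin.tail]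
      have h2 : (fun y => iteratedFDeriv ℝ n f y
          (fun k : Fin n => if (k : ℕ) < 0 then unitVec 0 else unitVec 1)) =
          (pd 1)^[n] f := by ext y; simpa using ih 0 (by omega) y
      rw [h1, h2]
      simp [Function.iterate_succ_apply', pd]
    · have h1 : (Fin.tail fun k : Fin (n + 1) => if (k : ℕ) < i + 1 then unitVec 0 else unitVec 1) =
        fun k : Fin n => if (k : ℕ) < i then unitVec 0 else unitVec 1 := by ext; simp [Fin.tail]
      have h2 : (fun y => iteratedFDeriv ℝ n f y
          (fun k : Fin n => if (k : ℕ) < i then unitVec 0 else unitVec 1)) =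
          (pd 0)^[i] ((pd 1)^[n - i] f) := by ext y; exact ih i (by omega) y
      rw [h1, h2]
      simp [Function.iterate_succ_apply', pd]

lemma mixedPartial_eq {f : Plane → ℝ} (hf : ContDiff ℝ ∞ f) (i j : ℕ) :
    mixedPartial i j f = (pd 0)^[i] ((pd 1)^[j] f) := by
  ext x
  have h := iteratedFDeriv_eq_pd hf (i + j) i (by omega) x
  rw [Nat.add_sub_cancel_left] at h
  exact h

lemma contDiff_mixedPartial {f : Plane → ℝ} (hf : ContDiff ℝ ∞ f) (i j : ℕ) :
    ContDiff ℝ ∞ (mixedPartial i j f) := by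
  rw [mixedPartial_eq hf]; exact contDiff_pd_iterate (contDiff_pd_iterate hf _ _) _ _

lemma mixedPartial_one_zero {f : Plane → ℝ} (hf : ContDiff ℝ ∞ f) :
    mixedPartial 1 0 f = pd 0 f := by simp [mixedPartial_eq hf]

lemma mixedPartial_zero_one {f : Plane → ℝ} (hf : ContDiff ℝ ∞ f) :
    mixedPartial 0 1 f = pd 1 f := by simp [mixedPartial_eq hf]

lemma mixedPartial_zero_zero (f : Plane → ℝ) : mixedPartial 0 0 f = f := by
  ext x; simp [mixedPartial]

lemma gradient_apply (f : Plane → ℝ) (x : Plane) (i : Fin 2) : gradient f x i = pd i f x := by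
  have h : inner ℝ (gradient f x) (unitVec i) = fderiv ℝ f x (unitVec i) := by
    simp [gradient]
  rw [pd, ← h, EuclideanSpace.inner_single_right]
  simp

lemma support_pd_subset (i : Fin 2) (f : Plane → ℝ) : tsupport (pd i f) ⊆ tsupport f := by
  refine (closure_mono ?_).trans (tsupport_fderiv_subset ℝ (f := f))
  intro x hx
  simp only [Function.mem_support, pd] at hx ⊢
  intro h; simp [h] at hx

lemma IsTestFunction.pd {D : Set Plane} {φ : Plane → ℝ} (h : IsTestFunction D φ) (i : Fin 2) :
    IsTestFunction D (pd i φ) :=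
  ⟨contDiff_pd h.1 i, h.2.1.of_isClosed_subset (isClosed_tsupport _) (support_pd_subset i φ),
    (support_pd_subset i φ).trans h.2.2⟩

lemma IsTestFunction.pd_iterate {D : Set Plane} {φ : Plane → ℝ} (h : IsTestFunction D φ) (i : Fin 2)
    (n : ℕ) : IsTestFunction D ((EVEM.pd i)^[n] φ) := by
  induction n with
  | zero => exact h
  | succ n ih => rw [Function.iterate_succ_apply']; exact ih.pd i

lemma IsTestFunction.mixedPartial {D : Set Plane} {φ : Plane → ℝ} (h : IsTestFunction D φ)
    (i j : ℕ) : IsTestFunction D (mixedPartial i j φ) := by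
  rw [mixedPartial_eq h.1]; exact (h.pd_iterate 1 j).pd_iterate 0 i

/-! ## Weak derivatives -/

lemma integrableOn_mul_of_tsupport {D : Set Plane} {u ψ : Plane → ℝ}
    (hu : LocallyIntegrableOn u D) (hψ : Continuous ψ) (hc : HasCompactSupport ψ)
    (hs : tsupport ψ ⊆ D) : Integrable (fun x => u x * ψ x) := by
  have h1 : IntegrableOn u (tsupport ψ) := hu.integrableOn_compact_subset hs hc
  have h2 : IntegrableOn (fun x => u x * ψ x) (tsupport ψ) :=
    h1.mul_continuousOn hψ.continuousOn hc
  refine (integrableOn_iff_integrable_of_support_subset ?_).1 h2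
  intro x hx
  exact subset_tsupport _ (by simp at hx ⊢; exact hx.2)

lemma IsTestFunction.integrable_mul {D : Set Plane} {u φ : Plane → ℝ} (hφ : IsTestFunction D φ)
    (hu : LocallyIntegrableOn u D) : Integrable (fun x => u x * φ x) :=
  integrableOn_mul_of_tsupport hu hφ.1.continuous hφ.2.1 hφ.2.2

lemma HasWeakPartial.add {D : Set Plane} {i j : ℕ} {u v g k : Plane → ℝ}
    (h : HasWeakPartial D i j u g) (h' : HasWeakPartial D i j v k) :
    HasWeakPartial D i j (u + v) (g + k) := by
  refine ⟨h.1.add h'.1, h.2.1.add h'.2.1, fun φ hφ => ?_⟩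
  have e1 := h.2.2 φ hφ
  have e2 := h'.2.2 φ hφ
  simp only [Pi.add_apply, add_mul]
  rw [integral_add ((hφ.mixedPartial i j).integrable_mul h.1).integrableOn
    ((hφ.mixedPartial i j).integrable_mul h'.1).integrableOn,
    integral_add (hφ.integrable_mul h.2.1).integrableOn (hφ.integrable_mul h'.2.1).integrableOn,
    e1, e2]
  ring

lemma HasWeakPartial.smul {D : Set Plane} {i j : ℕ} {u g : Plane → ℝ}
    (h : HasWeakPartial D i j u g) (c : ℝ) : HasWeakPartial D i j (c • u) (c • g) := by
  refine ⟨h.1.smul c, h.2.1.smul c, fun φ hφ => ?_⟩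
  simp only [Pi.smul_apply, smul_eq_mul, mul_assoc]
  rw [integral_const_mul, integral_const_mul, h.2.2 φ hφ]
  ring

lemma HasWeakPartial.sub {D : Set Plane} {i j : ℕ} {u v g k : Plane → ℝ}
    (h : HasWeakPartial D i j u g) (h' : HasWeakPartial D i j v k) :
    HasWeakPartial D i j (u - v) (g - k) := by
  simpa [sub_eq_add_neg] using h.add (h'.smul (-1))

lemma HasWeakPartial.congr {D : Set Plane} {i j : ℕ} {u v g k : Plane → ℝ}
    (h : HasWeakPartial D i j u g) (hu : u =ᵐ[volume.restrict D] v)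
    (hg : g =ᵐ[volume.restrict D] k) : HasWeakPartial D i j v k := by
  refine ⟨h.1.congr hu, h.2.1.congr hg, fun φ hφ => ?_⟩
  have e1 : (fun x => u x * mixedPartial i j φ x) =ᵐ[volume.restrict D]
      fun x => v x * mixedPartial i j φ x := hu.mono fun x hx => by simp only [hx]
  have e2 : (fun x => g x * φ x) =ᵐ[volume.restrict D] fun x => k x * φ x :=
    hg.mono fun x hx => by simp only [hx]
  rw [← integral_congr_ae e1, h.2.2 φ hφ, integral_congr_ae e2]

lemma IsTestFunction.mono {D D' : Set Plane} {φ : Plane → ℝ} (h : IsTestFunction D' φ)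
    (hD : D' ⊆ D) : IsTestFunction D φ := ⟨h.1, h.2.1, h.2.2.trans hD⟩

lemma setIntegral_mul_testFunction {D : Set Plane} {φ : Plane → ℝ} (u : Plane → ℝ)
    (h : tsupport φ ⊆ D) : ∫ x in D, u x * φ x = ∫ x, u x * φ x := by
  refine setIntegral_eq_integral_of_forall_compl_eq_zero fun x hx => ?_
  rw [image_eq_zero_of_notMem_tsupport (fun h' => hx (h h')), mul_zero]

lemma HasWeakPartial.mono {D D' : Set Plane} {i j : ℕ} {u g : Plane → ℝ}
    (h : HasWeakPartial D i j u g) (hD : D' ⊆ D) : HasWeakPartial D' i j u g := by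
  refine ⟨h.1.mono_set hD, h.2.1.mono_set hD, fun φ hφ => ?_⟩
  have := h.2.2 φ (hφ.mono hD)
  rwa [setIntegral_mul_testFunction _ ((hφ.mono hD).mixedPartial i j).2.2,
    setIntegral_mul_testFunction _ (hφ.mono hD).2.2,
    ← setIntegral_mul_testFunction _ (hφ.mixedPartial i j).2.2,
    ← setIntegral_mul_testFunction _ hφ.2.2] at this

/-- The fundamental lemma of the calculus of variations. It collapses the infimum in
`sobolevSeminormSq` to a single candidate. -/
lemma HasWeakPartial.unique {D : Set Plane} (hD : IsOpen D) {i j : ℕ} {u g k : Plane → ℝ}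
    (h : HasWeakPartial D i j u g) (h' : HasWeakPartial D i j u k) :
    g =ᵐ[volume.restrict D] k := by
  have key := IsOpen.ae_eq_zero_of_integral_contDiff_smul_eq_zero (μ := volume) hD
    (h.2.1.sub h'.2.1) (fun φ hφ hc hs => by
      have hT : IsTestFunction D φ := ⟨hφ, hc, hs⟩
      have e := (h.2.2 φ hT).symm.trans (h'.2.2 φ hT)
      have e' := mul_left_cancel₀ (pow_ne_zero _ (by norm_num)) e
      rw [setIntegral_mul_testFunction _ hs, setIntegral_mul_testFunction _ hs] at e'
      simp only [Pi.sub_apply, smul_eq_mul, mul_sub]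
      simp only [mul_comm (φ _)]
      rw [integral_sub (hT.integrable_mul h.2.1) (hT.integrable_mul h'.2.1), e', sub_self])
  rw [Filter.EventuallyEq, ae_restrict_iff' hD.measurableSet]
  filter_upwards [key] with x hx hxD
  have := hx hxD
  simpa [sub_eq_zero] using this

lemma iInf_weakPartial {D : Set Plane} (hD : IsOpen D) {i j : ℕ} {u g : Plane → ℝ}
    (h : HasWeakPartial D i j u g) :
    ⨅ (g : Plane → ℝ) (_ : HasWeakPartial D i j u g), ∫⁻ x in D, ‖g x‖ₑ ^ 2 =
      ∫⁻ x in D, ‖g x‖ₑ ^ 2 := by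
  refine le_antisymm (iInf₂_le g h) (le_iInf₂ fun k hk => le_of_eq (lintegral_congr_ae ?_))
  filter_upwards [h.unique hD hk] with x hx
  rw [hx]

lemma sobolevSeminormSq_eq {D : Set Plane} (hD : IsOpen D) {m : ℕ} {u : Plane → ℝ}
    (g : ℕ × ℕ → Plane → ℝ)
    (h : ∀ β ∈ Finset.HasAntidiagonal.antidiagonal m, HasWeakPartial D β.1 β.2 u (g β)) :
    sobolevSeminormSq m D u =
      ∑ β ∈ Finset.HasAntidiagonal.antidiagonal m, ∫⁻ x in D, ‖g β x‖ₑ ^ 2 :=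
  Finset.sum_congr rfl fun β hβ => iInf_weakPartial hD (h β hβ)

lemma exists_weakPartial_of_sobolevSeminormSq_lt_top {D : Set Plane} {m : ℕ} {u : Plane → ℝ}
    (h : sobolevSeminormSq m D u < ⊤) :
    ∃ g : ℕ × ℕ → Plane → ℝ, ∀ β ∈ Finset.HasAntidiagonal.antidiagonal m,
      HasWeakPartial D β.1 β.2 u (g β) ∧ ∫⁻ x in D, ‖g β x‖ₑ ^ 2 < ⊤ := by
  have : ∀ β : ℕ × ℕ, ∃ g : Plane → ℝ, β ∈ Finset.HasAntidiagonal.antidiagonal m →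
      HasWeakPartial D β.1 β.2 u g ∧ ∫⁻ x in D, ‖g x‖ₑ ^ 2 < ⊤ := by
    intro β
    by_cases hβ : β ∈ Finset.HasAntidiagonal.antidiagonal m
    · have h1 := ENNReal.sum_lt_top.1 h β hβ
      obtain ⟨g, hg⟩ := iInf_lt_iff.1 h1
      obtain ⟨hg', h2⟩ := iInf_lt_iff.1 hg
      exact ⟨g, fun _ => ⟨hg', h2⟩⟩
    · exact ⟨0, fun h => absurd h hβ⟩
  choose g hg using this
  exact ⟨g, hg⟩

/-! ## Square integrable functions -/

lemma eLpNorm_two_sq {α E : Type*} [MeasurableSpace α] [NormedAddCommGroup E] (μ : Measure α)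
    (f : α → E) : eLpNorm f 2 μ ^ 2 = ∫⁻ x, ‖f x‖ₑ ^ 2 ∂μ := by
  have := eLpNorm_nnreal_pow_eq_lintegral (f := f) (μ := μ) (p := 2) (by norm_num)
  simpa using this

lemma memLp_two_iff {α E : Type*} [MeasurableSpace α] [NormedAddCommGroup E] {μ : Measure α}
    {f : α → E} (hf : AEStronglyMeasurable f μ) : MemLp f 2 μ ↔ ∫⁻ x, ‖f x‖ₑ ^ 2 ∂μ < ⊤ := by
  rw [← eLpNorm_two_sq]
  simp [MemLp, hf]

lemma plane_enorm_sq (v : Plane) : ‖v‖ₑ ^ 2 = ‖v 0‖ₑ ^ 2 + ‖v 1‖ₑ ^ 2 := by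
  have h : ‖v‖ ^ 2 = ‖v 0‖ ^ 2 + ‖v 1‖ ^ 2 := by
    rw [EuclideanSpace.norm_sq_eq]; simp
  simp only [← ofReal_norm]
  rw [← ENNReal.ofReal_pow (norm_nonneg _), ← ENNReal.ofReal_pow (norm_nonneg _),
    ← ENNReal.ofReal_pow (norm_nonneg _), ← ENNReal.ofReal_add (by positivity) (by positivity), h]

lemma plane_inner (v w : Plane) : inner ℝ v w = v 0 * w 0 + v 1 * w 1 := by
  simp [PiLp.inner_apply, mul_comm]

lemma memLp_coord {μ : Measure Plane} {G : Plane → Plane} (h : MemLp G 2 μ) (i : Fin 2) :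
    MemLp (fun x => G x i) 2 μ :=
  (EuclideanSpace.proj (𝕜 := ℝ) i).comp_memLp' h

lemma memLp_of_coord {μ : Measure Plane} {G : Plane → Plane} (h0 : MemLp (fun x => G x 0) 2 μ)
    (h1 : MemLp (fun x => G x 1) 2 μ) : MemLp G 2 μ := by
  refine memLp_piLp_iff.2 ?_ 
  intro i; fin_cases i
  · exact h0
  · exact h1

end

/-! ### Integration by parts, and closedness of weak derivatives in $L^2$ -/

section

lemma pd_comm {f : Plane → ℝ} (hf : ContDiff ℝ ∞ f) (i j : Fin 2) :
    pd i (pd j f) = pd j (pd i f) := by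
  ext x
  have hd : DifferentiableAt ℝ (fderiv ℝ f) x :=
    (hf.fderiv_right (m := ∞) (by simp)).differentiable (by simp) x
  have key : ∀ v w : Plane, fderiv ℝ (fun y => fderiv ℝ f y v) x w =
      fderiv ℝ (fderiv ℝ f) x w v := by
    intro v w
    have := (ContinuousLinearMap.apply ℝ ℝ v).hasFDerivAt.comp x hd.hasFDerivAt
    exact congrArg (fun L => L w) this.fderiv
  have hs : IsSymmSndFDerivAt ℝ f x :=
    (hf.contDiffAt (x := x)).isSymmSndFDerivAt (by simpa using ENat.LEInfty.out)
  change fderiv ℝ (fun y => fderiv ℝ f y (unitVec j)) x (unitVec i) =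
    fderiv ℝ (fun y => fderiv ℝ f y (unitVec i)) x (unitVec j)
  rw [key, key]
  exact hs _ _

lemma pd_iterate_comm {f : Plane → ℝ} (hf : ContDiff ℝ ∞ f) (i j : Fin 2) (n : ℕ) :
    pd i ((pd j)^[n] f) = (pd j)^[n] (pd i f) := by
  induction n generalizing f with
  | zero => rfl
  | succ n ih =>
    rw [Function.iterate_succ_apply, Function.iterate_succ_apply, ih (contDiff_pd hf j),
      pd_comm hf]

lemma pd_iterate_iterate_comm {f : Plane → ℝ} (hf : ContDiff ℝ ∞ f) (i j : Fin 2) (m n : ℕ) :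
    (pd i)^[m] ((pd j)^[n] f) = (pd j)^[n] ((pd i)^[m] f) := by
  induction m generalizing f with
  | zero => rfl
  | succ m ih =>
    rw [Function.iterate_succ_apply, Function.iterate_succ_apply, pd_iterate_comm hf,
      ih (contDiff_pd hf i)]

/-- Only smoothness on `D` matters, because the test function cuts off everything else. This
generality serves the singular function, which is smooth inside an element but not near its closure.
-/
lemma integral_mul_pd {D : Set Plane} (hD : IsOpen D) {f φ : Plane → ℝ} (hf : ContDiffOn ℝ 1 f D)
    (hφ : IsTestFunction D φ) (i : Fin 2) :
    ∫ x, f x * pd i φ x = -∫ x, pd i f x * φ x := by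
  have h0 : LocallyIntegrableOn f D := hf.continuousOn.locallyIntegrableOn hD.measurableSet
  have h1 : LocallyIntegrableOn (pd i f) D := by
    refine ContinuousOn.locallyIntegrableOn ?_ hD.measurableSet
    exact (hf.continuousOn_fderiv_of_isOpen hD le_rfl).clm_apply continuousOn_const
  exact integral_mul_fderiv_eq_neg_fderiv_mul_of_integrable (hφ.integrable_mul h1)
    ((hφ.pd i).integrable_mul h0) (hφ.integrable_mul h0)
    (fun x hx => (hf.differentiableOn (by simp)).differentiableAt (hD.mem_nhds (hφ.2.2 hx)))
    (fun x _ => hφ.1.differentiable (by simp) x)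

lemma integral_mul_pd_iterate {D : Set Plane} (hD : IsOpen D) {f φ : Plane → ℝ}
    (hf : ContDiff ℝ ∞ f) (hφ : IsTestFunction D φ) (i : Fin 2) (n : ℕ) :
    ∫ x, f x * (pd i)^[n] φ x = (-1 : ℝ) ^ n * ∫ x, (pd i)^[n] f x * φ x := by
  induction n generalizing f with
  | zero => simp
  | succ n ih =>
    rw [Function.iterate_succ_apply',
      integral_mul_pd hD (hf.of_le (by simp)).contDiffOn (hφ.pd_iterate i n), ih (contDiff_pd hf i)]
    simp only [Function.iterate_succ_apply]
    ring

lemma hasWeakPartial_of_contDiff {D : Set Plane} (hD : IsOpen D) {f : Plane → ℝ}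
    (hf : ContDiff ℝ ∞ f) (i j : ℕ) : HasWeakPartial D i j f (mixedPartial i j f) := by
  refine ⟨hf.continuous.continuousOn.locallyIntegrableOn hD.measurableSet,
    (contDiff_mixedPartial hf i j).continuous.continuousOn.locallyIntegrableOn hD.measurableSet,
    fun φ hφ => ?_⟩
  rw [setIntegral_mul_testFunction _ (hφ.mixedPartial i j).2.2,
    setIntegral_mul_testFunction _ hφ.2.2, mixedPartial_eq hφ.1, mixedPartial_eq hf,
    integral_mul_pd_iterate hD hf (hφ.pd_iterate 1 j) 0 i,
    integral_mul_pd_iterate hD (contDiff_pd_iterate hf 0 i) hφ 1 j,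
    pd_iterate_iterate_comm hf]
  ring

/-! ## Convergence of pairings -/

lemma tendsto_integral_inner {α E : Type*} [MeasurableSpace α] [NormedAddCommGroup E]
    [InnerProductSpace ℝ E] {μ : Measure α} {F : ℕ → α → E} {f g : α → E}
    (hF : ∀ n, MemLp (F n) 2 μ) (hf : MemLp f 2 μ) (hg : MemLp g 2 μ)
    (h : Tendsto (fun n => eLpNorm (f - F n) 2 μ) atTop (𝓝 0)) :
    Tendsto (fun n => ∫ x, inner ℝ (F n x) (g x) ∂μ) atTop (𝓝 (∫ x, inner ℝ (f x) (g x) ∂μ)) := by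
  have hi : ∀ {k : α → E}, MemLp k 2 μ → Integrable (fun x => inner ℝ (k x) (g x)) μ := by
    intro k hk
    have := L2.integrable_inner (𝕜 := ℝ) hk.toLp hg.toLp
    refine this.congr ?_
    filter_upwards [hk.coeFn_toLp, hg.coeFn_toLp] with x h1 h2
    rw [h1, h2]
  refine tendsto_integral_of_L1' _ (hi hf).1 (Eventually.of_forall fun n => hi (hF n)) ?_
  have hb : ∀ n, eLpNorm ((fun x => inner ℝ (F n x) (g x)) - fun x => inner ℝ (f x) (g x)) 1 μ ≤
      eLpNorm (f - F n) 2 μ * eLpNorm g 2 μ := by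
    intro n
    have := eLpNorm_le_eLpNorm_mul_eLpNorm_of_nnnorm (p := 2) (q := 2) (r := 1)
      (hf.sub (hF n)).1 hg.1
      (fun a b => -inner ℝ a b) 1 (Eventually.of_forall fun x => by
        simpa using nnnorm_inner_le_nnnorm (𝕜 := ℝ) ((f - F n) x) (g x))
    refine le_trans (le_of_eq ?_) (this.trans (by simp))
    congr 1; ext x
    simp [inner_sub_left]
  have hz : Tendsto (fun n => eLpNorm (f - F n) 2 μ * eLpNorm g 2 μ) atTop (𝓝 0) := by
    simpa using ENNReal.Tendsto.mul_const h (Or.inr hg.2.ne)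
  exact tendsto_of_tendsto_of_tendsto_of_le_of_le tendsto_const_nhds hz (fun _ => bot_le) hb

lemma tendsto_integral_mul {α : Type*} [MeasurableSpace α] {μ : Measure α} {F : ℕ → α → ℝ}
    {f g : α → ℝ} (hF : ∀ n, MemLp (F n) 2 μ) (hf : MemLp f 2 μ) (hg : MemLp g 2 μ)
    (h : Tendsto (fun n => eLpNorm (f - F n) 2 μ) atTop (𝓝 0)) :
    Tendsto (fun n => ∫ x, F n x * g x ∂μ) atTop (𝓝 (∫ x, f x * g x ∂μ)) := by
  simpa [mul_comm] using tendsto_integral_inner hF hf hg h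

lemma IsTestFunction.memLp {D : Set Plane} {φ : Plane → ℝ} (h : IsTestFunction D φ)
    (μ : Measure Plane) [IsFiniteMeasureOnCompacts μ] : MemLp φ 2 μ :=
  h.1.continuous.memLp_of_hasCompactSupport h.2.1

lemma locallyIntegrableOn_of_memLp {D : Set Plane} {u : Plane → ℝ}
    (h : MemLp u 2 (volume.restrict D)) : LocallyIntegrableOn u D := by
  have : LocallyIntegrable u (volume.restrict D) := h.locallyIntegrable (by norm_num)
  exact locallyIntegrableOn_of_locallyIntegrable_restrict this

/-- Both sides of the defining identity are $L^2$ pairings with fixed test functions, so they pass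
to the limit. -/
lemma HasWeakPartial.of_tendsto {D : Set Plane} {i j : ℕ} {u g : Plane → ℝ}
    {U V : ℕ → Plane → ℝ} (hU : ∀ n, MemLp (U n) 2 (volume.restrict D))
    (hV : ∀ n, MemLp (V n) 2 (volume.restrict D))
    (hu : MemLp u 2 (volume.restrict D)) (hg : MemLp g 2 (volume.restrict D))
    (h : ∀ n, HasWeakPartial D i j (U n) (V n))
    (hlu : Tendsto (fun n => eLpNorm (u - U n) 2 (volume.restrict D)) atTop (𝓝 0))
    (hlg : Tendsto (fun n => eLpNorm (g - V n) 2 (volume.restrict D)) atTop (𝓝 0)) :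
    HasWeakPartial D i j u g := by
  refine ⟨locallyIntegrableOn_of_memLp hu, locallyIntegrableOn_of_memLp hg, fun φ hφ => ?_⟩
  have h1 := tendsto_integral_mul hU hu ((hφ.mixedPartial i j).memLp _) hlu
  have h2 := (tendsto_integral_mul hV hg (hφ.memLp _) hlg).const_mul ((-1 : ℝ) ^ (i + j))
  refine tendsto_nhds_unique h1 (h2.congr fun n => ?_)
  rw [(h n).2.2 φ hφ]

/-! ## The space `H¹` -/

/-- `u ∈ L²(D)` has the weak gradient `G ∈ L²(D)`. -/
def IsH1 (D : Set Plane) (u : Plane → ℝ) (G : Plane → Plane) : Prop :=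
  MemLp u 2 (volume.restrict D) ∧ HasWeakGradient D u G

variable {D : Set Plane} {u v : Plane → ℝ} {G H : Plane → Plane}

lemma IsH1.sobolevSeminormSq (hD : IsOpen D) (h : IsH1 D u G) :
    sobolevSeminormSq 1 D u = eLpNorm G 2 (volume.restrict D) ^ 2 := by
  rw [sobolevSeminormSq_eq hD (fun β x => if β = (1, 0) then G x 0 else G x 1)]
  · have : Finset.HasAntidiagonal.antidiagonal 1 = {((0, 1) : ℕ × ℕ), (1, 0)} := rfl
    rw [this, Finset.sum_pair (by simp), eLpNorm_two_sq]
    simp only [plane_enorm_sq]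
    rw [lintegral_add_left']
    · simp [add_comm]
    · exact ((memLp_coord h.2.1 0).1.enorm.pow_const 2)
  · have : Finset.HasAntidiagonal.antidiagonal 1 = {((0, 1) : ℕ × ℕ), (1, 0)} := rfl
    rw [this]
    simp only [Finset.mem_insert, Finset.mem_singleton]
    rintro β (rfl | rfl)
    · simpa using h.2.2.2
    · simpa using h.2.2.1

lemma IsH1.h1NormSq (hD : IsOpen D) (h : IsH1 D u G) :
    h1NormSq D u = eLpNorm u 2 (volume.restrict D) ^ 2 + eLpNorm G 2 (volume.restrict D) ^ 2 := by
  rw [EVEM.h1NormSq, h.sobolevSeminormSq hD, eLpNorm_two_sq (volume.restrict D) u]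

lemma IsH1.memH1 (hD : IsOpen D) (h : IsH1 D u G) : MemH1 D u := by
  refine ⟨h.1, ?_⟩
  rw [h.sobolevSeminormSq hD]
  exact ENNReal.pow_lt_top h.2.1.2

/-- Extracts an actual gradient from the finite infima; from here on the arguments work with pairs
$(u,G)$. -/
lemma MemH1.exists_isH1 (h : MemH1 D u) : ∃ G, IsH1 D u G := by
  obtain ⟨g, hg⟩ := exists_weakPartial_of_sobolevSeminormSq_lt_top h.2
  have h10 := hg (1, 0) (by simp)
  have h01 := hg (0, 1) (by simp)
  have hm : ∀ {i j : ℕ} {k : Plane → ℝ}, HasWeakPartial D i j u k → ∫⁻ x in D, ‖k x‖ₑ ^ 2 < ⊤ →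
      MemLp k 2 (volume.restrict D) := fun hk h2 =>
    (memLp_two_iff hk.2.1.aestronglyMeasurable).2 h2
  refine ⟨fun x => !₂[g (1, 0) x, g (0, 1) x], h.1, ?_, ?_, ?_⟩
  · exact memLp_of_coord (by simpa using hm h10.1 h10.2) (by simpa using hm h01.1 h01.2)
  · simpa using h10.1
  · simpa using h01.1

lemma IsH1.add (h : IsH1 D u G) (h' : IsH1 D v H) : IsH1 D (u + v) (G + H) :=
  ⟨h.1.add h'.1, h.2.1.add h'.2.1, h.2.2.1.add h'.2.2.1, h.2.2.2.add h'.2.2.2⟩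

lemma IsH1.sub (h : IsH1 D u G) (h' : IsH1 D v H) : IsH1 D (u - v) (G - H) :=
  ⟨h.1.sub h'.1, h.2.1.sub h'.2.1, h.2.2.1.sub h'.2.2.1, h.2.2.2.sub h'.2.2.2⟩

lemma IsH1.smul (h : IsH1 D u G) (c : ℝ) : IsH1 D (c • u) (c • G) :=
  ⟨h.1.const_smul c, h.2.1.const_smul c, h.2.2.1.smul c, h.2.2.2.smul c⟩

lemma IsH1.congr (h : IsH1 D u G) (hu : u =ᵐ[volume.restrict D] v)
    (hG : G =ᵐ[volume.restrict D] H) : IsH1 D v H :=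
  ⟨h.1.ae_eq hu, h.2.1.ae_eq hG, h.2.2.1.congr hu (hG.mono fun x hx => by simp only [hx]),
    h.2.2.2.congr hu (hG.mono fun x hx => by simp only [hx])⟩

lemma IsH1.mono {D' : Set Plane} (h : IsH1 D u G) (hD : D' ⊆ D) : IsH1 D' u G :=
  ⟨h.1.mono_measure (Measure.restrict_mono_set _ hD),
    h.2.1.mono_measure (Measure.restrict_mono_set _ hD), h.2.2.1.mono hD, h.2.2.2.mono hD⟩

lemma HasWeakGradient.unique (hD : IsOpen D) (h : HasWeakGradient D u G)
    (h' : HasWeakGradient D u H) : G =ᵐ[volume.restrict D] H := by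
  filter_upwards [h.2.1.unique hD h'.2.1, h.2.2.unique hD h'.2.2] with x h0 h1
  ext i; fin_cases i
  · exact h0
  · exact h1

lemma eLpNorm_coord_le {μ : Measure Plane} (G : Plane → Plane) (i : Fin 2) :
    eLpNorm (fun x => G x i) 2 μ ≤ eLpNorm G 2 μ :=
  eLpNorm_mono fun _ => PiLp.norm_apply_le _ _

lemma IsH1.of_tendsto {U : ℕ → Plane → ℝ} {V : ℕ → Plane → Plane} (h : ∀ n, IsH1 D (U n) (V n))
    (hu : MemLp u 2 (volume.restrict D)) (hG : MemLp G 2 (volume.restrict D))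
    (hlu : Tendsto (fun n => eLpNorm (u - U n) 2 (volume.restrict D)) atTop (𝓝 0))
    (hlG : Tendsto (fun n => eLpNorm (G - V n) 2 (volume.restrict D)) atTop (𝓝 0)) :
    IsH1 D u G := by
  have hc : ∀ i : Fin 2, Tendsto (fun n => eLpNorm ((fun x => G x i) - fun x => V n x i) 2
      (volume.restrict D)) atTop (𝓝 0) := fun i =>
    tendsto_of_tendsto_of_tendsto_of_le_of_le tendsto_const_nhds hlG (fun _ => bot_le)
      fun n => eLpNorm_coord_le (G - V n) i
  exact ⟨hu, hG,
    HasWeakPartial.of_tendsto (fun n => (h n).1) (fun n => memLp_coord (h n).2.1 0) hu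
      (memLp_coord hG 0) (fun n => (h n).2.2.1) hlu (hc 0),
    HasWeakPartial.of_tendsto (fun n => (h n).1) (fun n => memLp_coord (h n).2.1 1) hu
      (memLp_coord hG 1) (fun n => (h n).2.2.2) hlu (hc 1)⟩

lemma hasWeakPartial_of_contDiffOn (hD : IsOpen D) {f : Plane → ℝ} (hf : ContDiffOn ℝ 1 f D) :
    HasWeakPartial D 1 0 f (pd 0 f) ∧ HasWeakPartial D 0 1 f (pd 1 f) := by
  have h0 : LocallyIntegrableOn f D := hf.continuousOn.locallyIntegrableOn hD.measurableSet
  have h1 : ∀ i, LocallyIntegrableOn (pd i f) D := fun i => by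
    refine ContinuousOn.locallyIntegrableOn ?_ hD.measurableSet
    exact (hf.continuousOn_fderiv_of_isOpen hD le_rfl).clm_apply continuousOn_const
  have key : ∀ i φ, IsTestFunction D φ →
      ∫ x in D, f x * pd i φ x = -∫ x in D, pd i f x * φ x := fun i φ hφ => by
    rw [setIntegral_mul_testFunction _ (hφ.pd i).2.2, setIntegral_mul_testFunction _ hφ.2.2,
      integral_mul_pd hD hf hφ]
  refine ⟨⟨h0, h1 0, fun φ hφ => ?_⟩, ⟨h0, h1 1, fun φ hφ => ?_⟩⟩
  · rw [mixedPartial_one_zero hφ.1, key 0 φ hφ]; simp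
  · rw [mixedPartial_zero_one hφ.1, key 1 φ hφ]; simp

lemma isH1_of_contDiffOn (hD : IsOpen D) {f : Plane → ℝ} (hf : ContDiffOn ℝ 1 f D)
    (h0 : MemLp f 2 (volume.restrict D)) (h1 : MemLp (gradient f) 2 (volume.restrict D)) :
    IsH1 D f (gradient f) := by
  refine ⟨h0, h1, ?_, ?_⟩
  · simpa only [gradient_apply] using (hasWeakPartial_of_contDiffOn hD hf).1
  · simpa only [gradient_apply] using (hasWeakPartial_of_contDiffOn hD hf).2

lemma contDiff_gradient {f : Plane → ℝ} (hf : ContDiff ℝ ∞ f) : ContDiff ℝ ∞ (gradient f) := by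
  unfold gradient
  exact (InnerProductSpace.toDual ℝ Plane).symm.contDiff.comp (hf.fderiv_right (m := ∞) (by simp))

lemma memLp_of_continuous {E : Type*} [NormedAddCommGroup E] [SecondCountableTopology E]
    (hb : Bornology.IsBounded D) {f : Plane → E} (hf : Continuous f) (p : ℝ≥0∞) :
    MemLp f p (volume.restrict D) := by
  have hK : IsCompact (closure D) := hb.isCompact_closure
  have hfin : IsFiniteMeasure (volume.restrict (closure D)) := ⟨by simpa using hK.measure_lt_top⟩
  obtain ⟨C, hC⟩ := hK.exists_bound_of_continuousOn hf.continuousOn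
  refine MemLp.mono_measure (Measure.restrict_mono_set _ subset_closure) ?_
  refine MemLp.of_bound hf.aestronglyMeasurable C ?_
  filter_upwards [ae_restrict_mem isClosed_closure.measurableSet] with x hx using hC x hx

lemma isH1_of_contDiff (hD : IsOpen D) (hb : Bornology.IsBounded D) {f : Plane → ℝ}
    (hf : ContDiff ℝ ∞ f) : IsH1 D f (gradient f) :=
  isH1_of_contDiffOn hD (hf.of_le (by simp)).contDiffOn (memLp_of_continuous hb hf.continuous 2)
    (memLp_of_continuous hb (contDiff_gradient hf).continuous 2)

end

section

/-! ## Domains that are star-shaped with respect to a ball -/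

/-- `K` is a bounded open set that is star-shaped with respect to each point of the ball of radius
`ρ` about `z`. -/
structure IsStarDomain (K : Set Plane) (z : Plane) (ρ : ℝ) : Prop where
  isOpen : IsOpen K
  isBounded : Bornology.IsBounded K
  nonempty : K.Nonempty
  pos : 0 < ρ
  star : ∀ y ∈ Metric.ball z ρ, StarConvex ℝ y K

namespace IsStarDomain

variable {K : Set Plane} {z : Plane} {ρ : ℝ}

lemma ball_subset (hK : IsStarDomain K z ρ) : Metric.ball z ρ ⊆ K := by
  intro y hy
  obtain ⟨x, hx⟩ := hK.nonempty
  simpa using hK.star y hy hx zero_le_one le_rfl (by simp)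

lemma mem_center (hK : IsStarDomain K z ρ) : z ∈ K :=
  hK.ball_subset (Metric.mem_ball_self hK.pos)

lemma add_smul_mem (hK : IsStarDomain K z ρ) {x y : Plane} (hy : y ∈ Metric.ball z ρ) (hx : x ∈ K)
    {t : ℝ} (h0 : 0 ≤ t) (h1 : t ≤ 1) : y + t • (x - y) ∈ K :=
  (hK.star y hy).add_smul_sub_mem hx h0 h1

lemma diam_pos (hK : IsStarDomain K z ρ) : 0 < Metric.diam K := by
  have h := Metric.dist_le_diam_of_mem hK.isBounded hK.mem_center
    (hK.ball_subset (show z + (ρ / 2) • unitVec 0 ∈ Metric.ball z ρ by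
      simp [norm_smul, abs_of_pos hK.pos]; linarith [hK.pos]))
  have : dist z (z + (ρ / 2) • unitVec 0) = ρ / 2 := by
    simp [dist_eq_norm, norm_smul, abs_of_pos hK.pos]
  linarith [hK.pos]

/-- `K` lies in the closed disc of radius `diam K` about `z`, and areas of discs scale
quadratically. -/
lemma volume_le (hK : IsStarDomain K z ρ) :
    volume K ≤ ENNReal.ofReal ((Metric.diam K / ρ) ^ 2) * volume (Metric.ball z ρ) := by
  have h1 : K ⊆ Metric.closedBall z (Metric.diam K) := fun x hx =>
    Metric.dist_le_diam_of_mem hK.isBounded hx hK.mem_center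
  refine (measure_mono h1).trans ?_
  rw [Measure.addHaar_closedBall _ _ Metric.diam_nonneg, Measure.addHaar_ball _ _ hK.pos.le]
  rw [← mul_assoc, ← ENNReal.ofReal_mul (by positivity)]
  simp only [finrank_euclideanSpace, Fintype.card_fin]
  rw [div_pow, div_mul_cancel₀ _ (pow_ne_zero _ hK.pos.ne')]

end IsStarDomain

/-! ## A Poincaré inequality -/

lemma lintegral_comp_add_smul (g : Plane → ℝ≥0∞) (hg : Measurable g) (c : Plane) {s : ℝ}
    (hs : 0 < s) : ∫⁻ x, g (c + s • x) = ENNReal.ofReal ((s ^ 2)⁻¹) * ∫⁻ x, g x := by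
  have h1 : ∫⁻ x, g (c + s • x) = ∫⁻ x, g (c + x) ∂(Measure.map (s • ·) volume) := by
    rw [lintegral_map (f := fun x => g (c + x)) (hg.comp (measurable_const_add c))
      (measurable_const_smul s)]
  rw [h1, Measure.map_addHaar_smul _ hs.ne', lintegral_smul_measure, lintegral_add_left_eq_self]
  simp [abs_of_pos hs]

/-- Cauchy–Schwarz against the constant 1. -/
lemma lintegral_sq_le {α : Type*} [MeasurableSpace α] {μ : Measure α} [IsProbabilityMeasure μ]
    {f : α → ℝ≥0∞}
    (hf : AEMeasurable f μ) : (∫⁻ t, f t ∂μ) ^ 2 ≤ ∫⁻ t, f t ^ 2 ∂μ := by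
  have := ENNReal.lintegral_mul_le_Lp_mul_Lq μ (p := 2) (q := 2)
    (Real.HolderConjugate.two_two) hf (aemeasurable_const (b := (1 : ℝ≥0∞)))
  simp only [Pi.mul_apply, mul_one, ENNReal.rpow_two, one_pow, lintegral_const, measure_univ,
    ENNReal.one_rpow] at this
  calc (∫⁻ t, f t ∂μ) ^ 2 ≤ ((∫⁻ t, f t ^ 2 ∂μ) ^ (1 / 2 : ℝ)) ^ 2 := by gcongr
    _ = _ := by rw [← ENNReal.rpow_natCast, ← ENNReal.rpow_mul]; simp

lemma sub_eq_integral_gradient {φ : Plane → ℝ} (hφ : ContDiff ℝ ∞ φ) (x y : Plane) :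
    φ x - φ y = ∫ t in (0 : ℝ)..1, inner ℝ (gradient φ (y + t • (x - y))) (x - y) := by
  have hd : ∀ t : ℝ, HasDerivAt (fun t : ℝ => φ (y + t • (x - y)))
      (inner ℝ (gradient φ (y + t • (x - y))) (x - y)) t := by
    intro t
    have h1 : HasDerivAt (fun t : ℝ => y + t • (x - y)) (x - y) t := by
      simpa using ((hasDerivAt_id t).smul_const (x - y)).const_add y
    have h2 := (hφ.differentiable (by simp) (y + t • (x - y))).hasFDerivAt.comp_hasDerivAt t h1
    have h3 : inner ℝ (gradient φ (y + t • (x - y))) (x - y) =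
        fderiv ℝ φ (y + t • (x - y)) (x - y) := by simp [gradient]
    rw [h3]
    exact h2
  have hc : Continuous fun t : ℝ => inner ℝ (gradient φ (y + t • (x - y))) (x - y) := by
    have := (contDiff_gradient hφ).continuous
    fun_prop
  rw [intervalIntegral.integral_eq_sub_of_hasDerivAt (fun t _ => hd t) (hc.intervalIntegrable _ _)]
  simp

lemma enorm_sub_sq_le {φ : Plane → ℝ} (hφ : ContDiff ℝ ∞ φ) {h : ℝ} {x y : Plane}
    (hxy : dist x y ≤ h) : ‖φ x - φ y‖ₑ ^ 2 ≤
      ENNReal.ofReal (h ^ 2) * ∫⁻ t in Ioc (0 : ℝ) 1, ‖gradient φ (y + t • (x - y))‖ₑ ^ 2 := by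
  have hc : Continuous fun t : ℝ => gradient φ (y + t • (x - y)) := by
    have := (contDiff_gradient hφ).continuous
    fun_prop
  have hh : 0 ≤ h := dist_nonneg.trans hxy
  have hp : IsProbabilityMeasure (volume.restrict (Ioc (0 : ℝ) 1)) := ⟨by simp⟩
  rw [sub_eq_integral_gradient hφ, intervalIntegral.integral_of_le zero_le_one]
  calc _ ≤ (∫⁻ t in Ioc (0 : ℝ) 1, ‖inner ℝ (gradient φ (y + t • (x - y))) (x - y)‖ₑ) ^ 2 := by
        gcongr; exact enorm_integral_le_lintegral_enorm _
    _ ≤ (∫⁻ t in Ioc (0 : ℝ) 1, ENNReal.ofReal h * ‖gradient φ (y + t • (x - y))‖ₑ) ^ 2 := by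
        gcongr with t
        rw [mul_comm, ← ofReal_norm, ← ofReal_norm, ← ENNReal.ofReal_mul (norm_nonneg _)]
        refine ENNReal.ofReal_le_ofReal ((norm_inner_le_norm _ _).trans ?_)
        gcongr
        rwa [← dist_eq_norm]
    _ = ENNReal.ofReal (h ^ 2) *
          (∫⁻ t in Ioc (0 : ℝ) 1, ‖gradient φ (y + t • (x - y))‖ₑ) ^ 2 := by
        rw [lintegral_const_mul' _ _ ENNReal.ofReal_ne_top, mul_pow, ENNReal.ofReal_pow hh]
    _ ≤ _ := by
        gcongr
        exact lintegral_sq_le hc.enorm.aemeasurable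

namespace IsStarDomain

variable {K : Set Plane} {z : Plane} {ρ : ℝ}

/-- Integrating over `x ∈ K` and `y` in the ball, at a fixed convex combination. -/
lemma lintegral_lintegral_le (hK : IsStarDomain K z ρ) {g : Plane → ℝ≥0∞} (hg : Measurable g)
    {t : ℝ} (ht : t ∈ Ioc (0 : ℝ) 1) :
    ∫⁻ y in Metric.ball z ρ, ∫⁻ x in K, g (y + t • (x - y)) ≤
      4 * volume K * ∫⁻ x in K, g x := by
  have hK' := hK.isOpen.measurableSet
  set k : Plane → ℝ≥0∞ := K.indicator g with hk
  have hkm : Measurable k := hg.indicator hK'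
  have hle : ∀ y ∈ Metric.ball z ρ, ∀ x ∈ K, g (y + t • (x - y)) ≤ k (y + t • (x - y)) := by
    intro y hy x hx
    rw [hk, indicator_of_mem (hK.add_smul_mem hy hx ht.1.le ht.2)]
  have h4 : ∀ s : ℝ, 1 / 2 ≤ s → ENNReal.ofReal ((s ^ 2)⁻¹) ≤ 4 := by
    intro s hs
    rw [show (4 : ℝ≥0∞) = ENNReal.ofReal 4 by simp]
    refine ENNReal.ofReal_le_ofReal ?_
    rw [inv_le_comm₀ (by positivity) (by norm_num)]
    nlinarith
  have hint : ∫⁻ x, k x = ∫⁻ x in K, g x := lintegral_indicator hK' _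
  -- One of the coefficients $t$ and $1-t$ of $x$ and $y$ is at least $1/2$. Substituting in that
  -- variable costs a Jacobian of at most 4, uniformly in $t$.
  rcases le_total (1 / 2) t with h | h
  · have h1 : ∀ y ∈ Metric.ball z ρ, ∫⁻ x in K, g (y + t • (x - y)) ≤ 4 * ∫⁻ x in K, g x := by
      intro y hy
      calc ∫⁻ x in K, g (y + t • (x - y)) ≤ ∫⁻ x in K, k (y + t • (x - y)) :=
            setLIntegral_mono' hK' (hle y hy)
        _ ≤ ∫⁻ x, k (y + t • (x - y)) := setLIntegral_le_lintegral _ _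
        _ = ∫⁻ x, k ((y - t • y) + t • x) := by
            congr 1; ext x; congr 1; module
        _ = ENNReal.ofReal ((t ^ 2)⁻¹) * ∫⁻ x, k x := lintegral_comp_add_smul k hkm _ ht.1
        _ ≤ 4 * ∫⁻ x in K, g x := by rw [hint]; gcongr; exact h4 t h
    calc _ ≤ ∫⁻ y in Metric.ball z ρ, 4 * ∫⁻ x in K, g x :=
          setLIntegral_mono' measurableSet_ball h1
      _ = 4 * (∫⁻ x in K, g x) * volume (Metric.ball z ρ) := by simp
      _ ≤ 4 * (∫⁻ x in K, g x) * volume K := by gcongr; exact hK.ball_subset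
      _ = _ := by ring
  · have h1 : ∀ x ∈ K, ∫⁻ y in Metric.ball z ρ, g (y + t • (x - y)) ≤ 4 * ∫⁻ x in K, g x := by
      intro x hx
      calc ∫⁻ y in Metric.ball z ρ, g (y + t • (x - y))
            ≤ ∫⁻ y in Metric.ball z ρ, k (y + t • (x - y)) :=
            setLIntegral_mono' measurableSet_ball fun y hy => hle y hy x hx
        _ ≤ ∫⁻ y, k (y + t • (x - y)) := setLIntegral_le_lintegral _ _
        _ = ∫⁻ y, k (t • x + (1 - t) • y) := by
            congr 1; ext x; congr 1; module
        _ = ENNReal.ofReal (((1 - t) ^ 2)⁻¹) * ∫⁻ x, k x :=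
            lintegral_comp_add_smul k hkm _ (by linarith)
        _ ≤ 4 * ∫⁻ x in K, g x := by rw [hint]; gcongr; exact h4 _ (by linarith)
    rw [lintegral_lintegral_swap]
    · calc _ ≤ ∫⁻ x in K, 4 * ∫⁻ x in K, g x := setLIntegral_mono' hK' h1
        _ = _ := by simp; ring
    · refine Measurable.aemeasurable ?_
      exact hg.comp (by fun_prop)

/-- The Poincaré inequality, with a constant that depends only on the chunkiness of the domain. -/
theorem poincare (hK : IsStarDomain K z ρ) {φ : Plane → ℝ} (hφ : ContDiff ℝ ∞ φ) :
    ∃ a : ℝ, ∫⁻ x in K, ‖φ x - a‖ₑ ^ 2 ≤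
      ENNReal.ofReal (4 * (Metric.diam K / ρ) ^ 2 * Metric.diam K ^ 2) *
        ∫⁻ x in K, ‖gradient φ x‖ₑ ^ 2 := by
  set h := Metric.diam K
  set B := Metric.ball z ρ
  set I := ∫⁻ x in K, ‖gradient φ x‖ₑ ^ 2
  have hgc := (contDiff_gradient hφ).continuous
  have hgm : Measurable fun x => ‖gradient φ x‖ₑ ^ 2 := hgc.measurable.enorm.pow_const 2
  have hB0 : volume B ≠ 0 := (Metric.measure_ball_pos _ _ hK.pos).ne'
  have hBt : volume B ≠ ⊤ := measure_ball_lt_top.ne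
  -- Write $\varphi(x)-\varphi(y)$ as an integral of the gradient over the segment, which stays in
  -- `K` as `y` is in the ball; then exchange the integrals and estimate for each fixed parameter
  -- $t$.
  have main : ∫⁻ y in B, ∫⁻ x in K, ‖φ x - φ y‖ₑ ^ 2 ≤
      ENNReal.ofReal (h ^ 2) * (4 * volume K * I) := by
    calc _ ≤ ∫⁻ y in B, ∫⁻ x in K, ENNReal.ofReal (h ^ 2) *
            ∫⁻ t in Ioc (0 : ℝ) 1, ‖gradient φ (y + t • (x - y))‖ₑ ^ 2 :=
          setLIntegral_mono' measurableSet_ball fun y hy =>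
            setLIntegral_mono' hK.isOpen.measurableSet fun x hx => enorm_sub_sq_le hφ
              (Metric.dist_le_diam_of_mem hK.isBounded hx (hK.ball_subset hy))
      _ = ENNReal.ofReal (h ^ 2) * ∫⁻ y in B, ∫⁻ x in K,
            ∫⁻ t in Ioc (0 : ℝ) 1, ‖gradient φ (y + t • (x - y))‖ₑ ^ 2 := by
          simp_rw [lintegral_const_mul' _ _ ENNReal.ofReal_ne_top]
      _ = ENNReal.ofReal (h ^ 2) * ∫⁻ y in B, ∫⁻ t in Ioc (0 : ℝ) 1, ∫⁻ x in K,
            ‖gradient φ (y + t • (x - y))‖ₑ ^ 2 := by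
          congr 1
          refine lintegral_congr fun y => lintegral_lintegral_swap ?_
          exact (hgm.comp (f := fun q : Plane × ℝ => y + q.2 • (q.1 - y)) (by fun_prop)).aemeasurable
      _ = ENNReal.ofReal (h ^ 2) * ∫⁻ t in Ioc (0 : ℝ) 1, ∫⁻ y in B, ∫⁻ x in K,
            ‖gradient φ (y + t • (x - y))‖ₑ ^ 2 := by
          congr 1
          refine lintegral_lintegral_swap (Measurable.aemeasurable ?_)
          refine Measurable.lintegral_prod_right'
            (f := fun q : (Plane × ℝ) × Plane => ‖gradient φ (q.1.1 + q.1.2 • (q.2 - q.1.1))‖ₑ ^ 2) ?_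
          exact hgm.comp (f := fun q : (Plane × ℝ) × Plane => q.1.1 + q.1.2 • (q.2 - q.1.1))
            (by fun_prop)
      _ ≤ ENNReal.ofReal (h ^ 2) * ∫⁻ t in Ioc (0 : ℝ) 1, 4 * volume K * I := by
          refine mul_le_mul' le_rfl ?_
          exact setLIntegral_mono' measurableSet_Ioc fun t ht => hK.lintegral_lintegral_le hgm ht
      _ = _ := by simp
  -- Some `y` in the ball does not exceed the average, and its value `φ y` serves as the constant.
  obtain ⟨y, hy, hle⟩ := exists_le_setLAverage (μ := volume) (s := B)
    (f := fun y => ∫⁻ x in K, ‖φ x - φ y‖ₑ ^ 2) hB0 hBt (by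
      refine Measurable.aemeasurable ?_
      refine Measurable.lintegral_prod_right' (f := fun q : Plane × Plane => ‖φ q.2 - φ q.1‖ₑ ^ 2) ?_
      have := hφ.continuous.measurable
      fun_prop)
  refine ⟨φ y, hle.trans ?_⟩
  rw [setLAverage_eq]
  refine ENNReal.div_le_of_le_mul ?_
  refine main.trans ?_
  -- The quotient of the areas of `K` and of the ball is where the chunkiness enters.
  calc ENNReal.ofReal (h ^ 2) * (4 * volume K * I) ≤ ENNReal.ofReal (h ^ 2) *
        (4 * (ENNReal.ofReal ((h / ρ) ^ 2) * volume B) * I) := by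
        gcongr; exact hK.volume_le
    _ = _ := by
      rw [ENNReal.ofReal_mul (by positivity), ENNReal.ofReal_mul (by norm_num)]
      simp only [ENNReal.ofReal_ofNat]
      ring

end IsStarDomain

end

section

lemma contDiff_add_pi {f g : Plane → ℝ} (hf : ContDiff ℝ ∞ f) (hg : ContDiff ℝ ∞ g) :
    ContDiff ℝ ∞ (f + g) := hf.add hg

lemma contDiff_sub_pi {f g : Plane → ℝ} (hf : ContDiff ℝ ∞ f) (hg : ContDiff ℝ ∞ g) :
    ContDiff ℝ ∞ (f - g) := hf.sub hg

lemma contDiff_smul_pi {f : Plane → ℝ} (hf : ContDiff ℝ ∞ f) (c : ℝ) :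
    ContDiff ℝ ∞ (c • f) := hf.const_smul c

/-! ## Polynomials -/

/-- The monomial `x₀^a x₁^b`. -/
def monom (a b : ℕ) (x : Plane) : ℝ := x 0 ^ a * x 1 ^ b

lemma contDiff_coord (i : Fin 2) : ContDiff ℝ ∞ fun x : Plane => x i :=
  (EuclideanSpace.proj (𝕜 := ℝ) i).contDiff

lemma contDiff_monom (a b : ℕ) : ContDiff ℝ ∞ (monom a b) := by
  unfold monom
  exact ((contDiff_coord 0).pow a).mul ((contDiff_coord 1).pow b)

lemma monom_mem_polyLT {a b m : ℕ} (h : a + b < m) : monom a b ∈ polyLT m :=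
  Submodule.subset_span ⟨a, b, h, rfl⟩

lemma polyLT_mono {m n : ℕ} (h : m ≤ n) : polyLT m ≤ polyLT n :=
  Submodule.span_mono fun _ ⟨a, b, hab, e⟩ => ⟨a, b, hab.trans_le h, e⟩

lemma polyLT_induction {m : ℕ} {P : (Plane → ℝ) → Prop} (hm : ∀ a b, a + b < m → P (monom a b))
    (h0 : P 0) (ha : ∀ f ∈ polyLT m, ∀ g ∈ polyLT m, P f → P g → P (f + g))
    (hs : ∀ (c : ℝ), ∀ f ∈ polyLT m, P f → P (c • f)) : ∀ f ∈ polyLT m, P f := by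
  intro f hf
  induction hf using Submodule.span_induction with
  | mem f h => obtain ⟨a, b, hab, rfl⟩ := h; exact hm a b hab
  | zero => exact h0
  | add f g hf hg h1 h2 => exact ha f hf g hg h1 h2
  | smul c f hf h => exact hs c f hf h

lemma contDiff_of_mem_polyLT {m : ℕ} : ∀ f ∈ polyLT m, ContDiff ℝ ∞ f :=
  polyLT_induction (fun a b _ => contDiff_monom a b) contDiff_const (fun _ _ _ _ h h' => h.add h')
    (fun c _ _ h => h.const_smul c)

lemma polyLT_fg (m : ℕ) : (polyLT m).FG := by
  refine Submodule.fg_span (Set.Finite.subset (((Finset.range m ×ˢ Finset.range m).finite_toSet).image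
    fun q : ℕ × ℕ => monom q.1 q.2) ?_)
  rintro f ⟨a, b, h, rfl⟩
  exact ⟨(a, b), by simp; omega, rfl⟩

lemma hasFDerivAt_coord (i : Fin 2) (x : Plane) :
    HasFDerivAt (fun x : Plane => x i) (EuclideanSpace.proj (𝕜 := ℝ) i) x :=
  (EuclideanSpace.proj (𝕜 := ℝ) i).hasFDerivAt

lemma pd_zero_monom (a b : ℕ) : pd 0 (monom a b) = (a : ℝ) • monom (a - 1) b := by
  ext x
  have h := ((hasFDerivAt_coord 0 x).pow a).mul ((hasFDerivAt_coord 1 x).pow b)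
  rw [pd, show monom a b = (fun x : Plane => x 0 ^ a) * fun x : Plane => x 1 ^ b from rfl, h.fderiv]
  simp [monom]
  ring

lemma pd_one_monom (a b : ℕ) : pd 1 (monom a b) = (b : ℝ) • monom a (b - 1) := by
  ext x
  have h := ((hasFDerivAt_coord 0 x).pow a).mul ((hasFDerivAt_coord 1 x).pow b)
  rw [pd, show monom a b = (fun x : Plane => x 0 ^ a) * fun x : Plane => x 1 ^ b from rfl, h.fderiv]
  simp [monom]
  ring

lemma pd_add {f g : Plane → ℝ} (hf : ContDiff ℝ ∞ f) (hg : ContDiff ℝ ∞ g) (i : Fin 2) :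
    pd i (f + g) = pd i f + pd i g := by
  ext x
  simp [pd, fderiv_add (hf.differentiable (by simp) x) (hg.differentiable (by simp) x)]

lemma pd_smul {f : Plane → ℝ} (hf : ContDiff ℝ ∞ f) (c : ℝ) (i : Fin 2) :
    pd i (c • f) = c • pd i f := by
  ext x
  simp [pd, fderiv_const_smul (hf.differentiable (by simp) x)]

lemma pd_zero_iterate_monom (a b n : ℕ) :
    (pd 0)^[n] (monom a b) = (a.descFactorial n : ℝ) • monom (a - n) b := by
  induction n with
  | zero => simp
  | succ n ih =>
    rw [Function.iterate_succ_apply', ih, pd_smul (contDiff_monom _ _), pd_zero_monom, smul_smul,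
      Nat.descFactorial_succ, Nat.sub_sub]
    push_cast; ring_nf

lemma pd_one_iterate_monom (a b n : ℕ) :
    (pd 1)^[n] (monom a b) = (b.descFactorial n : ℝ) • monom a (b - n) := by
  induction n with
  | zero => simp
  | succ n ih =>
    rw [Function.iterate_succ_apply', ih, pd_smul (contDiff_monom _ _), pd_one_monom, smul_smul,
      Nat.descFactorial_succ, Nat.sub_sub]
    push_cast; ring_nf

lemma pd_iterate_smul {f : Plane → ℝ} (hf : ContDiff ℝ ∞ f) (c : ℝ) (i : Fin 2) (n : ℕ) :
    (pd i)^[n] (c • f) = c • (pd i)^[n] f := by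
  induction n with
  | zero => rfl
  | succ n ih =>
    rw [Function.iterate_succ_apply', Function.iterate_succ_apply', ih,
      pd_smul (contDiff_pd_iterate hf i n)]

lemma pd_iterate_add {f g : Plane → ℝ} (hf : ContDiff ℝ ∞ f) (hg : ContDiff ℝ ∞ g) (i : Fin 2)
    (n : ℕ) : (pd i)^[n] (f + g) = (pd i)^[n] f + (pd i)^[n] g := by
  induction n with
  | zero => rfl
  | succ n ih =>
    simp only [Function.iterate_succ_apply']
    rw [ih, pd_add (contDiff_pd_iterate hf i n) (contDiff_pd_iterate hg i n)]

lemma mixedPartial_add {f g : Plane → ℝ} (hf : ContDiff ℝ ∞ f) (hg : ContDiff ℝ ∞ g) (i j : ℕ) :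
    mixedPartial i j (f + g) = mixedPartial i j f + mixedPartial i j g := by
  rw [mixedPartial_eq (contDiff_add_pi hf hg), mixedPartial_eq hf, mixedPartial_eq hg, pd_iterate_add hf hg,
    pd_iterate_add (contDiff_pd_iterate hf _ _) (contDiff_pd_iterate hg _ _)]

lemma mixedPartial_smul {f : Plane → ℝ} (hf : ContDiff ℝ ∞ f) (c : ℝ) (i j : ℕ) :
    mixedPartial i j (c • f) = c • mixedPartial i j f := by
  rw [mixedPartial_eq (contDiff_smul_pi hf c), mixedPartial_eq hf, pd_iterate_smul hf,
    pd_iterate_smul (contDiff_pd_iterate hf _ _)]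

lemma mixedPartial_monom (i j a b : ℕ) : mixedPartial i j (monom a b) =
    ((a.descFactorial i : ℝ) * b.descFactorial j) • monom (a - i) (b - j) := by
  rw [mixedPartial_eq (contDiff_monom a b), pd_one_iterate_monom,
    pd_iterate_smul (contDiff_monom _ _), pd_zero_iterate_monom, smul_smul, mul_comm]

/-- A homogeneous polynomial with prescribed derivatives of top order. -/
lemma exists_poly_mixedPartial_eq (m : ℕ) (a : ℕ × ℕ → ℝ) : ∃ π ∈ polyLT (m + 1),
    ∀ β ∈ Finset.HasAntidiagonal.antidiagonal m, ∀ x, mixedPartial β.1 β.2 π x = a β := by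
  suffices h : ∀ s : Finset (ℕ × ℕ), s ⊆ Finset.HasAntidiagonal.antidiagonal m →
      ∃ π ∈ polyLT (m + 1), ∀ β ∈ Finset.HasAntidiagonal.antidiagonal m, ∀ x,
        mixedPartial β.1 β.2 π x = if β ∈ s then a β else 0 by
    obtain ⟨π, hπ, h1⟩ := h _ subset_rfl
    exact ⟨π, hπ, fun β hβ x => by rw [h1 β hβ x, if_pos hβ]⟩
  intro s
  induction s using Finset.induction with
  | empty =>
    intro _
    refine ⟨0, Submodule.zero_mem _, fun β _ x => ?_⟩
    simpa using congrFun (mixedPartial_smul (f := monom 0 0) (contDiff_monom 0 0) 0 β.1 β.2) x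
  | insert γ s hγ ih =>
    intro hs
    obtain ⟨π, hπ, h1⟩ := ih ((Finset.subset_insert _ _).trans hs)
    have hγm : γ.1 + γ.2 = m := by simpa using hs (Finset.mem_insert_self _ _)
    -- Among the derivatives of order `m`, only the one with index `γ` does not annihilate the
    -- monomial with exponents `γ`, and it gives the product of the factorials.
    refine ⟨π + (a γ / (γ.1.factorial * γ.2.factorial)) • monom γ.1 γ.2,
      Submodule.add_mem _ hπ (Submodule.smul_mem _ _ (monom_mem_polyLT (by omega))),
      fun β hβ x => ?_⟩
    rw [mixedPartial_add (contDiff_of_mem_polyLT _ hπ) (contDiff_smul_pi (contDiff_monom _ _) _),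
      mixedPartial_smul (contDiff_monom _ _), Pi.add_apply, h1 β hβ x, mixedPartial_monom]
    have hβm : β.1 + β.2 = m := by simpa using hβ
    by_cases h : β = γ
    · subst h
      have h1 : (β.1.factorial : ℝ) ≠ 0 := by positivity
      have h2 : (β.2.factorial : ℝ) ≠ 0 := by positivity
      simp [hγ, Nat.descFactorial_self, monom]
      field_simp
    · have hz : (γ.1.descFactorial β.1 : ℝ) * γ.2.descFactorial β.2 = 0 := by
        rcases lt_trichotomy γ.1 β.1 with h' | h' | h'
        · simp [Nat.descFactorial_eq_zero_iff_lt.2 h']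
        · exact absurd (Prod.ext h'.symm (by omega)) h
        · have : γ.2 < β.2 := by omega
          simp [Nat.descFactorial_eq_zero_iff_lt.2 this]
      simp [hz, h]

lemma sobolevSeminormSq_of_contDiff {D : Set Plane} (hD : IsOpen D) {f : Plane → ℝ}
    (hf : ContDiff ℝ ∞ f) (m : ℕ) : sobolevSeminormSq m D f =
      ∑ β ∈ Finset.HasAntidiagonal.antidiagonal m, ∫⁻ x in D, ‖mixedPartial β.1 β.2 f x‖ₑ ^ 2 :=
  sobolevSeminormSq_eq hD (fun β => mixedPartial β.1 β.2 f)
    fun β _ => hasWeakPartial_of_contDiff hD hf β.1 β.2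

lemma gradient_mixedPartial_enorm_sq {f : Plane → ℝ} (hf : ContDiff ℝ ∞ f) (i j : ℕ) (x : Plane) :
    ‖gradient (mixedPartial i j f) x‖ₑ ^ 2 =
      ‖mixedPartial (i + 1) j f x‖ₑ ^ 2 + ‖mixedPartial i (j + 1) f x‖ₑ ^ 2 := by
  simp only [plane_enorm_sq, gradient_apply, mixedPartial_eq hf]
  rw [Function.iterate_succ_apply' (pd 0), Function.iterate_succ_apply' (pd 1),
    pd_iterate_comm (contDiff_pd_iterate hf 1 j) 1 0]

/-- The square of the constant in the Poincaré inequality, with room for the summation over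
multi-indices. -/
def chunkConst (K : Set Plane) (ρ : ℝ) : ℝ≥0∞ :=
  2 * ENNReal.ofReal (4 * (Metric.diam K / ρ) ^ 2 * Metric.diam K ^ 2)

namespace IsStarDomain

variable {K : Set Plane} {z : Plane} {ρ : ℝ}

/-- Apply the Poincaré inequality to each derivative of order `m`. The resulting constants, one for
each multi-index, are the derivatives of a single polynomial. -/
lemma exists_poly_top (hK : IsStarDomain K z ρ) {φ : Plane → ℝ} (hφ : ContDiff ℝ ∞ φ) (m : ℕ) :
    ∃ π ∈ polyLT (m + 1), sobolevSeminormSq m K (φ - π) ≤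
      chunkConst K ρ * sobolevSeminormSq (m + 1) K φ := by
  have hp : ∀ β : ℕ × ℕ, _ := fun β => hK.poincare (contDiff_mixedPartial hφ β.1 β.2)
  choose a ha using hp
  obtain ⟨π, hπ, hd⟩ := exists_poly_mixedPartial_eq m a
  have hπs := contDiff_of_mem_polyLT _ hπ
  refine ⟨π, hπ, ?_⟩
  rw [sobolevSeminormSq_of_contDiff hK.isOpen (contDiff_sub_pi hφ hπs),
    sobolevSeminormSq_of_contDiff hK.isOpen hφ]
  set C := ENNReal.ofReal (4 * (Metric.diam K / ρ) ^ 2 * Metric.diam K ^ 2)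
  set N : ℕ × ℕ → ℝ≥0∞ := fun β => ∫⁻ x in K, ‖mixedPartial β.1 β.2 φ x‖ₑ ^ 2
  have hstep : ∀ β ∈ Finset.HasAntidiagonal.antidiagonal m,
      ∫⁻ x in K, ‖mixedPartial β.1 β.2 (φ - π) x‖ₑ ^ 2 ≤
        C * (N (β.1 + 1, β.2) + N (β.1, β.2 + 1)) := by
    intro β hβ
    have e : ∀ x, mixedPartial β.1 β.2 (φ - π) x = mixedPartial β.1 β.2 φ x - a β := by
      intro x
      have : φ - π = φ + (-1 : ℝ) • π := by simp [sub_eq_add_neg]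
      rw [this, mixedPartial_add hφ (contDiff_smul_pi hπs _), mixedPartial_smul hπs]
      simp [hd β hβ x, sub_eq_add_neg]
    simp_rw [e]
    refine (ha β).trans (le_of_eq ?_)
    simp_rw [gradient_mixedPartial_enorm_sq hφ]
    rw [lintegral_add_left]
    exact ((contDiff_mixedPartial hφ _ _).continuous.measurable.enorm.pow_const 2)
  calc _ ≤ ∑ β ∈ Finset.HasAntidiagonal.antidiagonal m,
          C * (N (β.1 + 1, β.2) + N (β.1, β.2 + 1)) := Finset.sum_le_sum hstep
    _ = C * ((∑ β ∈ Finset.HasAntidiagonal.antidiagonal m, N (β.1 + 1, β.2)) +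
          ∑ β ∈ Finset.HasAntidiagonal.antidiagonal m, N (β.1, β.2 + 1)) := by
        rw [← Finset.mul_sum, Finset.sum_add_distrib]
    -- Raising one of the two indices embeds the multi-indices of order `m` into those of order `m +
    -- 1`. The two ways of doing so account for the factor 2 in `chunkConst`.
    _ ≤ C * ((∑ β ∈ Finset.HasAntidiagonal.antidiagonal (m + 1), N β) +
          ∑ β ∈ Finset.HasAntidiagonal.antidiagonal (m + 1), N β) := by
        gcongr
        · rw [Finset.Nat.sum_antidiagonal_succ]; exact le_add_self
        · rw [Finset.Nat.sum_antidiagonal_succ']; exact le_add_self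
    _ = _ := by rw [chunkConst]; ring

/-- The Bramble–Hilbert lemma for smooth functions. -/
theorem exists_poly_of_contDiff (hK : IsStarDomain K z ρ) (m : ℕ) {φ : Plane → ℝ}
    (hφ : ContDiff ℝ ∞ φ) : ∃ π ∈ polyLT (m + 1), sobolevSeminormSq 1 K (φ - π) ≤
      chunkConst K ρ ^ m * sobolevSeminormSq (m + 1) K φ := by
  induction m generalizing φ with
  | zero => exact ⟨0, Submodule.zero_mem _, by simp⟩
  | succ m ih =>
    -- Proceed from the highest order down: once `π₁` has made the seminorm of order `m + 1` small,
    -- the induction hypothesis for `φ - π₁` adds a correction of lower degree.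
    obtain ⟨π₁, h₁, e₁⟩ := hK.exists_poly_top hφ (m + 1)
    obtain ⟨π₂, h₂, e₂⟩ := ih (contDiff_sub_pi hφ (contDiff_of_mem_polyLT _ h₁))
    refine ⟨π₁ + π₂, Submodule.add_mem _ h₁ (polyLT_mono (by omega) h₂), ?_⟩
    rw [← sub_sub]
    refine e₂.trans ?_
    rw [pow_succ, mul_assoc]
    gcongr

end IsStarDomain

end

section

/-! ## Mollification -/

/-- The convolution of `g` and `η`. -/
def mollify (η g : Plane → ℝ) (x : Plane) : ℝ := ∫ w, g w * η (x - w)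

open scoped Convolution in
lemma mollify_eq_convolution (η g : Plane → ℝ) :
    mollify η g = g ⋆[ContinuousLinearMap.mul ℝ ℝ, volume] η := rfl

lemma contDiff_mollify {η g : Plane → ℝ} (hη : ContDiff ℝ ∞ η) (hc : HasCompactSupport η)
    (hg : LocallyIntegrable g) : ContDiff ℝ ∞ (mollify η g) := by
  rw [mollify_eq_convolution]
  exact hc.contDiff_convolution_right _ hg hη

open scoped Convolution in
lemma pd_mollify {η g : Plane → ℝ} (hη : ContDiff ℝ ∞ η) (hc : HasCompactSupport η)
    (hg : LocallyIntegrable g) (i : Fin 2) : pd i (mollify η g) = mollify (pd i η) g := by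
  ext x
  have h := hc.hasFDerivAt_convolution_right (ContinuousLinearMap.mul ℝ ℝ) (μ := volume) hg
    (hη.of_le (by simp)) x
  rw [pd, mollify_eq_convolution, h.fderiv]
  rw [convolution_precompR_apply _ hg (hc.fderiv ℝ) (hη.continuous_fderiv (by simp))]
  rfl

lemma pd_comp_add_smul {f : Plane → ℝ} (hf : ContDiff ℝ ∞ f) (c : Plane) (s : ℝ) (i : Fin 2) :
    pd i (fun x => f (c + s • x)) = s • fun x => pd i f (c + s • x) := by
  ext x
  have h1 : HasFDerivAt (fun x : Plane => c + s • x) (s • ContinuousLinearMap.id ℝ Plane) x :=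
    ((hasFDerivAt_id x).const_smul s).const_add c
  have h2 := (hf.differentiable (by simp) (c + s • x)).hasFDerivAt.comp x h1
  rw [pd, show (fun x => f (c + s • x)) = f ∘ fun x => c + s • x from rfl, h2.fderiv]
  simp [pd]

lemma contDiff_comp_add_smul {f : Plane → ℝ} (hf : ContDiff ℝ ∞ f) (c : Plane) (s : ℝ) :
    ContDiff ℝ ∞ (fun x => f (c + s • x)) := hf.comp (by fun_prop)

lemma pd_iterate_comp_add_smul {f : Plane → ℝ} (hf : ContDiff ℝ ∞ f) (c : Plane) (s : ℝ)
    (i : Fin 2) (n : ℕ) :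
    (pd i)^[n] (fun x => f (c + s • x)) = s ^ n • fun x => (pd i)^[n] f (c + s • x) := by
  induction n with
  | zero => simp
  | succ n ih =>
    rw [Function.iterate_succ_apply', ih,
      pd_smul (contDiff_comp_add_smul (contDiff_pd_iterate hf i n) c s),
      pd_comp_add_smul (contDiff_pd_iterate hf i n), smul_smul, ← pow_succ]
    simp only [Function.iterate_succ_apply']

lemma mixedPartial_comp_add_smul {f : Plane → ℝ} (hf : ContDiff ℝ ∞ f) (c : Plane) (s : ℝ)
    (i j : ℕ) : mixedPartial i j (fun x => f (c + s • x)) =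
      s ^ (i + j) • fun x => mixedPartial i j f (c + s • x) := by
  rw [mixedPartial_eq (contDiff_comp_add_smul hf c s), mixedPartial_eq hf,
    pd_iterate_comp_add_smul hf,
    pd_iterate_smul (contDiff_comp_add_smul (contDiff_pd_iterate hf 1 j) c s),
    pd_iterate_comp_add_smul (contDiff_pd_iterate hf 1 j), smul_smul, ← pow_add, add_comm j]

lemma hasCompactSupport_pd_iterate {η : Plane → ℝ} (hη : ContDiff ℝ ∞ η) (hc : HasCompactSupport η)
    (i : Fin 2) (n : ℕ) : HasCompactSupport ((pd i)^[n] η) :=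
  (IsTestFunction.pd_iterate (D := univ) ⟨hη, hc, subset_univ _⟩ i n).2.1

lemma pd_iterate_mollify {η g : Plane → ℝ} (hη : ContDiff ℝ ∞ η) (hc : HasCompactSupport η)
    (hg : LocallyIntegrable g) (i : Fin 2) (n : ℕ) :
    (pd i)^[n] (mollify η g) = mollify ((pd i)^[n] η) g := by
  induction n with
  | zero => rfl
  | succ n ih =>
    rw [Function.iterate_succ_apply', ih, pd_mollify (contDiff_pd_iterate hη i n)
      (hasCompactSupport_pd_iterate hη hc i n) hg, Function.iterate_succ_apply']

lemma mixedPartial_mollify {η g : Plane → ℝ} (hη : ContDiff ℝ ∞ η) (hc : HasCompactSupport η)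
    (hg : LocallyIntegrable g) (i j : ℕ) :
    mixedPartial i j (mollify η g) = mollify (mixedPartial i j η) g := by
  rw [mixedPartial_eq (contDiff_mollify hη hc hg), mixedPartial_eq hη, pd_iterate_mollify hη hc hg,
    pd_iterate_mollify (contDiff_pd_iterate hη 1 j) (hasCompactSupport_pd_iterate hη hc 1 j) hg]

/-- The mollification of a weak derivative is the derivative of the mollification. -/
lemma mollify_mixedPartial {D : Set Plane} (hD : IsOpen D) {η u g : Plane → ℝ} {i j : ℕ}
    (hη : ContDiff ℝ ∞ η) (hc : HasCompactSupport η) (h : HasWeakPartial D i j u g) {y : Plane}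
    (hy : ∀ w, y - w ∈ tsupport η → w ∈ D) :
    mollify (mixedPartial i j η) (D.indicator u) y = mollify η (D.indicator g) y := by
  -- The reflected mollifier is an admissible test function; its derivative carries the sign
  -- $(-1)^{i+j}$, which cancels the one in the definition of the weak derivative.
  set ψ : Plane → ℝ := fun w => η (y + (-1 : ℝ) • w) with hψ
  have hψs : ContDiff ℝ ∞ ψ := contDiff_comp_add_smul hη y (-1)
  let e : Plane ≃ₜ Plane := (Homeomorph.neg Plane).trans (Homeomorph.addLeft y)
  have he : ψ = η ∘ e := by ext w; simp [hψ, e]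
  have hT : IsTestFunction D ψ := by
    refine ⟨hψs, ?_, ?_⟩
    · rw [he]; exact hc.comp_homeomorph e
    · intro w hw
      rw [he, tsupport_comp_eq_preimage] at hw
      exact hy w (by simpa [e, sub_eq_add_neg] using hw)
  have h1 := h.2.2 ψ hT
  have e1 : ∀ v k : Plane → ℝ, mollify k (D.indicator v) y = ∫ x in D, v x * k (y - x) := by
    intro v k
    rw [mollify, ← integral_indicator hD.measurableSet]
    congr 1; ext x
    by_cases hx : x ∈ D <;> simp [hx]
  rw [e1, e1]
  rw [mixedPartial_comp_add_smul hη] at h1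
  have h2 : ∀ x, y + (-1 : ℝ) • x = y - x := fun x => by simp [sub_eq_add_neg]
  simp only [Pi.smul_apply, smul_eq_mul, h2, hψ] at h1
  have h3 : ∫ x in D, u x * ((-1) ^ (i + j) * mixedPartial i j η (y - x)) =
      (-1) ^ (i + j) * ∫ x in D, u x * mixedPartial i j η (y - x) := by
    rw [← integral_const_mul]; congr 1; ext x; ring
  rw [h3] at h1
  exact mul_left_cancel₀ (pow_ne_zero _ (by norm_num)) h1

/-- A mollifier: a smooth probability density supported in the ball of radius `δ`. -/
structure IsMollifier (η : Plane → ℝ) (δ : ℝ) : Prop where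
  contDiff : ContDiff ℝ ∞ η
  nonneg : ∀ x, 0 ≤ η x
  integral : ∫ x, η x = 1
  tsupport_subset : tsupport η ⊆ Metric.closedBall 0 δ

lemma IsMollifier.hasCompactSupport {η : Plane → ℝ} {δ : ℝ} (h : IsMollifier η δ) :
    HasCompactSupport η :=
  (isCompact_closedBall 0 δ).of_isClosed_subset (isClosed_tsupport _) h.tsupport_subset

lemma IsMollifier.integrable {η : Plane → ℝ} {δ : ℝ} (h : IsMollifier η δ) :
    Integrable η := h.contDiff.continuous.integrable_of_hasCompactSupport h.hasCompactSupport

lemma IsMollifier.lintegral {η : Plane → ℝ} {δ : ℝ} (h : IsMollifier η δ) :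
    ∫⁻ x, ENNReal.ofReal (η x) = 1 := by
  rw [← ofReal_integral_eq_lintegral_ofReal h.integrable (Eventually.of_forall h.nonneg),
    h.integral, ENNReal.ofReal_one]

lemma exists_isMollifier {δ : ℝ} (hδ : 0 < δ) : ∃ η, IsMollifier η δ := by
  let f : ContDiffBump (0 : Plane) := ⟨δ / 2, δ, by positivity, by linarith⟩
  exact ⟨f.normed volume, f.contDiff_normed, fun x => f.nonneg_normed x, f.integral_normed,
    f.tsupport_normed_eq.le⟩

/-- Jensen's inequality for the probability measure with density $\eta(y-\cdot)$. -/
lemma enorm_mollify_sq_le {η g : Plane → ℝ} {δ : ℝ} (h : IsMollifier η δ)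
    (hg : AEMeasurable g) (y : Plane) :
    ‖mollify η g y‖ₑ ^ 2 ≤ ∫⁻ w, ENNReal.ofReal (η (y - w)) * ‖g w‖ₑ ^ 2 := by
  have hm : Measurable fun w => ENNReal.ofReal (η (y - w)) :=
    (h.contDiff.continuous.comp (continuous_const.sub continuous_id)).measurable.ennreal_ofReal
  set ν : Measure Plane := volume.withDensity fun w => ENNReal.ofReal (η (y - w))
  have hν : IsProbabilityMeasure ν := ⟨by
    rw [withDensity_apply _ MeasurableSet.univ, setLIntegral_univ,
      lintegral_sub_left_eq_self (fun w => ENNReal.ofReal (η w)) y, h.lintegral]⟩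
  have hac : ν ≪ volume := withDensity_absolutelyContinuous _ _
  have e1 : ∫⁻ w, ‖g w * η (y - w)‖ₑ = ∫⁻ w, ‖g w‖ₑ ∂ν := by
    rw [lintegral_withDensity_eq_lintegral_mul₀ hm.aemeasurable hg.enorm]
    refine lintegral_congr fun w => ?_
    simp only [Pi.mul_apply, enorm_mul, Real.enorm_of_nonneg (h.nonneg _)]
    ring
  calc ‖mollify η g y‖ₑ ^ 2 ≤ (∫⁻ w, ‖g w * η (y - w)‖ₑ) ^ 2 := by
        gcongr; exact enorm_integral_le_lintegral_enorm _
    _ = (∫⁻ w, ‖g w‖ₑ ∂ν) ^ 2 := by rw [e1]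
    _ ≤ ∫⁻ w, ‖g w‖ₑ ^ 2 ∂ν := lintegral_sq_le (hg.enorm.mono_ac hac)
    _ = _ := by
        rw [lintegral_withDensity_eq_lintegral_mul₀ hm.aemeasurable (hg.enorm.pow_const 2)]
        rfl

/-- Integrate the pointwise bound and exchange the integrals. The dilation costs $s^{-2}\le 4$, that
is a factor 2 after the square root. -/
lemma eLpNorm_mollify_le {η g : Plane → ℝ} {δ : ℝ} (h : IsMollifier η δ)
    (hg : AEMeasurable g) (c : Plane) {s : ℝ} (hs : 1 / 2 ≤ s) :
    eLpNorm (fun x => mollify η g (c + s • x)) 2 volume ≤ 2 * eLpNorm g 2 volume := by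
  rw [← ENNReal.pow_le_pow_left_iff (n := 2) (by norm_num), mul_pow, eLpNorm_two_sq, eLpNorm_two_sq]
  have hm : Measurable fun w => ENNReal.ofReal (η w) := h.contDiff.continuous.measurable.ennreal_ofReal
  have hs0 : 0 < s := by linarith
  calc _ ≤ ∫⁻ x, ∫⁻ w, ENNReal.ofReal (η (c + s • x - w)) * ‖g w‖ₑ ^ 2 :=
        lintegral_mono fun x => enorm_mollify_sq_le h hg _
    _ = ∫⁻ w, ∫⁻ x, ENNReal.ofReal (η (c + s • x - w)) * ‖g w‖ₑ ^ 2 := by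
        refine lintegral_lintegral_swap ?_
        refine AEMeasurable.mul (f := fun q : Plane × Plane => ENNReal.ofReal (η (c + s • q.1 - q.2)))
          (g := fun q : Plane × Plane => ‖g q.2‖ₑ ^ 2) ?_ ?_
        · exact (hm.comp (f := fun q : Plane × Plane => c + s • q.1 - q.2) (by fun_prop)).aemeasurable
        · exact ((hg.comp_quasiMeasurePreserving
            Measure.quasiMeasurePreserving_snd).enorm.pow_const 2)
    _ = ∫⁻ w, ENNReal.ofReal ((s ^ 2)⁻¹) * ‖g w‖ₑ ^ 2 := by
        refine lintegral_congr fun w => ?_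
        rw [lintegral_mul_const (f := fun x => ENNReal.ofReal (η (c + s • x - w))) _
          (hm.comp (f := fun x => c + s • x - w) (by fun_prop))]
        congr 1
        have := lintegral_comp_add_smul (fun x => ENNReal.ofReal (η x)) hm (c - w) hs0
        rw [h.lintegral, mul_one] at this
        rw [← this]
        refine lintegral_congr fun x => ?_
        congr 2; abel
    _ = ENNReal.ofReal ((s ^ 2)⁻¹) * ∫⁻ w, ‖g w‖ₑ ^ 2 :=
        lintegral_const_mul' _ _ ENNReal.ofReal_ne_top
    _ ≤ 2 ^ 2 * ∫⁻ w, ‖g w‖ₑ ^ 2 := by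
        gcongr
        rw [show (2 : ℝ≥0∞) ^ 2 = ENNReal.ofReal 4 by norm_num]
        refine ENNReal.ofReal_le_ofReal ?_
        rw [inv_le_comm₀ (by positivity) (by norm_num)]
        nlinarith

lemma norm_mollify_sub_le {η k : Plane → ℝ} {δ ε : ℝ} (h : IsMollifier η δ) (hk : Continuous k)
    {x y : Plane} (hε : ∀ w, dist w y ≤ δ → |k w - k x| ≤ ε) :
    |mollify η k y - k x| ≤ ε := by
  have hi : Integrable fun w => η (y - w) := h.integrable.comp_sub_left y
  have h1 : ∫ w, η (y - w) = 1 := by rw [integral_sub_left_eq_self, h.integral]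
  have hi2 : Integrable fun w => k w * η (y - w) := by
    refine (hk.mul (h.contDiff.continuous.comp
      (continuous_const.sub continuous_id))).integrable_of_hasCompactSupport ?_
    refine HasCompactSupport.mul_left ?_
    have := h.hasCompactSupport.comp_homeomorph
      ((Homeomorph.neg Plane).trans (Homeomorph.addLeft y))
    have e : (η ∘ ((Homeomorph.neg Plane).trans (Homeomorph.addLeft y))) = fun w => η (y - w) := by
      ext w; simp [sub_eq_add_neg]
    rwa [e] at this
  have e : mollify η k y - k x = ∫ w, (k w - k x) * η (y - w) := by
    simp only [sub_mul]
    rw [integral_sub hi2 (hi.const_mul _), integral_const_mul, h1, mul_one]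
    rfl
  rw [e, ← Real.norm_eq_abs]
  calc _ ≤ ∫ w, ε * η (y - w) := by
        refine norm_integral_le_of_norm_le (hi.const_mul ε) (Eventually.of_forall fun w => ?_)
        rw [norm_mul, Real.norm_eq_abs, Real.norm_of_nonneg (h.nonneg _)]
        by_cases hw : y - w ∈ tsupport η
        · have := h.tsupport_subset hw
          rw [mem_closedBall_zero_iff, ← dist_eq_norm, dist_comm] at this
          exact mul_le_mul_of_nonneg_right (hε w this) (h.nonneg _)
        · simp [image_eq_zero_of_notMem_tsupport hw]
    _ = ε := by rw [integral_const_mul, h1, mul_one]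

/-- A density argument: the claim is a matter of uniform continuity for a continuous function with
compact support, and the mollification operators are uniformly bounded in $L^2$. The dilations tend
to the identity uniformly on the bounded set `K`. -/
lemma tendsto_mollify {K : Set Plane} (hKb : Bornology.IsBounded K) (hKm : MeasurableSet K)
    {c : ℕ → Plane} {s δ : ℕ → ℝ}
    (hc : Tendsto c atTop (𝓝 0)) (hs : Tendsto s atTop (𝓝 1)) (hs0 : ∀ n, 1 / 2 ≤ s n)
    (hδ : Tendsto δ atTop (𝓝 0)) {η : ℕ → Plane → ℝ} (hη : ∀ n, IsMollifier (η n) (δ n))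
    {g : Plane → ℝ} (hg : MemLp g 2 volume) :
    Tendsto (fun n => eLpNorm (g - fun x => mollify (η n) g (c n + s n • x)) 2 (volume.restrict K))
      atTop (𝓝 0) := by
  rw [ENNReal.tendsto_atTop_zero]
  intro ε hε
  have hε4 : 0 < ε / 2 / 2 := ENNReal.half_pos (ENNReal.half_pos hε.ne').ne'
  by_cases hεt : ε = ⊤
  · exact ⟨0, fun n _ => hεt ▸ le_top⟩
  -- The budget is a quarter of `ε` for `g - k`, a quarter for the mollification error of `k`, and
  -- half for the mollified `g - k`, whose norm may double.
  obtain ⟨k, hks, hgk, hkc, hkL⟩ := hg.exists_hasCompactSupport_eLpNorm_sub_le (by norm_num)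
    (ε := ε / 2 / 2) hε4.ne'
  have hVfin : volume K ^ (1 / 2 : ℝ) ≠ ⊤ :=
    ENNReal.rpow_ne_top_of_nonneg (by norm_num) hKb.measure_lt_top.ne
  obtain ⟨ε', hε'0, hε'⟩ : ∃ ε' : ℝ, 0 < ε' ∧
      volume K ^ (1 / 2 : ℝ) * ENNReal.ofReal ε' ≤ ε / 2 / 2 := by
    have h0 : Tendsto (fun r : ℝ => volume K ^ (1 / 2 : ℝ) * ENNReal.ofReal r) (𝓝[>] 0) (𝓝 0) := by
      have := ENNReal.Tendsto.const_mul (a := volume K ^ (1 / 2 : ℝ))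
        (ENNReal.tendsto_ofReal (tendsto_id.mono_left (nhdsWithin_le_nhds (a := (0 : ℝ))
          (s := Ioi 0)))) (Or.inr hVfin)
      simpa using this
    have h1 := (h0.eventually (ge_mem_nhds hε4)).and self_mem_nhdsWithin
    obtain ⟨r, hr⟩ := h1.exists
    exact ⟨r, hr.2, hr.1⟩
  obtain ⟨d, hd0, hd⟩ := Metric.uniformContinuous_iff.1
    (hkc.uniformContinuous_of_tendsto_cocompact hks.is_zero_at_infty) ε' hε'0
  obtain ⟨R, hR⟩ := hKb.exists_norm_le
  have hlim : Tendsto (fun n => δ n + (‖c n‖ + |s n - 1| * R)) atTop (𝓝 0) := by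
    have := hδ.add (hc.norm.add (((hs.sub_const 1).abs).mul_const R))
    simpa using this
  obtain ⟨N, hN⟩ := eventually_atTop.1 (hlim.eventually_lt_const hd0)
  refine ⟨N, fun n hn => ?_⟩
  have hle : volume.restrict K ≤ volume := Measure.restrict_le_self
  have hsm : ∀ {f : Plane → ℝ}, LocallyIntegrable f →
      AEStronglyMeasurable (fun x => mollify (η n) f (c n + s n • x)) (volume.restrict K) :=
    fun hf => ((contDiff_mollify (hη n).contDiff (hη n).hasCompactSupport hf).continuous.comp
      (by fun_prop)).aestronglyMeasurable
  have hgl : LocallyIntegrable g := hg.locallyIntegrable (by norm_num)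
  have hkl : LocallyIntegrable k := hkc.locallyIntegrable
  have hint : ∀ {f : Plane → ℝ}, LocallyIntegrable f → ∀ y,
      Integrable fun w => f w * η n (y - w) := by
    intro f hf y
    have := integrableOn_mul_of_tsupport (D := univ) (u := f) (ψ := fun w => η n (y - w))
      (locallyIntegrableOn_univ.2 hf)
      ((hη n).contDiff.continuous.comp (continuous_const.sub continuous_id)) (by
        have := (hη n).hasCompactSupport.comp_homeomorph
          ((Homeomorph.neg Plane).trans (Homeomorph.addLeft y))
        have e : (η n ∘ ((Homeomorph.neg Plane).trans (Homeomorph.addLeft y))) =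
            fun w => η n (y - w) := by ext w; simp [sub_eq_add_neg]
        rwa [e] at this) (subset_univ _)
    exact this
  have hsplit : (g - fun x => mollify (η n) g (c n + s n • x)) =
      (g - k) + ((k - fun x => mollify (η n) k (c n + s n • x)) +
        -fun x => mollify (η n) (g - k) (c n + s n • x)) := by
    ext x
    simp only [Pi.sub_apply, Pi.add_apply, Pi.neg_apply, mollify, sub_mul]
    rw [integral_sub (hint hgl _) (hint hkl _)]
    ring
  have hgk' : MemLp (g - k) 2 volume := hg.sub hkL
  rw [hsplit]
  have e1 : eLpNorm (g - k) 2 (volume.restrict K) ≤ ε / 2 / 2 :=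
    (eLpNorm_mono_measure _ hle).trans hgk
  have e2 : eLpNorm (-fun x => mollify (η n) (g - k) (c n + s n • x)) 2 (volume.restrict K) ≤
      ε / 2 := by
    rw [eLpNorm_neg]
    refine (eLpNorm_mono_measure _ hle).trans
      ((eLpNorm_mollify_le (hη n) hgk'.1.aemeasurable _ (hs0 n)).trans ?_)
    calc 2 * eLpNorm (g - k) 2 volume ≤ 2 * (ε / 2 / 2) := by gcongr
      _ = ε / 2 := by
        exact ENNReal.mul_div_cancel (by simp) (by simp)
  have e3 : eLpNorm (k - fun x => mollify (η n) k (c n + s n • x)) 2 (volume.restrict K) ≤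
      ε / 2 / 2 := by
    refine (eLpNorm_le_of_ae_bound (C := ε') ?_).trans ?_
    · filter_upwards [ae_restrict_mem hKm] with x hx
      rw [Pi.sub_apply, norm_sub_rev, Real.norm_eq_abs]
      refine norm_mollify_sub_le (hη n) hkc fun w hw => ?_
      rw [← Real.dist_eq]
      refine (hd ?_).le
      have h1 : dist (c n + s n • x) x ≤ ‖c n‖ + |s n - 1| * R := by
        rw [dist_eq_norm, show c n + s n • x - x = c n + (s n - 1) • x by module]
        refine (norm_add_le _ _).trans ?_
        rw [norm_smul, Real.norm_eq_abs]
        gcongr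
        exact hR x hx
      exact (dist_triangle _ _ _).trans_lt ((add_le_add hw h1).trans_lt (hN n hn))
    · simpa using hε'
  calc _ ≤ ε / 2 / 2 + (ε / 2 / 2 + ε / 2) := by
        refine (eLpNorm_add_le hgk'.1.restrict ((hkl.aestronglyMeasurable.restrict.sub
          (hsm hkl)).add (hsm (hgk'.locallyIntegrable (by norm_num))).neg) (by norm_num)).trans ?_
        gcongr
        refine (eLpNorm_add_le (hkl.aestronglyMeasurable.restrict.sub
          (hsm hkl)) (hsm (hgk'.locallyIntegrable (by norm_num))).neg (by norm_num)).trans ?_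
        gcongr
    _ = ε := by
        rw [← add_assoc, ENNReal.add_halves, ENNReal.add_halves]

end

section

lemma ennreal_le_sqrt_iff {a b : ℝ≥0∞} : a ≤ b ^ (1 / 2 : ℝ) ↔ a ^ 2 ≤ b := by
  rw [one_div, ENNReal.le_rpow_inv_iff (by norm_num), ENNReal.rpow_two]

/-! ## Density of smooth functions -/

/-- Mollify at the shifted and dilated point $c_n+s_nx$, around which a small ball still lies in
`D`, even if `x` is close to the boundary of `D`. One sequence serves derivatives of every order,
since the dilation only contributes factors $s_n^{i+j}\to1$. -/
lemma exists_smooth_approx {D K : Set Plane} (hD : IsOpen D) (hKb : Bornology.IsBounded K)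
    (hKm : MeasurableSet K) (hKD : K ⊆ D) {c : ℕ → Plane} {s δ : ℕ → ℝ}
    (hc : Tendsto c atTop (𝓝 0)) (hs : Tendsto s atTop (𝓝 1)) (hs0 : ∀ n, 1 / 2 ≤ s n)
    (hδ : Tendsto δ atTop (𝓝 0)) (hδ0 : ∀ n, 0 < δ n)
    (hball : ∀ n, ∀ x ∈ K, Metric.closedBall (c n + s n • x) (δ n) ⊆ D)
    {u : Plane → ℝ} (hu : MemLp u 2 (volume.restrict D)) :
    ∃ φ : ℕ → Plane → ℝ, (∀ n, ContDiff ℝ ∞ (φ n)) ∧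
      ∀ i j g, HasWeakPartial D i j u g → MemLp g 2 (volume.restrict D) →
        Tendsto (fun n => eLpNorm (g - mixedPartial i j (φ n)) 2 (volume.restrict K)) atTop (𝓝 0) := by
  choose η hη using fun n => exists_isMollifier (hδ0 n)
  have hind : ∀ {g : Plane → ℝ}, MemLp g 2 (volume.restrict D) → MemLp (D.indicator g) 2 volume :=
    fun hg => (memLp_indicator_iff_restrict hD.measurableSet).2 hg
  have hloc := (hind hu).locallyIntegrable (by norm_num)
  set ψ : ℕ → Plane → ℝ := fun n => mollify (η n) (D.indicator u)
  have hψ : ∀ n, ContDiff ℝ ∞ (ψ n) := fun n =>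
    contDiff_mollify (hη n).contDiff (hη n).hasCompactSupport hloc
  refine ⟨fun n x => ψ n (c n + s n • x), fun n => contDiff_comp_add_smul (hψ n) _ _, ?_⟩
  intro i j g hg hgL
  have hgi := hind hgL
  set T : ℕ → Plane → ℝ := fun n x => mollify (η n) (D.indicator g) (c n + s n • x)
  have hT := tendsto_mollify hKb hKm hc hs hs0 hδ hη hgi
  have hTm : ∀ n, AEStronglyMeasurable (T n) (volume.restrict K) := fun n =>
    ((contDiff_mollify (hη n).contDiff (hη n).hasCompactSupport
      (hgi.locallyIntegrable (by norm_num))).continuous.comp (by fun_prop)).aestronglyMeasurable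
  have key : ∀ n, eLpNorm (g - mixedPartial i j (fun x => ψ n (c n + s n • x))) 2
      (volume.restrict K) ≤
      ‖s n ^ (i + j)‖ₑ * eLpNorm (D.indicator g - T n) 2 (volume.restrict K) +
      ‖1 - s n ^ (i + j)‖ₑ * eLpNorm (D.indicator g) 2 (volume.restrict K) := by
    intro n
    have e : g - mixedPartial i j (fun x => ψ n (c n + s n • x)) =ᵐ[volume.restrict K]
        s n ^ (i + j) • (D.indicator g - T n) + (1 - s n ^ (i + j)) • D.indicator g := by
      filter_upwards [ae_restrict_mem hKm] with x hx
      rw [Pi.sub_apply, mixedPartial_comp_add_smul (hψ n), Pi.smul_apply,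
        mixedPartial_mollify (hη n).contDiff (hη n).hasCompactSupport hloc,
        mollify_mixedPartial hD (hη n).contDiff (hη n).hasCompactSupport hg]
      · simp only [Pi.add_apply, Pi.smul_apply, Pi.sub_apply, smul_eq_mul, T,
          indicator_of_mem (hKD hx)]
        ring
      · intro w hw
        refine hball n x hx ?_
        have := (hη n).tsupport_subset hw
        rwa [mem_closedBall_zero_iff, ← dist_eq_norm, dist_comm] at this
    rw [eLpNorm_congr_ae e]
    refine (eLpNorm_add_le ((hgi.1.restrict.sub (hTm n)).const_smul _)
      (hgi.1.restrict.const_smul _) (by norm_num)).trans ?_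
    rw [eLpNorm_const_smul, eLpNorm_const_smul]
  have hsp : Tendsto (fun n => s n ^ (i + j)) atTop (𝓝 1) := by simpa using hs.pow (i + j)
  have h1 : Tendsto (fun n => ‖s n ^ (i + j)‖ₑ * eLpNorm (D.indicator g - T n) 2
      (volume.restrict K)) atTop (𝓝 0) := by
    have := ENNReal.Tendsto.mul (hsp.enorm) (Or.inr ENNReal.zero_ne_top) hT
      (Or.inr (by simp))
    simpa using this
  have h2 : Tendsto (fun n => ‖1 - s n ^ (i + j)‖ₑ * eLpNorm (D.indicator g) 2
      (volume.restrict K)) atTop (𝓝 0) := by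
    have h3 : Tendsto (fun n => ‖1 - s n ^ (i + j)‖ₑ) atTop (𝓝 0) := by
      simpa using (hsp.const_sub 1).enorm
    have := ENNReal.Tendsto.mul_const (b := eLpNorm (D.indicator g) 2
      (volume.restrict K)) h3 (Or.inr
        (hgi.mono_measure (Measure.restrict_le_self (s := K))).2.ne)
    simpa using this
  refine tendsto_of_tendsto_of_tendsto_of_le_of_le tendsto_const_nhds ?_ (fun _ => bot_le) key
  simpa using h1.add h2

lemma hasWeakPartial_zero_zero {D : Set Plane} {u : Plane → ℝ}
    (hu : MemLp u 2 (volume.restrict D)) : HasWeakPartial D 0 0 u u :=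
  ⟨locallyIntegrableOn_of_memLp hu, locallyIntegrableOn_of_memLp hu, fun φ _ => by
    simp [mixedPartial_zero_zero]⟩

lemma tendsto_eLpNorm_gradient {K : Set Plane} {G : Plane → Plane}
    {φ : ℕ → Plane → ℝ} (hφ : ∀ n, ContDiff ℝ ∞ (φ n))
    (hG : AEStronglyMeasurable G (volume.restrict K))
    (h0 : Tendsto (fun n => eLpNorm ((fun x => G x 0) - mixedPartial 1 0 (φ n)) 2
      (volume.restrict K)) atTop (𝓝 0))
    (h1 : Tendsto (fun n => eLpNorm ((fun x => G x 1) - mixedPartial 0 1 (φ n)) 2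
      (volume.restrict K)) atTop (𝓝 0)) :
    Tendsto (fun n => eLpNorm (G - gradient (φ n)) 2 (volume.restrict K)) atTop (𝓝 0) := by
  have key : ∀ n, eLpNorm (G - gradient (φ n)) 2 (volume.restrict K) ^ 2 =
      eLpNorm ((fun x => G x 0) - mixedPartial 1 0 (φ n)) 2 (volume.restrict K) ^ 2 +
      eLpNorm ((fun x => G x 1) - mixedPartial 0 1 (φ n)) 2 (volume.restrict K) ^ 2 := by
    intro n
    simp only [eLpNorm_two_sq, plane_enorm_sq]
    rw [lintegral_add_left']
    · simp only [Pi.sub_apply, PiLp.sub_apply, gradient_apply, mixedPartial_one_zero (hφ n),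
        mixedPartial_zero_one (hφ n)]
    · have h := hG.sub (contDiff_gradient (hφ n)).continuous.aestronglyMeasurable
      exact (((EuclideanSpace.proj (𝕜 := ℝ) (0 : Fin 2)).continuous.comp_aestronglyMeasurable
        h).enorm.pow_const 2)
  have h2 : Tendsto (fun n => eLpNorm (G - gradient (φ n)) 2 (volume.restrict K) ^ 2) atTop
      (𝓝 0) := by
    simp_rw [key]
    simpa using (ENNReal.Tendsto.pow (n := 2) h0).add (ENNReal.Tendsto.pow (n := 2) h1)
  have h3 := h2.ennrpow_const (1 / 2)
  simp only [ENNReal.zero_rpow_of_pos (show (0 : ℝ) < 1 / 2 by norm_num)] at h3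
  refine h3.congr fun n => ?_
  rw [← ENNReal.rpow_natCast, ← ENNReal.rpow_mul]
  simp

namespace IsStarDomain

variable {K : Set Plane} {z : Plane} {ρ : ℝ}

/-- Contraction towards the center moves every point of `K` away from the boundary by an amount
proportional to the contraction. -/
lemma exists_smooth_approx (hK : IsStarDomain K z ρ) {u : Plane → ℝ}
    (hu : MemLp u 2 (volume.restrict K)) :
    ∃ φ : ℕ → Plane → ℝ, (∀ n, ContDiff ℝ ∞ (φ n)) ∧
      ∀ i j g, HasWeakPartial K i j u g → MemLp g 2 (volume.restrict K) →
        Tendsto (fun n => eLpNorm (g - mixedPartial i j (φ n)) 2 (volume.restrict K)) atTop (𝓝 0) := by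
  -- The shift by 2 keeps the dilation factor `1 - e n` at least one half.
  set e : ℕ → ℝ := fun n => 1 / ((n : ℝ) + 2) with he
  have he0 : ∀ n, 0 < e n := fun n => by positivity
  have he1 : ∀ n, e n ≤ 1 / 2 := fun n => by
    rw [he]; exact one_div_le_one_div_of_le (by norm_num) (by linarith [n.cast_nonneg (α := ℝ)])
  have het : Tendsto e atTop (𝓝 0) := by
    have h1 := tendsto_one_div_add_atTop_nhds_zero_nat (𝕜 := ℝ)
    have h2 := h1.comp (tendsto_add_atTop_nat 1)
    refine h2.congr fun n => ?_
    simp only [Function.comp, he]; push_cast; ring_nf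
  refine EVEM.exists_smooth_approx (c := fun n => e n • z) (s := fun n => 1 - e n)
    (δ := fun n => e n * (ρ / 2)) hK.isOpen hK.isBounded hK.isOpen.measurableSet subset_rfl
    (by simpa using het.smul_const z) (by simpa using het.const_sub 1)
    (fun n => by linarith [he1 n]) (by simpa using het.mul_const (ρ / 2))
    (fun n => mul_pos (he0 n) (half_pos hK.pos)) ?_ hu
  intro n x hx w hw
  -- A point `w` near the contracted `x` is a convex combination of `x` and a point of the ball: the
  -- deviation of `w` is charged to the center, where it is enlarged by $e_n^{-1}$.
  have hy : z + (e n)⁻¹ • (w - (e n • z + (1 - e n) • x)) ∈ Metric.ball z ρ := by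
    rw [mem_ball_iff_norm, add_sub_cancel_left, norm_smul, norm_inv,
      Real.norm_of_nonneg (he0 n).le, inv_mul_lt_iff₀ (he0 n)]
    rw [mem_closedBall_iff_norm] at hw
    refine hw.trans_lt ?_
    gcongr
    linarith [hK.pos]
  have := hK.add_smul_mem hy hx (t := 1 - e n) (by linarith [he1 n]) (by linarith [he0 n])
  convert this using 1
  have hne := (he0 n).ne'
  rw [show w = (e n) • ((e n)⁻¹ • w) by rw [smul_smul, mul_inv_cancel₀ hne, one_smul]]
  simp only [smul_sub, smul_add, smul_smul, mul_inv_cancel₀ hne, inv_mul_cancel₀ hne, one_smul]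
  match_scalars <;> field_simp <;> ring

/-- Smooth functions are dense in `H¹`. -/
lemma exists_smooth_tendsto (hK : IsStarDomain K z ρ) {u : Plane → ℝ} {G : Plane → Plane}
    (h : IsH1 K u G) : ∃ φ : ℕ → Plane → ℝ, (∀ n, ContDiff ℝ ∞ (φ n)) ∧
      Tendsto (fun n => eLpNorm (u - φ n) 2 (volume.restrict K)) atTop (𝓝 0) ∧
      Tendsto (fun n => eLpNorm (G - gradient (φ n)) 2 (volume.restrict K)) atTop (𝓝 0) := by
  obtain ⟨φ, hφ, hφt⟩ := hK.exists_smooth_approx h.1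
  refine ⟨φ, hφ, ?_, tendsto_eLpNorm_gradient hφ h.2.1.1 (hφt 1 0 _ h.2.2.1 (memLp_coord h.2.1 0))
    (hφt 0 1 _ h.2.2.2 (memLp_coord h.2.1 1))⟩
  simpa only [mixedPartial_zero_zero] using hφt 0 0 u (hasWeakPartial_zero_zero h.1) h.1

end IsStarDomain

/-- The class of the gradient of a polynomial in `L²`. -/
def polyGradient {K : Set Plane} (hb : Bornology.IsBounded K) (m : ℕ) :
    polyLT m →ₗ[ℝ] Lp Plane 2 (volume.restrict K) where
  toFun π := (memLp_of_continuous hb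
    (contDiff_gradient (contDiff_of_mem_polyLT _ π.2)).continuous 2).toLp _
  map_add' f g := by
    rw [← MemLp.toLp_add]
    congr 1
    ext x i
    simp [gradient_apply, pd_add (contDiff_of_mem_polyLT _ f.2) (contDiff_of_mem_polyLT _ g.2)]
  map_smul' c f := by
    rw [RingHom.id_apply, ← MemLp.toLp_const_smul]
    congr 1
    ext x i
    simp [gradient_apply, pd_smul (contDiff_of_mem_polyLT _ f.2)]

/-- Orthogonal projection onto the finite-dimensional space of polynomial gradients. In the limit
from smooth to Sobolev functions, it replaces polynomials that vary with the approximating function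
by a fixed one. -/
lemma exists_poly_best_approx {K : Set Plane} (hb : Bornology.IsBounded K) (m : ℕ)
    {G : Plane → Plane} (hG : MemLp G 2 (volume.restrict K)) :
    ∃ π ∈ polyLT m, ∀ π' ∈ polyLT m, eLpNorm (G - gradient π) 2 (volume.restrict K) ≤
      eLpNorm (G - gradient π') 2 (volume.restrict K) := by
  have hfin : FiniteDimensional ℝ (polyLT m) := Module.Finite.iff_fg.2 (polyLT_fg m)
  set W := LinearMap.range (polyGradient hb m)
  have hmin := W.norm_eq_iInf_iff_inner_eq_zero (u := hG.toLp G)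
    (v := W.starProjection (hG.toLp G)) (W.starProjection_apply_mem _)
  obtain ⟨π, hπ⟩ := W.starProjection_apply_mem (hG.toLp G)
  refine ⟨π, π.2, fun π' h' => ?_⟩
  have h1 := hmin.2 (fun w hw => W.starProjection_inner_eq_zero _ w hw)
  have h2 : ‖hG.toLp G - polyGradient hb m π‖ ≤ ‖hG.toLp G - polyGradient hb m ⟨π', h'⟩‖ := by
    rw [hπ, h1]
    exact ciInf_le ⟨0, by rintro _ ⟨w, rfl⟩; exact norm_nonneg _⟩
      (⟨polyGradient hb m ⟨π', h'⟩, LinearMap.mem_range_self _ _⟩ : W)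
  have h3 : ∀ q : polyLT m, ‖hG.toLp G - polyGradient hb m q‖ₑ =
      eLpNorm (G - gradient (q : Plane → ℝ)) 2 (volume.restrict K) := by
    intro q
    rw [polyGradient, LinearMap.coe_mk, AddHom.coe_mk, ← MemLp.toLp_sub, Lp.enorm_toLp]
  rw [← enorm_le_iff_norm_le, h3, h3] at h2
  exact h2

lemma gradient_sub {f g : Plane → ℝ} (hf : ContDiff ℝ ∞ f) (hg : ContDiff ℝ ∞ g) :
    gradient (f - g) = gradient f - gradient g := by
  ext x i
  simp [gradient_apply, pd, fderiv_sub (hf.differentiable (by simp) x)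
    (hg.differentiable (by simp) x)]

namespace IsStarDomain

variable {K : Set Plane} {z : Plane} {ρ : ℝ}

/-- The Bramble–Hilbert lemma. -/
theorem exists_poly (hK : IsStarDomain K z ρ) (m : ℕ) {u : Plane → ℝ} {G : Plane → Plane}
    (h : IsH1 K u G) (hm : sobolevSeminormSq (m + 1) K u < ⊤) :
    ∃ π ∈ polyLT (m + 1), sobolevSeminormSq 1 K (u - π) ≤
      chunkConst K ρ ^ m * sobolevSeminormSq (m + 1) K u := by
  set μ := volume.restrict K
  obtain ⟨φ, hφ, hφt⟩ := hK.exists_smooth_approx h.1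
  obtain ⟨g, hg⟩ := exists_weakPartial_of_sobolevSeminormSq_lt_top hm
  have hgL : ∀ β ∈ Finset.HasAntidiagonal.antidiagonal (m + 1), MemLp (g β) 2 μ := fun β hβ =>
    (memLp_two_iff (hg β hβ).1.2.1.aestronglyMeasurable).2 (hg β hβ).2
  have hGt := tendsto_eLpNorm_gradient hφ h.2.1.1 (hφt 1 0 _ h.2.2.1 (memLp_coord h.2.1 0))
    (hφt 0 1 _ h.2.2.2 (memLp_coord h.2.1 1))
  obtain ⟨π, hπ, hmin⟩ := exists_poly_best_approx hK.isBounded (m + 1) h.2.1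
  have hπs := contDiff_of_mem_polyLT _ hπ
  refine ⟨π, hπ, ?_⟩
  rw [(h.sub (isH1_of_contDiff hK.isOpen hK.isBounded hπs)).sobolevSeminormSq hK.isOpen,
    sobolevSeminormSq_eq hK.isOpen g fun β hβ => (hg β hβ).1]
  simp_rw [← eLpNorm_two_sq]
  set C := chunkConst K ρ ^ m
  set ε : ℕ × ℕ → ℕ → ℝ≥0∞ := fun β n => eLpNorm (g β - mixedPartial β.1 β.2 (φ n)) 2 μ
  -- The best approximation `π` is compared with the polynomial that belongs to the smooth function
  -- `φ n`; as `n` grows, only the seminorm of `u` remains.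
  have hbound : ∀ n, eLpNorm (G - gradient π) 2 μ ≤ eLpNorm (G - gradient (φ n)) 2 μ +
      (C * ∑ β ∈ Finset.HasAntidiagonal.antidiagonal (m + 1),
        (eLpNorm (g β) 2 μ + ε β n) ^ 2) ^ (1 / 2 : ℝ) := by
    intro n
    obtain ⟨q, hq, hle⟩ := hK.exists_poly_of_contDiff m (hφ n)
    have hqs := contDiff_of_mem_polyLT _ hq
    have hcg : ∀ {f : Plane → ℝ}, ContDiff ℝ ∞ f → AEStronglyMeasurable (gradient f) μ :=
      fun hf => (contDiff_gradient hf).continuous.aestronglyMeasurable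
    have e1 : eLpNorm (gradient (φ n) - gradient q) 2 μ ≤
        (C * ∑ β ∈ Finset.HasAntidiagonal.antidiagonal (m + 1),
          (eLpNorm (g β) 2 μ + ε β n) ^ 2) ^ (1 / 2 : ℝ) := by
      rw [ennreal_le_sqrt_iff]
      rw [(isH1_of_contDiff hK.isOpen hK.isBounded
        (contDiff_sub_pi (hφ n) hqs)).sobolevSeminormSq hK.isOpen, gradient_sub (hφ n) hqs,
        sobolevSeminormSq_of_contDiff hK.isOpen (hφ n)] at hle
      refine hle.trans ?_
      gcongr with β hβ
      rw [← eLpNorm_two_sq]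
      gcongr
      have hmp := (contDiff_mixedPartial (hφ n) β.1 β.2).continuous.aestronglyMeasurable (μ := μ)
      calc _ = eLpNorm (g β - (g β - mixedPartial β.1 β.2 (φ n))) 2 μ := by rw [sub_sub_cancel]
        _ ≤ _ := eLpNorm_sub_le (hgL β hβ).1 ((hgL β hβ).1.sub hmp) (by norm_num)
    refine (hmin q hq).trans ?_
    rw [← sub_add_sub_cancel G (gradient (φ n)) (gradient q)]
    refine (eLpNorm_add_le (h.2.1.1.sub (hcg (hφ n))) ((hcg (hφ n)).sub (hcg hqs))
      (by norm_num)).trans ?_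
    gcongr
  have hC : C ≠ ⊤ := ENNReal.pow_ne_top (ENNReal.mul_ne_top (by simp) ENNReal.ofReal_ne_top)
  have hlim : Tendsto (fun n => eLpNorm (G - gradient (φ n)) 2 μ +
      (C * ∑ β ∈ Finset.HasAntidiagonal.antidiagonal (m + 1),
        (eLpNorm (g β) 2 μ + ε β n) ^ 2) ^ (1 / 2 : ℝ)) atTop
      (𝓝 (0 + (C * ∑ β ∈ Finset.HasAntidiagonal.antidiagonal (m + 1),
        (eLpNorm (g β) 2 μ + 0) ^ 2) ^ (1 / 2 : ℝ))) := by
    refine hGt.add (Tendsto.ennrpow_const _ (ENNReal.Tendsto.const_mul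
      (tendsto_finsetSum _ fun β hβ => ENNReal.Tendsto.pow (tendsto_const_nhds.add
        (hφt β.1 β.2 _ (hg β hβ).1 (hgL β hβ)))) (Or.inr hC)))
  have := ge_of_tendsto' hlim hbound
  simp only [zero_add, add_zero] at this
  rwa [ennreal_le_sqrt_iff] at this

end IsStarDomain

end

section

/-! ## Geometry of star-shaped polygons -/

/-- The determinant of two vectors of the plane. -/
def cross (a b : Plane) : ℝ := a 0 * b 1 - a 1 * b 0

lemma cross_self (a : Plane) : cross a a = 0 := by simp [cross]; ring

lemma cross_comm (a b : Plane) : cross a b = -cross b a := by simp [cross]; ring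

lemma cross_add_left (a b c : Plane) : cross (a + b) c = cross a c + cross b c := by
  simp [cross]; ring

lemma cross_add_right (a b c : Plane) : cross a (b + c) = cross a b + cross a c := by
  simp [cross]; ring

lemma cross_smul_left (r : ℝ) (a b : Plane) : cross (r • a) b = r * cross a b := by
  simp [cross]; ring

lemma cross_smul_right (r : ℝ) (a b : Plane) : cross a (r • b) = r * cross a b := by
  simp [cross]; ring

/-- Cramer's rule for three vectors of the plane. -/
lemma cross_cycle (X Y b : Plane) : cross Y b • X = cross X b • Y - cross X Y • b := by
  ext i; fin_cases i <;> simp [cross] <;> ring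

lemma exists_smul_of_cross_eq_zero {a b : Plane} (ha : a ≠ 0) (h : cross a b = 0) :
    ∃ l : ℝ, b = l • a := by
  simp only [cross] at h
  have hn : a 0 ^ 2 + a 1 ^ 2 ≠ 0 := by
    intro h0
    apply ha
    ext i
    have h1 : a 0 = 0 := by nlinarith [sq_nonneg (a 0), sq_nonneg (a 1)]
    have h2 : a 1 = 0 := by nlinarith [sq_nonneg (a 0), sq_nonneg (a 1)]
    fin_cases i <;> simp [h1, h2]
  refine ⟨(a 0 * b 0 + a 1 * b 1) / (a 0 ^ 2 + a 1 ^ 2), ?_⟩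
  ext i
  fin_cases i <;> simp <;> field_simp
  · linear_combination (-a 1) * h
  · linear_combination (a 0) * h

namespace IsStarDomain

variable {K : Set Plane} {z : Plane} {ρ : ℝ}

/-- Replace the boundary point `y` by a nearby point of `K` and compensate by moving the center; the
new center is still in the ball, and star-shapedness with respect to it applies. -/
lemma add_smul_mem_of_closure (hK : IsStarDomain K z ρ) {y : Plane} (hy : y ∈ closure K) {s : ℝ}
    (h0 : 0 ≤ s) (h1 : s < 1) : z + s • (y - z) ∈ K := by
  have hc : ContinuousAt (fun y' : Plane => (1 - s)⁻¹ • (z + s • (y - z) - s • y')) y := by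
    fun_prop
  have hv : (1 - s)⁻¹ • (z + s • (y - z) - s • y) = z := by
    have : 1 - s ≠ 0 := by linarith
    rw [show z + s • (y - z) - s • y = (1 - s) • z by module, smul_smul, inv_mul_cancel₀ this,
      one_smul]
  have hb : ∀ᶠ y' in 𝓝 y, (1 - s)⁻¹ • (z + s • (y - z) - s • y') ∈ Metric.ball z ρ := by
    refine hc.eventually_mem ?_
    rw [hv]; exact Metric.ball_mem_nhds _ hK.pos
  obtain ⟨y', hy', hyK⟩ := mem_closure_iff_nhds.1 hy _ hb
  have := hK.add_smul_mem hy' hyK h0 h1.le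
  convert this using 1
  have h2 : (1 - s) ≠ 0 := by linarith
  have h3 : (1 - s) • ((1 - s)⁻¹ • (z + s • (y - z) - s • y')) = z + s • (y - z) - s • y' := by
    rw [smul_smul, mul_inv_cancel₀ h2, one_smul]
  set w := (1 - s)⁻¹ • (z + s • (y - z) - s • y')
  rw [show w + s • (y' - w) = (1 - s) • w + s • y' by module, h3]
  module

lemma notMem_frontier (hK : IsStarDomain K z ρ) {x : Plane} (hx : x ∈ K) : x ∉ frontier K := by
  rw [hK.isOpen.frontier_eq]; exact fun h => h.2 hx

/-- Each ray from the center meets the boundary at most once. -/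
lemma eq_of_ray (hK : IsStarDomain K z ρ) {y y' : Plane} (hy : y ∈ frontier K)
    (hy' : y' ∈ frontier K) {l : ℝ} (hl : 0 < l) (h : y' - z = l • (y - z)) : y' = y := by
  rcases lt_trichotomy l 1 with h1 | h1 | h1
  · have := hK.add_smul_mem_of_closure (frontier_subset_closure hy) hl.le h1
    rw [← h, add_sub_cancel] at this
    exact absurd hy' (hK.notMem_frontier this)
  · rw [h1, one_smul] at h; exact sub_left_injective h
  · have := hK.add_smul_mem_of_closure (frontier_subset_closure hy') (inv_nonneg.2 hl.le)
      (inv_lt_one_of_one_lt₀ h1)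
    rw [h, smul_smul, inv_mul_cancel₀ hl.ne', one_smul, add_sub_cancel] at this
    exact absurd hy (hK.notMem_frontier this)

/-- Each ray from the center meets the boundary. -/
lemma exists_frontier (hK : IsStarDomain K z ρ) {x : Plane} (hx : x ∈ K) (hxz : x ≠ z) :
    ∃ y ∈ frontier K, ∃ s ∈ Ioo (0 : ℝ) 1, x = z + s • (y - z) := by
  -- The parameters at which the ray is outside `K`; the smallest one belongs to the boundary point.
  set T : Set ℝ := {t | 1 ≤ t ∧ z + t • (x - z) ∉ K} with hT
  have hxz' : 0 < ‖x - z‖ := norm_pos_iff.2 (sub_ne_zero.2 hxz)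
  have hc : Continuous fun t : ℝ => z + t • (x - z) := by fun_prop
  have hTc : IsClosed T := isClosed_Ici.inter (hK.isOpen.isClosed_compl.preimage hc)
  have hTn : T.Nonempty := by
    refine ⟨max 1 ((Metric.diam K + 1) / ‖x - z‖), le_max_left _ _, fun h => ?_⟩
    have h1 := Metric.dist_le_diam_of_mem hK.isBounded h hK.mem_center
    rw [dist_eq_norm, add_sub_cancel_left, norm_smul, Real.norm_of_nonneg
      (zero_le_one.trans (le_max_left _ _))] at h1
    have h2 : (Metric.diam K + 1) / ‖x - z‖ * ‖x - z‖ ≤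
        max 1 ((Metric.diam K + 1) / ‖x - z‖) * ‖x - z‖ := by gcongr; exact le_max_right _ _
    rw [div_mul_cancel₀ _ hxz'.ne'] at h2
    linarith
  have hTb : BddBelow T := ⟨1, fun t ht => ht.1⟩
  set t₀ := sInf T
  have ht₀ : t₀ ∈ T := hTc.csInf_mem hTn hTb
  have h1 : 1 < t₀ := lt_of_le_of_ne ht₀.1 fun h => by
    have := ht₀.2; rw [← h] at this; simp [hx] at this
  have hbelow : ∀ t ∈ Ioo 1 t₀, z + t • (x - z) ∈ K := fun t ht => by
    by_contra h
    exact absurd (csInf_le hTb (show t ∈ T from ⟨ht.1.le, h⟩)) (not_le.2 ht.2)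
  refine ⟨z + t₀ • (x - z), ?_, t₀⁻¹, ⟨inv_pos.2 (by linarith), inv_lt_one_of_one_lt₀ h1⟩, ?_⟩
  · rw [hK.isOpen.frontier_eq]
    refine ⟨?_, ht₀.2⟩
    have : t₀ ∈ closure (Ioo 1 t₀) := by rw [closure_Ioo h1.ne]; exact ⟨h1.le, le_rfl⟩
    exact map_mem_closure (f := fun t : ℝ => z + t • (x - z)) hc this hbelow
  · rw [add_sub_cancel_left, smul_smul, inv_mul_cancel₀ (by linarith), one_smul, add_sub_cancel]

end IsStarDomain

namespace PolygonalCell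

variable {K : PolygonalCell} {z : Plane} {ρ : ℝ}

/-- The position of the `i`-th vertex relative to `z`. -/
def rel (K : PolygonalCell) (z : Plane) (i : Fin (K.m + 3)) : Plane := K.vert i - z

/-- The point with parameter `t` of the `i`-th side, relative to `z`. -/
def relSide (K : PolygonalCell) (z : Plane) (i : Fin (K.m + 3)) (t : ℝ) : Plane :=
  K.rel z i + t • (K.rel z (i + 1) - K.rel z i)

lemma segment_subset_frontier (i : Fin (K.m + 3)) :
    segment ℝ (K.vert i) (K.vert (i + 1)) ⊆ frontier K.body := by
  rw [K.frontier_body]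
  exact subset_iUnion (fun i => segment ℝ (K.vert i) (K.vert (i + 1))) i

lemma add_relSide (i : Fin (K.m + 3)) (t : ℝ) :
    z + K.relSide z i t = AffineMap.lineMap (K.vert i) (K.vert (i + 1)) t := by
  rw [AffineMap.lineMap_apply_module', relSide, rel, rel]; module

lemma add_relSide_mem {i : Fin (K.m + 3)} {t : ℝ} (ht : t ∈ Icc (0 : ℝ) 1) :
    z + K.relSide z i t ∈ segment ℝ (K.vert i) (K.vert (i + 1)) := by
  rw [add_relSide, segment_eq_image_lineMap]
  exact ⟨t, ht, rfl⟩

lemma add_relSide_mem_frontier {i : Fin (K.m + 3)} {t : ℝ} (ht : t ∈ Icc (0 : ℝ) 1) :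
    z + K.relSide z i t ∈ frontier K.body := segment_subset_frontier i (add_relSide_mem ht)

lemma succ_ne (i : Fin (K.m + 3)) : i + 1 ≠ i := by
  intro h
  have h1 : (1 : Fin (K.m + 3)) = 0 := by simp at h
  exact absurd h1 (by simp)

lemma rel_injective (z : Plane) : Function.Injective (K.rel z) := fun _ _ h =>
  K.vert_injective (sub_left_injective h)

lemma rel_ne_zero (h : IsStarDomain K.body z ρ) (i : Fin (K.m + 3)) : K.rel z i ≠ 0 := by
  intro h0
  have h1 : z = K.vert i := (sub_eq_zero.1 h0).symm
  refine h.notMem_frontier h.mem_center ?_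
  rw [h1]
  exact segment_subset_frontier i (left_mem_segment ℝ _ _)

lemma relSide_ray (h : IsStarDomain K.body z ρ) {i j : Fin (K.m + 3)} {t t' : ℝ}
    (ht : t ∈ Icc (0 : ℝ) 1) (ht' : t' ∈ Icc (0 : ℝ) 1) {l : ℝ} (hl : 0 < l)
    (e : K.relSide z j t' = l • K.relSide z i t) : K.relSide z j t' = K.relSide z i t := by
  have := h.eq_of_ray (add_relSide_mem_frontier (z := z) (i := i) ht)
    (add_relSide_mem_frontier (z := z) (i := j) ht') hl (by simpa using e)
  simpa using this

/-- If the two vertices were collinear with `z`, then either both would lie on one ray from `z`,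
which meets the boundary only once, or the side would pass through the interior point `z`. -/
lemma cross_ne_zero (h : IsStarDomain K.body z ρ) (i : Fin (K.m + 3)) :
    cross (K.rel z i) (K.rel z (i + 1)) ≠ 0 := by
  intro h0
  obtain ⟨l, hl⟩ := exists_smul_of_cross_eq_zero (rel_ne_zero h i) h0
  rcases lt_or_ge 0 l with h1 | h1
  · have e := relSide_ray h (i := i) (j := i) (t := 0) (t' := 1) (by simp) (by simp) h1
      (by simp [relSide, hl])
    simp only [relSide, one_smul, zero_smul, add_zero, add_sub_cancel] at e
    exact succ_ne i (rel_injective z e)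
  · have hden : 0 < 1 - l := by linarith
    have hmem : (1 - l)⁻¹ ∈ Icc (0 : ℝ) 1 :=
      ⟨inv_nonneg.2 hden.le, inv_le_one_of_one_le₀ (by linarith)⟩
    have e : K.relSide z i (1 - l)⁻¹ = 0 := by
      rw [relSide, hl]
      have : K.rel z i + (1 - l)⁻¹ • (l • K.rel z i - K.rel z i) =
        (1 - (1 - l)⁻¹ * (1 - l)) • K.rel z i := by module
      rw [this, inv_mul_cancel₀ hden.ne', sub_self, zero_smul]
    have := add_relSide_mem_frontier (z := z) (i := i) hmem
    rw [e, add_zero] at this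
    exact h.notMem_frontier h.mem_center this

/-- Two different sides of a simple polygon share at most vertices, so an interior point of a side
determines it. -/
lemma relSide_eq_relSide {i j : Fin (K.m + 3)} {t t' : ℝ}
    (ht : t ∈ Ioo (0 : ℝ) 1) (ht' : t' ∈ Icc (0 : ℝ) 1)
    (e : K.relSide z j t' = K.relSide z i t) : i = j := by
  by_contra hij
  have hm : z + K.relSide z i t ∈ segment ℝ (K.vert i) (K.vert (i + 1)) ∩
      segment ℝ (K.vert j) (K.vert (j + 1)) :=
    ⟨add_relSide_mem (Ioo_subset_Icc_self ht), by rw [← e]; exact add_relSide_mem ht'⟩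
  have hne : K.rel z (i + 1) - K.rel z i ≠ 0 :=
    sub_ne_zero.2 fun h' => succ_ne i (rel_injective z h')
  rcases (K.simple i j hij hm).1 with h1 | h1
  · have h2 : t • (K.rel z (i + 1) - K.rel z i) = 0 := by
      have h1' : z + K.relSide z i t = z + K.rel z i := by rw [h1, rel]; abel
      simpa [relSide] using h1'
    rcases smul_eq_zero.1 h2 with h3 | h3
    · exact ht.1.ne' h3
    · exact hne h3
  · have h2 : (1 - t) • (K.rel z (i + 1) - K.rel z i) = 0 := by
      have h1' : z + K.relSide z i t = z + K.rel z (i + 1) := by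
        rw [mem_singleton_iff.1 h1, rel]; abel
      have h4 : K.relSide z i t = K.rel z (i + 1) := by simpa using h1'
      rw [← sub_eq_zero.2 h4.symm, relSide]; module
    rcases smul_eq_zero.1 h2 with h3 | h3
    · linarith [ht.2]
    · exact hne h3

/-- Consecutive triangles have the same orientation. -/
lemma cross_mul_cross_pos (h : IsStarDomain K.body z ρ) (i : Fin (K.m + 3)) :
    0 < cross (K.rel z i) (K.rel z (i + 1)) * cross (K.rel z (i + 1)) (K.rel z (i + 1 + 1)) := by
  by_contra hneg
  set a := K.rel z i with ha
  set b := K.rel z (i + 1) with hb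
  set c := K.rel z (i + 1 + 1) with hc
  set p := cross a b with hp
  set q := cross c b with hq
  set r := cross a c with hr
  have hp0 : p ≠ 0 := cross_ne_zero h i
  have hq0 : q ≠ 0 := by
    rw [hq, cross_comm]; exact neg_ne_zero.2 (cross_ne_zero h (i + 1))
  have hpq : 0 < p * q := by
    rw [cross_comm b c, ← hq] at hneg
    refine lt_of_le_of_ne (by nlinarith) (mul_ne_zero hp0 hq0).symm
  -- With opposite orientations, `a` and `c` lie on the same side of the line through `z` in
  -- direction `b`. Then a ray close to `b` meets both sides that end at this vertex. Here `τ` is so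
  -- small that `q - τ * r` keeps the sign of `q`.
  set τ := |q| / (2 * (|r| + 1)) with hτ
  have hτ0 : 0 < τ := by positivity
  have hτr : |τ * r| < |q| := by
    rw [abs_mul, abs_of_pos hτ0, hτ, div_mul_eq_mul_div, div_lt_iff₀ (by positivity)]
    have := abs_pos.2 hq0
    nlinarith [abs_nonneg r]
  have hqr : 0 < q * (q - τ * r) := by
    have h1 : q * (τ * r) ≤ |q| * |τ * r| := by rw [← abs_mul]; exact le_abs_self _
    have h2 : |q| * |q| = q * q := abs_mul_abs_self q
    nlinarith [abs_pos.2 hq0]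
  have hd0 : q - τ * r ≠ 0 := fun h0 => by rw [h0] at hqr; simp at hqr
  -- The solution of the linear equation that makes `b + τ' • c` parallel to `b + τ • a`; it is
  -- positive by the choice of `τ`.
  set τ' := τ * p / (q - τ * r) with hτ'
  have hτ'0 : 0 < τ' := by
    have : τ' = τ * (p * q) * (q * (q - τ * r)) / (q ^ 2 * (q - τ * r) ^ 2) := by
      rw [hτ']; field_simp
    rw [this]; positivity
  have hX : cross (b + τ • a) (b + τ' • c) = 0 := by
    have h1 : cross b c = -q := by rw [hq, cross_comm]
    simp only [cross_add_left, cross_add_right, cross_smul_left, cross_smul_right, cross_self]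
    rw [h1, ← hp, ← hr, hτ']
    field_simp
    ring
  have e := cross_cycle (b + τ • a) (b + τ' • c) b
  rw [hX, zero_smul, sub_zero] at e
  have e1 : cross (b + τ' • c) b = τ' * q := by
    simp only [cross_add_left, cross_smul_left, cross_self]; rw [← hq]; ring
  have e2 : cross (b + τ • a) b = τ * p := by
    simp only [cross_add_left, cross_smul_left, cross_self]; rw [← hp]; ring
  rw [e1, e2] at e
  -- Divided by `1 + τ` and `1 + τ'`, the two vectors become convex combinations of end points, that
  -- is, points of the two sides. They lie on one ray, hence coincide, although the first one is not
  -- a vertex.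
  have ht : (1 + τ)⁻¹ ∈ Ioo (0 : ℝ) 1 :=
    ⟨by positivity, inv_lt_one_of_one_lt₀ (by linarith)⟩
  have ht' : 1 - (1 + τ')⁻¹ ∈ Icc (0 : ℝ) 1 := by
    have h1 : 0 < (1 + τ')⁻¹ := by positivity
    have h2 : (1 + τ')⁻¹ ≤ 1 := inv_le_one_of_one_le₀ (by linarith)
    exact ⟨by linarith, by linarith⟩
  have s1 : K.relSide z i (1 + τ)⁻¹ = (1 + τ)⁻¹ • (b + τ • a) := by
    rw [relSide, ← ha, ← hb]
    have h0 : (1 + τ) ≠ 0 := by positivity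
    match_scalars <;> field_simp <;> ring
  have s2 : K.relSide z (i + 1) (1 - (1 + τ')⁻¹) = (1 + τ')⁻¹ • (b + τ' • c) := by
    rw [relSide, ← hb, ← hc]
    have h0 : (1 + τ') ≠ 0 := by positivity
    match_scalars <;> field_simp <;> ring
  have hl : b + τ' • c = (τ' * q / (τ * p)) • (b + τ • a) := by
    rw [div_eq_inv_mul, mul_smul, e, smul_smul, inv_mul_cancel₀ (mul_ne_zero hτ0.ne' hp0), one_smul]
  have hlp : 0 < (1 + τ')⁻¹ * (τ' * q / (τ * p)) * (1 + τ) := by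
    have : τ' * q / (τ * p) = τ' * (p * q) / (τ * p ^ 2) := by field_simp
    rw [this]; positivity
  have key : K.relSide z (i + 1) (1 - (1 + τ')⁻¹) =
      ((1 + τ')⁻¹ * (τ' * q / (τ * p)) * (1 + τ)) • K.relSide z i (1 + τ)⁻¹ := by
    rw [s1, s2, hl, smul_smul, smul_smul]
    congr 1
    have h0 : (1 + τ) ≠ 0 := by positivity
    field_simp
  have := relSide_ray h (Ioo_subset_Icc_self ht) ht' hlp key
  exact succ_ne i (relSide_eq_relSide ht ht' this).symm

/-- All the triangles have the same orientation. -/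
lemma exists_orientation (h : IsStarDomain K.body z ρ) : ∃ σ : ℝ, σ ^ 2 = 1 ∧
    ∀ i, 0 < σ * cross (K.rel z i) (K.rel z (i + 1)) := by
  set p : Fin (K.m + 3) → ℝ := fun i => cross (K.rel z i) (K.rel z (i + 1)) with hp
  have h0 : p 0 ≠ 0 := cross_ne_zero h 0
  refine ⟨SignType.sign (p 0), ?_, ?_⟩
  · rcases lt_or_gt_of_ne h0 with h1 | h1 <;> simp [h1]
  · have hind : ∀ (n : ℕ) (hn : n < K.m + 3), 0 < ((SignType.sign (p 0) : SignType) : ℝ) *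
        p ⟨n, hn⟩ := by
      intro n
      induction n with
      | zero =>
        intro hn
        rw [show (⟨0, hn⟩ : Fin (K.m + 3)) = 0 from rfl]
        rcases lt_or_gt_of_ne h0 with h1 | h1 <;> simp [h1]
      | succ n ih =>
        intro hn
        have hn' : n < K.m + 3 := by omega
        have e : (⟨n, hn'⟩ : Fin (K.m + 3)) + 1 = ⟨n + 1, hn⟩ := by
          ext; simp [Fin.val_add, Nat.mod_eq_of_lt hn]
        have h1 : 0 < p ⟨n, hn'⟩ * p ⟨n + 1, hn⟩ := e ▸ cross_mul_cross_pos h ⟨n, hn'⟩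
        set σ := ((SignType.sign (p 0) : SignType) : ℝ)
        have h2 := mul_pos (ih hn') h1
        rw [show (σ * p ⟨n, hn'⟩) * (p ⟨n, hn'⟩ * p ⟨n + 1, hn⟩) =
          (p ⟨n, hn'⟩) ^ 2 * (σ * p ⟨n + 1, hn⟩) by ring] at h2
        exact pos_of_mul_pos_right h2 (sq_nonneg _)
    exact fun i => hind i.1 i.2

end PolygonalCell

end

section

/-! ## Triangular coordinates -/

/-- The open unit square. -/
abbrev unitSquare : Set (ℝ × ℝ) := Ioo (0 : ℝ) 1 ×ˢ Ioo (0 : ℝ) 1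

lemma measurableSet_unitSquare : MeasurableSet unitSquare :=
  measurableSet_Ioo.prod measurableSet_Ioo

/-- The parametrization of the triangle with vertices `z`, `z + a`, `z + b` by the unit square. -/
def tri (z a b : Plane) (q : ℝ × ℝ) : Plane := z + q.1 • (a + q.2 • (b - a))

lemma continuous_tri (z a b : Plane) : Continuous (tri z a b) := by unfold tri; fun_prop

lemma injOn_tri (z : Plane) {a b : Plane} (h : cross a b ≠ 0) : InjOn (tri z a b) unitSquare := by
  rintro ⟨s, t⟩ hq ⟨s', t'⟩ hq' e
  have e1 : s • (a + t • (b - a)) = s' • (a + t' • (b - a)) := add_left_cancel e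
  have c1 := congrArg (fun v => cross v (b - a)) e1
  have c2 := congrArg (fun v => cross a v) e1
  have hd : cross a (b - a) = cross a b := by simp [cross]; ring
  simp only [cross_smul_left, cross_add_left, cross_self, hd, mul_zero, add_zero] at c1
  simp only [cross_smul_right, cross_add_right, cross_self, hd, zero_add] at c2
  have h1 : s = s' := mul_right_cancel₀ h c1
  subst h1
  have h2 : s * t = s * t' := by
    rw [← mul_assoc, ← mul_assoc] at c2; exact mul_right_cancel₀ h c2
  rw [mul_left_cancel₀ hq.1.1.ne' h2]

/-- Cartesian coordinates. -/
def planeEquiv : Plane ≃ᵐ ℝ × ℝ :=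
  (MeasurableEquiv.toLp 2 (Fin 2 → ℝ)).symm.trans MeasurableEquiv.finTwoArrow

lemma measurePreserving_planeEquiv : MeasurePreserving planeEquiv :=
  (volume_preserving_finTwoArrow ℝ).comp
    (EuclideanSpace.volume_preserving_symm_measurableEquiv_toLp (Fin 2))

lemma planeEquiv_apply (x : Plane) : planeEquiv x = (x 0, x 1) := rfl

/-- The parametrization of a triangle in Cartesian coordinates. -/
def triPair (z a b : Plane) (q : ℝ × ℝ) : ℝ × ℝ :=
  (z 0 + q.1 * (a 0 + q.2 * (b 0 - a 0)), z 1 + q.1 * (a 1 + q.2 * (b 1 - a 1)))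

lemma planeEquiv_tri (z a b : Plane) (q : ℝ × ℝ) :
    planeEquiv (tri z a b q) = triPair z a b q := by
  simp only [planeEquiv_apply, tri, triPair, PiLp.add_apply, PiLp.smul_apply, PiLp.sub_apply,
    smul_eq_mul]

lemma planeEquiv_symm_triPair (z a b : Plane) (q : ℝ × ℝ) :
    planeEquiv.symm (triPair z a b q) = tri z a b q := by
  rw [← planeEquiv_tri, MeasurableEquiv.symm_apply_apply]

/-- The derivative of `triPair`. -/
def triPairDeriv (a b : Plane) (q : ℝ × ℝ) : ℝ × ℝ →L[ℝ] ℝ × ℝ :=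
  (Matrix.toLin (.finTwoProd ℝ) (.finTwoProd ℝ)
    !![a 0 + q.2 * (b 0 - a 0), q.1 * (b 0 - a 0);
      a 1 + q.2 * (b 1 - a 1), q.1 * (b 1 - a 1)]).toContinuousLinearMap

lemma hasFDerivAt_triPair (z a b : Plane) (q : ℝ × ℝ) :
    HasFDerivAt (triPair z a b) (triPairDeriv a b q) q := by
  unfold triPairDeriv
  rw [Matrix.toLin_finTwoProd_toContinuousLinearMap]
  have h : ∀ i : Fin 2, HasFDerivAt (fun q : ℝ × ℝ => z i + q.1 * (a i + q.2 * (b i - a i)))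
      ((a i + q.2 * (b i - a i)) • ContinuousLinearMap.fst ℝ ℝ ℝ +
        (q.1 * (b i - a i)) • ContinuousLinearMap.snd ℝ ℝ ℝ) q := by
    intro i
    have := (hasFDerivAt_fst (𝕜 := ℝ) (p := q)).mul
      (((hasFDerivAt_snd (𝕜 := ℝ) (p := q)).mul_const (b i - a i)).const_add (a i))
    refine (this.const_add (z i)).congr_fderiv ?_
    ext <;> simp
  exact (h 0).prodMk (h 1)

lemma det_triPairDeriv (a b : Plane) (q : ℝ × ℝ) :
    (triPairDeriv a b q).det = q.1 * cross a b := by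
  unfold triPairDeriv
  simp only [LinearMap.det_toContinuousLinearMap, LinearMap.det_toLin, Matrix.det_fin_two_of, cross]
  ring

lemma abs_det_triPairDeriv (a b : Plane) {q : ℝ × ℝ} (hq : q ∈ unitSquare) :
    |(triPairDeriv a b q).det| = q.1 * |cross a b| := by
  rw [det_triPairDeriv, abs_mul, abs_of_pos hq.1.1]

lemma injOn_triPair (z : Plane) {a b : Plane} (h : cross a b ≠ 0) :
    InjOn (triPair z a b) unitSquare := by
  intro q hq q' hq' e
  refine injOn_tri z h hq hq' ?_
  rw [← planeEquiv_symm_triPair, e, planeEquiv_symm_triPair]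

lemma image_tri (z a b : Plane) (Q : Set (ℝ × ℝ)) :
    planeEquiv.symm '' (triPair z a b '' Q) = tri z a b '' Q := by
  rw [image_image]; simp only [planeEquiv_symm_triPair]

lemma measurableSet_image_tri (z : Plane) {a b : Plane} (h : cross a b ≠ 0) :
    MeasurableSet (tri z a b '' unitSquare) :=
  measurableSet_unitSquare.image_of_continuousOn_injOn (continuous_tri z a b).continuousOn
    (injOn_tri z h)

/-- The coordinates collapse the edge `q.1 = 0` of the square to the tip, whence the factor `q.1` in
the Jacobian. -/
lemma lintegral_image_tri (z : Plane) {a b : Plane} (h : cross a b ≠ 0) (f : Plane → ℝ≥0∞) :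
    ∫⁻ x in tri z a b '' unitSquare, f x =
      ∫⁻ q in unitSquare, ENNReal.ofReal (q.1 * |cross a b|) * f (tri z a b q) := by
  rw [← image_tri, ← measurePreserving_planeEquiv.symm.setLIntegral_comp_emb
    planeEquiv.symm.measurableEmbedding,
    lintegral_image_eq_lintegral_abs_det_fderiv_mul volume measurableSet_unitSquare
      (fun q _ => (hasFDerivAt_triPair z a b q).hasFDerivWithinAt) (injOn_triPair z h)]
  refine setLIntegral_congr_fun measurableSet_unitSquare fun q hq => ?_
  simp only [abs_det_triPairDeriv a b hq, planeEquiv_symm_triPair]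

lemma integral_image_tri (z : Plane) {a b : Plane} (h : cross a b ≠ 0) (f : Plane → ℝ) :
    ∫ x in tri z a b '' unitSquare, f x =
      ∫ q in unitSquare, (q.1 * |cross a b|) * f (tri z a b q) := by
  rw [← image_tri, measurePreserving_planeEquiv.symm.setIntegral_image_emb
    planeEquiv.symm.measurableEmbedding,
    integral_image_eq_integral_abs_det_fderiv_smul volume measurableSet_unitSquare
      (fun q _ => (hasFDerivAt_triPair z a b q).hasFDerivWithinAt) (injOn_triPair z h)]
  refine setIntegral_congr_fun measurableSet_unitSquare fun q hq => ?_
  simp only [abs_det_triPairDeriv a b hq, planeEquiv_symm_triPair, smul_eq_mul]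

lemma integrableOn_image_tri (z : Plane) {a b : Plane} (h : cross a b ≠ 0) (f : Plane → ℝ) :
    IntegrableOn f (tri z a b '' unitSquare) ↔
      IntegrableOn (fun q => (q.1 * |cross a b|) * f (tri z a b q)) unitSquare := by
  rw [← image_tri, measurePreserving_planeEquiv.symm.integrableOn_image
    planeEquiv.symm.measurableEmbedding,
    integrableOn_image_iff_integrableOn_abs_det_fderiv_smul volume measurableSet_unitSquare
      (fun q _ => (hasFDerivAt_triPair z a b q).hasFDerivWithinAt) (injOn_triPair z h)]
  refine integrableOn_congr_fun (fun q hq => ?_) measurableSet_unitSquare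
  simp only [abs_det_triPairDeriv a b hq, Function.comp, planeEquiv_symm_triPair, smul_eq_mul]

lemma volume_ray (z : Plane) {v : Plane} (hv : v ≠ 0) :
    volume {x : Plane | ∃ s : ℝ, x = z + s • v} = 0 := by
  have h : {x : Plane | ∃ s : ℝ, x = z + s • v} ⊆
      (AffineSubspace.mk' z (ℝ ∙ v) : Set Plane) := by
    rintro x ⟨s, rfl⟩
    simp [AffineSubspace.mem_mk', Submodule.mem_span_singleton]
  refine measure_mono_null h (Measure.addHaar_affineSubspace _ _ fun ht => ?_)
  have hd := congrArg AffineSubspace.direction ht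
  rw [AffineSubspace.direction_mk', AffineSubspace.direction_top] at hd
  have := finrank_span_singleton (K := ℝ) hv
  rw [hd, finrank_top] at this
  simp at this

namespace PolygonalCell

variable {K : PolygonalCell} {z : Plane} {ρ : ℝ}

/-- The triangle spanned by the center and the `i`-th side, without its sides. -/
def fan (K : PolygonalCell) (z : Plane) (i : Fin (K.m + 3)) : Set Plane :=
  tri z (K.rel z i) (K.rel z (i + 1)) '' unitSquare

lemma tri_eq (i : Fin (K.m + 3)) (q : ℝ × ℝ) :
    tri z (K.rel z i) (K.rel z (i + 1)) q = z + q.1 • K.relSide z i q.2 := rfl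

lemma add_smul_relSide_mem (h : IsStarDomain K.body z ρ) (i : Fin (K.m + 3)) {s t : ℝ}
    (hs : 0 ≤ s) (hs' : s < 1) (ht : t ∈ Icc (0 : ℝ) 1) : z + s • K.relSide z i t ∈ K.body := by
  have := h.add_smul_mem_of_closure (frontier_subset_closure
    (add_relSide_mem_frontier (z := z) (i := i) ht)) hs hs'
  simpa using this

lemma fan_subset (h : IsStarDomain K.body z ρ) (i : Fin (K.m + 3)) : K.fan z i ⊆ K.body := by
  rintro _ ⟨q, hq, rfl⟩
  rw [tri_eq]
  exact add_smul_relSide_mem h i hq.1.1.le hq.1.2 (Ioo_subset_Icc_self hq.2)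

/-- A ray from the center meets the boundary once, hence in the interior of at most one side. -/
lemma disjoint_fan (h : IsStarDomain K.body z ρ) :
    Pairwise fun i j => Disjoint (K.fan z i) (K.fan z j) := by
  intro i j hij
  rw [Set.disjoint_left]
  rintro _ ⟨q, hq, rfl⟩ ⟨q', hq', e⟩
  rw [tri_eq, tri_eq] at e
  have e1 : K.relSide z j q'.2 = (q'.1⁻¹ * q.1) • K.relSide z i q.2 := by
    rw [mul_smul, ← add_left_cancel e, smul_smul, inv_mul_cancel₀ hq'.1.1.ne', one_smul]
  have := relSide_ray h (Ioo_subset_Icc_self hq.2) (Ioo_subset_Icc_self hq'.2)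
    (mul_pos (inv_pos.2 hq'.1.1) hq.1.1) e1
  exact hij (relSide_eq_relSide hq.2 (Ioo_subset_Icc_self hq'.2) this)

/-- Every point of the polygon other than `z` is on a ray to a boundary point; only the lines
through `z` and the vertices are missed, and these are null sets. -/
lemma iUnion_fan_ae_eq (h : IsStarDomain K.body z ρ) :
    (⋃ i, K.fan z i) =ᵐ[volume] K.body := by
  have hsub : (⋃ i, K.fan z i) ⊆ K.body := iUnion_subset (fan_subset h)
  refine (ae_eq_set.2 ⟨by rw [sdiff_eq_empty.2 hsub, measure_empty], ?_⟩)
  refine measure_mono_null (t := ⋃ i, {x : Plane | ∃ s : ℝ, x = z + s • K.rel z i}) ?_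
    (measure_iUnion_null fun i => volume_ray z (rel_ne_zero h i))
  rintro x ⟨hx, hx'⟩
  rw [mem_iUnion]
  by_cases hxz : x = z
  · exact ⟨0, 0, by simp [hxz]⟩
  obtain ⟨y, hy, s, hs, hxy⟩ := h.exists_frontier hx hxz
  rw [K.frontier_body] at hy
  obtain ⟨i, hi⟩ := mem_iUnion.1 hy
  rw [segment_eq_image_lineMap] at hi
  obtain ⟨t, ht, rfl⟩ := hi
  rw [← add_relSide (z := z), add_sub_cancel_left] at hxy
  by_cases h0 : t = 0
  · exact ⟨i, s, by rw [hxy, h0]; simp [relSide]⟩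
  by_cases h1 : t = 1
  · exact ⟨i + 1, s, by rw [hxy, h1]; simp [relSide]⟩
  · have hmem : x ∈ K.fan z i := ⟨(s, t), ⟨hs, lt_of_le_of_ne ht.1 (Ne.symm h0),
      lt_of_le_of_ne ht.2 h1⟩, by rw [tri_eq, hxy]⟩
    exact absurd (mem_iUnion.2 ⟨i, hmem⟩) hx'

lemma setIntegral_body (h : IsStarDomain K.body z ρ) {f : Plane → ℝ}
    (hf : IntegrableOn f K.body) : ∫ x in K.body, f x = ∑ i, ∫ q in unitSquare,
      (q.1 * |cross (K.rel z i) (K.rel z (i + 1))|) * f (z + q.1 • K.relSide z i q.2) := by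
  rw [← setIntegral_congr_set (iUnion_fan_ae_eq h), integral_iUnion_fintype (s := K.fan z)
    (fun i => measurableSet_image_tri z (cross_ne_zero h i)) (disjoint_fan h)
    (fun i => hf.mono_set (fan_subset h i))]
  exact Finset.sum_congr rfl fun i _ => integral_image_tri z (cross_ne_zero h i) f

end PolygonalCell

end

section

/-! ## Green's formula -/

namespace PolygonalCell

variable {K : PolygonalCell} {z : Plane} {ρ : ℝ}

lemma hasFDerivAt_tri (z a b : Plane) (q : ℝ × ℝ) : HasFDerivAt (tri z a b)
    ((ContinuousLinearMap.fst ℝ ℝ ℝ).smulRight (a + q.2 • (b - a)) +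
      (ContinuousLinearMap.snd ℝ ℝ ℝ).smulRight (q.1 • (b - a))) q := by
  have h1 : HasFDerivAt (fun q : ℝ × ℝ => a + q.2 • (b - a))
      ((ContinuousLinearMap.snd ℝ ℝ ℝ).smulRight (b - a)) q :=
    ((hasFDerivAt_snd (𝕜 := ℝ) (p := q)).smul_const (b - a)).const_add a
  have h2 := ((hasFDerivAt_fst (𝕜 := ℝ) (p := q)).smul h1).const_add z
  refine h2.congr_fderiv ?_
  ext <;> simp

lemma tri_mem_body (h : IsStarDomain K.body z ρ) (i : Fin (K.m + 3)) {S : ℝ} (hS : S < 1)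
    {q : ℝ × ℝ} (hq : q ∈ Icc (0 : ℝ × ℝ) (S, 1)) :
    tri z (K.rel z i) (K.rel z (i + 1)) q ∈ K.body := by
  rw [tri_eq]
  exact add_smul_relSide_mem h i hq.1.1 (hq.2.1.trans_lt hS) ⟨hq.1.2, hq.2.2⟩

/-- Green's formula on a triangle with its tip at the center. -/
lemma green_triangle (h : IsStarDomain K.body z ρ) {F₀ F₁ : Plane → ℝ}
    (h₀ : ContDiffOn ℝ 1 F₀ K.body) (h₁ : ContDiffOn ℝ 1 F₁ K.body) (i : Fin (K.m + 3)) {S : ℝ}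
    (hS0 : 0 ≤ S) (hS : S < 1) :
    ∫ q in Icc (0 : ℝ × ℝ) (S, 1), q.1 * cross (K.rel z i) (K.rel z (i + 1)) *
        (pd 0 F₀ (z + q.1 • K.relSide z i q.2) + pd 1 F₁ (z + q.1 • K.relSide z i q.2)) =
      (S * ∫ t in (0 : ℝ)..1, (F₀ (z + S • K.relSide z i t) * (K.rel z (i + 1) - K.rel z i) 1 -
          F₁ (z + S • K.relSide z i t) * (K.rel z (i + 1) - K.rel z i) 0)) +
      ((∫ s in (0 : ℝ)..S, (F₀ (z + s • K.rel z i) * K.rel z i 1 -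
          F₁ (z + s • K.rel z i) * K.rel z i 0)) -
        ∫ s in (0 : ℝ)..S, (F₀ (z + s • K.rel z (i + 1)) * K.rel z (i + 1) 1 -
          F₁ (z + s • K.rel z (i + 1)) * K.rel z (i + 1) 0)) := by
  set a := K.rel z i
  set b := K.rel z (i + 1)
  set X := tri z a b with hX
  have hXe : ∀ q, X q = z + q.1 • K.relSide z i q.2 := fun q => rfl
  have hmem : ∀ q ∈ Icc (0 : ℝ × ℝ) (S, 1), X q ∈ K.body := fun q hq => tri_mem_body h i hS hq
  have hXc : Continuous X := continuous_tri z a b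
  have hcomp : ∀ {F : Plane → ℝ}, ContinuousOn F K.body →
      ContinuousOn (fun q => F (X q)) (Icc (0 : ℝ × ℝ) (S, 1)) := fun hF =>
    hF.comp hXc.continuousOn hmem
  have hcd : ∀ {F : Plane → ℝ}, ContDiffOn ℝ 1 F K.body → ContinuousOn (fderiv ℝ F) K.body :=
    fun hF => hF.continuousOn_fderiv_of_isOpen h.isOpen le_rfl
  set X' : ℝ × ℝ → (ℝ × ℝ →L[ℝ] Plane) := fun q =>
    (ContinuousLinearMap.fst ℝ ℝ ℝ).smulRight (a + q.2 • (b - a)) +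
      (ContinuousLinearMap.snd ℝ ℝ ℝ).smulRight (q.1 • (b - a)) with hX'
  have hFX : ∀ {F : Plane → ℝ}, ContDiffOn ℝ 1 F K.body → ∀ q ∈ Icc (0 : ℝ × ℝ) (S, 1),
      HasFDerivAt (fun q => F (X q)) ((fderiv ℝ F (X q)).comp (X' q)) q := by
    intro F hF q hq
    have hd : DifferentiableAt ℝ F (X q) :=
      (hF.differentiableOn (by simp)).differentiableAt (h.isOpen.mem_nhds (hmem q hq))
    exact hd.hasFDerivAt.comp q (hasFDerivAt_tri z a b q)
  set d := b - a with hd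
  -- The pull-back of the vector field to the rectangle (the Piola transform): `f` is the flux
  -- density through the lines $s=\mathrm{const}$, and `g` the one through the lines
  -- $t=\mathrm{const}$.
  set f : ℝ × ℝ → ℝ := fun q => q.1 * (F₀ (X q) * d 1 - F₁ (X q) * d 0) with hf
  set g : ℝ × ℝ → ℝ := fun q =>
    -(F₀ (X q) * (a 1 + q.2 * d 1) - F₁ (X q) * (a 0 + q.2 * d 0)) with hg
  set f' : ℝ × ℝ → (ℝ × ℝ →L[ℝ] ℝ) := fun q =>
    q.1 • (d 1 • (fderiv ℝ F₀ (X q)).comp (X' q) - d 0 • (fderiv ℝ F₁ (X q)).comp (X' q)) +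
      (F₀ (X q) * d 1 - F₁ (X q) * d 0) • ContinuousLinearMap.fst ℝ ℝ ℝ with hf'
  set g' : ℝ × ℝ → (ℝ × ℝ →L[ℝ] ℝ) := fun q =>
    -((F₀ (X q) • (d 1 • ContinuousLinearMap.snd ℝ ℝ ℝ) +
        (a 1 + q.2 * d 1) • (fderiv ℝ F₀ (X q)).comp (X' q)) -
      (F₁ (X q) • (d 0 • ContinuousLinearMap.snd ℝ ℝ ℝ) +
        (a 0 + q.2 * d 0) • (fderiv ℝ F₁ (X q)).comp (X' q))) with hg'
  have hfd : ∀ q ∈ Icc (0 : ℝ × ℝ) (S, 1), HasFDerivAt f (f' q) q := by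
    intro q hq
    exact (hasFDerivAt_fst (𝕜 := ℝ) (p := q)).mul
      (((hFX h₀ q hq).mul_const (d 1)).sub ((hFX h₁ q hq).mul_const (d 0)))
  have hgd : ∀ q ∈ Icc (0 : ℝ × ℝ) (S, 1), HasFDerivAt g (g' q) q := by
    intro q hq
    have hl : ∀ j : Fin 2, HasFDerivAt (fun q : ℝ × ℝ => a j + q.2 * d j)
        (d j • ContinuousLinearMap.snd ℝ ℝ ℝ) q := fun j =>
      ((hasFDerivAt_snd (𝕜 := ℝ) (p := q)).mul_const (d j)).const_add (a j)
    exact (((hFX h₀ q hq).mul (hl 1)).sub ((hFX h₁ q hq).mul (hl 0))).neg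
  -- The divergence of the pulled-back field is the Jacobian times the divergence; the terms without
  -- derivatives of the field cancel.
  have hpt : ∀ q, f' q (1, 0) + g' q (0, 1) =
      q.1 * cross a b * (pd 0 F₀ (X q) + pd 1 F₁ (X q)) := by
    intro q
    have hv : ∀ (L : Plane →L[ℝ] ℝ) (v : Plane), L v = v 0 * L (unitVec 0) + v 1 * L (unitVec 1) := by
      intro L v
      have : v = v 0 • unitVec 0 + v 1 • unitVec 1 := by
        ext j; fin_cases j <;> simp
      conv_lhs => rw [this]
      simp
    have e1 : X' q (1, 0) = a + q.2 • d := by simp [hX', hd]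
    have e2 : X' q (0, 1) = q.1 • d := by simp [hX', hd]
    simp only [hf', hg', _root_.add_apply, _root_.sub_apply,
      _root_.smul_apply, _root_.neg_apply, ContinuousLinearMap.comp_apply,
      e1, e2, smul_eq_mul, ContinuousLinearMap.coe_fst', ContinuousLinearMap.coe_snd']
    rw [hv (fderiv ℝ F₀ (X q)) (a + q.2 • d), hv (fderiv ℝ F₁ (X q)) (a + q.2 • d),
      hv (fderiv ℝ F₀ (X q)) (q.1 • d), hv (fderiv ℝ F₁ (X q)) (q.1 • d)]
    simp only [pd, cross, hd, PiLp.add_apply, PiLp.smul_apply, PiLp.sub_apply, smul_eq_mul]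
    ring
  have hdivc : ContinuousOn (fun q => q.1 * cross a b * (pd 0 F₀ (X q) + pd 1 F₁ (X q)))
      (Icc (0 : ℝ × ℝ) (S, 1)) := by
    have hp : ∀ {F : Plane → ℝ}, ContDiffOn ℝ 1 F K.body → ∀ j, ContinuousOn (pd j F) K.body :=
      fun hF j => (hcd hF).clm_apply continuousOn_const
    exact (by fun_prop : ContinuousOn (fun q : ℝ × ℝ => q.1 * cross a b) _).mul
      ((hcomp (hp h₀ 0)).add (hcomp (hp h₁ 1)))
  have hfc : ContinuousOn f (Icc (0 : ℝ × ℝ) (S, 1)) := fun q hq =>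
    (hfd q hq).continuousAt.continuousWithinAt
  have hgc : ContinuousOn g (Icc (0 : ℝ × ℝ) (S, 1)) := fun q hq =>
    (hgd q hq).continuousAt.continuousWithinAt
  have main := integral_divergence_prod_Icc_of_hasFDerivAt_of_le f g f' g' (0 : ℝ × ℝ) (S, 1)
    ⟨hS0, zero_le_one⟩ hfc hgc
    (fun q hq => hfd q ⟨⟨hq.1.1.le, hq.2.1.le⟩, ⟨hq.1.2.le, hq.2.2.le⟩⟩)
    (fun q hq => hgd q ⟨⟨hq.1.1.le, hq.2.1.le⟩, ⟨hq.1.2.le, hq.2.2.le⟩⟩)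
    (by simp_rw [hpt]; exact hdivc.integrableOn_compact isCompact_Icc)
  simp_rw [hpt] at main
  change ∫ q in Icc (0 : ℝ × ℝ) (S, 1), q.1 * cross a b * (pd 0 F₀ (X q) + pd 1 F₁ (X q)) = _
  rw [main]
  have hb1 : ∀ s, X (s, 1) = z + s • b := fun s => by simp [hX, tri]
  have hb0 : ∀ s, X (s, 0) = z + s • a := fun s => by simp [hX, tri]
  have hd1 : ∀ j : Fin 2, a j + 1 * d j = b j := fun j => by simp [hd]
  have i1 : ∫ s in (0 : ℝ)..S, g (s, 1) =
      -∫ s in (0 : ℝ)..S, (F₀ (z + s • b) * b 1 - F₁ (z + s • b) * b 0) := by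
    rw [← intervalIntegral.integral_neg]
    simp only [hg, hb1, hd1]
  have i2 : ∫ s in (0 : ℝ)..S, g (s, 0) =
      -∫ s in (0 : ℝ)..S, (F₀ (z + s • a) * a 1 - F₁ (z + s • a) * a 0) := by
    rw [← intervalIntegral.integral_neg]
    simp only [hg, hb0, zero_mul, add_zero]
  have i3 : ∫ t in (0 : ℝ)..1, f (S, t) = S * ∫ t in (0 : ℝ)..1,
      (F₀ (z + S • K.relSide z i t) * d 1 - F₁ (z + S • K.relSide z i t) * d 0) := by
    rw [← intervalIntegral.integral_const_mul]
    simp only [hf, hXe]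
  -- The edge $s=0$ is the tip of the triangle and carries no flux.
  have i4 : ∫ t in (0 : ℝ)..1, f (0, t) = 0 := by simp [hf]
  simp only [Prod.fst_zero, Prod.snd_zero]
  rw [i1, i2, i3, i4]
  ring

lemma continuous_relSide (i : Fin (K.m + 3)) : Continuous (K.relSide z i) := by
  unfold relSide; fun_prop

/-- Green's formula for a vector field that is continuously differentiable inside a star-shaped
polygon and has dominated radial limits on its sides. -/
theorem green (h : IsStarDomain K.body z ρ) {σ : ℝ} (hσ : σ ^ 2 = 1)
    (hσc : ∀ i, 0 < σ * cross (K.rel z i) (K.rel z (i + 1))) {F₀ F₁ : Plane → ℝ}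
    (h₀ : ContDiffOn ℝ 1 F₀ K.body) (h₁ : ContDiffOn ℝ 1 F₁ K.body)
    (hdiv : IntegrableOn (fun x => pd 0 F₀ x + pd 1 F₁ x) K.body)
    {B : Fin (K.m + 3) → ℝ → ℝ} (hB : ∀ i, IntervalIntegrable (B i) volume 0 1)
    (hbd : ∀ i, ∀ s ∈ Ico (0 : ℝ) 1, ∀ᵐ t, t ∈ uIoc (0 : ℝ) 1 →
      |F₀ (z + s • K.relSide z i t)| ≤ B i t ∧ |F₁ (z + s • K.relSide z i t)| ≤ B i t)
    {L₀ L₁ : Fin (K.m + 3) → ℝ → ℝ}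
    (hL₀ : ∀ i, ∀ᵐ t, t ∈ uIoc (0 : ℝ) 1 →
      Tendsto (fun s => F₀ (z + s • K.relSide z i t)) (𝓝[<] (1 : ℝ)) (𝓝 (L₀ i t)))
    (hL₁ : ∀ i, ∀ᵐ t, t ∈ uIoc (0 : ℝ) 1 →
      Tendsto (fun s => F₁ (z + s • K.relSide z i t)) (𝓝[<] (1 : ℝ)) (𝓝 (L₁ i t))) :
    ∫ x in K.body, (pd 0 F₀ x + pd 1 F₁ x) = σ * ∑ i, ∫ t in (0 : ℝ)..1,
      (L₀ i t * (K.rel z (i + 1) - K.rel z i) 1 - L₁ i t * (K.rel z (i + 1) - K.rel z i) 0) := by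
  -- The polygon is exhausted by copies of itself shrunk towards `z`, on whose closures the field is
  -- continuously differentiable.
  set S : ℕ → ℝ := fun n => 1 - 1 / ((n : ℝ) + 1) with hS
  have hS1 : ∀ n, S n < 1 := fun n => by
    have : 0 < 1 / ((n : ℝ) + 1) := by positivity
    simp only [hS]; linarith
  have hS0 : ∀ n, 0 ≤ S n := fun n => by
    have : 1 / ((n : ℝ) + 1) ≤ 1 := by
      rw [div_le_one (by positivity)]; linarith [n.cast_nonneg (α := ℝ)]
    simp only [hS]; linarith
  have hSt : Tendsto S atTop (𝓝 1) := by
    have := (tendsto_one_div_add_atTop_nhds_zero_nat (𝕜 := ℝ)).const_sub 1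
    rwa [sub_zero] at this
  have hSt' : Tendsto S atTop (𝓝[<] 1) :=
    tendsto_nhdsWithin_iff.2 ⟨hSt, Eventually.of_forall hS1⟩
  have hSm : Monotone S := fun m n hmn => by
    have hmn' : (m : ℝ) ≤ n := by exact_mod_cast hmn
    have : 1 / ((n : ℝ) + 1) ≤ 1 / ((m : ℝ) + 1) := by gcongr
    simp only [hS]; linarith
  set w : Fin (K.m + 3) → ℝ × ℝ → ℝ := fun i q => q.1 * cross (K.rel z i) (K.rel z (i + 1)) *
    (pd 0 F₀ (z + q.1 • K.relSide z i q.2) + pd 1 F₁ (z + q.1 • K.relSide z i q.2)) with hw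
  have habs : ∀ i, |cross (K.rel z i) (K.rel z (i + 1))| =
      σ * cross (K.rel z i) (K.rel z (i + 1)) := by
    intro i
    have hσa : |σ| = 1 := by
      rw [← sq_eq_sq₀ (abs_nonneg _) zero_le_one, sq_abs, hσ, one_pow]
    rw [← abs_of_pos (hσc i), abs_mul, hσa, one_mul]
  have hunion : (⋃ n, Icc (0 : ℝ × ℝ) (S n, 1)) =ᵐ[volume] unitSquare := by
    have e : (⋃ n, Icc (0 : ℝ × ℝ) (S n, 1)) = Ico (0 : ℝ) 1 ×ˢ Icc (0 : ℝ) 1 := by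
      ext ⟨s, t⟩
      simp only [mem_iUnion, mem_prod, mem_Icc, mem_Ico, Prod.le_def, Prod.fst_zero, Prod.snd_zero]
      constructor
      · rintro ⟨n, ⟨h1, h2⟩, h3, h4⟩
        exact ⟨⟨h1, h3.trans_lt (hS1 n)⟩, h2, h4⟩
      · rintro ⟨⟨h1, h2⟩, h3, h4⟩
        obtain ⟨n, hn⟩ := (hSt.eventually_const_lt h2).exists
        exact ⟨n, ⟨h1, h3⟩, hn.le, h4⟩
    rw [e]
    exact Measure.set_prod_ae_eq Ioo_ae_eq_Ico.symm Ioo_ae_eq_Icc.symm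
  have hwi : ∀ i, IntegrableOn (w i) unitSquare := by
    intro i
    have h1 := (integrableOn_image_tri z (cross_ne_zero h i) _).1 (hdiv.mono_set (fan_subset h i))
    refine (h1.const_mul σ).congr (Eventually.of_forall fun q => ?_)
    simp only [hw, habs, tri_eq]
    linear_combination (q.1 * cross (K.rel z i) (K.rel z (i + 1)) *
      (pd 0 F₀ (z + q.1 • K.relSide z i q.2) + pd 1 F₁ (z + q.1 • K.relSide z i q.2))) * hσ
  have hlhs : ∫ x in K.body, (pd 0 F₀ x + pd 1 F₁ x) =
      σ * ∑ i, ∫ q in unitSquare, w i q := by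
    rw [setIntegral_body h hdiv, Finset.mul_sum]
    refine Finset.sum_congr rfl fun i _ => ?_
    rw [← integral_const_mul]
    refine integral_congr_ae (Eventually.of_forall fun q => ?_)
    simp only [hw, habs]; ring
  rw [hlhs]
  congr 1
  have hlim1 : Tendsto (fun n => ∑ i, ∫ q in Icc (0 : ℝ × ℝ) (S n, 1), w i q) atTop
      (𝓝 (∑ i, ∫ q in unitSquare, w i q)) := by
    refine tendsto_finsetSum _ fun i _ => ?_
    rw [← setIntegral_congr_set hunion]
    refine tendsto_setIntegral_of_monotone (fun n => measurableSet_Icc) ?_ ?_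
    · intro m n hmn
      exact Icc_subset_Icc_right ⟨hSm hmn, le_rfl⟩
    · rw [integrableOn_congr_set_ae hunion]; exact hwi i
  set d : Fin (K.m + 3) → Plane := fun i => K.rel z (i + 1) - K.rel z i
  -- The fluxes through the shrunken sides converge by dominated convergence; here the bounds `B`
  -- and the radial limits are used.
  have hlim2 : Tendsto (fun n => ∑ i, S n * ∫ t in (0 : ℝ)..1,
      (F₀ (z + S n • K.relSide z i t) * d i 1 - F₁ (z + S n • K.relSide z i t) * d i 0)) atTop
      (𝓝 (∑ i, 1 * ∫ t in (0 : ℝ)..1, (L₀ i t * d i 1 - L₁ i t * d i 0))) := by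
    refine tendsto_finsetSum _ fun i _ => hSt.mul ?_
    refine intervalIntegral.tendsto_integral_filter_of_dominated_convergence
      (fun t => B i t * (|d i 1| + |d i 0|)) (Eventually.of_forall fun n => ?_)
      (Eventually.of_forall fun n => ?_) ((hB i).mul_const _) ?_
    · refine ContinuousOn.aestronglyMeasurable ?_ measurableSet_uIoc
      have hc : ∀ {F : Plane → ℝ}, ContDiffOn ℝ 1 F K.body →
          ContinuousOn (fun t => F (z + S n • K.relSide z i t)) (uIoc (0 : ℝ) 1) := by
        intro F hF
        refine hF.continuousOn.comp ?_ ?_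
        · have := continuous_relSide (z := z) i
          fun_prop
        · intro t ht
          rw [uIoc_of_le zero_le_one] at ht
          exact add_smul_relSide_mem h i (hS0 n) (hS1 n) (Ioc_subset_Icc_self ht)
      exact ((hc h₀).mul continuousOn_const).sub ((hc h₁).mul continuousOn_const)
    · filter_upwards [hbd i (S n) ⟨hS0 n, hS1 n⟩] with t ht hti
      obtain ⟨e0, e1⟩ := ht hti
      rw [Real.norm_eq_abs]
      refine (abs_sub _ _).trans ?_
      rw [abs_mul, abs_mul, mul_add]
      gcongr
    · filter_upwards [hL₀ i, hL₁ i] with t ht0 ht1 hti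
      exact (((ht0 hti).comp hSt').mul_const _).sub (((ht1 hti).comp hSt').mul_const _)
  simp only [one_mul] at hlim2
  refine tendsto_nhds_unique hlim1 (hlim2.congr fun n => ?_)
  rw [Finset.sum_congr rfl fun i _ => green_triangle h h₀ h₁ i (hS0 n) (hS1 n),
    Finset.sum_add_distrib, Finset.sum_sub_distrib]
  set E : Fin (K.m + 3) → ℝ := fun i => ∫ s in (0 : ℝ)..S n,
    (F₀ (z + s • K.rel z i) * K.rel z i 1 - F₁ (z + s • K.rel z i) * K.rel z i 0)
  -- Each segment from the center to a vertex is passed twice, in opposite directions, by the two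
  -- adjacent triangles.
  have hE : ∑ i, E (i + 1) = ∑ i, E i := Equiv.sum_comp (Equiv.addRight 1) E
  change _ = _ + (∑ i, E i - ∑ i, E (i + 1))
  rw [hE, sub_self, add_zero]

end PolygonalCell

end

section

/-! ## Weighted trace inequalities -/

lemma ofReal_intervalIntegral {k : ℝ → ℝ} (hk : IntervalIntegrable k volume 0 1)
    (h0 : ∀ t ∈ Ioo (0 : ℝ) 1, 0 ≤ k t) :
    ENNReal.ofReal (∫ t in (0 : ℝ)..1, k t) = ∫⁻ t in Ioo (0 : ℝ) 1, ENNReal.ofReal (k t) := by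
  rw [intervalIntegral.integral_of_le zero_le_one, integral_Ioc_eq_integral_Ioo,
    ofReal_integral_eq_lintegral_ofReal]
  · rw [intervalIntegrable_iff_integrableOn_Ioo_of_le zero_le_one] at hk; exact hk
  · exact (ae_restrict_iff' measurableSet_Ioo).2 (Eventually.of_forall h0)

/-- Integrate the derivative of $(1-t)g(t)^2$. -/
lemma sq_le_integral {g g' : ℝ → ℝ} (hg : ∀ t, HasDerivAt g (g' t) t) (hg' : Continuous g') :
    g 0 ^ 2 ≤ ∫ t in (0 : ℝ)..1, (g t ^ 2 + 2 * |g t| * |g' t|) := by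
  have hgc : Continuous g := continuous_iff_continuousAt.2 fun t => (hg t).continuousAt
  have hF : ∀ t, HasDerivAt (fun t => (1 - t) * g t ^ 2)
      (-(g t ^ 2) + (1 - t) * (2 * g t * g' t)) t := by
    intro t
    have := ((hasDerivAt_id t).const_sub 1).mul ((hg t).pow 2)
    refine this.congr_deriv ?_
    simp
  have hc : Continuous fun t => -(g t ^ 2) + (1 - t) * (2 * g t * g' t) := by fun_prop
  have h1 := intervalIntegral.integral_eq_sub_of_hasDerivAt (a := 0) (b := 1)
    (fun t _ => hF t) (hc.intervalIntegrable _ _)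
  have h2 : g 0 ^ 2 = ∫ t in (0 : ℝ)..1, -(-(g t ^ 2) + (1 - t) * (2 * g t * g' t)) := by
    rw [intervalIntegral.integral_neg, h1]; ring
  rw [h2]
  refine intervalIntegral.integral_mono_on zero_le_one (hc.neg.intervalIntegrable _ _)
    (by apply Continuous.intervalIntegrable; fun_prop) fun t ht => ?_
  have h3 : |g t * g' t| = |g t| * |g' t| := abs_mul _ _
  have h4 := neg_abs_le (g t * g' t)
  have h5 : 0 ≤ |g t * g' t| := abs_nonneg _
  nlinarith [ht.1, ht.2, mul_nonneg ht.1 h5]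

/-- A Hardy inequality in the radial variable, with the weight $r$ of polar coordinates on the
right. The proof adds a multiple of the derivative of $(r^{1-\beta}-r^2)g^2$, which vanishes at both
end points, and compares the integrands pointwise. -/
lemma integral_rpow_mul_sq_le {β : ℝ} (hβ0 : 0 ≤ β) (hβ : β < 1) {g g' : ℝ → ℝ}
    (hg : ∀ t, HasDerivAt g (g' t) t) (hg' : Continuous g') :
    ∫ r in (0 : ℝ)..1, (1 - β) ^ 2 / 4 * (r ^ (-β) * g r ^ 2) ≤
      ∫ r in (0 : ℝ)..1, r * (g r ^ 2 + g' r ^ 2) := by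
  have hgc : Continuous g := continuous_iff_continuousAt.2 fun t => (hg t).continuousAt
  set c := 1 - β with hc
  have hc0 : 0 < c := by linarith
  have hc1 : c ≤ 1 := by linarith
  set F' : ℝ → ℝ := fun r => (c * r ^ (-β) - 2 * r) * g r ^ 2 + (r ^ c - r ^ 2) * (2 * g r * g' r)
    with hF'
  have hF : ∀ r ∈ Ioo (0 : ℝ) 1, HasDerivAt (fun r => (r ^ c - r ^ 2) * g r ^ 2) (F' r) r := by
    intro r hr
    have h1 := (Real.hasDerivAt_rpow_const (p := c) (Or.inl hr.1.ne')).sub (hasDerivAt_pow 2 r)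
    refine (h1.mul ((hg r).pow 2)).congr_deriv ?_
    simp [hF', show c - 1 = -β by linarith]
  have hri : IntervalIntegrable (fun r : ℝ => r ^ (-β)) volume 0 1 :=
    intervalIntegral.intervalIntegrable_rpow' (by linarith)
  have hrc : Continuous fun r : ℝ => r ^ c := Real.continuous_rpow_const hc0.le
  have hF'i : IntervalIntegrable F' volume 0 1 := by
    refine ((((hri.const_mul c).sub
      ((continuous_const.mul continuous_id).intervalIntegrable _ _)).mul_continuousOn
      (hgc.pow 2).continuousOn).add ?_)
    apply Continuous.intervalIntegrable; fun_prop
  have h1 := intervalIntegral.integral_eq_sub_of_hasDerivAt_of_le zero_le_one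
    (by fun_prop : ContinuousOn (fun r => (r ^ c - r ^ 2) * g r ^ 2) (Icc 0 1)) hF hF'i
  have h2 : ∫ r in (0 : ℝ)..1, F' r = 0 := by
    rw [h1]; simp [Real.zero_rpow hc0.ne']
  have hki : IntervalIntegrable (fun r => r * (g r ^ 2 + g' r ^ 2)) volume 0 1 := by
    apply Continuous.intervalIntegrable; fun_prop
  -- With the multiple `c / 2`, completing the square in the mixed term uses up half of
  -- $\frac{c^2}{2}r^{-\beta}g^2$ and all of $r g'^2$; the other half is the left-hand side.
  have h3 : ∫ r in (0 : ℝ)..1, r * (g r ^ 2 + g' r ^ 2) =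
      ∫ r in (0 : ℝ)..1, (r * (g r ^ 2 + g' r ^ 2) + c / 2 * F' r) := by
    rw [intervalIntegral.integral_add hki (hF'i.const_mul _), intervalIntegral.integral_const_mul,
      h2, mul_zero, add_zero]
  rw [h3]
  refine intervalIntegral.integral_mono_on_of_le_Ioo zero_le_one
    ((hri.mul_continuousOn (hgc.pow 2).continuousOn).const_mul _) (hki.add (hF'i.const_mul _))
    fun r hr => ?_
  have hR : r ^ c = r * r ^ (-β) := by
    rw [hc, show (1 : ℝ) - β = 1 + -β by ring, Real.rpow_add hr.1, Real.rpow_one]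
  have hR0 : 0 < r ^ (-β) := Real.rpow_pos_of_pos hr.1 _
  have hR1 : r * r ^ (-β) ≤ 1 := by rw [← hR]; exact Real.rpow_le_one hr.1.le hr.2.le hc0.le
  have hR2 : 1 ≤ r ^ (-β) := Real.one_le_rpow_of_pos_of_le_one_of_nonpos hr.1 hr.2.le (by linarith)
  simp only [hF', hR]
  set R := r ^ (-β)
  have e1 : 0 ≤ R - r := by linarith [hr.2]
  set x := g r
  set y := g' r
  have k1 : -(c * (r * (R - r)) * (x * y)) ≤ c ^ 2 / 4 * (r * R ^ 2 * x ^ 2) + r * y ^ 2 := by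
    have : 0 ≤ r * (c / 2 * (R - r) * x + y) ^ 2 := mul_nonneg hr.1.le (sq_nonneg _)
    have h5 : (R - r) ^ 2 ≤ R ^ 2 := by
      apply pow_le_pow_left₀ e1; linarith [hr.1]
    have h6 : c ^ 2 / 4 * (r * (R - r) ^ 2 * x ^ 2) ≤ c ^ 2 / 4 * (r * R ^ 2 * x ^ 2) := by
      have := hr.1.le
      gcongr
    nlinarith
  have k2 : c ^ 2 / 4 * (r * R ^ 2 * x ^ 2) ≤ c ^ 2 / 4 * (R * x ^ 2) := by
    have : r * R ^ 2 * x ^ 2 ≤ R * x ^ 2 := by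
      have := mul_le_mul_of_nonneg_right hR1 (mul_nonneg hR0.le (sq_nonneg x))
      nlinarith
    gcongr
  have k3 : c * (r * x ^ 2) ≤ r * x ^ 2 := by
    have := mul_nonneg hr.1.le (sq_nonneg x)
    nlinarith
  nlinarith

/-- The weighted trace inequality on the unit square in polar-like coordinates. -/
lemma lintegral_rpow_mul_le {β : ℝ} (hβ0 : 0 ≤ β) (hβ : β < 1) (P a b : Plane)
    {f : Plane → ℝ} (hf : ContDiff ℝ ∞ f) :
    ∫⁻ r in Ioo (0 : ℝ) 1, ENNReal.ofReal (r ^ (-β)) * ‖f (P + r • a)‖ₑ ^ 2 ≤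
      ENNReal.ofReal (9 / (1 - β) ^ 2 * (1 + (‖a‖ + ‖b‖) ^ 2)) * ∫⁻ q in unitSquare,
        ENNReal.ofReal q.1 * (‖f (tri P a b q)‖ₑ ^ 2 + ‖gradient f (tri P a b q)‖ₑ ^ 2) := by
  set D := ‖a‖ + ‖b‖ with hD
  have hD0 : 0 ≤ D := by positivity
  set c := 1 - β with hc
  have hc0 : 0 < c := by linarith
  have hc1 : c ≤ 1 := by linarith
  set g : ℝ × ℝ → ℝ := fun q => f (tri P a b q) with hg
  set G : ℝ × ℝ → Plane := fun q => gradient f (tri P a b q) with hG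
  have hgc : Continuous g := hf.continuous.comp (continuous_tri P a b)
  have hGc : Continuous G := (contDiff_gradient hf).continuous.comp (continuous_tri P a b)
  have hfd : ∀ x v, fderiv ℝ f x v = inner ℝ (gradient f x) v := by
    intro x v
    rw [gradient, InnerProductSpace.toDual_symm_apply]
  have hd1 : ∀ r t, HasDerivAt (fun r => g (r, t)) (inner ℝ (G (r, t)) (a + t • (b - a))) r := by
    intro r t
    have h1 : HasDerivAt (fun r : ℝ => tri P a b (r, t)) (a + t • (b - a)) r := by
      have := ((hasDerivAt_id r).smul_const (a + t • (b - a))).const_add P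
      rwa [one_smul] at this
    have := ((hf.differentiable (by simp)) (tri P a b (r, t))).hasFDerivAt.comp_hasDerivAt r h1
    rwa [hfd] at this
  have hd2 : ∀ r t, HasDerivAt (fun t => g (r, t)) (inner ℝ (G (r, t)) (r • (b - a))) t := by
    intro r t
    have h1 : HasDerivAt (fun t : ℝ => tri P a b (r, t)) (r • (b - a)) t := by
      have := ((((hasDerivAt_id t).smul_const (b - a)).const_add a).const_smul r).const_add P
      rwa [one_smul] at this
    have := ((hf.differentiable (by simp)) (tri P a b (r, t))).hasFDerivAt.comp_hasDerivAt t h1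
    rwa [hfd] at this
  have hv1 : ∀ t ∈ Ioo (0 : ℝ) 1, ‖a + t • (b - a)‖ ≤ D := by
    intro t ht
    have : a + t • (b - a) = (1 - t) • a + t • b := by module
    rw [this]
    refine (norm_add_le _ _).trans ?_
    rw [norm_smul, norm_smul, Real.norm_of_nonneg (by linarith [ht.2]), Real.norm_of_nonneg ht.1.le]
    nlinarith [norm_nonneg a, norm_nonneg b, ht.1, ht.2]
  have hv2 : ‖b - a‖ ≤ D := (norm_sub_le _ _).trans (by rw [hD, add_comm])
  -- the estimate along the cross sections
  have hB : ∀ r ∈ Ioo (0 : ℝ) 1, ENNReal.ofReal (r ^ (-β)) * ‖f (P + r • a)‖ₑ ^ 2 ≤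
      ∫⁻ t in Ioo (0 : ℝ) 1, ENNReal.ofReal (2 * (r ^ (-β) * g (r, t) ^ 2) +
        r * (D ^ 2 * ‖G (r, t)‖ ^ 2)) := by
    intro r hr
    have hR0 : 0 < r ^ (-β) := Real.rpow_pos_of_pos hr.1 _
    have hR1 : r * r ^ (-β) ≤ 1 := by
      have : r ^ c = r * r ^ (-β) := by
        rw [hc, show (1 : ℝ) - β = 1 + -β by ring, Real.rpow_add hr.1, Real.rpow_one]
      rw [← this]; exact Real.rpow_le_one hr.1.le hr.2.le hc0.le
    have h0 : f (P + r • a) = g (r, 0) := by simp [hg, tri]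
    have hcr : ∀ {E : Type} [TopologicalSpace E] {k : ℝ × ℝ → E}, Continuous k →
        Continuous fun t => k (r, t) := fun hk => hk.comp (by fun_prop)
    have hgr := hcr hgc
    have hGr := hcr hGc
    rw [h0, ← enorm_pow, Real.enorm_of_nonneg (sq_nonneg _), ← ENNReal.ofReal_mul hR0.le,
      ← ofReal_intervalIntegral]
    rotate_left
    · apply Continuous.intervalIntegrable; fun_prop
    · intro t _
      have := hr.1.le
      positivity
    refine ENNReal.ofReal_le_ofReal ?_
    have h1 := sq_le_integral (hd2 r) (hGr.inner continuous_const)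
    refine (mul_le_mul_of_nonneg_left h1 hR0.le).trans ?_
    rw [← intervalIntegral.integral_const_mul]
    refine intervalIntegral.integral_mono_on zero_le_one
      (by apply Continuous.intervalIntegrable; fun_prop)
      (by apply Continuous.intervalIntegrable; fun_prop) fun t ht => ?_
    set R := r ^ (-β)
    have h2 : |inner ℝ (G (r, t)) (r • (b - a))| ≤ r * (D * ‖G (r, t)‖) := by
      refine (abs_real_inner_le_norm _ _).trans ?_
      rw [norm_smul, Real.norm_of_nonneg hr.1.le]
      have := mul_le_mul_of_nonneg_left hv2 (mul_nonneg hr.1.le (norm_nonneg (G (r, t))))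
      linarith
    set y := D * ‖G (r, t)‖
    set x := |g (r, t)| with hx
    have hx0 : 0 ≤ x := abs_nonneg _
    have hx2 : g (r, t) ^ 2 = x ^ 2 := (sq_abs _).symm
    rw [hx2, ← mul_pow]
    change R * (x ^ 2 + 2 * x * _) ≤ 2 * (R * x ^ 2) + r * y ^ 2
    have h3 : R * (2 * x * |inner ℝ (G (r, t)) (r • (b - a))|) ≤ R * (2 * x * (r * y)) := by
      gcongr
    have h4 : 0 ≤ r * (R * x - y) ^ 2 := mul_nonneg hr.1.le (sq_nonneg _)
    have h5 : r * R ^ 2 * x ^ 2 ≤ R * x ^ 2 := by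
      have := mul_le_mul_of_nonneg_right hR1 (mul_nonneg hR0.le (sq_nonneg x))
      nlinarith
    nlinarith
  -- Along each ray from the tip, the Hardy inequality trades the singular weight for the Jacobian
  -- weight.
  have hA : ∀ t ∈ Ioo (0 : ℝ) 1, ∫⁻ r in Ioo (0 : ℝ) 1, ENNReal.ofReal (r ^ (-β) * g (r, t) ^ 2) ≤
      ENNReal.ofReal (4 / c ^ 2) *
        ∫⁻ r in Ioo (0 : ℝ) 1, ENNReal.ofReal (r * (g (r, t) ^ 2 + D ^ 2 * ‖G (r, t)‖ ^ 2)) := by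
    intro t ht
    have hgt : Continuous fun r => g (r, t) := hgc.comp (by fun_prop)
    have hGt : Continuous fun r => G (r, t) := hGc.comp (by fun_prop)
    have hri : IntervalIntegrable (fun r : ℝ => r ^ (-β) * g (r, t) ^ 2) volume 0 1 :=
      (intervalIntegral.intervalIntegrable_rpow' (by linarith)).mul_continuousOn
        (hgt.pow 2).continuousOn
    rw [← ofReal_intervalIntegral hri, ← ofReal_intervalIntegral,
      ← ENNReal.ofReal_mul (by positivity)]
    rotate_left
    · apply Continuous.intervalIntegrable; fun_prop
    · intro r hr
      have := hr.1.le
      positivity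
    · intro r hr
      have := Real.rpow_nonneg hr.1.le (-β)
      positivity
    refine ENNReal.ofReal_le_ofReal ?_
    have h1 := integral_rpow_mul_sq_le hβ0 hβ (fun r => hd1 r t) (hGt.inner continuous_const)
    rw [intervalIntegral.integral_const_mul] at h1
    have h2 : ∫ r in (0 : ℝ)..1, r * (g (r, t) ^ 2 + inner ℝ (G (r, t)) (a + t • (b - a)) ^ 2) ≤
        ∫ r in (0 : ℝ)..1, r * (g (r, t) ^ 2 + D ^ 2 * ‖G (r, t)‖ ^ 2) := by
      refine intervalIntegral.integral_mono_on zero_le_one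
        (by apply Continuous.intervalIntegrable; fun_prop)
        (by apply Continuous.intervalIntegrable; fun_prop) fun r hr => ?_
      have h3 : |inner ℝ (G (r, t)) (a + t • (b - a))| ≤ D * ‖G (r, t)‖ := by
        refine (abs_real_inner_le_norm _ _).trans ?_
        rw [mul_comm]
        exact mul_le_mul_of_nonneg_right (hv1 t ht) (norm_nonneg _)
      have h4 := pow_le_pow_left₀ (abs_nonneg _) h3 2
      rw [sq_abs, mul_pow] at h4
      have := hr.1
      gcongr
    have h5 := h1.trans h2
    rw [← hc] at h5
    calc _ = 4 / c ^ 2 * (c ^ 2 / 4 * ∫ r in (0 : ℝ)..1, r ^ (-β) * g (r, t) ^ 2) := by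
          field_simp
      _ ≤ _ := by gcongr
  have hmeas : Measurable fun q : ℝ × ℝ => ENNReal.ofReal (q.1 ^ (-β) * g q ^ 2) := by
    have := hgc.measurable
    fun_prop
  have hmeas2 : Measurable fun q : ℝ × ℝ => ENNReal.ofReal (q.1 * (D ^ 2 * ‖G q‖ ^ 2)) := by
    have := hGc.measurable
    fun_prop
  have hmeas3 : Measurable fun q : ℝ × ℝ =>
      ENNReal.ofReal (q.1 * (g q ^ 2 + D ^ 2 * ‖G q‖ ^ 2)) := by
    have := hgc.measurable
    have := hGc.measurable
    fun_prop
  have hsq : ∀ k : ℝ × ℝ → ℝ≥0∞, Measurable k → ∫⁻ q in unitSquare, k q =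
      ∫⁻ r in Ioo (0 : ℝ) 1, ∫⁻ t in Ioo (0 : ℝ) 1, k (r, t) := by
    intro k hk
    rw [unitSquare, Measure.volume_eq_prod, ← Measure.prod_restrict, lintegral_prod _ hk.aemeasurable]
  set I := ∫⁻ q in unitSquare, ENNReal.ofReal (q.1 * (g q ^ 2 + D ^ 2 * ‖G q‖ ^ 2)) with hI
  have s1 : ∫⁻ q in unitSquare, ENNReal.ofReal (q.1 ^ (-β) * g q ^ 2) ≤
      ENNReal.ofReal (4 / c ^ 2) * I := by
    rw [hsq _ hmeas, lintegral_lintegral_swap hmeas.aemeasurable]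
    refine (setLIntegral_mono' measurableSet_Ioo hA).trans ?_
    rw [lintegral_const_mul' _ _ ENNReal.ofReal_ne_top, hI, hsq _ hmeas3,
      lintegral_lintegral_swap (f := fun x y => ENNReal.ofReal (x * (g (x, y) ^ 2 + D ^ 2 * ‖G (x, y)‖ ^ 2))) hmeas3.aemeasurable]
  have s2 : ∫⁻ q in unitSquare, ENNReal.ofReal (q.1 * (D ^ 2 * ‖G q‖ ^ 2)) ≤ I := by
    refine setLIntegral_mono' measurableSet_unitSquare fun q hq => ENNReal.ofReal_le_ofReal ?_
    have := hq.1.1.le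
    gcongr
    nlinarith [sq_nonneg (g q)]
  have s3 : I ≤ ENNReal.ofReal (1 + D ^ 2) * ∫⁻ q in unitSquare,
      ENNReal.ofReal q.1 * (‖f (tri P a b q)‖ₑ ^ 2 + ‖gradient f (tri P a b q)‖ₑ ^ 2) := by
    rw [← lintegral_const_mul' _ _ ENNReal.ofReal_ne_top]
    refine setLIntegral_mono' measurableSet_unitSquare fun q hq => ?_
    have h1 : ‖f (tri P a b q)‖ₑ ^ 2 + ‖gradient f (tri P a b q)‖ₑ ^ 2 =
        ENNReal.ofReal (g q ^ 2 + ‖G q‖ ^ 2) := by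
      rw [ENNReal.ofReal_add (sq_nonneg _) (sq_nonneg _), ← enorm_pow, Real.enorm_of_nonneg
        (sq_nonneg _), ENNReal.ofReal_pow (norm_nonneg _), ofReal_norm]
    rw [h1, ← ENNReal.ofReal_mul hq.1.1.le, ← ENNReal.ofReal_mul (by positivity)]
    refine ENNReal.ofReal_le_ofReal ?_
    have := hq.1.1.le
    rw [mul_left_comm]
    gcongr
    nlinarith [sq_nonneg (g q), sq_nonneg (‖G q‖), mul_nonneg (sq_nonneg D) (sq_nonneg (g q))]
  calc _ ≤ ∫⁻ r in Ioo (0 : ℝ) 1, ∫⁻ t in Ioo (0 : ℝ) 1,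
        ENNReal.ofReal (2 * (r ^ (-β) * g (r, t) ^ 2) + r * (D ^ 2 * ‖G (r, t)‖ ^ 2)) :=
        setLIntegral_mono' measurableSet_Ioo hB
    _ = ∫⁻ q in unitSquare, ENNReal.ofReal (2 * (q.1 ^ (-β) * g q ^ 2) +
        q.1 * (D ^ 2 * ‖G q‖ ^ 2)) := by
        rw [hsq]
        have := hgc.measurable
        have := hGc.measurable
        fun_prop
    _ = ∫⁻ q in unitSquare, (2 * ENNReal.ofReal (q.1 ^ (-β) * g q ^ 2) +
        ENNReal.ofReal (q.1 * (D ^ 2 * ‖G q‖ ^ 2))) := by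
        refine setLIntegral_congr_fun measurableSet_unitSquare fun q hq => ?_
        have h1 := Real.rpow_nonneg hq.1.1.le (-β)
        have h2 := hq.1.1.le
        rw [ENNReal.ofReal_add (by positivity) (by positivity), ENNReal.ofReal_mul two_pos.le,
          ENNReal.ofReal_ofNat]
    _ ≤ 2 * (ENNReal.ofReal (4 / c ^ 2) * I) + I := by
        rw [lintegral_add_left (hmeas.const_mul 2), lintegral_const_mul _ hmeas]
        gcongr
    _ = ENNReal.ofReal (8 / c ^ 2 + 1) * I := by
        rw [ENNReal.ofReal_add (by positivity) zero_le_one, ENNReal.ofReal_one, add_mul, one_mul,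
          ← mul_assoc, ← ENNReal.ofReal_ofNat 2, ← ENNReal.ofReal_mul two_pos.le,
          show 2 * (4 / c ^ 2) = 8 / c ^ 2 by ring]
    -- Uses $c\le1$ to absorb the summand 1.
    _ ≤ ENNReal.ofReal (9 / c ^ 2) * I := by
        gcongr
        rw [← sub_nonneg]
        have : 9 / c ^ 2 - (8 / c ^ 2 + 1) = (1 - c ^ 2) / c ^ 2 := by field_simp; ring
        rw [this]
        refine div_nonneg ?_ (sq_nonneg _)
        nlinarith
    _ ≤ _ := by
        rw [ENNReal.ofReal_mul (by positivity), mul_assoc]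
        gcongr

end

/-! ### Trace inequalities on the sides of a polygon -/

section

lemma h1NormSq_of_contDiff {D : Set Plane} (hD : IsOpen D) (hb : Bornology.IsBounded D)
    {f : Plane → ℝ} (hf : ContDiff ℝ ∞ f) :
    h1NormSq D f = (∫⁻ x in D, ‖f x‖ₑ ^ 2) + ∫⁻ x in D, ‖gradient f x‖ₑ ^ 2 := by
  rw [(isH1_of_contDiff hD hb hf).h1NormSq hD, eLpNorm_two_sq, eLpNorm_two_sq]

namespace PolygonalCell

variable {K : PolygonalCell} {z : Plane} {ρ : ℝ}

/-- Take the singular point `P` of the side as the tip of a triangle, with one edge along the side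
and the other one leading to the center. This triangle lies in the polygon, so the inequality on the
unit square applies with the weight singular at the tip. -/
lemma weighted_trace_half (h : IsStarDomain K.body z ρ) (i : Fin (K.m + 3)) {t₀ t₁ : ℝ}
    (ht₀ : t₀ ∈ Icc (0 : ℝ) 1) (ht₁ : t₁ ∈ Icc (0 : ℝ) 1) {β : ℝ} (hβ0 : 0 ≤ β) (hβ : β < 1) :
    ∃ C : ℝ≥0∞, C ≠ ⊤ ∧ ∀ f : Plane → ℝ, ContDiff ℝ ∞ f →
      ∫⁻ t in (fun r => t₀ + r * (t₁ - t₀)) '' Ioo (0 : ℝ) 1,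
        ENNReal.ofReal (|t - t₀| ^ (-β)) * ‖f (z + K.relSide z i t)‖ₑ ^ 2 ≤
      C * h1NormSq K.body f := by
  rcases eq_or_ne t₁ t₀ with rfl | hne
  · refine ⟨0, by simp, fun f _ => ?_⟩
    rw [setLIntegral_measure_zero]
    · exact bot_le
    · refine measure_mono_null (t := {t₁}) ?_ (by simp)
      rintro _ ⟨r, _, rfl⟩
      simp
  have hl : t₁ - t₀ ≠ 0 := sub_ne_zero.2 hne
  set l := t₁ - t₀ with hl'
  set d := K.rel z (i + 1) - K.rel z i with hd
  set P := z + K.relSide z i t₀ with hP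
  have hcr : cross (l • d) (z - P) = l * cross (K.rel z i) (K.rel z (i + 1)) := by
    rw [hP, relSide, cross_smul_left, hd]
    simp only [cross, PiLp.add_apply, PiLp.sub_apply, PiLp.smul_apply, smul_eq_mul]
    ring
  have hcr0 : cross (l • d) (z - P) ≠ 0 := by
    rw [hcr]; exact mul_ne_zero hl (cross_ne_zero h i)
  -- A point of this triangle is a boundary point contracted towards `z` by the factor `1 - r * t`,
  -- which is less than one.
  have himg : tri P (l • d) (z - P) '' unitSquare ⊆ K.body := by
    rintro _ ⟨⟨r, t⟩, ⟨⟨hr0, hr1⟩, ht0, ht1⟩, rfl⟩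
    simp only at hr0 hr1 ht0 ht1
    have hrt : 0 < 1 - r * t := by nlinarith
    set w := r * (1 - t) / (1 - r * t) with hw
    have hw0 : 0 ≤ w := div_nonneg (by nlinarith) hrt.le
    have hw1 : w ≤ 1 := by rw [hw, div_le_one hrt]; nlinarith
    have e : tri P (l • d) (z - P) (r, t) = z + (1 - r * t) • K.relSide z i (t₀ + w * l) := by
      have e1 : (1 - r * t) * w = r * (1 - t) := by rw [hw]; field_simp
      have e2 : (1 - r * t) • K.relSide z i (t₀ + w * l) =
          (1 - r * t) • (K.rel z i + t₀ • d) + (((1 - r * t) * w) * l) • d := by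
        rw [relSide, ← hd]; module
      rw [e2, e1, tri, hP, relSide, ← hd]
      module
    rw [e]
    refine add_smul_relSide_mem h i hrt.le (by nlinarith) ⟨?_, ?_⟩
    · nlinarith [ht₀.1, ht₁.1]
    · nlinarith [ht₀.2, ht₁.2]
  refine ⟨ENNReal.ofReal (|l| * |l| ^ (-β)) *
    (ENNReal.ofReal (9 / (1 - β) ^ 2 * (1 + (‖l • d‖ + ‖z - P‖) ^ 2)) *
      ENNReal.ofReal (|cross (l • d) (z - P)|⁻¹)),
    by finiteness, fun f hf => ?_⟩
  rw [lintegral_image_eq_lintegral_abs_deriv_mul measurableSet_Ioo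
    (f' := fun _ => l) (fun r _ => by
      have := ((hasDerivAt_id r).mul_const l).const_add t₀
      rw [one_mul] at this
      exact this.hasDerivWithinAt)
    (fun r _ r' _ e => by
      have e' : t₀ + r * l = t₀ + r' * l := e
      exact mul_right_cancel₀ hl (add_left_cancel e'))]
  have hint : ∀ r ∈ Ioo (0 : ℝ) 1, ENNReal.ofReal |l| * (ENNReal.ofReal (|t₀ + r * l - t₀| ^ (-β)) *
      ‖f (z + K.relSide z i (t₀ + r * l))‖ₑ ^ 2) =
      ENNReal.ofReal (|l| * |l| ^ (-β)) *
        (ENNReal.ofReal (r ^ (-β)) * ‖f (P + r • (l • d))‖ₑ ^ 2) := by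
    intro r hr
    have e1 : z + K.relSide z i (t₀ + r * l) = P + r • (l • d) := by
      rw [hP, relSide, relSide, ← hd]; module
    rw [e1, add_sub_cancel_left, abs_mul, abs_of_pos hr.1, Real.mul_rpow hr.1.le (abs_nonneg _),
      ENNReal.ofReal_mul (Real.rpow_nonneg hr.1.le _), ENNReal.ofReal_mul (abs_nonneg _)]
    ring
  rw [setLIntegral_congr_fun measurableSet_Ioo hint,
    lintegral_const_mul' _ _ ENNReal.ofReal_ne_top, mul_assoc]
  gcongr
  refine (lintegral_rpow_mul_le hβ0 hβ P (l • d) (z - P) hf).trans ?_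
  rw [mul_assoc]
  gcongr
  rw [h1NormSq_of_contDiff K.isOpen_body K.isBounded_body hf, ← lintegral_add_left
    (hf.continuous.measurable.enorm.pow_const 2)]
  have hc0 : 0 < |cross (l • d) (z - P)| := abs_pos.2 hcr0
  calc _ = ENNReal.ofReal (|cross (l • d) (z - P)|⁻¹) * ∫⁻ q in unitSquare,
        ENNReal.ofReal (q.1 * |cross (l • d) (z - P)|) * (‖f (tri P (l • d) (z - P) q)‖ₑ ^ 2 +
          ‖gradient f (tri P (l • d) (z - P) q)‖ₑ ^ 2) := by
        rw [← lintegral_const_mul' _ _ ENNReal.ofReal_ne_top]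
        refine setLIntegral_congr_fun measurableSet_unitSquare fun q hq => ?_
        rw [← mul_assoc, ← ENNReal.ofReal_mul (by positivity)]
        congr 2
        field_simp
    _ ≤ _ := by
        rw [← lintegral_image_tri P hcr0 (fun x => ‖f x‖ₑ ^ 2 + ‖gradient f x‖ₑ ^ 2)]
        gcongr

/-- The point `t₀` splits the side into two parts, one of which may be degenerate. -/
lemma weighted_trace_param (h : IsStarDomain K.body z ρ) (i : Fin (K.m + 3)) {t₀ : ℝ}
    (ht₀ : t₀ ∈ Icc (0 : ℝ) 1) {β : ℝ} (hβ0 : 0 ≤ β) (hβ : β < 1) :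
    ∃ C : ℝ≥0∞, C ≠ ⊤ ∧ ∀ f : Plane → ℝ, ContDiff ℝ ∞ f →
      ∫⁻ t in Icc (0 : ℝ) 1,
        ENNReal.ofReal (|t - t₀| ^ (-β)) * ‖f (z + K.relSide z i t)‖ₑ ^ 2 ≤
      C * h1NormSq K.body f := by
  obtain ⟨C0, hC0, H0⟩ := weighted_trace_half h i ht₀ (t₁ := 0) (by simp) hβ0 hβ
  obtain ⟨C1, hC1, H1⟩ := weighted_trace_half h i ht₀ (t₁ := 1) (by simp) hβ0 hβ
  refine ⟨C0 + C1, by finiteness, fun f hf => ?_⟩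
  rw [← setLIntegral_congr Ioo_ae_eq_Icc]
  have hsub : Ioo (0 : ℝ) 1 ⊆ ((fun r => t₀ + r * (0 - t₀)) '' Ioo (0 : ℝ) 1 ∪
      (fun r => t₀ + r * (1 - t₀)) '' Ioo (0 : ℝ) 1) ∪ {t₀} := by
    intro t ht
    rcases lt_trichotomy t t₀ with h1 | h1 | h1
    · refine Or.inl (Or.inl ⟨(t₀ - t) / t₀, ⟨?_, ?_⟩, ?_⟩)
      · exact div_pos (by linarith) (by linarith [ht.1])
      · rw [div_lt_one (by linarith [ht.1])]; linarith [ht.1]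
      · have : t₀ ≠ 0 := by linarith [ht.1]
        field_simp; ring
    · exact Or.inr h1
    · refine Or.inl (Or.inr ⟨(t - t₀) / (1 - t₀), ⟨?_, ?_⟩, ?_⟩)
      · exact div_pos (by linarith) (by linarith [ht.2])
      · rw [div_lt_one (by linarith [ht.2])]; linarith [ht.2]
      · have : 1 - t₀ ≠ 0 := by linarith [ht.2]
        field_simp; ring
  refine (lintegral_mono_set hsub).trans ((lintegral_union_le _ _ _).trans ?_)
  rw [setLIntegral_measure_zero {t₀} _ (by simp), add_zero, add_mul]
  exact (lintegral_union_le _ _ _).trans (add_le_add (H0 f hf) (H1 f hf))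

end PolygonalCell

lemma lintegral_arcLength (a b : Plane) {g : Plane → ℝ≥0∞} (hg : Measurable g) :
    ∫⁻ x, g x ∂(arcLength a b) =
      ENNReal.ofReal (dist a b) * ∫⁻ t in Icc (0 : ℝ) 1, g (AffineMap.lineMap a b t) := by
  have hm : Measurable fun t : ℝ => (AffineMap.lineMap a b t : Plane) :=
    (AffineMap.lineMap_continuous (R := ℝ)).measurable
  rw [arcLength, lintegral_smul_measure, lintegral_map hg hm, smul_eq_mul]

/-- Smooth functions are bounded in `L²(μ)` by their norm in `H¹(D)`. -/
def TraceBound (D : Set Plane) (μ : Measure Plane) : Prop :=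
  ∃ C : ℝ≥0∞, C ≠ ⊤ ∧ ∀ f : Plane → ℝ, ContDiff ℝ ∞ f → ∫⁻ x, ‖f x‖ₑ ^ 2 ∂μ ≤ C * h1NormSq D f

/-- Integration against `m` with respect to `μ` is bounded by the norm of `H¹(D)`. -/
def TraceMultiplier (D : Set Plane) (μ : Measure Plane) (m : Plane → ℝ) : Prop :=
  AEStronglyMeasurable m μ ∧ ∃ C : ℝ≥0∞, C ≠ ⊤ ∧ ∀ f : Plane → ℝ, ContDiff ℝ ∞ f →
    (∫⁻ x, ‖f x‖ₑ * ‖m x‖ₑ ∂μ) ^ 2 ≤ C * h1NormSq D f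

lemma lintegral_mul_sq_le {α : Type*} [MeasurableSpace α] {μ : Measure α} {f g : α → ℝ≥0∞}
    (hf : AEMeasurable f μ) (hg : AEMeasurable g μ) :
    (∫⁻ x, f x * g x ∂μ) ^ 2 ≤ (∫⁻ x, f x ^ 2 ∂μ) * ∫⁻ x, g x ^ 2 ∂μ := by
  have h := ENNReal.lintegral_mul_le_Lp_mul_Lq μ Real.HolderConjugate.two_two hf hg
  refine (pow_le_pow_left₀ bot_le h 2).trans ?_
  rw [mul_pow]
  simp only [← ENNReal.rpow_natCast, ← ENNReal.rpow_mul]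
  norm_num

namespace PolygonalCell

variable {K : PolygonalCell} {z : Plane} {ρ : ℝ}

/-- Arc length on the `i`-th side. -/
def sideArc (K : PolygonalCell) (i : Fin (K.m + 3)) : Measure Plane :=
  arcLength (K.vert i) (K.vert (i + 1))

instance (a b : Plane) : IsFiniteMeasure (arcLength a b) := by
  refine ⟨?_⟩
  have := lintegral_arcLength a b (g := fun _ => 1) measurable_const
  rw [lintegral_one] at this
  rw [this]
  simp only [lintegral_const, Measure.restrict_apply, MeasurableSet.univ, univ_inter, one_mul,
    Real.volume_Icc]
  finiteness

instance (i : Fin (K.m + 3)) : IsFiniteMeasure (K.sideArc i) := by unfold sideArc; infer_instance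

/-- The trace inequality on a side, with a weight that may be singular at a point. -/
theorem weighted_trace (h : IsStarDomain K.body z ρ) (i : Fin (K.m + 3)) (A : Plane) {β : ℝ}
    (hβ0 : 0 ≤ β) (hβ : β < 1) :
    ∃ C : ℝ≥0∞, C ≠ ⊤ ∧ ∀ f : Plane → ℝ, ContDiff ℝ ∞ f →
      ∫⁻ x, ENNReal.ofReal (dist x A ^ (-β)) * ‖f x‖ₑ ^ 2 ∂(K.sideArc i) ≤
      C * h1NormSq K.body f := by
  set y : ℝ → Plane := fun t => AffineMap.lineMap (K.vert i) (K.vert (i + 1)) t with hy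
  have hyc : Continuous y := AffineMap.lineMap_continuous
  -- The point `A` may be anywhere in the plane; the weight is compared with the one centered at the
  -- point of the side that is closest to `A`.
  obtain ⟨t₀, ht₀, hmin⟩ := isCompact_Icc.exists_isMinOn (nonempty_Icc.2 zero_le_one)
    ((hyc.dist continuous_const).continuousOn (s := Icc (0 : ℝ) 1) : ContinuousOn (fun t => dist (y t) A) _)
  obtain ⟨C, hC, H⟩ := weighted_trace_param h i ht₀ hβ0 hβ
  set L := dist (K.vert i) (K.vert (i + 1)) with hL
  have hL0 : 0 < L := dist_pos.2 fun e => succ_ne i (K.vert_injective e).symm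
  refine ⟨ENNReal.ofReal L * ENNReal.ofReal ((L / 2) ^ (-β)) * C, by finiteness, fun f hf => ?_⟩
  have hm : Measurable fun x => ENNReal.ofReal (dist x A ^ (-β)) * ‖f x‖ₑ ^ 2 := by
    have := hf.continuous.measurable
    fun_prop
  rw [sideArc, lintegral_arcLength _ _ hm, mul_assoc, mul_assoc]
  gcongr
  refine le_trans ?_ (mul_le_mul_right (H f hf) _)
  rw [← lintegral_const_mul' _ _ ENNReal.ofReal_ne_top]
  refine setLIntegral_mono_ae' measurableSet_Icc ?_
  filter_upwards [compl_mem_ae_iff.2 (measure_singleton t₀)] with t ht hti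
  rw [add_relSide, ← mul_assoc, ← ENNReal.ofReal_mul (by positivity)]
  gcongr
  have hne : 0 < |t - t₀| := abs_pos.2 (sub_ne_zero.2 ht)
  rw [← Real.mul_rpow (by positivity) hne.le]
  refine Real.rpow_le_rpow_of_nonpos (by positivity) ?_ (by linarith)
  -- By minimality and the triangle inequality, twice the distance from `A` is at least the distance
  -- from the closest point.
  have h1 : dist (y t₀) A ≤ dist (y t) A := hmin hti
  have h2 : dist (y t) (y t₀) = |t - t₀| * L := by
    rw [hy, dist_lineMap_lineMap, Real.dist_eq]
  have h3 := dist_triangle_right (y t) (y t₀) A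
  change L / 2 * |t - t₀| ≤ dist (y t) A
  linarith

lemma traceBound_side (h : IsStarDomain K.body z ρ) (i : Fin (K.m + 3)) :
    TraceBound K.body (K.sideArc i) := by
  obtain ⟨C, hC, H⟩ := weighted_trace h i z le_rfl zero_lt_one
  exact ⟨C, hC, fun f hf => by simpa using H f hf⟩

/-- The weighted trace inequality for the constant function 1. -/
lemma lintegral_dist_rpow_lt_top (h : IsStarDomain K.body z ρ) (i : Fin (K.m + 3)) (A : Plane)
    {β : ℝ} (hβ0 : 0 ≤ β) (hβ : β < 1) :
    ∫⁻ x, ENNReal.ofReal (dist x A ^ (-β)) ∂(K.sideArc i) < ⊤ := by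
  obtain ⟨C, hC, H⟩ := weighted_trace h i A hβ0 hβ
  have h1 := H (fun _ => 1) contDiff_const
  simp only [enorm_one, one_pow, mul_one] at h1
  refine h1.trans_lt (ENNReal.mul_lt_top hC.lt_top ?_)
  rw [(isH1_of_contDiff K.isOpen_body K.isBounded_body contDiff_const).h1NormSq K.isOpen_body]
  have := isH1_of_contDiff K.isOpen_body K.isBounded_body (f := fun _ => (1 : ℝ)) contDiff_const
  exact ENNReal.add_lt_top.2 ⟨ENNReal.pow_lt_top this.1.2, ENNReal.pow_lt_top this.2.1.2⟩

/-- Split the weight $r^{-\beta}$ into two factors $r^{-\beta/2}$ and use Cauchy–Schwarz. For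
$\beta\ge1/2$ the function `m` may fail to be in $L^2$ of the side, so the $L^2$ bound of the trace
alone would not suffice. -/
lemma traceMultiplier_of_le (h : IsStarDomain K.body z ρ) (i : Fin (K.m + 3)) (A : Plane) {β : ℝ}
    (hβ0 : 0 ≤ β) (hβ : β < 1) {m : Plane → ℝ} (hm : AEStronglyMeasurable m (K.sideArc i)) {c : ℝ}
    (hc : ∀ᵐ x ∂(K.sideArc i), |m x| ≤ c * dist x A ^ (-β)) :
    TraceMultiplier K.body (K.sideArc i) m := by
  obtain ⟨C, hC, H⟩ := weighted_trace h i A hβ0 hβ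
  have hI := lintegral_dist_rpow_lt_top h i A hβ0 hβ
  set I := ∫⁻ x, ENNReal.ofReal (dist x A ^ (-β)) ∂(K.sideArc i)
  refine ⟨hm, ENNReal.ofReal c ^ 2 * (I * C), by finiteness, fun f hf => ?_⟩
  set w : Plane → ℝ≥0∞ := fun x => ENNReal.ofReal (dist x A ^ (-β / 2)) with hw
  have hw2 : ∀ x, w x ^ 2 = ENNReal.ofReal (dist x A ^ (-β)) := by
    intro x
    rw [hw, ← ENNReal.ofReal_pow (by positivity), ← Real.rpow_mul_natCast dist_nonneg]
    norm_num
  have hwm : Measurable w := by rw [hw]; fun_prop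
  have hfm := hf.continuous.measurable
  have h1 : ∫⁻ x, ‖f x‖ₑ * ‖m x‖ₑ ∂(K.sideArc i) ≤
      ENNReal.ofReal c * ∫⁻ x, (w x * ‖f x‖ₑ) * w x ∂(K.sideArc i) := by
    rw [← lintegral_const_mul' _ _ ENNReal.ofReal_ne_top]
    refine lintegral_mono_ae ?_
    filter_upwards [hc] with x hx
    have h2 : ‖m x‖ₑ ≤ ENNReal.ofReal c * w x ^ 2 := by
      rw [hw2, ← ENNReal.ofReal_mul' (by positivity), Real.enorm_eq_ofReal_abs]
      exact ENNReal.ofReal_le_ofReal hx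
    calc _ ≤ ‖f x‖ₑ * (ENNReal.ofReal c * w x ^ 2) := by gcongr
      _ = _ := by ring
  have h3 := lintegral_mul_sq_le (μ := K.sideArc i) (f := fun x => w x * ‖f x‖ₑ) (g := w)
    (by fun_prop) (by fun_prop)
  simp only [mul_pow, hw2] at h3
  calc _ ≤ ENNReal.ofReal c ^ 2 * (∫⁻ x, (w x * ‖f x‖ₑ) * w x ∂(K.sideArc i)) ^ 2 := by
        rw [← mul_pow]; gcongr
    _ ≤ ENNReal.ofReal c ^ 2 * ((C * h1NormSq K.body f) * I) := by
        gcongr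
        refine h3.trans ?_
        gcongr
        exact H f hf
    _ = _ := by ring

end PolygonalCell

end

section

/-! ## Traces -/

lemma ennreal_add_sq_le (a b : ℝ≥0∞) : (a + b) ^ 2 ≤ 4 * (a ^ 2 + b ^ 2) := by
  wlog hab : a ≤ b generalizing a b
  · rw [add_comm a b, add_comm (a ^ 2)]; exact this b a (le_of_not_ge hab)
  calc (a + b) ^ 2 ≤ (b + b) ^ 2 := by gcongr
    _ = 4 * b ^ 2 := by ring
    _ ≤ 4 * (a ^ 2 + b ^ 2) := by gcongr; exact le_add_self

lemma ennreal_tendsto_sq_iff {α : Type*} {l : Filter α} {f : α → ℝ≥0∞} :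
    Tendsto (fun n => f n ^ 2) l (𝓝 0) ↔ Tendsto f l (𝓝 0) := by
  constructor
  · intro h
    have := Filter.Tendsto.ennrpow_const (1 / 2 : ℝ) h
    simp only [← ENNReal.rpow_natCast, ← ENNReal.rpow_mul] at this
    norm_num at this
    exact this
  · intro h
    simpa using ENNReal.Tendsto.pow (n := 2) h

section

variable {D : Set Plane} {μ : Measure Plane} {u v : Plane → ℝ} {G H : Plane → Plane}

lemma h1NormSq_sub_le (hD : IsOpen D) (hu : IsH1 D u G) (hv : IsH1 D v H) :
    h1NormSq D (u - v) ≤ 4 * (h1NormSq D u + h1NormSq D v) := by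
  rw [hu.h1NormSq hD, hv.h1NormSq hD, (hu.sub hv).h1NormSq hD]
  have h1 := eLpNorm_sub_le hu.1.1 hv.1.1 one_le_two
  have h2 := eLpNorm_sub_le hu.2.1.1 hv.2.1.1 one_le_two
  calc _ ≤ (eLpNorm u 2 (volume.restrict D) + eLpNorm v 2 (volume.restrict D)) ^ 2 +
      (eLpNorm G 2 (volume.restrict D) + eLpNorm H 2 (volume.restrict D)) ^ 2 := by gcongr
    _ ≤ _ := by
      refine (add_le_add (ennreal_add_sq_le _ _) (ennreal_add_sq_le _ _)).trans (le_of_eq ?_)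
      ring

lemma h1NormSq_congr (hD : IsOpen D) (hu : IsH1 D u G) (h : u =ᵐ[volume.restrict D] v) :
    h1NormSq D u = h1NormSq D v := by
  rw [hu.h1NormSq hD, (hu.congr h EventuallyEq.rfl).h1NormSq hD, eLpNorm_congr_ae h]

/-- The smooth functions `φ n` converge to `u` in `H¹(D)`. -/
def H1Tendsto (D : Set Plane) (φ : ℕ → Plane → ℝ) (u : Plane → ℝ) : Prop :=
  (∀ n, ContDiff ℝ ∞ (φ n)) ∧ Tendsto (fun n => h1NormSq D (u - φ n)) atTop (𝓝 0)

lemma h1Tendsto_iff (hD : IsOpen D) (hb : Bornology.IsBounded D) (hu : IsH1 D u G)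
    {φ : ℕ → Plane → ℝ} : H1Tendsto D φ u ↔ (∀ n, ContDiff ℝ ∞ (φ n)) ∧
      Tendsto (fun n => eLpNorm (u - φ n) 2 (volume.restrict D)) atTop (𝓝 0) ∧
      Tendsto (fun n => eLpNorm (G - gradient (φ n)) 2 (volume.restrict D)) atTop (𝓝 0) := by
  refine and_congr_right fun hφ => ?_
  have e : ∀ n, h1NormSq D (u - φ n) = eLpNorm (u - φ n) 2 (volume.restrict D) ^ 2 +
      eLpNorm (G - gradient (φ n)) 2 (volume.restrict D) ^ 2 := fun n =>
    (hu.sub (isH1_of_contDiff hD hb (hφ n))).h1NormSq hD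
  simp only [e]
  constructor
  · intro h
    constructor <;> rw [← ennreal_tendsto_sq_iff]
    · exact tendsto_of_tendsto_of_tendsto_of_le_of_le tendsto_const_nhds h (fun _ => bot_le)
        fun _ => le_self_add
    · exact tendsto_of_tendsto_of_tendsto_of_le_of_le tendsto_const_nhds h (fun _ => bot_le)
        fun _ => le_add_self
  · rintro ⟨h1, h2⟩
    have := (ennreal_tendsto_sq_iff.2 h1).add (ennreal_tendsto_sq_iff.2 h2)
    rwa [add_zero] at this

lemma IsStarDomain.exists_h1Tendsto {z : Plane} {ρ : ℝ} (h : IsStarDomain D z ρ)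
    (hu : IsH1 D u G) : ∃ φ, H1Tendsto D φ u := by
  obtain ⟨φ, h1, h2⟩ := h.exists_smooth_tendsto hu
  exact ⟨φ, (h1Tendsto_iff h.isOpen h.isBounded hu).2 ⟨h1, h2⟩⟩

lemma H1Tendsto.sub (hD : IsOpen D) (hb : Bornology.IsBounded D) {φ ψ : ℕ → Plane → ℝ}
    (hu : IsH1 D u G) (hv : IsH1 D v H) (h : H1Tendsto D φ u) (h' : H1Tendsto D ψ v) :
    H1Tendsto D (fun n => φ n - ψ n) (u - v) := by
  refine ⟨fun n => contDiff_sub_pi (h.1 n) (h'.1 n), ?_⟩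
  have h0 := ENNReal.Tendsto.const_mul (a := 4) (h.2.add h'.2) (Or.inr (by simp))
  rw [add_zero, mul_zero] at h0
  refine tendsto_of_tendsto_of_tendsto_of_le_of_le tendsto_const_nhds h0 (fun _ => bot_le)
    fun n => ?_
  have e : u - v - (φ n - ψ n) = (u - φ n) - (v - ψ n) := by ring
  simp only [e]
  exact h1NormSq_sub_le hD (hu.sub (isH1_of_contDiff hD hb (h.1 n)))
    (hv.sub (isH1_of_contDiff hD hb (h'.1 n)))

/-- Two sequences with the same limit in `H¹`. -/
lemma H1Tendsto.sub_self (hD : IsOpen D) (hb : Bornology.IsBounded D) {φ ψ : ℕ → Plane → ℝ}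
    (hu : IsH1 D u G) (h : H1Tendsto D φ u) (h' : H1Tendsto D ψ u) :
    Tendsto (fun n => h1NormSq D (φ n - ψ n)) atTop (𝓝 0) := by
  have h0 := ENNReal.Tendsto.const_mul (a := 4) (h'.2.add h.2) (Or.inr (by simp))
  rw [add_zero, mul_zero] at h0
  refine tendsto_of_tendsto_of_tendsto_of_le_of_le tendsto_const_nhds h0 (fun _ => bot_le)
    fun n => ?_
  have e : φ n - ψ n = (u - ψ n) - (u - φ n) := by ring
  simp only [e]
  exact h1NormSq_sub_le hD (hu.sub (isH1_of_contDiff hD hb (h'.1 n)))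
    (hu.sub (isH1_of_contDiff hD hb (h.1 n)))

lemma TraceBound.eLpNorm_tendsto (hμ : TraceBound D μ) {φ : ℕ → Plane → ℝ}
    (hφ : ∀ n, ContDiff ℝ ∞ (φ n)) (h : Tendsto (fun n => h1NormSq D (φ n)) atTop (𝓝 0)) :
    Tendsto (fun n => eLpNorm (φ n) 2 μ) atTop (𝓝 0) := by
  obtain ⟨C, hC, H⟩ := hμ
  rw [← ennreal_tendsto_sq_iff]
  simp only [eLpNorm_two_sq]
  have h0 := ENNReal.Tendsto.const_mul (a := C) h (Or.inr hC)
  rw [mul_zero] at h0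
  exact tendsto_of_tendsto_of_tendsto_of_le_of_le tendsto_const_nhds h0 (fun _ => bot_le)
    fun n => H _ (hφ n)

variable {t s : Plane → ℝ}

/-- The trace bound makes the limit independent of the approximating sequence, so a trace may be
computed with whichever smooth functions are at hand. -/
lemma HasTrace.tendsto (hD : IsOpen D) (hb : Bornology.IsBounded D) (hμ : TraceBound D μ)
    (hu : IsH1 D u G) (h : HasTrace D μ u t) {φ : ℕ → Plane → ℝ} (hφ : H1Tendsto D φ u) :
    Tendsto (fun n => eLpNorm (t - φ n) 2 μ) atTop (𝓝 0) := by
  obtain ⟨ht, ψ, hψ, h1, h2⟩ := h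
  have h3 := hμ.eLpNorm_tendsto (fun n => contDiff_sub_pi (hψ n) (hφ.1 n))
    (H1Tendsto.sub_self hD hb hu ⟨hψ, h1⟩ hφ)
  have h4 := h2.add h3
  rw [add_zero] at h4
  refine tendsto_of_tendsto_of_tendsto_of_le_of_le tendsto_const_nhds h4 (fun _ => bot_le)
    fun n => ?_
  have e : t - φ n = (t - ψ n) + (ψ n - φ n) := by ring
  simp only [e]
  exact eLpNorm_add_le (ht.1.sub (hψ n).continuous.aestronglyMeasurable)
    ((hψ n).continuous.sub (hφ.1 n).continuous).aestronglyMeasurable one_le_two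

lemma HasTrace.sub (hD : IsOpen D) (hb : Bornology.IsBounded D)
    (hu : IsH1 D u G) (hv : IsH1 D v H) (h : HasTrace D μ u t) (h' : HasTrace D μ v s) :
    HasTrace D μ (u - v) (t - s) := by
  obtain ⟨ht, φ, hφ, h1, h2⟩ := h
  obtain ⟨hs, ψ, hψ, h3, h4⟩ := h'
  obtain ⟨h5, h6⟩ := H1Tendsto.sub hD hb hu hv ⟨hφ, h1⟩ ⟨hψ, h3⟩
  refine ⟨ht.sub hs, _, h5, h6, ?_⟩
  have h7 := h2.add h4
  rw [add_zero] at h7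
  refine tendsto_of_tendsto_of_tendsto_of_le_of_le tendsto_const_nhds h7 (fun _ => bot_le)
    fun n => ?_
  have e : t - s - (φ n - ψ n) = (t - φ n) - (s - ψ n) := by ring
  simp only [e]
  exact eLpNorm_sub_le (ht.1.sub (hφ n).continuous.aestronglyMeasurable)
      (hs.1.sub (hψ n).continuous.aestronglyMeasurable) one_le_two

lemma HasTrace.congr (hD : IsOpen D) (hb : Bornology.IsBounded D)
    (hu : IsH1 D u G) (h : HasTrace D μ u t) (huv : u =ᵐ[volume.restrict D] v)
    (hts : t =ᵐ[μ] s) : HasTrace D μ v s := by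
  obtain ⟨ht, φ, hφ, h1, h2⟩ := h
  refine ⟨ht.ae_eq hts, φ, hφ, h1.congr fun n => ?_, h2.congr fun n => ?_⟩
  · exact h1NormSq_congr hD (hu.sub (isH1_of_contDiff hD hb (hφ n)))
      (huv.sub EventuallyEq.rfl)
  · exact eLpNorm_congr_ae (hts.sub EventuallyEq.rfl)

lemma memLp_of_contDiff_of_traceBound (hD : IsOpen D) (hb : Bornology.IsBounded D)
    (hμ : TraceBound D μ) {f : Plane → ℝ} (hf : ContDiff ℝ ∞ f) : MemLp f 2 μ := by
  obtain ⟨C, hC, H⟩ := hμ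
  rw [memLp_two_iff hf.continuous.aestronglyMeasurable]
  refine (H f hf).trans_lt (ENNReal.mul_lt_top hC.lt_top ?_)
  have := isH1_of_contDiff hD hb hf
  rw [this.h1NormSq hD]
  exact ENNReal.add_lt_top.2 ⟨ENNReal.pow_lt_top this.1.2, ENNReal.pow_lt_top this.2.1.2⟩

lemma h1NormSq_zero (hD : IsOpen D) : h1NormSq D 0 = 0 := by
  have h : IsH1 D 0 0 := by
    refine ⟨MemLp.zero, MemLp.zero, ?_, ?_⟩ <;>
      exact ⟨locallyIntegrableOn_zero, locallyIntegrableOn_zero, by simp⟩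
  rw [h.h1NormSq hD]
  simp

lemma hasTrace_of_contDiff (hD : IsOpen D) (hb : Bornology.IsBounded D)
    (hμ : TraceBound D μ) {f : Plane → ℝ} (hf : ContDiff ℝ ∞ f) : HasTrace D μ f f :=
  ⟨memLp_of_contDiff_of_traceBound hD hb hμ hf, fun _ => f, fun _ => hf, by
    simp [h1NormSq_zero hD], by simp⟩

/-- By the trace bound, a convergent sequence in $H^1$ restricts to a Cauchy sequence in $L^2(\mu)$.
-/
lemma H1Tendsto.exists_hasTrace (hD : IsOpen D) (hb : Bornology.IsBounded D)
    (hμ : TraceBound D μ) (hu : IsH1 D u G) {φ : ℕ → Plane → ℝ} (hφ : H1Tendsto D φ u) :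
    ∃ t, HasTrace D μ u t := by
  have hm : ∀ n, MemLp (φ n) 2 μ := fun n => memLp_of_contDiff_of_traceBound hD hb hμ (hφ.1 n)
  obtain ⟨C, hC, H⟩ := hμ
  have hd : ∀ m n, h1NormSq D (φ m - φ n) ≤ 4 * (h1NormSq D (u - φ n) + h1NormSq D (u - φ m)) := by
    intro m n
    have e : φ m - φ n = (u - φ n) - (u - φ m) := by ring
    rw [e]
    exact h1NormSq_sub_le hD (hu.sub (isH1_of_contDiff hD hb (hφ.1 n)))
      (hu.sub (isH1_of_contDiff hD hb (hφ.1 m)))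
  set F : ℕ → Lp ℝ 2 μ := fun n => (hm n).toLp with hF
  have hcauchy : CauchySeq F := by
    rw [EMetric.cauchySeq_iff]
    intro ε hε
    have h0 := ENNReal.Tendsto.const_mul (a := C * (4 * 2)) hφ.2 (Or.inr (by finiteness))
    rw [mul_zero] at h0
    obtain ⟨N, hN⟩ := eventually_atTop.1 (h0.eventually_lt_const (ENNReal.pow_pos hε 2))
    have hN' : ∀ m n, N ≤ m → N ≤ n → h1NormSq D (u - φ m) ≤ h1NormSq D (u - φ n) →
        eLpNorm (φ m - φ n) 2 μ ^ 2 < ε ^ 2 := by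
      intro m n _ hn hmn
      refine lt_of_le_of_lt ?_ (hN n hn)
      rw [eLpNorm_two_sq]
      refine (H _ (contDiff_sub_pi (hφ.1 m) (hφ.1 n))).trans ?_
      rw [mul_assoc]
      gcongr
      refine (hd m n).trans ?_
      rw [mul_assoc, two_mul]
      gcongr
    refine ⟨N, fun m hm' n hn' => ?_⟩
    have hlt : eLpNorm (φ m - φ n) 2 μ < ε := by
      refine lt_of_not_ge fun hge => not_le_of_gt (?_ : eLpNorm (φ m - φ n) 2 μ ^ 2 < ε ^ 2)
        (pow_le_pow_left₀ bot_le hge 2)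
      rcases le_total (h1NormSq D (u - φ m)) (h1NormSq D (u - φ n)) with h | h
      · exact hN' m n hm' hn' h
      · rw [eLpNorm_sub_comm]; exact hN' n m hn' hm' h
    rw [hF, Lp.edist_toLp_toLp]
    exact hlt
  obtain ⟨T, hT⟩ := cauchySeq_tendsto_of_complete hcauchy
  refine ⟨T, Lp.memLp T, φ, hφ.1, hφ.2, ?_⟩
  rw [tendsto_iff_edist_tendsto_0] at hT
  refine hT.congr fun n => ?_
  rw [edist_comm, Lp.edist_def]
  refine eLpNorm_congr_ae (EventuallyEq.rfl.sub (hm n).coeFn_toLp)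

/-! ### Multipliers -/

lemma TraceMultiplier.add {m m' : Plane → ℝ} (h : TraceMultiplier D μ m)
    (h' : TraceMultiplier D μ m') : TraceMultiplier D μ (m + m') := by
  obtain ⟨hm, C, hC, H⟩ := h
  obtain ⟨hm', C', hC', H'⟩ := h'
  refine ⟨hm.add hm', 4 * (C + C'), by finiteness, fun f hf => ?_⟩
  have h1 : ∫⁻ x, ‖f x‖ₑ * ‖(m + m') x‖ₑ ∂μ ≤
      (∫⁻ x, ‖f x‖ₑ * ‖m x‖ₑ ∂μ) + ∫⁻ x, ‖f x‖ₑ * ‖m' x‖ₑ ∂μ := by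
    rw [← lintegral_add_left' (f := fun x => ‖f x‖ₑ * ‖m x‖ₑ)
      (hf.continuous.aestronglyMeasurable.enorm.mul hm.enorm)]
    refine lintegral_mono fun x => ?_
    rw [← mul_add]
    gcongr
    exact enorm_add_le _ _
  calc _ ≤ _ := pow_le_pow_left₀ bot_le h1 2
    _ ≤ _ := ennreal_add_sq_le _ _
    _ ≤ 4 * (C * h1NormSq D f + C' * h1NormSq D f) := by gcongr; exacts [H f hf, H' f hf]
    _ = _ := by ring

lemma TraceMultiplier.smul {m : Plane → ℝ} (h : TraceMultiplier D μ m) (c : ℝ) :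
    TraceMultiplier D μ (c • m) := by
  obtain ⟨hm, C, hC, H⟩ := h
  refine ⟨hm.const_smul c, ‖c‖ₑ ^ 2 * C, by finiteness, fun f hf => ?_⟩
  have h1 : ∫⁻ x, ‖f x‖ₑ * ‖(c • m) x‖ₑ ∂μ = ‖c‖ₑ * ∫⁻ x, ‖f x‖ₑ * ‖m x‖ₑ ∂μ := by
    rw [← lintegral_const_mul' _ _ (by finiteness)]
    refine lintegral_congr fun x => ?_
    rw [Pi.smul_apply, smul_eq_mul, enorm_mul]; ring
  rw [h1, mul_pow, mul_assoc]
  gcongr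
  exact H f hf

lemma TraceMultiplier.zero : TraceMultiplier D μ 0 :=
  ⟨aestronglyMeasurable_zero, 0, by simp, fun f _ => by simp⟩

/-- Traces can be integrated against multipliers, and these integrals are continuous. -/
theorem HasTrace.tendsto_integral (hD : IsOpen D) (hb : Bornology.IsBounded D)
    (hμ : TraceBound D μ) (hu : IsH1 D u G) (h : HasTrace D μ u t) {φ : ℕ → Plane → ℝ}
    (hφ : H1Tendsto D φ u) {m : Plane → ℝ} (hm : TraceMultiplier D μ m) :
    Integrable (fun x => t x * m x) μ ∧
      Tendsto (fun n => ∫ x, φ n x * m x ∂μ) atTop (𝓝 (∫ x, t x * m x ∂μ)) := by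
  have ht := h.tendsto hD hb hμ hu hφ
  have htm := h.1
  obtain ⟨hmm, C, hC, H⟩ := hm
  have hφm : ∀ n, AEStronglyMeasurable (φ n) μ := fun n => (hφ.1 n).continuous.aestronglyMeasurable
  -- As `m` need not be square integrable, $L^2$ convergence does not control the pairing. The
  -- multiplier bound is available for differences of smooth functions; Fatou's lemma along an
  -- almost everywhere convergent subsequence carries it over to `t - φ n`.
  obtain ⟨ns, hns, hae⟩ := (tendstoInMeasure_of_tendsto_eLpNorm two_ne_zero hφm htm.1 (by
    refine ht.congr fun n => ?_
    rw [eLpNorm_sub_comm])).exists_seq_tendsto_ae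
  -- the distance in the weighted norm
  have key : ∀ n, (∫⁻ x, ‖t x - φ n x‖ₑ * ‖m x‖ₑ ∂μ) ^ 2 ≤ C * (4 * h1NormSq D (u - φ n)) := by
    intro n
    have hsq : ∫⁻ x, ‖t x - φ n x‖ₑ * ‖m x‖ₑ ∂μ ≤ (C * (4 * h1NormSq D (u - φ n))) ^ (1 / 2 : ℝ) := by
      have h1 : ∫⁻ x, ‖t x - φ n x‖ₑ * ‖m x‖ₑ ∂μ ≤
          liminf (fun k => ∫⁻ x, ‖(φ (ns k) - φ n) x‖ₑ * ‖m x‖ₑ ∂μ) atTop := by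
        refine le_trans ?_ (lintegral_liminf_le' fun k =>
          ((hφm _).sub (hφm n)).enorm.mul hmm.enorm)
        refine lintegral_mono_ae ?_
        filter_upwards [hae] with x hx
        refine le_of_eq (Tendsto.liminf_eq ?_).symm
        refine ENNReal.Tendsto.mul_const ?_ (Or.inr (by finiteness))
        exact (continuous_enorm.tendsto _).comp (hx.sub_const _)
      refine h1.trans ?_
      have h2 : Tendsto (fun k => (C * (4 * (h1NormSq D (u - φ n) + h1NormSq D (u - φ (ns k))))) ^
          (1 / 2 : ℝ)) atTop (𝓝 ((C * (4 * h1NormSq D (u - φ n))) ^ (1 / 2 : ℝ))) := by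
        refine Filter.Tendsto.ennrpow_const _ (ENNReal.Tendsto.const_mul
          (ENNReal.Tendsto.const_mul ?_ (Or.inr (by simp))) (Or.inr hC))
        have := (tendsto_const_nhds (x := h1NormSq D (u - φ n))).add
          (hφ.2.comp hns.tendsto_atTop)
        rwa [add_zero] at this
      rw [← h2.liminf_eq]
      refine liminf_le_liminf (Eventually.of_forall fun k => ?_)
      rw [ennreal_le_sqrt_iff]
      refine (H _ (contDiff_sub_pi (hφ.1 _) (hφ.1 n))).trans ?_
      gcongr
      have e : φ (ns k) - φ n = (u - φ n) - (u - φ (ns k)) := by ring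
      rw [e]
      exact h1NormSq_sub_le hD (hu.sub (isH1_of_contDiff hD hb (hφ.1 n)))
        (hu.sub (isH1_of_contDiff hD hb (hφ.1 _)))
    rwa [ennreal_le_sqrt_iff] at hsq
  have hφi : ∀ n, Integrable (fun x => φ n x * m x) μ := by
    intro n
    refine ⟨(hφm n).mul hmm, ?_⟩
    rw [hasFiniteIntegral_iff_enorm]
    simp only [enorm_mul]
    have h1 := (H _ (hφ.1 n)).trans_lt (ENNReal.mul_lt_top hC.lt_top (by
      have := isH1_of_contDiff hD hb (hφ.1 n)
      rw [this.h1NormSq hD]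
      exact ENNReal.add_lt_top.2 ⟨ENNReal.pow_lt_top this.1.2, ENNReal.pow_lt_top this.2.1.2⟩))
    by_contra hcon
    rw [not_lt, top_le_iff] at hcon
    rw [hcon] at h1
    simp at h1
  have hlim : Tendsto (fun n => ∫⁻ x, ‖t x - φ n x‖ₑ * ‖m x‖ₑ ∂μ) atTop (𝓝 0) := by
    rw [← ennreal_tendsto_sq_iff]
    have h0 := ENNReal.Tendsto.const_mul (a := C) (ENNReal.Tendsto.const_mul (a := 4) hφ.2
      (Or.inr (by simp))) (Or.inr hC)
    rw [mul_zero, mul_zero] at h0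
    exact tendsto_of_tendsto_of_tendsto_of_le_of_le tendsto_const_nhds h0 (fun _ => bot_le) key
  have hti : Integrable (fun x => t x * m x) μ := by
    obtain ⟨n, hn⟩ := (hlim.eventually_lt_const (zero_lt_one' ℝ≥0∞)).exists
    have h1 : Integrable (fun x => (t x - φ n x) * m x) μ := by
      refine ⟨(htm.1.sub (hφm n)).mul hmm, ?_⟩
      rw [hasFiniteIntegral_iff_enorm]
      simp only [enorm_mul]
      exact hn.trans ENNReal.one_lt_top
    refine (h1.add (hφi n)).congr (Eventually.of_forall fun x => ?_)
    simp only [Pi.add_apply]; ring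
  refine ⟨hti, ?_⟩
  refine tendsto_integral_of_L1 _ hti.1 (Eventually.of_forall hφi) ?_
  refine hlim.congr fun n => lintegral_congr fun x => ?_
  rw [← enorm_mul, ← enorm_neg]
  congr 1; ring

lemma TraceMultiplier.integrable (hD : IsOpen D) (hb : Bornology.IsBounded D)
    (hμ : TraceBound D μ) {m f : Plane → ℝ} (hm : TraceMultiplier D μ m) (hf : ContDiff ℝ ∞ f) :
    Integrable (fun x => f x * m x) μ :=
  ((hasTrace_of_contDiff hD hb hμ hf).tendsto_integral hD hb hμ (isH1_of_contDiff hD hb hf)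
    (φ := fun _ => f) ⟨fun _ => hf, by simp [h1NormSq_zero hD]⟩ hm).1

end

end

section

/-! ## Functions with a point singularity on the boundary -/

/-- In polar coordinates the integrand is $r^{s+1}$, with an exponent above $-1$. -/
lemma integrableOn_dist_rpow {K : Set Plane} (hK : Bornology.IsBounded K) (A : Plane) {s : ℝ}
    (hs : -2 < s) : IntegrableOn (fun x => dist x A ^ s) K := by
  obtain ⟨r, hr⟩ := hK.subset_ball A
  refine IntegrableOn.mono_set ?_ hr
  have h1 : IntegrableOn (fun x : Plane => ‖x‖ ^ s) (Metric.ball 0 r) := by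
    rw [integrableOn_fun_norm_addHaar (μ := volume) (f := fun t : ℝ => t ^ s)]
    have h2 : IntegrableOn (fun y : ℝ => y ^ (s + 1)) (Ioo 0 r) :=
      (intervalIntegral.intervalIntegrable_rpow' (a := 0) (b := r) (by linarith)).1.mono_set
        Ioo_subset_Ioc_self
    refine h2.congr_fun (fun y hy => ?_) measurableSet_Ioo
    simp only [finrank_euclideanSpace, Fintype.card_fin, smul_eq_mul]
    rw [Real.rpow_add hy.1, Real.rpow_one]
    simp [mul_comm]
  have h3 := (measurePreserving_sub_right (volume : Measure Plane) A).integrableOn_comp_preimage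
    (MeasurableEquiv.subRight A).measurableEmbedding (f := fun x : Plane => ‖x‖ ^ s)
    (s := Metric.ball 0 r)
  have h4 := h3.2 h1
  have h5 : (fun x : Plane => x - A) ⁻¹' Metric.ball 0 r = Metric.ball A r := by
    ext x; simp [dist_eq_norm]
  rw [h5] at h4
  refine h4.congr_fun (fun x _ => ?_) measurableSet_ball
  simp [dist_eq_norm]

lemma integrable_inner_of_memLp {α E : Type*} [MeasurableSpace α] [NormedAddCommGroup E]
    [InnerProductSpace ℝ E] {μ : Measure α} {f g : α → E} (hf : MemLp f 2 μ) (hg : MemLp g 2 μ) :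
    Integrable (fun x => inner ℝ (f x) (g x)) μ := by
  refine (L2.integrable_inner (𝕜 := ℝ) hf.toLp hg.toLp).congr ?_
  filter_upwards [hf.coeFn_toLp, hg.coeFn_toLp] with x h1 h2
  rw [h1, h2]

namespace IsStarDomain

variable {K : Set Plane} {z : Plane} {ρ : ℝ}

/-- The contracted point $X=z+s(y-z)$ is the center of a disc of radius $(1-s)\rho$ in `K`, so `A`
has at least this distance from it, while $|y-X|\le(1-s)\operatorname{diam}K$. Hence a singular
weight on the whole segment from `z` to `y` is dominated by its value at `y`. -/
lemma dist_le_of_notMem (hK : IsStarDomain K z ρ) {A y : Plane} (hA : A ∉ K)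
    (hy : y ∈ closure K) {s : ℝ} (hs0 : 0 ≤ s) (hs1 : s < 1) :
    dist y A ≤ (1 + Metric.diam K / ρ) * dist (z + s • (y - z)) A := by
  set X := z + s • (y - z) with hX
  have h1s : 0 < 1 - s := by linarith
  have h1 : (1 - s) * ρ ≤ dist X A := by
    by_contra hlt
    rw [not_le] at hlt
    set v := (1 - s)⁻¹ • (A - X) with hv
    have hvn : ‖v‖ < ρ := by
      rw [hv, norm_smul, norm_inv, Real.norm_of_nonneg h1s.le, inv_mul_lt_iff₀ h1s, ← dist_eq_norm,
        dist_comm]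
      exact hlt
    have hK' : IsStarDomain K (z + v) (ρ - ‖v‖) := by
      refine ⟨hK.isOpen, hK.isBounded, hK.nonempty, by linarith, fun w hw => hK.star w ?_⟩
      rw [Metric.mem_ball] at hw ⊢
      have h2 := dist_triangle w (z + v) z
      rw [dist_eq_norm (z + v) z, add_sub_cancel_left] at h2
      linarith
    have h3 := hK'.add_smul_mem_of_closure hy hs0 hs1
    have h4 : z + v + s • (y - (z + v)) = A := by
      have : (1 - s) • v = A - X := by
        rw [hv, smul_smul, mul_inv_cancel₀ h1s.ne', one_smul]
      calc z + v + s • (y - (z + v)) = z + s • (y - z) + (1 - s) • v := by module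
        _ = A := by rw [this, ← hX]; abel
    rw [h4] at h3
    exact hA h3
  have h2 : dist y X = (1 - s) * dist y z := by
    have : y - X = (1 - s) • (y - z) := by rw [hX]; module
    rw [dist_eq_norm, this, norm_smul, Real.norm_of_nonneg h1s.le, dist_eq_norm]
  have h3 : dist y z ≤ Metric.diam K := by
    rw [← Metric.diam_closure]
    exact Metric.dist_le_diam_of_mem hK.isBounded.closure hy (subset_closure hK.mem_center)
  have h4 := dist_triangle y X A
  have h5 : (1 - s) * dist y z ≤ Metric.diam K / ρ * dist X A := by
    have hρ := hK.pos
    calc (1 - s) * dist y z ≤ (1 - s) * Metric.diam K := by gcongr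
      _ = Metric.diam K / ρ * ((1 - s) * ρ) := by field_simp
      _ ≤ _ := by
        have := hK.diam_pos.le
        gcongr
  linarith

end IsStarDomain

/-- `g` is twice continuously differentiable near the closure of `K`, except possibly at `A`, where
its gradient may blow up like the distance to the power `-γ`; its Laplacian is `q`. -/
structure IsSingularOn (K : Set Plane) (A : Plane) (γ : ℝ) (V : Set Plane) (g q : Plane → ℝ)
    (C : ℝ) : Prop where
  isOpen : IsOpen V
  closure_subset : closure K \ {A} ⊆ V
  contDiffOn : ContDiffOn ℝ 2 g V
  laplace : ∀ x ∈ K, pd 0 (pd 0 g) x + pd 1 (pd 1 g) x = q x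
  bound : ∀ x ∈ closure K \ {A}, |g x| ≤ C
  grad_bound : ∀ x ∈ closure K \ {A}, ‖gradient g x‖ ≤ C * dist x A ^ (-γ)
  notMem : A ∉ K
  nonneg : 0 ≤ γ
  lt_one : γ < 1

lemma abs_pd_le (g : Plane → ℝ) (x : Plane) (i : Fin 2) : |pd i g x| ≤ ‖gradient g x‖ := by
  rw [← gradient_apply, ← Real.norm_eq_abs]
  exact PiLp.norm_apply_le _ _

/-- With exponent 0, smooth functions are covered by the same Green formula as the singular
function. -/
lemma isSingularOn_of_contDiff {K : Set Plane} (hb : Bornology.IsBounded K) {f : Plane → ℝ}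
    (hf : ContDiff ℝ ∞ f) {A : Plane} (hA : A ∉ K) :
    ∃ C, IsSingularOn K A 0 univ f (pd 0 (pd 0 f) + pd 1 (pd 1 f)) C := by
  have hc : IsCompact (closure K) := hb.isCompact_closure
  obtain ⟨C, hC⟩ := hc.exists_bound_of_continuousOn hf.continuous.continuousOn
  obtain ⟨C', hC'⟩ := hc.exists_bound_of_continuousOn (contDiff_gradient hf).continuous.continuousOn
  refine ⟨max C C', isOpen_univ, subset_univ _, (contDiff_infty.1 hf 2).contDiffOn,
    fun x _ => rfl, fun x hx => (hC x hx.1).trans (le_max_left _ _), fun x hx => ?_, hA, le_rfl,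
    zero_lt_one⟩
  simpa using (hC' x hx.1).trans (le_max_right C C')

namespace IsSingularOn

variable {K : Set Plane} {A : Plane} {γ : ℝ} {V : Set Plane} {g q : Plane → ℝ} {C : ℝ}

lemma subset (h : IsSingularOn K A γ V g q C) : K ⊆ V := fun _ hx =>
  h.closure_subset ⟨subset_closure hx, fun e => h.notMem (e ▸ hx)⟩

lemma mem_diff (h : IsSingularOn K A γ V g q C) {x : Plane} (hx : x ∈ K) : x ∈ closure K \ {A} :=
  ⟨subset_closure hx, fun e => h.notMem (e ▸ hx)⟩

lemma contDiffOn_pd (h : IsSingularOn K A γ V g q C) (i : Fin 2) : ContDiffOn ℝ 1 (pd i g) V :=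
  (h.contDiffOn.fderiv_of_isOpen h.isOpen (by norm_num)).clm_apply contDiffOn_const

lemma continuousOn_gradient (h : IsSingularOn K A γ V g q C) : ContinuousOn (gradient g) V := by
  have h1 := h.contDiffOn.continuousOn_fderiv_of_isOpen h.isOpen (by norm_num)
  exact (InnerProductSpace.toDual ℝ Plane).symm.continuous.comp_continuousOn h1

/-- The square of the gradient is bounded by a power of the distance with exponent $-2\gamma>-2$,
integrable in the plane. -/
lemma memLp_gradient (h : IsSingularOn K A γ V g q C) (hK : IsOpen K)
    (hb : Bornology.IsBounded K) : MemLp (gradient g) 2 (volume.restrict K) := by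
  have hm := (h.continuousOn_gradient.mono h.subset).aestronglyMeasurable (μ := volume)
    hK.measurableSet
  rw [memLp_two_iff_integrable_sq_norm hm]
  have h1 := (integrableOn_dist_rpow hb A (s := -γ * 2) (by linarith [h.lt_one])).const_mul (C ^ 2)
  refine Integrable.mono' h1 (hm.norm.pow 2) ?_
  refine (ae_restrict_iff' hK.measurableSet).2 (Eventually.of_forall fun x hx => ?_)
  rw [Real.norm_of_nonneg (sq_nonneg _)]
  refine (pow_le_pow_left₀ (norm_nonneg _) (h.grad_bound x (h.mem_diff hx)) 2).trans ?_
  rw [mul_pow, ← Real.rpow_mul_natCast dist_nonneg]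
  norm_num

theorem isH1 (h : IsSingularOn K A γ V g q C) (hK : IsOpen K)
    (hb : Bornology.IsBounded K) : IsH1 K g (gradient g) := by
  have hc := (h.contDiffOn.mono h.subset)
  refine isH1_of_contDiffOn hK (hc.of_le (by norm_num)) ?_ (h.memLp_gradient hK hb)
  have : IsFiniteMeasure (volume.restrict K) := isFiniteMeasure_restrict.2 hb.measure_lt_top.ne
  refine MemLp.of_bound (hc.continuousOn.aestronglyMeasurable hK.measurableSet) C ?_
  exact (ae_restrict_iff' hK.measurableSet).2 (Eventually.of_forall fun x hx =>
    h.bound x (h.mem_diff hx))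

end IsSingularOn

lemma ae_arcLength_mem_segment (a b : Plane) : ∀ᵐ x ∂(arcLength a b), x ∈ segment ℝ a b := by
  refine Measure.ae_smul_measure ?_ _
  have hm : Measurable fun t : ℝ => (AffineMap.lineMap a b t : Plane) :=
    (AffineMap.lineMap_continuous (R := ℝ)).measurable
  have hs : MeasurableSet (segment ℝ a b) := by
    rw [segment_eq_image_lineMap]
    exact (isCompact_Icc.image AffineMap.lineMap_continuous).isClosed.measurableSet
  refine (ae_map_iff (p := fun x => x ∈ segment ℝ a b) hm.aemeasurable hs).2 ?_
  refine (ae_restrict_iff' measurableSet_Icc).2 (Eventually.of_forall fun t ht => ?_)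
  rw [segment_eq_image_lineMap]
  exact ⟨t, ht, rfl⟩

lemma ae_arcLength_ne {a b : Plane} (hab : a ≠ b) (A : Plane) : ∀ᵐ x ∂(arcLength a b), x ≠ A := by
  refine Measure.ae_smul_measure ?_ _
  have hm : Measurable fun t : ℝ => (AffineMap.lineMap a b t : Plane) :=
    (AffineMap.lineMap_continuous (R := ℝ)).measurable
  refine (ae_map_iff (p := fun x => x ≠ A) hm.aemeasurable (measurableSet_singleton A).compl).2 ?_
  refine ae_restrict_of_ae ?_
  rw [ae_iff]
  refine Set.Subsingleton.measure_zero (fun t ht t' ht' => ?_) _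
  simp only [ne_eq, not_not, mem_ofPred_eq] at ht ht'
  exact AffineMap.lineMap_injective ℝ hab (ht.trans ht'.symm)

lemma integral_arcLength (a b : Plane) {g : Plane → ℝ} (hg : AEStronglyMeasurable g (arcLength a b)) :
    ∫ x, g x ∂(arcLength a b) = dist a b * ∫ t in (0 : ℝ)..1, g (AffineMap.lineMap a b t) := by
  rcases eq_or_ne a b with rfl | hab
  · simp [arcLength]
  have hm : Measurable fun t : ℝ => (AffineMap.lineMap a b t : Plane) :=
    (AffineMap.lineMap_continuous (R := ℝ)).measurable
  have h0 : ENNReal.ofReal (dist a b) ≠ 0 := by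
    rw [Ne, ENNReal.ofReal_eq_zero, not_le]; exact dist_pos.2 hab
  have hg' : AEStronglyMeasurable g (Measure.map (fun t : ℝ => AffineMap.lineMap a b t)
      (volume.restrict (Icc (0 : ℝ) 1))) :=
    hg.mono_ac (Measure.absolutelyContinuous_smul h0)
  rw [arcLength, integral_smul_measure, integral_map hm.aemeasurable hg',
    ENNReal.toReal_ofReal dist_nonneg, smul_eq_mul, intervalIntegral.integral_of_le zero_le_one,
    integral_Icc_eq_integral_Ioc]

namespace PolygonalCell

variable {K : PolygonalCell} {z : Plane} {ρ : ℝ}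

lemma vert_ne (i : Fin (K.m + 3)) : K.vert i ≠ K.vert (i + 1) := fun e =>
  succ_ne i (K.vert_injective e).symm

/-- A unit normal of the `i`-th side. -/
def normal (K : PolygonalCell) (i : Fin (K.m + 3)) : Plane :=
  (dist (K.vert i) (K.vert (i + 1)))⁻¹ •
    !₂[K.vert (i + 1) 1 - K.vert i 1, -(K.vert (i + 1) 0 - K.vert i 0)]

lemma norm_normal (i : Fin (K.m + 3)) : ‖K.normal i‖ = 1 := by
  have h0 : 0 < dist (K.vert i) (K.vert (i + 1)) := dist_pos.2 (vert_ne i)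
  rw [normal, norm_smul, norm_inv, Real.norm_of_nonneg h0.le]
  have : ‖(!₂[K.vert (i + 1) 1 - K.vert i 1, -(K.vert (i + 1) 0 - K.vert i 0)] : Plane)‖ =
      dist (K.vert i) (K.vert (i + 1)) := by
    rw [EuclideanSpace.norm_eq, EuclideanSpace.dist_eq]
    congr 1
    simp [Fin.sum_univ_two, Real.dist_eq]
    ring
  rw [this, inv_mul_cancel₀ h0.ne']

lemma ae_mem_closure (i : Fin (K.m + 3)) (A : Plane) :
    ∀ᵐ x ∂(K.sideArc i), x ∈ closure K.body \ {A} := by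
  filter_upwards [ae_arcLength_mem_segment (K.vert i) (K.vert (i + 1)),
    ae_arcLength_ne (vert_ne i) A] with x hx hx'
  exact ⟨frontier_subset_closure (segment_subset_frontier i hx), hx'⟩

variable {A : Plane} {γ : ℝ} {V : Set Plane} {g q : Plane → ℝ} {C : ℝ}

lemma aestronglyMeasurable_flux (hs : IsSingularOn K.body A γ V g q C) (i : Fin (K.m + 3)) :
    AEStronglyMeasurable (fun x => inner ℝ (K.normal i) (gradient g x)) (K.sideArc i) := by
  rw [← Measure.restrict_eq_self_of_ae_mem (ae_mem_closure i A)]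
  refine ContinuousOn.aestronglyMeasurable ?_
    (isClosed_closure.measurableSet.diff (measurableSet_singleton A))
  exact continuousOn_const.inner (hs.continuousOn_gradient.mono hs.closure_subset)

lemma ae_abs_flux_le (hs : IsSingularOn K.body A γ V g q C) (i : Fin (K.m + 3)) :
    ∀ᵐ x ∂(K.sideArc i), |inner ℝ (K.normal i) (gradient g x)| ≤ C * dist x A ^ (-γ) := by
  filter_upwards [ae_mem_closure i A] with x hx
  refine (abs_real_inner_le_norm _ _).trans ?_
  rw [norm_normal, one_mul]
  exact hs.grad_bound x hx

/-- Green's formula for functions with a point singularity on the boundary. -/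
theorem green_singular (h : IsStarDomain K.body z ρ) : ∃ σ : ℝ, ∀ {A : Plane} {γ : ℝ} {V : Set Plane}
    {g q : Plane → ℝ} {C : ℝ}, IsSingularOn K.body A γ V g q C → Continuous q →
    ∀ φ : Plane → ℝ, ContDiff ℝ ∞ φ →
      ∫ x in K.body, inner ℝ (gradient g x) (gradient φ x) = -(∫ x in K.body, q x * φ x) +
        ∑ i, ∫ x, σ * inner ℝ (K.normal i) (gradient g x) * φ x ∂(K.sideArc i) := by
  -- All the vectors `normal` point outwards, or all point inwards, according to the orientation of
  -- the vertices; `σ` is this common sign.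
  obtain ⟨σ, hσ, hσc⟩ := exists_orientation h
  refine ⟨σ, fun {A γ V g q C} hs hq φ hφ => ?_⟩
  have hφ1 : ContDiff ℝ 1 φ := hφ.of_le (by exact_mod_cast le_top)
  -- The divergence theorem is applied to $\varphi\nabla g$.
  set F : Fin 2 → Plane → ℝ := fun j x => φ x * pd j g x with hF
  have hFc : ∀ j, ContDiffOn ℝ 1 (F j) V := fun j => hφ1.contDiffOn.mul (hs.contDiffOn_pd j)
  have hdivx : ∀ x ∈ K.body, pd 0 (F 0) x + pd 1 (F 1) x =
      inner ℝ (gradient g x) (gradient φ x) + q x * φ x := by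
    intro x hx
    have hd : ∀ j, pd j (F j) x = pd j φ x * pd j g x + φ x * pd j (pd j g) x := by
      intro j
      have h1 : DifferentiableAt ℝ (pd j g) x :=
        ((hs.contDiffOn_pd j).differentiableOn (by simp)).differentiableAt
          (hs.isOpen.mem_nhds (hs.subset hx))
      have h2 : DifferentiableAt ℝ φ x := hφ1.differentiable (by simp) x
      have e : F j = φ * pd j g := rfl
      rw [pd, e, (h2.hasFDerivAt.mul h1.hasFDerivAt).fderiv]
      simp only [_root_.add_apply, _root_.smul_apply, smul_eq_mul, pd]
      ring
    rw [hd, hd, plane_inner, gradient_apply, gradient_apply, gradient_apply, gradient_apply,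
      ← hs.laplace x hx]
    ring
  have hg2 := hs.memLp_gradient K.isOpen_body K.isBounded_body
  have hφ2 := memLp_of_continuous K.isBounded_body (contDiff_gradient hφ).continuous 2
  have hi1 : IntegrableOn (fun x => inner ℝ (gradient g x) (gradient φ x)) K.body :=
    integrable_inner_of_memLp hg2 hφ2
  have hi2 : IntegrableOn (fun x => q x * φ x) K.body :=
    memLp_one_iff_integrable.1 (memLp_of_continuous K.isBounded_body (hq.mul hφ.continuous) 1)
  have hdiv : IntegrableOn (fun x => pd 0 (F 0) x + pd 1 (F 1) x) K.body := by
    refine (hi1.add hi2).congr_fun (fun x hx => ?_) K.isOpen_body.measurableSet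
    exact (hdivx x hx).symm
  obtain ⟨Cφ, hCφ⟩ := K.isBounded_body.isCompact_closure.exists_bound_of_continuousOn
    hφ.continuous.continuousOn
  set M := 1 + Metric.diam K.body / ρ with hM
  have hM0 : 0 < M := by
    have := h.diam_pos; have := h.pos
    positivity
  set Y : Fin (K.m + 3) → ℝ → Plane := fun i t => z + K.relSide z i t with hY
  have hYc : ∀ i, Continuous (Y i) := fun i => continuous_const.add (continuous_relSide i)
  -- By `dist_le_of_notMem`, this bounds the field on the whole segment from the center to the
  -- boundary point; it is integrable along the side because $\gamma<1$.
  set B : Fin (K.m + 3) → ℝ → ℝ := fun i t => |Cφ| * (|C| * (M ^ γ * dist (Y i t) A ^ (-γ))) with hB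
  have hYA : ∀ i, ∀ᵐ t, t ∈ uIoc (0 : ℝ) 1 → Y i t ∈ closure K.body \ {A} := by
    intro i
    have h1 : ∀ᵐ t : ℝ, Y i t ≠ A := by
      rw [ae_iff]
      refine Set.Subsingleton.measure_zero (fun t ht t' ht' => ?_) _
      simp only [ne_eq, not_not, mem_ofPred_eq, hY, add_relSide] at ht ht'
      exact AffineMap.lineMap_injective ℝ (vert_ne i) (ht.trans ht'.symm)
    filter_upwards [h1] with t ht hti
    rw [uIoc_of_le zero_le_one] at hti
    exact ⟨frontier_subset_closure (add_relSide_mem_frontier (Ioc_subset_Icc_self hti)), ht⟩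
  have hBi : ∀ i, IntervalIntegrable (B i) volume 0 1 := by
    intro i
    have h1 := lintegral_dist_rpow_lt_top h i A hs.nonneg hs.lt_one
    have hm : Measurable fun x : Plane => ENNReal.ofReal (dist x A ^ (-γ)) := by fun_prop
    rw [sideArc, lintegral_arcLength _ _ hm] at h1
    have h0 : ENNReal.ofReal (dist (K.vert i) (K.vert (i + 1))) ≠ 0 := by
      rw [Ne, ENNReal.ofReal_eq_zero, not_le]; exact dist_pos.2 (vert_ne i)
    have h2 : ∫⁻ t in Icc (0 : ℝ) 1, ENNReal.ofReal (dist (Y i t) A ^ (-γ)) < ⊤ := by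
      simp only [hY, add_relSide]
      by_contra hcon
      rw [not_lt, top_le_iff] at hcon
      rw [hcon, ENNReal.mul_top h0] at h1
      exact lt_irrefl _ h1
    have h3 : IntervalIntegrable (fun t => dist (Y i t) A ^ (-γ)) volume 0 1 := by
      rw [intervalIntegrable_iff_integrableOn_Icc_of_le zero_le_one]
      refine ⟨?_, ?_⟩
      · have := (hYc i).measurable
        exact Measurable.aestronglyMeasurable (by fun_prop)
      · rw [hasFiniteIntegral_iff_ofReal (Eventually.of_forall fun t => by positivity)]
        exact h2
    exact ((h3.const_mul _).const_mul _).const_mul _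
  have hbd : ∀ i, ∀ s ∈ Ico (0 : ℝ) 1, ∀ᵐ t, t ∈ uIoc (0 : ℝ) 1 → ∀ j,
      |F j (z + s • K.relSide z i t)| ≤ B i t := by
    intro i s hs'
    filter_upwards [hYA i] with t ht hti j
    obtain ⟨hy, hyA⟩ := ht hti
    have e : z + s • K.relSide z i t = z + s • (Y i t - z) := by simp [hY]
    have hX : z + s • K.relSide z i t ∈ K.body := by
      rw [e]; exact h.add_smul_mem_of_closure hy hs'.1 hs'.2
    set X := z + s • K.relSide z i t with hXd
    have h1 := h.dist_le_of_notMem hs.notMem hy hs'.1 hs'.2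
    rw [← e] at h1
    have hpos : 0 < dist (Y i t) A := dist_pos.2 hyA
    have hXpos : 0 < dist X A := dist_pos.2 (hs.mem_diff hX).2
    have h2 : dist X A ^ (-γ) ≤ M ^ γ * dist (Y i t) A ^ (-γ) := by
      have h3 : dist (Y i t) A / M ≤ dist X A := by rwa [div_le_iff₀' hM0]
      refine (Real.rpow_le_rpow_of_nonpos (by positivity) h3 (by linarith [hs.nonneg])).trans ?_
      rw [Real.div_rpow hpos.le hM0.le, Real.rpow_neg hM0.le, div_inv_eq_mul, mul_comm]
    rw [hF, abs_mul]
    have h4 : |φ X| ≤ |Cφ| := (hCφ X (subset_closure hX)).trans (le_abs_self _)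
    have h5 : |pd j g X| ≤ |C| * (M ^ γ * dist (Y i t) A ^ (-γ)) := by
      refine (abs_pd_le g X j).trans ((hs.grad_bound X (hs.mem_diff hX)).trans ?_)
      exact mul_le_mul (le_abs_self C) h2 (by positivity) (abs_nonneg _)
    exact mul_le_mul h4 h5 (abs_nonneg _) (abs_nonneg _)
  have hlim : ∀ i j, ∀ᵐ t, t ∈ uIoc (0 : ℝ) 1 → Tendsto (fun s : ℝ => F j (z + s • K.relSide z i t))
      (𝓝[<] 1) (𝓝 (F j (Y i t))) := by
    intro i j
    filter_upwards [hYA i] with t ht hti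
    have hc : ContinuousAt (F j) (Y i t) :=
      (hFc j).continuousOn.continuousAt (hs.isOpen.mem_nhds (hs.closure_subset (ht hti)))
    have hl : Tendsto (fun s : ℝ => z + s • K.relSide z i t) (𝓝[<] 1) (𝓝 (Y i t)) := by
      have : Continuous fun s : ℝ => z + s • K.relSide z i t := by fun_prop
      have h1 := this.tendsto 1
      rw [one_smul] at h1
      exact h1.mono_left nhdsWithin_le_nhds
    exact hc.tendsto.comp hl
  have main := green h hσ hσc ((hFc 0).mono hs.subset) ((hFc 1).mono hs.subset) hdiv hBi
    (fun i s hs' => by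
      filter_upwards [hbd i s hs'] with t ht hti
      exact ⟨ht hti 0, ht hti 1⟩) (fun i => hlim i 0) (fun i => hlim i 1)
  rw [setIntegral_congr_fun K.isOpen_body.measurableSet hdivx, integral_add hi1 hi2] at main
  rw [eq_comm, neg_add_eq_iff_eq_add, eq_comm, add_comm (∫ x in K.body, q x * φ x), main,
    Finset.mul_sum]
  refine Finset.sum_congr rfl fun i _ => ?_
  have hmeas : AEStronglyMeasurable (fun x => σ * inner ℝ (K.normal i) (gradient g x) * φ x)
      (K.sideArc i) :=
    ((aestronglyMeasurable_flux hs i).const_mul σ).mul hφ.continuous.aestronglyMeasurable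
  rw [sideArc, integral_arcLength _ _ hmeas, ← intervalIntegral.integral_const_mul,
    ← intervalIntegral.integral_const_mul]
  refine intervalIntegral.integral_congr fun t _ => ?_
  have h0 : dist (K.vert i) (K.vert (i + 1)) ≠ 0 := (dist_pos.2 (vert_ne i)).ne'
  simp only [hF, hY, add_relSide, plane_inner, normal, PiLp.smul_apply, smul_eq_mul,
    gradient_apply, rel, PiLp.sub_apply]
  simp
  field_simp
  ring

end PolygonalCell

end

section

/-! ## The singular function as the imaginary part of a holomorphic function -/

/-- The plane as the complex numbers. -/
def cplx : Plane ≃ₗᵢ[ℝ] ℂ := Complex.orthonormalBasisOneI.repr.symm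

lemma cplx_apply (x : Plane) : cplx x = x 0 + x 1 * Complex.I := by
  rw [cplx, Complex.orthonormalBasisOneI_repr_symm_apply]

lemma cplx_re (x : Plane) : (cplx x).re = x 0 := by simp [cplx_apply]

lemma cplx_im (x : Plane) : (cplx x).im = x 1 := by simp [cplx_apply]

/-- The affine map that sends `A` to `0` and `A + c` to `1`. -/
def toDisk (A : Plane) (c : ℂ) (x : Plane) : ℂ := cplx (x - A) / c

lemma hasFDerivAt_comp_toDisk {H : ℂ → ℂ} {H' : ℂ} {A : Plane} {c : ℂ} {x : Plane}
    (h : HasDerivAt H H' (toDisk A c x)) :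
    HasFDerivAt (fun y => H (toDisk A c y))
      ((H' / c) • (cplx.toContinuousLinearEquiv : Plane →L[ℝ] ℂ)) x := by
  have h1 : HasFDerivAt (toDisk A c)
      ((1 / c) • (cplx.toContinuousLinearEquiv : Plane →L[ℝ] ℂ)) x := by
    have h2 : HasFDerivAt (fun y : Plane => cplx (y - A))
        (cplx.toContinuousLinearEquiv : Plane →L[ℝ] ℂ) x := by
      have := (cplx.toContinuousLinearEquiv : Plane →L[ℝ] ℂ).hasFDerivAt (x := x - A)
      exact this.comp x ((hasFDerivAt_id x).sub_const A)
    have h3 := h2.const_smul (1 / c)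
    refine h3.congr_of_eventuallyEq (Eventually.of_forall fun y => ?_)
    simp [toDisk, div_eq_inv_mul]
  have h4 := (h.hasFDerivAt.restrictScalars ℝ).comp x h1
  refine h4.congr_fderiv ?_
  ext v
  simp
  ring

lemma pd_im_comp_toDisk {H : ℂ → ℂ} {H' : ℂ} {A : Plane} {c : ℂ} {x : Plane}
    (h : HasDerivAt H H' (toDisk A c x)) :
    pd 0 (fun y => (H (toDisk A c y)).im) x = (H' / c).im ∧
      pd 1 (fun y => (H (toDisk A c y)).im) x = (H' / c).re := by
  have h1 := Complex.imCLM.hasFDerivAt.comp x (hasFDerivAt_comp_toDisk h)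
  have h2 : ∀ i, pd i (fun y => (H (toDisk A c y)).im) x = (H' / c * cplx (unitVec i)).im := by
    intro i
    have e : (fun y => (H (toDisk A c y)).im) = Complex.imCLM ∘ fun y => H (toDisk A c y) := rfl
    rw [pd, e, h1.fderiv]
    rfl
  constructor <;> rw [h2, cplx_apply] <;> simp

lemma pd_re_comp_toDisk {H : ℂ → ℂ} {H' : ℂ} {A : Plane} {c : ℂ} {x : Plane}
    (h : HasDerivAt H H' (toDisk A c x)) :
    pd 1 (fun y => (H (toDisk A c y)).re) x = -(H' / c).im := by
  have h1 := Complex.reCLM.hasFDerivAt.comp x (hasFDerivAt_comp_toDisk h)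
  have e : (fun y => (H (toDisk A c y)).re) = Complex.reCLM ∘ fun y => H (toDisk A c y) := rfl
  have h2 : pd 1 (fun y => (H (toDisk A c y)).re) x = (H' / c * cplx (unitVec 1)).re := by
    rw [pd, e, h1.fderiv]
    rfl
  rw [h2, cplx_apply]; simp

lemma continuous_toDisk (A : Plane) (c : ℂ) : Continuous (toDisk A c) := by
  unfold toDisk
  exact (cplx.continuous.comp (continuous_id.sub continuous_const)).div_const c

lemma contDiff_toDisk (A : Plane) (c : ℂ) : ContDiff ℝ ∞ (toDisk A c) := by
  unfold toDisk
  exact (cplx.toContinuousLinearEquiv.contDiff.comp (contDiff_id.sub contDiff_const)).div_const c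

lemma norm_toDisk (A : Plane) (c : ℂ) (x : Plane) : ‖toDisk A c x‖ = dist x A / ‖c‖ := by
  rw [toDisk, norm_div, LinearIsometryEquiv.norm_map, dist_eq_norm]

/-- The imaginary part of a holomorphic function is harmonic. -/
lemma im_comp_toDisk {F F' : ℂ → ℂ} {U : Set ℂ} (hU : IsOpen U)
    (hF : ∀ w ∈ U, HasDerivAt F (F' w) w) (A : Plane) (c : ℂ) :
    ContDiffOn ℝ 2 (fun x => (F (toDisk A c x)).im) (toDisk A c ⁻¹' U) ∧
    (∀ x, toDisk A c x ∈ U → pd 0 (pd 0 fun x => (F (toDisk A c x)).im) x +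
      pd 1 (pd 1 fun x => (F (toDisk A c x)).im) x = 0) ∧
    ∀ x, toDisk A c x ∈ U →
      ‖gradient (fun x => (F (toDisk A c x)).im) x‖ = ‖F' (toDisk A c x)‖ / ‖c‖ := by
  set g : Plane → ℝ := fun x => (F (toDisk A c x)).im with hg
  have hFd : DifferentiableOn ℂ F U := fun w hw => (hF w hw).differentiableAt.differentiableWithinAt
  have hF'd : DifferentiableOn ℂ F' U := by
    refine (hFd.deriv hU).congr fun w hw => ?_
    exact ((hF w hw).deriv).symm
  refine ⟨?_, fun x hx => ?_, fun x hx => ?_⟩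
  · have h1 : ContDiffOn ℝ 2 F U := (hFd.contDiffOn hU).restrict_scalars ℝ
    exact Complex.imCLM.contDiff.comp_contDiffOn
      (h1.comp (contDiff_infty.1 (contDiff_toDisk A c) 2).contDiffOn (fun _ h => h))
  · have hV : ∀ᶠ y in 𝓝 x, toDisk A c y ∈ U :=
      (continuous_toDisk A c).continuousAt.eventually (hU.mem_nhds hx)
    -- By the Cauchy–Riemann equations, both partial derivatives of $\operatorname{Im}F$ are parts
    -- of $F'/c$, so the same formulas apply once more and the second derivatives cancel.
    have e0 : pd 0 g =ᶠ[𝓝 x] fun y => (F' (toDisk A c y) / c).im := by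
      filter_upwards [hV] with y hy
      exact (pd_im_comp_toDisk (hF _ hy)).1
    have e1 : pd 1 g =ᶠ[𝓝 x] fun y => (F' (toDisk A c y) / c).re := by
      filter_upwards [hV] with y hy
      exact (pd_im_comp_toDisk (hF _ hy)).2
    have h1 : HasDerivAt (fun w => F' w / c) (deriv F' (toDisk A c x) / c) (toDisk A c x) :=
      ((hF'd.differentiableAt (hU.mem_nhds hx)).hasDerivAt).div_const c
    have h2 := (pd_im_comp_toDisk h1).1
    have h3 := pd_re_comp_toDisk h1
    rw [pd, e0.fderiv_eq, pd, e1.fderiv_eq]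
    rw [pd] at h2 h3
    rw [h2, h3, add_neg_cancel]
  · rw [← norm_div, EuclideanSpace.norm_eq, Complex.norm_def, Complex.normSq_apply,
      Fin.sum_univ_two, gradient_apply, gradient_apply, (pd_im_comp_toDisk (hF _ hx)).1,
      (pd_im_comp_toDisk (hF _ hx)).2, Real.norm_eq_abs, Real.norm_eq_abs, sq_abs, sq_abs]
    congr 1; ring

/-- Apply $\log x\le x-1$ to $\sqrt r$ and to its inverse. This puts the logarithm under the weight
with exponent $1/2$. -/
lemma abs_log_le_sqrt {r : ℝ} (hr : 0 < r) : √r * |Real.log r| ≤ 2 * r + 2 := by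
  have hs : 0 < √r := Real.sqrt_pos.2 hr
  have hsq : √r * √r = r := Real.mul_self_sqrt hr.le
  have h1 := Real.log_le_sub_one_of_pos hs
  have h2 := Real.log_le_sub_one_of_pos (inv_pos.2 hs)
  rw [Real.log_inv] at h2
  have h3 : Real.log r = 2 * Real.log √r := by rw [Real.log_sqrt hr.le]; ring
  have h4 : √r * (√r)⁻¹ = 1 := mul_inv_cancel₀ hs.ne'
  rw [h3, abs_mul, abs_two]
  rcases abs_cases (Real.log √r) with ⟨h, _⟩ | ⟨h, _⟩ <;> rw [h] <;> nlinarith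

/-- The singular functions in polar coordinates are imaginary parts of holomorphic functions on the
slit plane. -/
lemma IsSingularProfile.exists_holomorphic {p : ℕ} {σ : ℝ → ℝ → ℝ} (h : IsSingularProfile p σ)
    {R : ℝ} (hR : 0 < R) (τ : ℝ) :
    ∃ (F F' : ℂ → ℂ) (γ : ℝ), 0 ≤ γ ∧ γ < 1 ∧
      (∀ w ∈ Complex.slitPlane, HasDerivAt F (F' w) w) ∧
      (∀ w ∈ Complex.slitPlane, σ (R * ‖w‖) (τ + w.arg) = (F w).im) ∧
      ∀ W : ℝ, ∃ C : ℝ, ∀ w ∈ Complex.slitPlane, ‖w‖ ≤ W →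
        ‖F w‖ ≤ C ∧ ‖F' w‖ ≤ C * ‖w‖ ^ (-γ) := by
  -- The logarithm in the given polar coordinates: its real part is the logarithm of the radius `R *
  -- ‖w‖`, and its imaginary part is the angle `τ + w.arg`.
  set L : ℂ → ℂ := fun w => Complex.log w + (Real.log R + τ * Complex.I) with hL
  have hLd : ∀ w ∈ Complex.slitPlane, HasDerivAt L w⁻¹ w := fun w hw =>
    (Complex.hasDerivAt_log hw).add_const _
  have hw0 : ∀ w ∈ Complex.slitPlane, 0 < ‖w‖ := fun w hw =>
    norm_pos_iff.2 (Complex.slitPlane_ne_zero hw)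
  have hLre : ∀ w ∈ Complex.slitPlane, (L w).re = Real.log (R * ‖w‖) := by
    intro w hw
    rw [Real.log_mul hR.ne' (hw0 w hw).ne']
    simp [hL, Complex.log_re]; ring
  have hLim : ∀ w, (L w).im = τ + w.arg := by
    intro w
    simp [hL, Complex.log_im]; ring
  have hexp : ∀ a : ℝ, ∀ w ∈ Complex.slitPlane, ‖Complex.exp (a * L w)‖ = (R * ‖w‖) ^ a := by
    intro a w hw
    rw [Complex.norm_exp, Complex.re_ofReal_mul, hLre w hw,
      Real.rpow_def_of_pos (mul_pos hR (hw0 w hw)), mul_comm]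
  have hexpim : ∀ a : ℝ, ∀ w ∈ Complex.slitPlane, (Complex.exp (a * L w)).im =
      (R * ‖w‖) ^ a * Real.sin (a * (τ + w.arg)) := by
    intro a w hw
    rw [Complex.exp_im, Complex.re_ofReal_mul, Complex.im_ofReal_mul, hLre w hw, hLim,
      Real.rpow_def_of_pos (mul_pos hR (hw0 w hw)), mul_comm a (Real.log _)]
  have hexpre : ∀ a : ℝ, ∀ w ∈ Complex.slitPlane, (Complex.exp (a * L w)).re =
      (R * ‖w‖) ^ a * Real.cos (a * (τ + w.arg)) := by
    intro a w hw
    rw [Complex.exp_re, Complex.re_ofReal_mul, Complex.im_ofReal_mul, hLre w hw, hLim,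
      Real.rpow_def_of_pos (mul_pos hR (hw0 w hw)), mul_comm a (Real.log _)]
  rcases h with ⟨α, hα, rfl⟩ | ⟨n, hn, -, rfl⟩
  -- The derivative has size $|w|^{\alpha-1}$, unbounded at 0 only if $\alpha<1$, hence the exponent
  -- `max (1 - α) 0`.
  · refine ⟨fun w => Complex.exp (α * L w), fun w => Complex.exp (α * L w) * (α * w⁻¹),
      max (1 - α) 0, le_max_right _ _, max_lt (by linarith) zero_lt_one, fun w hw => ?_,
      fun w hw => ?_, fun W => ?_⟩
    · exact ((hLd w hw).const_mul (α : ℂ)).cexp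
    · rw [hexpim α w hw]
    · set Q := max W 1 with hQ
      have hQ1 : 1 ≤ Q := le_max_right _ _
      refine ⟨(R * Q) ^ α + R ^ α * α * Q ^ α, fun w hw hwW => ?_⟩
      have hwp := hw0 w hw
      have hwQ : ‖w‖ ≤ Q := hwW.trans (le_max_left _ _)
      have hQ0 : 0 < Q := by linarith
      constructor
      · rw [hexp α w hw]
        have : (R * ‖w‖) ^ α ≤ (R * Q) ^ α := by gcongr
        have : 0 ≤ R ^ α * α * Q ^ α := by positivity
        linarith
      · rw [norm_mul, hexp α w hw, norm_mul, norm_inv, Complex.norm_real, Real.norm_of_nonneg hα.le]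
        have h1 : (R * ‖w‖) ^ α * (α * ‖w‖⁻¹) = R ^ α * α * ‖w‖ ^ (α - 1) := by
          rw [Real.mul_rpow hR.le hwp.le, Real.rpow_sub_one hwp.ne']
          ring
        have h2 : ‖w‖ ^ (α - 1) ≤ Q ^ α * ‖w‖ ^ (-(max (1 - α) 0)) := by
          rcases le_total α 1 with h | h
          · rw [max_eq_left (by linarith), neg_sub]
            have : 1 ≤ Q ^ α := Real.one_le_rpow hQ1 hα.le
            have h3 : 0 ≤ ‖w‖ ^ (α - 1) := by positivity
            nlinarith
          · rw [max_eq_right (by linarith), neg_zero, Real.rpow_zero, mul_one]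
            calc ‖w‖ ^ (α - 1) ≤ Q ^ (α - 1) := Real.rpow_le_rpow hwp.le hwQ (by linarith)
              _ ≤ Q ^ α := Real.rpow_le_rpow_of_exponent_le hQ1 (by linarith)
        rw [h1]
        have h3 : 0 ≤ ‖w‖ ^ (-(max (1 - α) 0)) := by positivity
        have h4 : 0 ≤ (R * Q) ^ α * ‖w‖ ^ (-(max (1 - α) 0)) := by positivity
        have h5 : R ^ α * α * ‖w‖ ^ (α - 1) ≤
            R ^ α * α * (Q ^ α * ‖w‖ ^ (-(max (1 - α) 0))) := by gcongr
        linarith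
  · obtain ⟨k, rfl⟩ : ∃ k, n = k + 1 := ⟨n - 1, by omega⟩
    set a : ℝ := ((k + 1 : ℕ) : ℝ) with ha
    have ha0 : 0 ≤ a := by positivity
    -- The imaginary part of $Le^{aL}$ is $r^a(\log r\sin(a\theta)+\theta\cos(a\theta))$. As
    -- $a\ge1$, the derivative is at worst logarithmic at 0, and any positive exponent would do.
    refine ⟨fun w => L w * Complex.exp (a * L w),
      fun w => w⁻¹ * Complex.exp (a * L w) + L w * (Complex.exp (a * L w) * (a * w⁻¹)),
      1 / 2, by norm_num, by norm_num, fun w hw => ?_, fun w hw => ?_, fun W => ?_⟩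
    · exact (hLd w hw).mul ((hLd w hw).const_mul (a : ℂ)).cexp
    · rw [Complex.mul_im, hexpim a w hw, hexpre a w hw, hLre w hw, hLim, ha, Real.rpow_natCast]
      ring
    · set Q := max (R * W) 1 with hQ
      have hQ1 : 1 ≤ Q := le_max_right _ _
      set T := |τ| + Real.pi with hT
      have hT0 : 0 ≤ T := by positivity
      refine ⟨Q ^ k * Q * ((4 + T) * Q) + R * Q ^ k * (Q + a * ((4 + T) * Q)) * R ^ (-(1 / 2) : ℝ),
        fun w hw hwW => ?_⟩
      have hwp := hw0 w hw
      set r := R * ‖w‖ with hr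
      have hr0 : 0 < r := by positivity
      have hrQ : r ≤ Q := (mul_le_mul_of_nonneg_left hwW hR.le).trans (le_max_left _ _)
      have hsQ : √r ≤ Q := by
        rw [Real.sqrt_le_left (by linarith)]
        nlinarith
      have hs0 : 0 < √r := Real.sqrt_pos.2 hr0
      have hss : √r * √r = r := Real.mul_self_sqrt hr0.le
      have hLn : √r * ‖L w‖ ≤ (4 + T) * Q := by
        have h1 : ‖L w‖ ≤ |Real.log r| + T := by
          refine (Complex.norm_le_abs_re_add_abs_im _).trans ?_
          rw [hLre w hw, hLim]
          have := (abs_add_le τ w.arg).trans (add_le_add_right (Complex.abs_arg_le_pi w) _)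
          linarith
        have h2 := abs_log_le_sqrt hr0
        calc √r * ‖L w‖ ≤ √r * (|Real.log r| + T) := by gcongr
          _ ≤ 2 * r + 2 + √r * T := by rw [mul_add]; linarith
          _ ≤ _ := by nlinarith [mul_le_mul_of_nonneg_right hsQ hT0]
      have hen : ‖Complex.exp (a * L w)‖ = r ^ k * r := by
        rw [hexp a w hw, ha, Real.rpow_natCast, pow_succ]
      have hQ0 : 0 < Q := by linarith
      have hrk : r ^ k ≤ Q ^ k := pow_le_pow_left₀ hr0.le hrQ k
      have hwr : r ^ (-(1 / 2) : ℝ) = R ^ (-(1 / 2) : ℝ) * ‖w‖ ^ (-(1 / 2) : ℝ) :=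
        Real.mul_rpow hR.le hwp.le
      have hrs : r ^ (-(1 / 2) : ℝ) = (√r)⁻¹ := by
        rw [Real.sqrt_eq_rpow, Real.rpow_neg hr0.le]
      constructor
      · rw [norm_mul, hen]
        have h1 : ‖L w‖ * (r ^ k * r) = r ^ k * √r * (√r * ‖L w‖) := by
          linear_combination (-(r ^ k * ‖L w‖)) * hss
        have h2 : r ^ k * √r * (√r * ‖L w‖) ≤ Q ^ k * Q * ((4 + T) * Q) := by gcongr
        rw [h1]
        have : 0 ≤ R * Q ^ k * (Q + a * ((4 + T) * Q)) * R ^ (-(1 / 2) : ℝ) := by positivity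
        linarith
      · have h1 : ‖w⁻¹ * Complex.exp (a * L w) + L w * (Complex.exp (a * L w) * (a * w⁻¹))‖ ≤
            ‖w‖⁻¹ * (r ^ k * r) * (1 + a * ‖L w‖) := by
          refine (norm_add_le _ _).trans (le_of_eq ?_)
          rw [norm_mul, norm_mul, norm_mul, norm_mul, norm_inv, hen, Complex.norm_real,
            Real.norm_of_nonneg ha0]
          ring
        have h2 : ‖w‖⁻¹ * (r ^ k * r) * (1 + a * ‖L w‖) =
            R * r ^ k * (√r + a * (√r * ‖L w‖)) * r ^ (-(1 / 2) : ℝ) := by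
          rw [hrs]
          have : ‖w‖⁻¹ * r = R := by rw [hr]; field_simp
          rw [← this]
          field_simp
        have h3 : R * r ^ k * (√r + a * (√r * ‖L w‖)) * r ^ (-(1 / 2) : ℝ) ≤
            R * Q ^ k * (Q + a * ((4 + T) * Q)) * r ^ (-(1 / 2) : ℝ) := by gcongr
        rw [hwr] at h3
        have h4 : 0 ≤ Q ^ k * Q * ((4 + T) * Q) * ‖w‖ ^ (-(1 / 2) : ℝ) := by positivity
        refine h1.trans (h2.le.trans ?_)
        rw [hwr]
        refine h3.trans ?_
        rw [add_mul]
        linarith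

/-! ### The polar angle -/

lemma eq_of_continuousOn_of_mem_zmultiples {f : ℝ → ℝ} (hf : ContinuousOn f (Icc 0 1))
    (hi : ∀ s ∈ Icc (0 : ℝ) 1, ∃ k : ℤ, f s = 2 * Real.pi * k) : f 0 = f 1 := by
  obtain ⟨k, hk⟩ := hi 0 (by simp)
  obtain ⟨l, hl⟩ := hi 1 (by simp)
  have hπ := Real.pi_pos
  -- By the intermediate value theorem, a value halfway between two multiples of $2\pi$ would be
  -- attained.
  have key : ∀ m : ℤ, 2 * Real.pi * m + Real.pi ∉ uIcc (f 0) (f 1) := by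
    intro m hm
    have hf' : ContinuousOn f (uIcc 0 1) := by rwa [uIcc_of_le zero_le_one]
    obtain ⟨s, hs, e⟩ := intermediate_value_uIcc hf' hm
    rw [uIcc_of_le zero_le_one] at hs
    obtain ⟨n, hn⟩ := hi s hs
    rw [hn] at e
    have e1 : Real.pi * (2 * (n : ℝ)) = Real.pi * (2 * m + 1) := by linarith
    have e2 := mul_left_cancel₀ hπ.ne' e1
    have e3 : 2 * n = 2 * m + 1 := by exact_mod_cast e2
    omega
  rcases lt_trichotomy k l with h | h | h
  · refine absurd ?_ (key k)
    have : (k : ℝ) + 1 ≤ l := by exact_mod_cast h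
    rw [mem_uIcc, hk, hl]
    left
    constructor <;> nlinarith
  · rw [hk, hl, h]
  · refine absurd ?_ (key l)
    have : (l : ℝ) + 1 ≤ k := by exact_mod_cast h
    rw [mem_uIcc, hk, hl]
    right
    constructor <;> nlinarith

lemma exists_int_of_cos_sin {a b : ℝ} (h1 : Real.cos a = Real.cos b) (h2 : Real.sin a = Real.sin b) :
    ∃ k : ℤ, a - b = 2 * Real.pi * k :=
  Real.Angle.angle_eq_iff_two_pi_dvd_sub.1 (Real.Angle.cos_sin_inj h1 h2)

/-- There is no continuous determination of the polar angle around `A`. -/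
lemma IsPolarAngle.notMem {A : Plane} {U K : Set Plane} {θ : Plane → ℝ} (h : IsPolarAngle A U θ)
    (hK : IsOpen K) (hKU : K ⊆ U) : A ∉ K := by
  intro hA
  obtain ⟨hc, β, hβ⟩ := h
  obtain ⟨ε, hε, hball⟩ := Metric.isOpen_iff.1 hK A hA
  set e : ℝ → Plane := fun s => !₂[Real.cos (2 * Real.pi * s), Real.sin (2 * Real.pi * s)] with he
  have hen : ∀ s, ‖e s‖ = 1 := by
    intro s
    rw [EuclideanSpace.norm_eq]
    simp [he, Fin.sum_univ_two]
  have hec : Continuous e := by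
    rw [he]
    refine (PiLp.continuous_toLp 2 _).comp (continuous_pi fun i => ?_)
    fin_cases i
    · change Continuous fun s => Real.cos (2 * Real.pi * s); fun_prop
    · change Continuous fun s => Real.sin (2 * Real.pi * s); fun_prop
  set y : ℝ → Plane := fun s => A + (ε / 2) • e s with hy
  have hyd : ∀ s, dist (y s) A = ε / 2 := by
    intro s
    rw [hy, dist_eq_norm, add_sub_cancel_left, norm_smul, hen, mul_one,
      Real.norm_of_nonneg (by linarith)]
  have hyU : ∀ s, y s ∈ U := fun s => hKU (hball (by rw [Metric.mem_ball, hyd]; linarith))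
  have hyc : Continuous y := by rw [hy]; fun_prop
  have hθ : Continuous fun s => θ (y s) := hc.comp_continuous hyc hyU
  -- On a small circle around `A`, the angle minus $2\pi s$ is continuous with values in
  -- $2\pi\mathbb Z$, hence the same at both ends; but the circle closes up, so that `θ` has the
  -- same value there and $2\pi s$ has not.
  have hk := eq_of_continuousOn_of_mem_zmultiples
    (f := fun s => β + θ (y s) - 2 * Real.pi * s) ((continuous_const.add hθ).sub
      (continuous_const.mul continuous_id)).continuousOn (fun s _ => by
      have h1 := hβ (y s) (hyU s)
      rw [hyd] at h1
      have h2 : e s = !₂[Real.cos (β + θ (y s)), Real.sin (β + θ (y s))] := by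
        have h3 : (ε / 2) • e s = (ε / 2) • !₂[Real.cos (β + θ (y s)), Real.sin (β + θ (y s))] :=
          add_left_cancel (a := A) h1
        exact smul_right_injective _ (by linarith : ε / 2 ≠ 0) h3
      have h4 := congrArg (fun v : Plane => v 0) h2
      have h5 := congrArg (fun v : Plane => v 1) h2
      simp only [he] at h4 h5
      exact exists_int_of_cos_sin (by simpa using h4.symm) (by simpa using h5.symm))
  have e01 : y 0 = y 1 := by
    have : e 0 = e 1 := by
      ext i; fin_cases i <;> simp [he]
    rw [hy]; simp only [this]
  simp only [e01, mul_zero, mul_one] at hk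
  linarith [Real.pi_pos]

namespace IsStarDomain

variable {K : Set Plane} {z : Plane} {ρ : ℝ} {A : Plane}

lemma toDisk_add_smul (hzA : z ≠ A) (x : Plane) (s : ℝ) :
    toDisk A (cplx (z - A)) (z + s • (x - z)) = 1 + s * (toDisk A (cplx (z - A)) x - 1) := by
  have h0 : cplx (z - A) ≠ 0 := by
    rw [Ne, LinearIsometryEquiv.map_eq_zero_iff, sub_eq_zero]; exact hzA
  have e : z + s • (x - z) - A = (z - A) + s • ((x - A) - (z - A)) := by module
  rw [toDisk, toDisk, e]
  generalize z - A = b at h0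
  rw [map_add, map_smul, map_sub, Complex.real_smul]
  field_simp

/-- A point on the slit is opposite to `z` as seen from `A`, so `A` is on the segment from `z` to
it; then star-shapedness would place `A` inside `K`. -/
lemma toDisk_mem_slitPlane (hK : IsStarDomain K z ρ) (hA : A ∉ K) {x : Plane}
    (hx : x ∈ closure K) (hxA : x ≠ A) : toDisk A (cplx (z - A)) x ∈ Complex.slitPlane := by
  have hzA : z ≠ A := fun e => hA (e ▸ hK.mem_center)
  have h0 : cplx (z - A) ≠ 0 := by
    rw [Ne, LinearIsometryEquiv.map_eq_zero_iff, sub_eq_zero]; exact hzA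
  by_contra hcon
  rw [Complex.mem_slitPlane_iff, not_or, not_lt, not_not] at hcon
  set w := toDisk A (cplx (z - A)) x with hw
  have hw0 : w ≠ 0 := by
    rw [hw, toDisk, Ne, div_eq_zero_iff, not_or, LinearIsometryEquiv.map_eq_zero_iff, sub_eq_zero]
    exact ⟨hxA, h0⟩
  have hre : w.re < 0 := lt_of_le_of_ne hcon.1 fun h => hw0 (Complex.ext h hcon.2)
  have hwr : w = (w.re : ℂ) := Complex.ext (by simp) (by simp [hcon.2])
  set s := (1 - w.re)⁻¹ with hs
  have h1 : 0 < 1 - w.re := by linarith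
  have hs0 : 0 ≤ s := inv_nonneg.2 h1.le
  have hs1 : s < 1 := inv_lt_one_of_one_lt₀ (by linarith)
  have h2 := toDisk_add_smul hzA x s
  rw [← hw, hwr] at h2
  have h3 : (1 : ℂ) + s * ((w.re : ℂ) - 1) = 0 := by
    have : 1 + s * (w.re - 1) = 0 := by rw [hs]; field_simp; ring
    exact_mod_cast this
  rw [h3, toDisk, div_eq_zero_iff, or_iff_left h0, LinearIsometryEquiv.map_eq_zero_iff,
    sub_eq_zero] at h2
  exact hA (h2 ▸ hK.add_smul_mem_of_closure hx hs0 hs1)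

/-- The two sides differ by a multiple of $2\pi$ everywhere on the segment from `z` to `x`, depend
continuously on the point of the segment, and agree at `z`. -/
lemma polarAngle_eq (hK : IsStarDomain K z ρ) {U : Set Plane} {θ : Plane → ℝ}
    (h : IsPolarAngle A U θ) (hKU : K ⊆ U) {x : Plane} (hx : x ∈ K) :
    θ x = θ z + (toDisk A (cplx (z - A)) x).arg := by
  have hA := h.notMem hK.isOpen hKU
  obtain ⟨hc, β, hβ⟩ := h
  have hzA : z ≠ A := fun e => hA (e ▸ hK.mem_center)
  set c := cplx (z - A) with hcdef
  have hc0 : c ≠ 0 := by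
    rw [Ne, hcdef, LinearIsometryEquiv.map_eq_zero_iff, sub_eq_zero]; exact hzA
  have hpol : ∀ y ∈ K, cplx (y - A) = dist y A * Complex.exp ((β + θ y : ℝ) * Complex.I) := by
    intro y hy
    have h1 := hβ y (hKU hy)
    have h2 : y - A = dist y A • !₂[Real.cos (β + θ y), Real.sin (β + θ y)] := by
      conv_lhs => rw [h1]
      rw [add_sub_cancel_left]
    rw [h2, map_smul, cplx_apply, Complex.real_smul, Complex.exp_mul_I]
    simp
  have harg : ∀ y ∈ K, ∃ k : ℤ, θ y - θ z - (toDisk A c y).arg = 2 * Real.pi * k := by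
    intro y hy
    have hyA : 0 < dist y A := dist_pos.2 fun e => hA (e ▸ hy)
    have hzA' : 0 < dist z A := dist_pos.2 hzA
    have h1 : toDisk A c y = (dist y A / dist z A : ℝ) *
        (Complex.cos (θ y - θ z : ℝ) + Complex.sin (θ y - θ z : ℝ) * Complex.I) := by
      rw [toDisk, hcdef, hpol y hy, hpol z hK.mem_center, ← Complex.exp_mul_I, mul_div_mul_comm,
        ← Complex.exp_sub]
      push_cast
      congr 2
      ring
    have h2 := Complex.arg_mul_cos_add_sin_mul_I_coe_angle
      (div_pos hyA hzA') ((θ y - θ z : ℝ) : Real.Angle)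
    simp only [Real.Angle.cos_coe, Real.Angle.sin_coe, Complex.ofReal_cos, Complex.ofReal_sin] at h2
    rw [← h1] at h2
    exact Real.Angle.angle_eq_iff_two_pi_dvd_sub.1 h2.symm
  have hseg : ∀ s ∈ Icc (0 : ℝ) 1, z + s • (x - z) ∈ K := fun s hs =>
    hK.add_smul_mem (Metric.mem_ball_self hK.pos) hx hs.1 hs.2
  have hk := eq_of_continuousOn_of_mem_zmultiples
    (f := fun s => θ (z + s • (x - z)) - θ z - (toDisk A c (z + s • (x - z))).arg) ?_
    (fun s hs => harg _ (hseg s hs))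
  · simp only [zero_smul, add_zero, one_smul, add_sub_cancel, sub_self] at hk
    have hz1 : toDisk A c z = 1 := by rw [toDisk, hcdef, div_self hc0]
    rw [hz1, Complex.arg_one] at hk
    linarith
  · have hlin : ContinuousOn (fun s : ℝ => z + s • (x - z)) (Icc 0 1) := by fun_prop
    refine ((hc.comp hlin fun s hs => hKU (hseg s hs)).sub continuousOn_const).sub ?_
    intro s hs
    have hm : toDisk A c (z + s • (x - z)) ∈ Complex.slitPlane :=
      hK.toDisk_mem_slitPlane hA (subset_closure (hseg s hs)) fun e => hA (e ▸ hseg s hs)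
    have h1 : ContinuousAt (fun s : ℝ => toDisk A c (z + s • (x - z))) s :=
      ((continuous_toDisk A c).comp (by fun_prop : Continuous fun s : ℝ => z + s • (x - z))).continuousAt
    exact (ContinuousAt.comp (f := fun s : ℝ => toDisk A c (z + s • (x - z)))
      (Complex.continuousAt_arg hm) h1).continuousWithinAt

/-- On a star-shaped domain, the singular function extends beyond the boundary as a harmonic
function, except at the singular point. -/
theorem exists_isSingularOn (hK : IsStarDomain K z ρ) {U : Set Plane} {θ : Plane → ℝ}
    (hθ : IsPolarAngle A U θ) (hKU : K ⊆ U) {p : ℕ} {σ : ℝ → ℝ → ℝ} (hσ : IsSingularProfile p σ)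
    {h : ℝ} (hh : 0 < h) :
    ∃ γ V g C, IsSingularOn K A γ V g 0 C ∧ EqOn (fun x => σ (dist x A / h) (θ x)) g K := by
  have hA := hθ.notMem hK.isOpen hKU
  have hzA : z ≠ A := fun e => hA (e ▸ hK.mem_center)
  set c := cplx (z - A) with hcdef
  have hcn : ‖c‖ = dist z A := by rw [hcdef, LinearIsometryEquiv.norm_map, dist_eq_norm]
  have hc0 : 0 < ‖c‖ := by rw [hcn]; exact dist_pos.2 hzA
  -- In the coordinate that sends `A` to 0 and `z` to 1, the radius is measured in units of `‖c‖`
  -- and the angle starts at `θ z`.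
  obtain ⟨F, F', γ, hγ0, hγ1, hF, hFσ, hFb⟩ := hσ.exists_holomorphic (div_pos hc0 hh) (θ z)
  obtain ⟨hcd, hlap, hgrad⟩ := im_comp_toDisk Complex.isOpen_slitPlane hF A c
  obtain ⟨W, hW⟩ := hK.isBounded.isCompact_closure.exists_bound_of_continuousOn
    (continuous_toDisk A c).continuousOn
  obtain ⟨C, hC⟩ := hFb W
  have hmem : ∀ x ∈ closure K \ {A}, toDisk A c x ∈ Complex.slitPlane := fun x hx =>
    hK.toDisk_mem_slitPlane hA hx.1 hx.2
  have hC0 : 0 ≤ C := by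
    have hz : z ∈ closure K \ {A} := ⟨subset_closure hK.mem_center, hzA⟩
    exact (norm_nonneg _).trans (hC _ (hmem z hz) (hW z hz.1)).1
  set C' := C * ‖c‖ ^ γ / ‖c‖ with hC'
  refine ⟨γ, toDisk A c ⁻¹' Complex.slitPlane, fun x => (F (toDisk A c x)).im, max C C',
    ⟨Complex.isOpen_slitPlane.preimage (continuous_toDisk A c), hmem, hcd, fun x hx => ?_,
      fun x hx => ?_, fun x hx => ?_, hA, hγ0, hγ1⟩, fun x hx => ?_⟩
  · rw [hlap x (hmem x ⟨subset_closure hx, fun e => hA (e ▸ hx)⟩), Pi.zero_apply]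
  · exact (Complex.abs_im_le_norm _).trans
      ((hC _ (hmem x hx) (hW x hx.1)).1.trans (le_max_left _ _))
  · rw [hgrad x (hmem x hx)]
    have h1 := (hC _ (hmem x hx) (hW x hx.1)).2
    rw [norm_toDisk, Real.div_rpow dist_nonneg hc0.le, Real.rpow_neg hc0.le, div_inv_eq_mul] at h1
    calc _ ≤ C * (dist x A ^ (-γ) * ‖c‖ ^ γ) / ‖c‖ := by gcongr
      _ = C' * dist x A ^ (-γ) := by rw [hC']; ring
      _ ≤ _ := by gcongr; exact le_max_right _ _
  · have hm := hmem x ⟨subset_closure hx, fun e => hA (e ▸ hx)⟩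
    simp only
    rw [← hFσ _ hm, hK.polarAngle_eq hθ hKU hx, norm_toDisk]
    congr 1
    field_simp

end IsStarDomain

end

/-! ### Polynomials, and the rescaling of the singular function -/

section

lemma pd_mem_polyLT {m : ℕ} (i : Fin 2) : ∀ f ∈ polyLT m, pd i f ∈ polyLT (m - 1) := by
  refine polyLT_induction (fun a b hab => ?_) ?_ (fun f hf g hg h h' => ?_) fun c f hf h => ?_
  · fin_cases i
    · change pd 0 _ ∈ _
      rw [pd_zero_monom]
      rcases Nat.eq_zero_or_pos a with rfl | ha
      · simp
      · exact Submodule.smul_mem _ _ (monom_mem_polyLT (by omega))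
    · change pd 1 _ ∈ _
      rw [pd_one_monom]
      rcases Nat.eq_zero_or_pos b with rfl | hb
      · simp
      · exact Submodule.smul_mem _ _ (monom_mem_polyLT (by omega))
  · have : pd i (0 : Plane → ℝ) = 0 := by
      ext x; simp [pd]
    rw [this]; exact Submodule.zero_mem _
  · rw [pd_add (contDiff_of_mem_polyLT f hf) (contDiff_of_mem_polyLT g hg)]
    exact Submodule.add_mem _ h h'
  · rw [pd_smul (contDiff_of_mem_polyLT f hf)]
    exact Submodule.smul_mem _ _ h

lemma coord_mul_mem_polyLT {m : ℕ} (i : Fin 2) :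
    ∀ f ∈ polyLT m, (fun x => x i * f x) ∈ polyLT (m + 1) := by
  refine polyLT_induction (fun a b hab => ?_) ?_ (fun f hf g hg h h' => ?_) fun c f hf h => ?_
  · fin_cases i
    · convert monom_mem_polyLT (a := a + 1) (b := b) (m := m + 1) (by omega) using 1
      ext x; simp [monom]; ring
    · convert monom_mem_polyLT (a := a) (b := b + 1) (m := m + 1) (by omega) using 1
      ext x; simp [monom]; ring
  · convert Submodule.zero_mem (polyLT (m + 1)) using 1
    ext x; simp
  · convert Submodule.add_mem _ h h' using 1
    ext x; simp [mul_add]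
  · convert Submodule.smul_mem _ c h using 1
    ext x; simp; ring

lemma sub_coord_mul_mem_polyLT {m : ℕ} (A : Plane) (i : Fin 2) {f : Plane → ℝ} (hf : f ∈ polyLT m) :
    (fun x => (x i - A i) * f x) ∈ polyLT (m + 1) := by
  convert Submodule.sub_mem _ (coord_mul_mem_polyLT i f hf)
    (Submodule.smul_mem _ (A i) (polyLT_mono (Nat.le_succ m) hf)) using 1
  ext x; simp; ring

lemma const_mem_polyLT (c : ℝ) {m : ℕ} (hm : 0 < m) : (fun _ => c) ∈ polyLT m := by
  convert Submodule.smul_mem _ c (monom_mem_polyLT (a := 0) (b := 0) (m := m) (by omega)) using 1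
  ext x; simp [monom]

/-- Supplies the harmonic polynomial $r^n\sin(n\theta)$; the factor `c` allows for the reference
direction of the angle. The induction needs real and imaginary part together. -/
lemma complex_pow_mem_polyLT (A : Plane) (c : ℂ) (n : ℕ) :
    (fun x => (c * cplx (x - A) ^ n).re) ∈ polyLT (n + 1) ∧
      (fun x => (c * cplx (x - A) ^ n).im) ∈ polyLT (n + 1) := by
  induction n with
  | zero => simpa using ⟨const_mem_polyLT c.re zero_lt_one, const_mem_polyLT c.im zero_lt_one⟩
  | succ n ih =>
    constructor
    · convert Submodule.sub_mem _ (sub_coord_mul_mem_polyLT A 0 ih.1)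
        (sub_coord_mul_mem_polyLT A 1 ih.2) using 1
      ext x
      simp only [Pi.sub_apply]
      rw [pow_succ, ← mul_assoc, Complex.mul_re, cplx_re, cplx_im]
      simp; ring
    · convert Submodule.add_mem _ (sub_coord_mul_mem_polyLT A 1 ih.1)
        (sub_coord_mul_mem_polyLT A 0 ih.2) using 1
      ext x
      simp only [Pi.add_apply]
      rw [pow_succ, ← mul_assoc, Complex.mul_im, cplx_re, cplx_im]
      simp; ring

/-- A change of the scaling parameter multiplies the singular function by a constant, up to adding a
polynomial. -/
lemma IsSingularProfile.rescale {p : ℕ} {σ : ℝ → ℝ → ℝ} (hσ : IsSingularProfile p σ) {A : Plane}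
    {U : Set Plane} {θ : Plane → ℝ} (hθ : IsPolarAngle A U θ) {h h' : ℝ} (hh : 0 < h)
    (hh' : 0 < h') : ∃ a : ℝ, ∃ P ∈ polyLT (p + 1), ∀ x ∈ U,
      σ (dist x A / h) (θ x) = a * σ (dist x A / h') (θ x) + P x := by
  rcases hσ with ⟨α, hα, rfl⟩ | ⟨n, hn, hnp, rfl⟩
  · refine ⟨(h' / h) ^ α, 0, Submodule.zero_mem _, fun x _ => ?_⟩
    have e : dist x A / h = h' / h * (dist x A / h') := by field_simp
    simp only [Pi.zero_apply, add_zero]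
    rw [e, Real.mul_rpow (by positivity) (by positivity)]
    ring
  · obtain ⟨-, β, hβ⟩ := hθ
    -- The rotation that turns the reference direction `β` back.
    set c : ℂ := Complex.exp ((-(n * β) : ℝ) * Complex.I) with hc
    -- The polynomial comes from $\log(r/h)=\log(r/h')+\log(h'/h)$.
    refine ⟨(h' / h) ^ n, (Real.log (h' / h) * (h⁻¹) ^ n) • fun x => (c * cplx (x - A) ^ n).im,
      Submodule.smul_mem _ _ (polyLT_mono (by omega) (complex_pow_mem_polyLT A c n).2),
      fun x hx => ?_⟩
    have hpol : (c * cplx (x - A) ^ n).im = dist x A ^ n * Real.sin (n * θ x) := by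
      have h2 : x - A = dist x A • !₂[Real.cos (β + θ x), Real.sin (β + θ x)] := by
        conv_lhs => rw [hβ x hx]
        rw [add_sub_cancel_left]
      have h3 : cplx (x - A) = dist x A * Complex.exp ((β + θ x : ℝ) * Complex.I) := by
        rw [h2, map_smul, cplx_apply, Complex.real_smul, Complex.exp_mul_I]
        simp
      have h4 : c * cplx (x - A) ^ n = (dist x A ^ n : ℝ) * Complex.exp ((n * θ x : ℝ) * Complex.I) := by
        rw [h3, mul_pow, ← Complex.exp_nat_mul, hc, mul_left_comm, ← Complex.exp_add]
        push_cast
        congr 2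
        ring
      rw [h4, Complex.im_ofReal_mul, Complex.exp_ofReal_mul_I_im]
    simp only [Pi.smul_apply, smul_eq_mul]
    rw [hpol]
    -- At `A` itself the logarithm rule is not available, but all terms vanish because $n\ge1$.
    rcases (dist_nonneg (x := x) (y := A)).eq_or_lt with h0 | h0
    · rw [← h0]
      have : n ≠ 0 := by omega
      simp [this]
    · rw [Real.log_div h0.ne' hh.ne', Real.log_div h0.ne' hh'.ne', Real.log_div hh'.ne' hh.ne']
      have e1 : (dist x A / h) ^ n = (h' / h) ^ n * (dist x A / h') ^ n := by
        rw [← mul_pow]; congr 1; field_simp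
      have e2 : (dist x A / h) ^ n = h⁻¹ ^ n * dist x A ^ n := by
        rw [← mul_pow, inv_mul_eq_div]
      linear_combination ((Real.log (dist x A) - Real.log h') * Real.sin (n * θ x) +
        θ x * Real.cos (n * θ x)) * e1 + (Real.log h' - Real.log h) * Real.sin (n * θ x) * e2

/-! ## Segments and arc length -/

/-- End points are the extreme points of a segment, here in the parameters along the second segment.
-/
lemma segment_eq_iff {a b c d : Plane} (h : segment ℝ a b = segment ℝ c d) :
    (a = c ∧ b = d) ∨ (a = d ∧ b = c) := by
  rcases eq_or_ne c d with rfl | hcd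
  · rw [segment_same] at h
    have h1 : a ∈ ({c} : Set Plane) := h ▸ left_mem_segment ℝ a b
    have h2 : b ∈ ({c} : Set Plane) := h ▸ right_mem_segment ℝ a b
    exact Or.inl ⟨h1, h2⟩
  have ha : a ∈ segment ℝ c d := h ▸ left_mem_segment ℝ a b
  have hb : b ∈ segment ℝ c d := h ▸ right_mem_segment ℝ a b
  have hc : c ∈ segment ℝ a b := h ▸ left_mem_segment ℝ c d
  have hd : d ∈ segment ℝ a b := h ▸ right_mem_segment ℝ c d
  rw [segment_eq_image_lineMap] at ha hb hc hd
  obtain ⟨α, ⟨hα0, hα1⟩, rfl⟩ := ha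
  obtain ⟨β, ⟨hβ0, hβ1⟩, rfl⟩ := hb
  obtain ⟨t, ⟨ht0, ht1⟩, e1⟩ := hc
  obtain ⟨s, ⟨hs0, hs1⟩, e2⟩ := hd
  have hinj := AffineMap.lineMap_injective ℝ hcd
  have k1 : (1 - t) * α + t * β = 0 := by
    refine hinj (Eq.trans ?_ (e1.trans (AffineMap.lineMap_apply_zero c d).symm))
    simp only [AffineMap.lineMap_apply_module']
    module
  have k2 : (1 - s) * α + s * β = 1 := by
    refine hinj (Eq.trans ?_ (e2.trans (AffineMap.lineMap_apply_one c d).symm))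
    simp only [AffineMap.lineMap_apply_module']
    module
  -- The numbers 0 and 1 are convex combinations of `α` and `β` in the unit interval, so each
  -- nonnegative summand must vanish.
  have m1 : (1 - t) * α = 0 := by nlinarith [mul_nonneg (sub_nonneg.2 ht1) hα0, mul_nonneg ht0 hβ0]
  have m2 : t * β = 0 := by linarith
  have m3 : (1 - s) * (1 - α) = 0 := by
    nlinarith [mul_nonneg (sub_nonneg.2 hs1) (sub_nonneg.2 hα1), mul_nonneg hs0 (sub_nonneg.2 hβ1)]
  have m4 : s * (1 - β) = 0 := by linarith
  have z1 : α = 0 ∨ β = 0 := by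
    rcases mul_eq_zero.1 m1 with h | h
    · right
      rcases mul_eq_zero.1 m2 with h' | h'
      · linarith
      · exact h'
    · exact Or.inl h
  have z2 : α = 1 ∨ β = 1 := by
    rcases mul_eq_zero.1 m4 with h | h
    · left
      rcases mul_eq_zero.1 m3 with h' | h'
      · linarith
      · linarith
    · right; linarith
  rcases z1 with rfl | rfl <;> rcases z2 with h' | h'
  · linarith
  · subst h'; simp
  · subst h'; simp
  · linarith

lemma arcLength_comm (a b : Plane) : arcLength a b = arcLength b a := by
  refine Measure.ext_of_lintegral _ fun g hg => ?_
  rw [lintegral_arcLength _ _ hg, lintegral_arcLength _ _ hg, dist_comm]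
  congr 1
  have hm := (Measure.measurePreserving_sub_left (volume : Measure ℝ) 1).setLIntegral_comp_preimage_emb
    (MeasurableEquiv.subLeft (1 : ℝ)).measurableEmbedding
    (fun t => g (AffineMap.lineMap a b t)) (Icc 0 1)
  rw [← hm]
  have : (fun x : ℝ => 1 - x) ⁻¹' Icc 0 1 = Icc 0 1 := by
    ext x; simp only [mem_preimage, mem_Icc]; constructor <;> rintro ⟨h1, h2⟩ <;> constructor <;> linarith
  rw [this]
  refine setLIntegral_congr_fun measurableSet_Icc fun t _ => ?_
  rw [AffineMap.lineMap_apply_one_sub]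

/-! ## Edges of a mesh -/

namespace Mesh

variable {Ω : Set Plane} {ι : Type} {M : Mesh Ω ι} {s s' s'' : M.Side}

lemma openSegment_eq_of_segment_eq {a b c d : Plane} (h : segment ℝ a b = segment ℝ c d) :
    openSegment ℝ a b = openSegment ℝ c d := by
  rcases segment_eq_iff h with ⟨rfl, rfl⟩ | ⟨rfl, rfl⟩
  · rfl
  · exact openSegment_symm ℝ _ _

lemma SameEdge.segment_eq (h : M.SameEdge s s') :
    segment ℝ (M.sideA s) (M.sideB s) = segment ℝ (M.sideA s') (M.sideB s') := by
  rcases h with rfl | ⟨_, h⟩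
  · rfl
  · exact h

lemma SameEdge.symm (h : M.SameEdge s s') : M.SameEdge s' s := by
  rcases h with rfl | ⟨h1, h2⟩
  · exact Or.inl rfl
  · exact Or.inr ⟨openSegment_eq_of_segment_eq h2 ▸ h1, h2.symm⟩

lemma SameEdge.trans (h : M.SameEdge s s') (h' : M.SameEdge s' s'') : M.SameEdge s s'' := by
  rcases h with rfl | ⟨h1, h2⟩
  · exact h'
  · exact Or.inr ⟨h1, h2.trans h'.segment_eq⟩

lemma SameEdge.sideMeasure_eq (h : M.SameEdge s s') : M.sideMeasure s = M.sideMeasure s' := by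
  rcases segment_eq_iff h.segment_eq with ⟨h1, h2⟩ | ⟨h1, h2⟩
  · rw [sideMeasure, sideMeasure, h1, h2]
  · rw [sideMeasure, sideMeasure, h1, h2, arcLength_comm]

/-- The enrichment collects the fluxes from all sides of one equivalence class, so the two elements
at an internal edge test with the same functions. -/
lemma SameEdge.enrichedEdge_eq (h : M.SameEdge s s') (S : Enrichment) (p : ℕ) :
    M.enrichedEdge S p s = M.enrichedEdge S p s' := by
  unfold enrichedEdge
  congr 2
  ext g
  exact ⟨fun ⟨t, h1, h2⟩ => ⟨t, h.symm.trans h1, h2⟩, fun ⟨t, h1, h2⟩ => ⟨t, h.trans h1, h2⟩⟩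

end Mesh

end

/-! ### The normal derivative of the singular function on the edges of a mesh -/

section

namespace IsSingularOn

variable {K : Set Plane} {A : Plane} {γ : ℝ} {V : Set Plane} {g q f : Plane → ℝ} {C : ℝ}

/-- The function `f` is known only inside `K`; its gradient at a boundary point is a limit from
inside, equal to the gradient of the extension `g`. -/
lemma tendsto_gradient (h : IsSingularOn K A γ V g q C) (hK : IsOpen K) (hf : EqOn f g K)
    {x : Plane} (hx : x ∈ closure K \ {A}) :
    Tendsto (gradient f) (𝓝[K] x) (𝓝 (gradient g x)) := by
  have h1 : Tendsto (gradient g) (𝓝[K] x) (𝓝 (gradient g x)) :=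
    ((h.continuousOn_gradient.continuousAt (h.isOpen.mem_nhds (h.closure_subset hx))).tendsto).mono_left
      nhdsWithin_le_nhds
  refine h1.congr' ?_
  filter_upwards [self_mem_nhdsWithin] with y hy
  have : f =ᶠ[𝓝 y] g := hf.eventuallyEq_of_mem (hK.mem_nhds hy)
  rw [gradient, gradient, this.fderiv_eq]

lemma differentiableAt (h : IsSingularOn K A γ V g q C) (hK : IsOpen K) (hf : EqOn f g K)
    {x : Plane} (hx : x ∈ K) : DifferentiableAt ℝ f x := by
  have h1 : DifferentiableAt ℝ g x := (h.contDiffOn.differentiableOn (by norm_num)).differentiableAt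
    (h.isOpen.mem_nhds (h.subset hx))
  exact h1.congr_of_eventuallyEq (hf.eventuallyEq_of_mem (hK.mem_nhds hx))

end IsSingularOn

namespace Mesh

variable {Ω : Set Plane} {ι : Type} {M : Mesh Ω ι} {S : Enrichment} {p : ℕ}

/-- The properties of the mesh and of the enrichment that do not involve constants. -/
structure Admissible (M : Mesh Ω ι) (S : Enrichment) (p : ℕ) : Prop where
  star : ∀ k, ∃ z ρ, IsStarDomain (M.elem k).body z ρ
  profile : IsSingularProfile p S.σ
  angle : IsPolarAngle S.A (M.firstPatch S) S.θ

lemma body_subset_firstPatch {k : ι} (hk : k ∈ M.firstLayer S) :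
    (M.elem k).body ⊆ M.firstPatch S := fun _ hx =>
  ⟨M.body_subset k hx, mem_iUnion₂.2 ⟨k, hk, subset_closure hx⟩⟩

lemma sideLength_pos (s : M.Side) : 0 < M.sideLength s :=
  dist_pos.2 (PolygonalCell.vert_ne s.2)

/-- Shows that the limit in the definition of `singularFlux` exists away from the singular point,
and identifies it with the flux of the harmonic extension. -/
lemma Admissible.exists_flux (H : M.Admissible S p) (s : M.Side) (hs : s.1 ∈ M.firstLayer S) :
    ∃ γ V g C, IsSingularOn (M.elem s.1).body S.A γ V g 0 C ∧
      EqOn (S.scaled (M.sideLength s)) g (M.elem s.1).body ∧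
      ∀ x ∈ closure (M.elem s.1).body \ {S.A},
        M.singularFlux S s x = inner ℝ ((M.elem s.1).normal s.2) (gradient g x) := by
  obtain ⟨z, ρ, hK⟩ := H.star s.1
  obtain ⟨γ, V, g, C, h1, h2⟩ := hK.exists_isSingularOn H.angle (body_subset_firstPatch hs)
    H.profile (sideLength_pos s)
  refine ⟨γ, V, g, C, h1, h2, fun x hx => ?_⟩
  have : (𝓝[(M.elem s.1).body] x).NeBot := mem_closure_iff_nhdsWithin_neBot.1 hx.1
  have h3 : Tendsto (gradient (S.scaled (M.sideLength s))) (𝓝[(M.elem s.1).body] x)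
      (𝓝 (gradient g x)) := h1.tendsto_gradient hK.isOpen h2 hx
  rw [singularFlux, h3.limUnder_eq]
  rfl

/-- The flux may come from the neighbor across the edge. Its bound in terms of the distance from the
singular point is obtained there and carried over, because both elements have the same arc length on
the edge. -/
lemma Admissible.traceMultiplier_singularFlux (H : M.Admissible S p) {s s' : M.Side}
    (hss : M.SameEdge s s') (hs : s'.1 ∈ M.firstLayer S) :
    TraceMultiplier (M.elem s.1).body (M.sideMeasure s) (M.singularFlux S s') := by
  obtain ⟨γ, V, g, C, h1, h2, h3⟩ := H.exists_flux s' hs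
  obtain ⟨z, ρ, hK⟩ := H.star s.1
  have hae : ∀ᵐ x ∂(M.sideMeasure s), M.singularFlux S s' x =
      inner ℝ ((M.elem s'.1).normal s'.2) (gradient g x) := by
    rw [hss.sideMeasure_eq]
    filter_upwards [PolygonalCell.ae_mem_closure (K := M.elem s'.1) s'.2 S.A] with x hx
    exact h3 x hx
  have hm : AEStronglyMeasurable (M.singularFlux S s') (M.sideMeasure s) := by
    have h4 := PolygonalCell.aestronglyMeasurable_flux h1 s'.2
    have e : (M.elem s'.1).sideArc s'.2 = M.sideMeasure s := hss.sideMeasure_eq.symm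
    rw [e] at h4
    exact h4.congr (hae.mono fun x hx => hx.symm)
  have hb : ∀ᵐ x ∂(M.sideMeasure s), |M.singularFlux S s' x| ≤ C * dist x S.A ^ (-γ) := by
    have h4 := PolygonalCell.ae_abs_flux_le h1 s'.2
    have e : (M.elem s'.1).sideArc s'.2 = M.sideMeasure s := hss.sideMeasure_eq.symm
    rw [e] at h4
    filter_upwards [h4, hae] with x hx hx'
    rwa [hx']
  exact PolygonalCell.traceMultiplier_of_le hK s.2 S.A h1.nonneg h1.lt_one hm hb

lemma traceMultiplier_of_continuous {K : PolygonalCell} {z : Plane} {ρ : ℝ}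
    (hK : IsStarDomain K.body z ρ) (i : Fin (K.m + 3)) {m : Plane → ℝ} (hm : Continuous m) :
    TraceMultiplier K.body (K.sideArc i) m := by
  obtain ⟨C, hC⟩ := K.isBounded_body.isCompact_closure.exists_bound_of_continuousOn hm.continuousOn
  refine PolygonalCell.traceMultiplier_of_le hK i z le_rfl zero_lt_one hm.aestronglyMeasurable
    (c := C) ?_
  filter_upwards [PolygonalCell.ae_mem_closure i z] with x hx
  simpa using hC x hx.1

lemma Admissible.traceMultiplier (H : M.Admissible S p) (s : M.Side) {m : Plane → ℝ}
    (hm : m ∈ M.enrichedEdge S p s) :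
    TraceMultiplier (M.elem s.1).body (M.sideMeasure s) m := by
  obtain ⟨z, ρ, hK⟩ := H.star s.1
  obtain ⟨P, hP, f, hf, rfl⟩ := Submodule.mem_sup.1 hm
  refine (traceMultiplier_of_continuous hK s.2 (contDiff_of_mem_polyLT P hP).continuous).add ?_
  induction hf using Submodule.span_induction with
  | mem f h =>
    obtain ⟨s', h1, h2, rfl⟩ := h
    exact H.traceMultiplier_singularFlux h1 h2
  | zero => exact TraceMultiplier.zero
  | add f g hf hg h1 h2 => exact (h1 (Submodule.add_mem_sup hP hf)).add (h2 (Submodule.add_mem_sup hP hg))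
  | smul c f hf h => exact (h (Submodule.add_mem_sup hP hf)).smul c

lemma Admissible.traceBound (H : M.Admissible S p) (s : M.Side) :
    TraceBound (M.elem s.1).body (M.sideMeasure s) := by
  obtain ⟨z, ρ, hK⟩ := H.star s.1
  exact PolygonalCell.traceBound_side hK s.2

lemma Admissible.integrable (H : M.Admissible S p) (s : M.Side) {m φ : Plane → ℝ}
    (hm : m ∈ M.enrichedEdge S p s) (hφ : ContDiff ℝ ∞ φ) :
    Integrable (fun x => m x * φ x) (M.sideMeasure s) := by
  have := (H.traceMultiplier s hm).integrable (M.elem s.1).isOpen_body (M.elem s.1).isBounded_body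
    (H.traceBound s) hφ
  simpa only [mul_comm] using this

/-! ### The local spaces -/

lemma integrableOn_mul_of_continuous {D : Set Plane} (hb : Bornology.IsBounded D) {f g : Plane → ℝ}
    (hf : Continuous f) (hg : Continuous g) : IntegrableOn (fun x => f x * g x) D :=
  memLp_one_iff_integrable.1 (memLp_of_continuous hb (hf.mul hg) 1)

lemma Admissible.memLocal_add (H : M.Admissible S p) {k : ι} {v w : Plane → ℝ}
    (hv : M.MemLocal S p k v) (hw : M.MemLocal S p k w) : M.MemLocal S p k (v + w) := by
  obtain ⟨⟨hv1, -⟩, G, hG, q, hq, g, hg, e⟩ := hv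
  obtain ⟨⟨hw1, -⟩, G', hG', q', hq', g', hg', e'⟩ := hw
  have hK := (M.elem k).isOpen_body
  have hb := (M.elem k).isBounded_body
  have h1 : IsH1 (M.elem k).body (v + w) (G + G') := IsH1.add ⟨hv1, hG⟩ ⟨hw1, hG'⟩
  refine ⟨h1.memH1 hK, G + G', h1.2, q + q', Submodule.add_mem _ hq hq', fun i => g i + g' i,
    fun i => Submodule.add_mem _ (hg i) (hg' i), fun φ hφ => ?_⟩
  have hφ2 := memLp_of_continuous hb (contDiff_gradient hφ).continuous 2
  have hqc := (contDiff_of_mem_polyLT q hq).continuous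
  have hqc' := (contDiff_of_mem_polyLT q' hq').continuous
  simp only [Pi.add_apply, inner_add_left, add_mul]
  rw [integral_add (integrable_inner_of_memLp hG.1 hφ2) (integrable_inner_of_memLp hG'.1 hφ2),
    integral_add (integrableOn_mul_of_continuous hb hqc hφ.continuous)
      (integrableOn_mul_of_continuous hb hqc' hφ.continuous), e φ hφ, e' φ hφ]
  have : ∀ i, ∫ x, (g i x * φ x + g' i x * φ x) ∂(M.sideMeasure ⟨k, i⟩) =
      (∫ x, g i x * φ x ∂(M.sideMeasure ⟨k, i⟩)) + ∫ x, g' i x * φ x ∂(M.sideMeasure ⟨k, i⟩) :=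
    fun i => integral_add (H.integrable ⟨k, i⟩ (hg i) hφ) (H.integrable ⟨k, i⟩ (hg' i) hφ)
  simp only [this]
  rw [Finset.sum_add_distrib]
  ring

lemma memLocal_smul {k : ι} {v : Plane → ℝ} (hv : M.MemLocal S p k v) (c : ℝ) :
    M.MemLocal S p k (c • v) := by
  obtain ⟨⟨hv1, -⟩, G, hG, q, hq, g, hg, e⟩ := hv
  have h1 : IsH1 (M.elem k).body (c • v) (c • G) := IsH1.smul ⟨hv1, hG⟩ c
  refine ⟨h1.memH1 (M.elem k).isOpen_body, c • G, h1.2, c • q, Submodule.smul_mem _ _ hq,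
    fun i => c • g i, fun i => Submodule.smul_mem _ _ (hg i), fun φ hφ => ?_⟩
  simp only [Pi.smul_apply, inner_smul_left, smul_eq_mul, mul_assoc, integral_const_mul,
    ← Finset.mul_sum]
  simp only [conj_trivial]
  rw [e φ hφ]
  ring

lemma MemLocal.congr {k : ι} {v w : Plane → ℝ} (hv : M.MemLocal S p k v)
    (h : v =ᵐ[volume.restrict (M.elem k).body] w) : M.MemLocal S p k w := by
  obtain ⟨⟨hv1, -⟩, G, hG, q, hq, g, hg, e⟩ := hv
  have h1 : IsH1 (M.elem k).body w G := IsH1.congr ⟨hv1, hG⟩ h EventuallyEq.rfl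
  exact ⟨h1.memH1 (M.elem k).isOpen_body, G, h1.2, q, hq, g, hg, e⟩

lemma normal_flux_mem_polyLT {m : ℕ} {P : Plane → ℝ} (hP : P ∈ polyLT (m + 1)) (n : Plane) :
    (fun x => inner ℝ n (gradient P x)) ∈ polyLT m := by
  have e : (fun x => inner ℝ n (gradient P x)) = n 0 • pd 0 P + n 1 • pd 1 P := by
    funext x
    rw [plane_inner, gradient_apply, gradient_apply]
    rfl
  have h0 := pd_mem_polyLT 0 P hP
  have h1 := pd_mem_polyLT 1 P hP
  rw [Nat.add_sub_cancel] at h0 h1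
  rw [e]
  exact Submodule.add_mem _ (Submodule.smul_mem _ (n 0) h0) (Submodule.smul_mem _ (n 1) h1)

lemma polyLT_le_enrichedEdge (s : M.Side) : polyLT p ≤ M.enrichedEdge S p s := le_sup_left

lemma singularFlux_mem {s : M.Side} (hs : s.1 ∈ M.firstLayer S) :
    M.singularFlux S s ∈ M.enrichedEdge S p s :=
  Submodule.mem_sup_right (Submodule.subset_span ⟨s, Or.inl rfl, hs, rfl⟩)

/-- Two derivatives lower the degree by two, and the normal is constant on a side; Green's formula
does the rest. -/
lemma Admissible.memLocal_poly (H : M.Admissible S p) (k : ι) {P : Plane → ℝ}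
    (hP : P ∈ polyLT (p + 1)) : M.MemLocal S p k P := by
  obtain ⟨z, ρ, hK⟩ := H.star k
  obtain ⟨σ, hσ⟩ := PolygonalCell.green_singular hK
  have hPs := contDiff_of_mem_polyLT P hP
  -- There is no singularity here; any point outside the open element can play the role of the
  -- singular point.
  have hA : (M.elem k).vert 0 ∉ (M.elem k).body := fun h => hK.notMem_frontier h
    (PolygonalCell.segment_subset_frontier 0 (left_mem_segment ℝ _ _))
  obtain ⟨C, hs⟩ := isSingularOn_of_contDiff (M.elem k).isBounded_body hPs hA
  have h1 := isH1_of_contDiff hK.isOpen hK.isBounded hPs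
  have hp0 := pd_mem_polyLT 0 P hP
  have hp1 := pd_mem_polyLT 1 P hP
  rw [Nat.add_sub_cancel] at hp0 hp1
  have hq : pd 0 (pd 0 P) + pd 1 (pd 1 P) ∈ polyLT (p - 1) :=
    Submodule.add_mem _ (pd_mem_polyLT 0 _ hp0) (pd_mem_polyLT 1 _ hp1)
  generalize pd 0 (pd 0 P) + pd 1 (pd 1 P) = q at hs hq
  refine ⟨h1.memH1 hK.isOpen, gradient P, h1.2, q, hq,
    fun i => σ • fun x => inner ℝ ((M.elem k).normal i) (gradient P x),
    fun i => polyLT_le_enrichedEdge _ (Submodule.smul_mem _ _ (normal_flux_mem_polyLT hP _)),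
    fun φ hφ => ?_⟩
  have hg := hσ hs (contDiff_of_mem_polyLT q hq).continuous φ hφ
  simp only [Pi.smul_apply, smul_eq_mul]
  exact hg

/-- The function is harmonic, so its Laplacian contributes nothing. Its flux is formed with the
scale `h`, whereas the edge space has the scale of the edge; by `IsSingularProfile.rescale` they
differ by a factor and the normal derivative of a polynomial of degree at most `p`, which is in the
edge space as well. -/
lemma Admissible.memLocal_singular (H : M.Admissible S p) {k : ι} (hk : k ∈ M.firstLayer S) {h : ℝ}
    (hh : 0 < h) : M.MemLocal S p k (S.scaled h) := by
  obtain ⟨z, ρ, hK⟩ := H.star k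
  obtain ⟨σ, hσ⟩ := PolygonalCell.green_singular hK
  have hKU := body_subset_firstPatch hk
  obtain ⟨γ, V, g, C, h1, h2⟩ := hK.exists_isSingularOn H.angle hKU H.profile hh
  replace h2 : EqOn (S.scaled h) g (M.elem k).body := h2
  have hg1 := h1.isH1 hK.isOpen hK.isBounded
  have hae : g =ᵐ[volume.restrict (M.elem k).body] S.scaled h :=
    (ae_restrict_iff' hK.isOpen.measurableSet).2 (Eventually.of_forall fun x hx => (h2 hx).symm)
  have hflux : ∀ i, ∃ m ∈ M.enrichedEdge S p ⟨k, i⟩, ∀ᵐ x ∂(M.sideMeasure ⟨k, i⟩),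
      inner ℝ ((M.elem k).normal i) (gradient g x) = m x := by
    intro i
    obtain ⟨a, P, hP, e⟩ := H.profile.rescale H.angle hh (sideLength_pos (M := M) ⟨k, i⟩)
    obtain ⟨γ', V', g', C', h1', h2', h3'⟩ := H.exists_flux ⟨k, i⟩ hk
    have hPs := contDiff_of_mem_polyLT P hP
    refine ⟨a • M.singularFlux S ⟨k, i⟩ + fun x => inner ℝ ((M.elem k).normal i) (gradient P x),
      Submodule.add_mem _ (Submodule.smul_mem _ _ (singularFlux_mem (s := ⟨k, i⟩) hk))
        (polyLT_le_enrichedEdge _ (normal_flux_mem_polyLT hP _)), ?_⟩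
    filter_upwards [PolygonalCell.ae_mem_closure (K := M.elem k) i S.A] with x hx
    have : (𝓝[(M.elem k).body] x).NeBot := mem_closure_iff_nhdsWithin_neBot.1 hx.1
    have t1 := h1.tendsto_gradient hK.isOpen h2 hx
    have t2 := h1'.tendsto_gradient hK.isOpen h2' hx
    have t3 : Tendsto (gradient P) (𝓝[(M.elem k).body] x) (𝓝 (gradient P x)) :=
      ((contDiff_gradient hPs).continuous.tendsto x).mono_left nhdsWithin_le_nhds
    have t4 := (t2.const_smul a).add t3
    -- The relation between the two scales holds inside the element, where it can be differentiated;
    -- the boundary values follow by passing to the limit.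
    have hlim : gradient g x = a • gradient g' x + gradient P x := by
      refine tendsto_nhds_unique t1 (t4.congr' ?_)
      filter_upwards [self_mem_nhdsWithin] with y hy
      have hd := h1'.differentiableAt hK.isOpen h2' hy
      have hEq : S.scaled h =ᶠ[𝓝 y] fun x => a * S.scaled (M.sideLength ⟨k, i⟩) x + P x :=
        Filter.eventuallyEq_of_mem (hK.isOpen.mem_nhds hy) fun x hx => e x (hKU hx)
      have hfd : HasFDerivAt (S.scaled h) (a • fderiv ℝ (S.scaled (M.sideLength ⟨k, i⟩)) y +
          fderiv ℝ P y) y :=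
        ((hd.hasFDerivAt.const_mul a).add
          ((hPs.differentiable (by simp)) y).hasFDerivAt).congr_of_eventuallyEq hEq
      simp only [gradient, hfd.fderiv, map_add, map_smul]
    rw [hlim, inner_add_right, inner_smul_right, Pi.add_apply, Pi.smul_apply, h3' x hx, smul_eq_mul]
  choose m hm hmae using hflux
  refine MemLocal.congr ⟨hg1.memH1 hK.isOpen, gradient g, hg1.2, 0, Submodule.zero_mem _,
    fun i => σ • m i, fun i => Submodule.smul_mem _ _ (hm i), fun φ hφ => ?_⟩ hae
  have := hσ h1 continuous_zero φ hφ
  refine this.trans ?_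
  congr 1
  refine Finset.sum_congr rfl fun i _ => integral_congr_ae ?_
  filter_upwards [hmae i] with x hx
  rw [hx]; rfl

lemma Admissible.memLocal_enrichedPoly (H : M.Admissible S p) {k : ι} {f : Plane → ℝ}
    (hf : f ∈ M.enrichedPoly S p k) : M.MemLocal S p k f := by
  obtain ⟨z, ρ, hK⟩ := H.star k
  obtain ⟨P, hP, g, hg, rfl⟩ := Submodule.mem_sup.1 hf
  refine H.memLocal_add (H.memLocal_poly k hP) ?_
  split_ifs at hg with hk
  · obtain ⟨c, rfl⟩ := Submodule.mem_span_singleton.1 hg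
    exact memLocal_smul (H.memLocal_singular hk hK.diam_pos) c
  · rw [(Submodule.mem_bot ℝ).1 hg]
    exact H.memLocal_poly k (Submodule.zero_mem _)

end Mesh

end

section

/-! ## Existence of the degree-of-freedom interpolant -/

/-- The space of smooth functions. -/
def smoothFun : Submodule ℝ (Plane → ℝ) where
  carrier := {f | ContDiff ℝ ∞ f}
  add_mem' hf hg := contDiff_add_pi hf hg
  zero_mem' := (contDiff_const : ContDiff ℝ ∞ fun _ : Plane => (0 : ℝ))
  smul_mem' c _ hf := contDiff_smul_pi hf c

/-- The gradient of smooth functions, as an element of `L²(K)`. -/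
def smoothGradient {K : Set Plane} (hb : Bornology.IsBounded K) :
    smoothFun →ₗ[ℝ] Lp Plane 2 (volume.restrict K) where
  toFun f := (memLp_of_continuous hb (contDiff_gradient f.2).continuous 2).toLp _
  map_add' f g := by
    rw [← MemLp.toLp_add]
    congr 1
    ext x i
    simp [gradient_apply, pd_add f.2 g.2]
  map_smul' c f := by
    rw [RingHom.id_apply, ← MemLp.toLp_const_smul]
    congr 1
    ext x i
    simp [gradient_apply, pd_smul f.2]

/-- The pairing of a space of functions with smooth functions. -/
def pairing (μ : Measure Plane) (B : Submodule ℝ (Plane → ℝ))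
    (h : ∀ m ∈ B, ∀ φ ∈ smoothFun, Integrable (fun x => m x * φ x) μ) :
    B →ₗ[ℝ] smoothFun →ₗ[ℝ] ℝ :=
  LinearMap.mk₂ ℝ (fun m φ => ∫ x, m.1 x * φ.1 x ∂μ)
    (fun m m' φ => by
      rw [← integral_add (h _ m.2 _ φ.2) (h _ m'.2 _ φ.2)]
      simp [add_mul])
    (fun c m φ => by
      rw [smul_eq_mul, ← integral_const_mul]
      simp [mul_assoc])
    (fun m φ φ' => by
      rw [← integral_add (h _ m.2 _ φ.2) (h _ m.2 _ φ'.2)]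
      simp [mul_add])
    (fun c m φ => by
      rw [smul_eq_mul, ← integral_const_mul]
      simp [mul_left_comm])

lemma ennreal_rpow_half_sq (a : ℝ≥0∞) : (a ^ 2) ^ (1 / 2 : ℝ) = a := by
  rw [← ENNReal.rpow_natCast, ← ENNReal.rpow_mul]
  norm_num

lemma cauchySeq_of_edist_le {α β : Type*} [PseudoEMetricSpace α] [PseudoEMetricSpace β]
    {f : ℕ → α} {g : ℕ → β} {C : ℝ≥0∞} (hC : C ≠ ⊤) (hg : CauchySeq g)
    (h : ∀ m n, edist (f m) (f n) ≤ C * edist (g m) (g n)) : CauchySeq f := by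
  rw [EMetric.cauchySeq_iff] at hg ⊢
  intro ε hε
  obtain ⟨N, hN⟩ := hg (ε / (C + 1)) (ENNReal.div_pos hε.ne' (by finiteness))
  refine ⟨N, fun m hm n hn => ?_⟩
  have h1 := hN m hm n hn
  rw [ENNReal.lt_div_iff_mul_lt (by simp) (by simp [hC]), mul_comm] at h1
  refine lt_of_le_of_lt ((h m n).trans ?_) h1
  gcongr
  exact le_self_add

namespace PolygonalCell

variable {K : PolygonalCell} {z : Plane} {ρ : ℝ}

/-- The Poincaré inequality for functions with mean value zero on a side. -/
lemma poincare_side (h : IsStarDomain K.body z ρ) (i : Fin (K.m + 3)) :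
    ∃ C : ℝ≥0∞, C ≠ ⊤ ∧ ∀ φ : Plane → ℝ, ContDiff ℝ ∞ φ → ∫ x, φ x ∂(K.sideArc i) = 0 →
      ∫⁻ x in K.body, ‖φ x‖ₑ ^ 2 ≤ C * ∫⁻ x in K.body, ‖gradient φ x‖ₑ ^ 2 := by
  obtain ⟨C₂, hC₂, H⟩ := traceBound_side h i
  set C₁ := ENNReal.ofReal (4 * (Metric.diam K.body / ρ) ^ 2 * Metric.diam K.body ^ 2) with hC₁
  set L := K.sideArc i univ with hL
  have hL0 : L ≠ 0 := by
    have h1 := lintegral_arcLength (K.vert i) (K.vert (i + 1)) (g := fun _ => 1) measurable_const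
    rw [lintegral_one] at h1
    rw [hL, sideArc, h1]
    simp [vert_ne i]
  have hLt : L ≠ ⊤ := measure_ne_top _ _
  have hvol : volume K.body ≠ ⊤ := K.isBounded_body.measure_lt_top.ne
  refine ⟨4 * (C₁ + L⁻¹ * (C₂ * (C₁ + 1)) * volume K.body), by finiteness, fun φ hφ h0 => ?_⟩
  -- The interior inequality controls `φ - a`. As `φ` has mean value zero on the side, `a` is up to
  -- sign the mean of `φ - a` there, and the trace bound controls it.
  obtain ⟨a, ha⟩ := h.poincare hφ
  set N := ∫⁻ x in K.body, ‖gradient φ x‖ₑ ^ 2 with hN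
  set ψ : Plane → ℝ := fun x => φ x - a with hψ
  have hψs : ContDiff ℝ ∞ ψ := hφ.sub contDiff_const
  have hgrad : ∀ x, gradient ψ x = gradient φ x := by
    intro x; simp [gradient, hψ, fderiv_sub_const]
  have h1 : h1NormSq K.body ψ ≤ (C₁ + 1) * N := by
    rw [h1NormSq_of_contDiff K.isOpen_body K.isBounded_body hψs, add_mul, one_mul]
    simp only [hgrad]
    gcongr
  have h2 : ∫⁻ x, ‖ψ x‖ₑ ^ 2 ∂(K.sideArc i) ≤ C₂ * ((C₁ + 1) * N) := (H ψ hψs).trans (by gcongr)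
  have hint : Integrable φ (K.sideArc i) :=
    (memLp_of_contDiff_of_traceBound K.isOpen_body K.isBounded_body (traceBound_side h i)
      hφ).integrable one_le_two
  have h3 : ‖a‖ₑ * L ≤ ∫⁻ x, ‖ψ x‖ₑ * 1 ∂(K.sideArc i) := by
    have e : ∫ x, ψ x ∂(K.sideArc i) = -(L.toReal * a) := by
      rw [hψ, integral_sub hint (integrable_const a), h0, integral_const]
      simp [hL, Measure.real]
    have := enorm_integral_le_lintegral_enorm (μ := K.sideArc i) ψ
    rw [e, enorm_neg, enorm_mul, Real.enorm_of_nonneg ENNReal.toReal_nonneg,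
      ENNReal.ofReal_toReal hLt, mul_comm] at this
    simpa using this
  have h4 : ‖a‖ₑ ^ 2 * L ≤ C₂ * ((C₁ + 1) * N) := by
    have h5 := pow_le_pow_left₀ bot_le h3 2
    have h6 := h5.trans (lintegral_mul_sq_le (μ := K.sideArc i)
      (hψs.continuous.measurable.enorm.aemeasurable) aemeasurable_const)
    simp only [one_pow, lintegral_one] at h6
    rw [mul_pow, sq L, ← mul_assoc] at h6
    exact ((ENNReal.mul_le_mul_iff_left hL0 hLt).1 h6).trans h2
  have h5 : ‖a‖ₑ ^ 2 ≤ L⁻¹ * (C₂ * (C₁ + 1)) * N := by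
    calc ‖a‖ₑ ^ 2 = L⁻¹ * (‖a‖ₑ ^ 2 * L) := by
          rw [mul_comm (‖a‖ₑ ^ 2), ← mul_assoc, ENNReal.inv_mul_cancel hL0 hLt, one_mul]
      _ ≤ L⁻¹ * (C₂ * ((C₁ + 1) * N)) := by gcongr
      _ = _ := by ring
  calc ∫⁻ x in K.body, ‖φ x‖ₑ ^ 2 ≤ ∫⁻ x in K.body, 4 * (‖φ x - a‖ₑ ^ 2 + ‖a‖ₑ ^ 2) := by
        refine lintegral_mono fun x => ?_
        refine le_trans ?_ (ennreal_add_sq_le _ _)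
        gcongr
        simpa using enorm_add_le (φ x - a) a
    _ = 4 * ((∫⁻ x in K.body, ‖φ x - a‖ₑ ^ 2) + ‖a‖ₑ ^ 2 * volume K.body) := by
        rw [lintegral_const_mul' _ _ (by simp), lintegral_add_right _ measurable_const]
        simp
    _ ≤ 4 * (C₁ * N + (L⁻¹ * (C₂ * (C₁ + 1)) * N) * volume K.body) := by gcongr
    _ = _ := by ring

end PolygonalCell

namespace Mesh

variable {Ω : Set Plane} {ι : Type} {M : Mesh Ω ι} {S : Enrichment} {p : ℕ}

/-- Finitely many elements have finitely many sides. The duality argument for the interpolant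
depends on this finite dimension. -/
lemma finite_enrichedEdge [Finite ι] (s : M.Side) : Module.Finite ℝ (M.enrichedEdge S p s) := by
  rw [Module.Finite.iff_fg]
  refine (polyLT_fg p).sup (Submodule.fg_span ?_)
  refine (Set.finite_range fun s' : M.Side => M.singularFlux S s').subset ?_
  rintro g ⟨s', -, -, rfl⟩
  exact ⟨s', rfl⟩

/-- The interpolant is `u - w`, where `w` is a limit of smooth functions with vanishing degrees of
freedom, chosen so that its gradient is the projection of the gradient of `u`. The degrees of
freedom of `w` vanish by continuity. That `u - w` is in the local space comes from duality: a
functional that vanishes wherever finitely many functionals vanish is a combination of them. -/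
theorem Admissible.exists_local_interpolant [Finite ι] (H : M.Admissible S p) (hp : 1 ≤ p) (k : ι)
    {u : Plane → ℝ} {G : Plane → Plane} (hu : IsH1 (M.elem k).body u G) :
    ∃ v, M.MemLocal S p k v ∧
      (∀ q ∈ polyLT (p - 1), ∫ x in (M.elem k).body, (u x - v x) * q x = 0) ∧
      ∀ i, ∃ t, HasTrace (M.elem k).body (M.sideMeasure ⟨k, i⟩) (u - v) t ∧
        ∀ m ∈ M.enrichedEdge S p ⟨k, i⟩, ∫ x, t x * m x ∂(M.sideMeasure ⟨k, i⟩) = 0 := by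
  obtain ⟨z, ρ, hK⟩ := H.star k
  have hO := (M.elem k).isOpen_body
  have hb := (M.elem k).isBounded_body
  set μ := volume.restrict (M.elem k).body with hμ
  -- the degrees of freedom
  set DK : polyLT (p - 1) →ₗ[ℝ] smoothFun →ₗ[ℝ] ℝ := pairing μ (polyLT (p - 1))
    (fun q hq φ hφ => integrableOn_mul_of_continuous hb (contDiff_of_mem_polyLT q hq).continuous
      (show ContDiff ℝ ∞ φ from hφ).continuous) with hDK
  set DE : ∀ i, M.enrichedEdge S p ⟨k, i⟩ →ₗ[ℝ] smoothFun →ₗ[ℝ] ℝ := fun i =>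
    pairing (M.sideMeasure ⟨k, i⟩) (M.enrichedEdge S p ⟨k, i⟩)
      (fun m hm φ hφ => H.integrable ⟨k, i⟩ hm hφ) with hDE
  set D : (polyLT (p - 1) × ∀ i, M.enrichedEdge S p ⟨k, i⟩) →ₗ[ℝ] Module.Dual ℝ smoothFun :=
    DK.comp (LinearMap.fst ℝ _ _) +
      (∑ i, (DE i).comp (LinearMap.proj i)).comp (LinearMap.snd ℝ _ _) with hD
  have hDapp : ∀ q m φ, D (q, m) φ = (∫ x in (M.elem k).body, q.1 x * φ.1 x) +
      ∑ i, ∫ x, (m i).1 x * φ.1 x ∂(M.sideMeasure ⟨k, i⟩) := by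
    intro q m φ
    simp [hD, hDK, hDE, pairing, LinearMap.sum_apply]
    rfl
  have hfin1 : Module.Finite ℝ (polyLT (p - 1)) := Module.Finite.iff_fg.2 (polyLT_fg _)
  have hfin2 : ∀ i, Module.Finite ℝ (M.enrichedEdge S p ⟨k, i⟩) := fun i => finite_enrichedEdge _
  -- All combinations of degrees of freedom, as functionals on smooth functions; `N₀` is their
  -- common kernel.
  set R := LinearMap.range D with hR
  set N₀ : Submodule ℝ smoothFun := Submodule.dualCoannihilator R with hN₀
  have hq0 : ∀ φ ∈ N₀, ∀ q ∈ polyLT (p - 1), ∫ x in (M.elem k).body, q x * φ.1 x = 0 := by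
    intro φ hφ q hq
    have h1 := (Submodule.mem_dualCoannihilator φ).1 hφ (D (⟨q, hq⟩, 0)) ⟨_, rfl⟩
    rw [hDapp] at h1
    simpa using h1
  have hm0 : ∀ φ ∈ N₀, ∀ i, ∀ m ∈ M.enrichedEdge S p ⟨k, i⟩,
      ∫ x, m x * φ.1 x ∂(M.sideMeasure ⟨k, i⟩) = 0 := by
    intro φ hφ i m hm
    have h1 := (Submodule.mem_dualCoannihilator φ).1 hφ (D (0, Pi.single i ⟨m, hm⟩)) ⟨_, rfl⟩
    rw [hDapp, Finset.sum_eq_single i] at h1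
    · simpa using h1
    · intro j _ hj
      rw [Pi.single_eq_of_ne hj]
      simp
    · simp
  -- projection of the gradient
  set W : Submodule ℝ (Lp Plane 2 μ) := (N₀.map (smoothGradient hb)).topologicalClosure with hW
  have hWc : IsClosed (W : Set (Lp Plane 2 μ)) := Submodule.isClosed_topologicalClosure _
  have : CompleteSpace W := hWc.completeSpace_coe
  set Gu : Lp Plane 2 μ := hu.2.1.toLp G with hGu
  set PG : Lp Plane 2 μ := W.starProjection Gu with hPG
  have hPW : PG ∈ closure ((N₀.map (smoothGradient hb) : Submodule ℝ _) : Set (Lp Plane 2 μ)) :=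
    W.starProjection_apply_mem Gu
  obtain ⟨F, hF, hFt⟩ := mem_closure_iff_seq_limit.1 hPW
  choose φ hφ0 hφF using fun n => Submodule.mem_map.1 (hF n)
  have hφs : ∀ n, ContDiff ℝ ∞ (φ n).1 := fun n => (φ n).2
  have hgt : Tendsto (fun n => eLpNorm (PG - gradient (φ n).1 : Plane → Plane) 2 μ) atTop (𝓝 0) := by
    rw [tendsto_iff_edist_tendsto_0] at hFt
    refine hFt.congr fun n => ?_
    rw [edist_comm, Lp.edist_def, ← hφF n]
    exact eLpNorm_congr_ae (EventuallyEq.rfl.sub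
      (memLp_of_continuous hb (contDiff_gradient (hφs n)).continuous 2).coeFn_toLp)
  -- the limit of the functions
  obtain ⟨C, hC, hP⟩ := PolygonalCell.poincare_side hK 0
  -- As $p\ge1$, constants are edge functions, so members of `N₀` have mean value zero on a side and
  -- their gradients control them.
  have hone : (fun _ => (1 : ℝ)) ∈ M.enrichedEdge S p ⟨k, 0⟩ :=
    polyLT_le_enrichedEdge _ (const_mem_polyLT 1 (by omega))
  have hφm : ∀ n, MemLp (φ n).1 2 μ := fun n => memLp_of_continuous hb (hφs n).continuous 2
  have hcauchy : CauchySeq fun n => (hφm n).toLp := by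
    refine cauchySeq_of_edist_le (C := C ^ (1 / 2 : ℝ))
      (ENNReal.rpow_ne_top_of_nonneg (by norm_num) hC) hFt.cauchySeq fun m n => ?_
    have hmn : φ m - φ n ∈ N₀ := Submodule.sub_mem _ (hφ0 m) (hφ0 n)
    have h0 : ∫ x, (φ m - φ n).1 x ∂((M.elem k).sideArc 0) = 0 := by
      have := hm0 _ hmn 0 _ hone
      simp only [one_mul] at this
      exact this
    have h1 := hP (φ m - φ n).1 (φ m - φ n).2 h0
    have e1 : edist ((hφm m).toLp) ((hφm n).toLp) = eLpNorm (φ m - φ n).1 2 μ := by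
      rw [Lp.edist_toLp_toLp]; rfl
    have e2 : edist (F m) (F n) = eLpNorm (gradient (φ m - φ n).1) 2 μ := by
      rw [← hφF m, ← hφF n, edist_eq_enorm_sub, ← map_sub]
      exact Lp.enorm_toLp
        (memLp_of_continuous hb (contDiff_gradient (φ m - φ n).2).continuous 2)
    rw [e1, e2, ← ennreal_rpow_half_sq (eLpNorm (gradient (φ m - φ n).1) 2 μ),
      ← ENNReal.mul_rpow_of_nonneg _ _ (by norm_num), ennreal_le_sqrt_iff, eLpNorm_two_sq,
      eLpNorm_two_sq]
    exact h1
  obtain ⟨nL, hnL⟩ := cauchySeq_tendsto_of_complete hcauchy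
  have hnt : Tendsto (fun n => eLpNorm (nL - (φ n).1 : Plane → ℝ) 2 μ) atTop (𝓝 0) := by
    rw [tendsto_iff_edist_tendsto_0] at hnL
    refine hnL.congr fun n => ?_
    rw [edist_comm, Lp.edist_def]
    exact eLpNorm_congr_ae (EventuallyEq.rfl.sub (hφm n).coeFn_toLp)
  set w : Plane → ℝ := ⇑nL with hw
  have hwH : IsH1 (M.elem k).body w PG :=
    IsH1.of_tendsto (fun n => isH1_of_contDiff hO hb (hφs n)) (Lp.memLp nL) (Lp.memLp PG) hnt hgt
  have hwt : H1Tendsto (M.elem k).body (fun n => (φ n).1) w :=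
    (h1Tendsto_iff hO hb hwH).2 ⟨hφs, hnt, hgt⟩
  have hv : IsH1 (M.elem k).body (u - w) (G - ⇑PG) := hu.sub hwH
  have hperp : ∀ φ ∈ N₀, ∫ x in (M.elem k).body, inner ℝ ((G - ⇑PG) x) (gradient φ.1 x) = 0 := by
    intro φ hφ
    have h1 := W.sub_starProjection_mem_orthogonal Gu
    have h2 := (W.mem_orthogonal _).1 h1 (smoothGradient hb φ)
      (subset_closure (Submodule.mem_map_of_mem hφ))
    rw [real_inner_comm, L2.inner_def] at h2
    rw [← h2]
    refine integral_congr_ae ?_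
    have hgm := memLp_of_continuous hb (contDiff_gradient φ.2).continuous 2
    have e1 : (smoothGradient hb φ : Plane → Plane) =ᵐ[μ] gradient φ.1 := hgm.coeFn_toLp
    filter_upwards [e1, Lp.coeFn_sub Gu PG, hu.2.1.coeFn_toLp] with x h3 h4 h5
    rw [h3, h4, Pi.sub_apply, Pi.sub_apply, hGu, h5]
  -- the functional is a combination of the degrees of freedom
  have hGm : MemLp (G - ⇑PG) 2 μ := hv.2.1
  set ℓ : Module.Dual ℝ smoothFun :=
    (innerSL ℝ (hGm.toLp (G - ⇑PG))).toLinearMap.comp (smoothGradient hb) with hℓ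
  have hℓapp : ∀ φ, ℓ φ = ∫ x in (M.elem k).body, inner ℝ ((G - ⇑PG) x) (gradient φ.1 x) := by
    intro φ
    change inner ℝ (hGm.toLp (G - ⇑PG)) (smoothGradient hb φ) = _
    rw [L2.inner_def]
    refine integral_congr_ae ?_
    have hgm := memLp_of_continuous hb (contDiff_gradient φ.2).continuous 2
    have e1 : (smoothGradient hb φ : Plane → Plane) =ᵐ[μ] gradient φ.1 := hgm.coeFn_toLp
    filter_upwards [e1, hGm.coeFn_toLp] with x h3 h4
    rw [h3, h4]
  -- A finite-dimensional space of functionals is the annihilator of its common kernel.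
  have hℓR : ℓ ∈ R := by
    have e := Subspace.dualCoannihilator_dualAnnihilator_eq (W := R)
    rw [← e, Submodule.mem_dualAnnihilator]
    intro φ hφ
    rw [hℓapp]
    exact hperp φ hφ
  obtain ⟨⟨q, m⟩, hqm⟩ := hℓR
  -- The sign of `q` is reversed because the Laplacian enters Green's formula with a minus.
  refine ⟨u - w, ⟨hv.memH1 hO, G - ⇑PG, hv.2, -q.1, Submodule.neg_mem _ q.2, fun i => (m i).1,
    fun i => (m i).2, fun ψ hψ => ?_⟩, fun r hr => ?_, fun i => ?_⟩
  · have h1 := hDapp q m ⟨ψ, hψ⟩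
    rw [hqm, hℓapp] at h1
    refine h1.trans ?_
    simp [integral_neg]
  · have h1 := tendsto_integral_mul (g := r) (fun n => (isH1_of_contDiff hO hb (hφs n)).1) hwH.1
      (memLp_of_continuous hb (contDiff_of_mem_polyLT r hr).continuous 2) hnt
    have h2 : ∀ n, ∫ x in (M.elem k).body, (φ n).1 x * r x = 0 := by
      intro n
      rw [← hq0 _ (hφ0 n) r hr]
      simp only [mul_comm]
    simp only [h2] at h1
    have h3 := tendsto_nhds_unique h1 tendsto_const_nhds
    simpa using h3
  · have hTB := H.traceBound ⟨k, i⟩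
    obtain ⟨t, ht⟩ := hwt.exists_hasTrace hO hb hTB hwH
    refine ⟨t, ?_, fun m hm => ?_⟩
    · rwa [sub_sub_cancel]
    · have h1 := (ht.tendsto_integral hO hb hTB hwH hwt (H.traceMultiplier ⟨k, i⟩ hm)).2
      have h2 : ∀ n, ∫ x, (φ n).1 x * m x ∂(M.sideMeasure ⟨k, i⟩) = 0 := by
        intro n
        rw [← hm0 _ (hφ0 n) i m hm]
        simp only [mul_comm]
      simp only [h2] at h1
      exact tendsto_nhds_unique h1 tendsto_const_nhds

end Mesh

end

section

/-! ## Quasi-optimality of the degree-of-freedom interpolant -/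

/-- Pythagoras. -/
lemma eLpNorm_le_add_of_inner_eq_zero {α : Type*} [MeasurableSpace α] {μ : Measure α}
    {F G : α → Plane} (hF : MemLp F 2 μ) (hG : MemLp G 2 μ) (h : ∫ x, inner ℝ (F x) (G x) ∂μ = 0) :
    eLpNorm F 2 μ ≤ eLpNorm (F + G) 2 μ := by
  have h1 : inner ℝ (hF.toLp F) (hG.toLp G) = (0 : ℝ) := by
    rw [L2.inner_def, ← h]
    refine integral_congr_ae ?_
    filter_upwards [hF.coeFn_toLp, hG.coeFn_toLp] with x h3 h4
    rw [h3, h4]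
  have h2 : ‖hF.toLp F‖ ≤ ‖hF.toLp F + hG.toLp G‖ := by
    have := norm_add_sq_real (hF.toLp F) (hG.toLp G)
    rw [h1] at this
    refine (sq_le_sq₀ (norm_nonneg _) (norm_nonneg _)).1 ?_
    nlinarith [sq_nonneg ‖hG.toLp G‖]
  rw [← MemLp.toLp_add, Lp.norm_toLp, Lp.norm_toLp] at h2
  exact (ENNReal.toReal_le_toReal hF.2.ne (hF.add hG).2.ne).1 h2

namespace Mesh

variable {Ω : Set Plane} {ι : Type} {M : Mesh Ω ι} {S : Enrichment} {p : ℕ}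

/-- Functions of the local space are orthogonal to functions with vanishing degrees of freedom. -/
lemma Admissible.integral_inner_eq_zero (H : M.Admissible S p) {k : ι} {v w : Plane → ℝ}
    {F W : Plane → Plane} (hv : M.MemLocal S p k v) (hF : IsH1 (M.elem k).body v F)
    (hW : IsH1 (M.elem k).body w W)
    (hq : ∀ q ∈ polyLT (p - 1), ∫ x in (M.elem k).body, w x * q x = 0)
    (ht : ∀ i, ∃ t, HasTrace (M.elem k).body (M.sideMeasure ⟨k, i⟩) w t ∧
      ∀ m ∈ M.enrichedEdge S p ⟨k, i⟩, ∫ x, t x * m x ∂(M.sideMeasure ⟨k, i⟩) = 0) :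
    ∫ x in (M.elem k).body, inner ℝ (W x) (F x) = 0 := by
  obtain ⟨z, ρ, hK⟩ := H.star k
  have hO := hK.isOpen
  have hb := hK.isBounded
  obtain ⟨-, G, hG, q, hqm, g, hg, e⟩ := hv
  -- The local space is defined by testing with smooth functions, so `w` is approximated by them. In
  -- the limit, the terms on the right of Green's formula become degrees of freedom of `w`.
  obtain ⟨φ, hφ⟩ := hK.exists_h1Tendsto hW
  obtain ⟨hφs, h1, h2⟩ := (h1Tendsto_iff hO hb hW).1 hφ
  have hφi := fun n => isH1_of_contDiff hO hb (hφs n)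
  have l1 := tendsto_integral_inner (fun n => (hφi n).2.1) hW.2.1 hG.1 h2
  have l2 := tendsto_integral_mul (fun n => (hφi n).1) hW.1
    (memLp_of_continuous hb (contDiff_of_mem_polyLT q hqm).continuous 2) h1
  have l3 : ∀ i, Tendsto (fun n => ∫ x, φ n x * g i x ∂(M.sideMeasure ⟨k, i⟩)) atTop (𝓝 0) := by
    intro i
    obtain ⟨t, h3, h4⟩ := ht i
    rw [← h4 _ (hg i)]
    exact (h3.tendsto_integral hO hb (H.traceBound ⟨k, i⟩) hW hφ
      (H.traceMultiplier ⟨k, i⟩ (hg i))).2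
  have l4 := (l2.neg).add (tendsto_finsetSum Finset.univ fun i _ => l3 i)
  rw [hq q hqm] at l4
  have e' : ∀ n, ∫ x in (M.elem k).body, inner ℝ (gradient (φ n) x) (G x) =
      -(∫ x in (M.elem k).body, φ n x * q x) +
        ∑ i, ∫ x, φ n x * g i x ∂(M.sideMeasure ⟨k, i⟩) := by
    intro n
    simpa only [real_inner_comm, mul_comm] using e (φ n) (hφs n)
  simp only [e'] at l1
  have h5 := tendsto_nhds_unique l1 l4
  simp only [neg_zero, Finset.sum_const_zero, add_zero] at h5
  rw [← h5]
  refine integral_congr_ae ?_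
  filter_upwards [HasWeakGradient.unique hO hF.2 hG] with x hx
  rw [hx]

/-- In `u - f = (u - v) + (v - f)` the second summand is in the local space and the first has
vanishing degrees of freedom, so their gradients are orthogonal. -/
lemma Admissible.sobolevSeminormSq_le (H : M.Admissible S p) {k : ι} {u v f : Plane → ℝ}
    (hu : MemH1 (M.elem k).body u) (hv : M.MemLocal S p k v) (hf : M.MemLocal S p k f)
    (hq : ∀ q ∈ polyLT (p - 1), ∫ x in (M.elem k).body, (u x - v x) * q x = 0)
    (ht : ∀ i, ∃ t, HasTrace (M.elem k).body (M.sideMeasure ⟨k, i⟩) (u - v) t ∧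
      ∀ m ∈ M.enrichedEdge S p ⟨k, i⟩, ∫ x, t x * m x ∂(M.sideMeasure ⟨k, i⟩) = 0) :
    sobolevSeminormSq 1 (M.elem k).body (u - v) ≤ sobolevSeminormSq 1 (M.elem k).body (u - f) := by
  have hO := (M.elem k).isOpen_body
  obtain ⟨G, hG⟩ := hu.exists_isH1
  obtain ⟨F, hF⟩ := hv.1.exists_isH1
  have hvf : M.MemLocal S p k (v + (-1 : ℝ) • f) := H.memLocal_add hv (memLocal_smul hf _)
  obtain ⟨E, hE⟩ := hvf.1.exists_isH1
  have hW := hG.sub hF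
  have h0 := H.integral_inner_eq_zero hvf hE hW hq ht
  have e : u - f = (u - v) + (v + (-1 : ℝ) • f) := by
    ext x; simp; ring
  rw [e, hW.sobolevSeminormSq hO, (hW.add hE).sobolevSeminormSq hO]
  gcongr
  exact eLpNorm_le_add_of_inner_eq_zero hW.2.1 hE.2.1 h0

theorem Admissible.brokenSeminorm_le [Fintype ι] (H : M.Admissible S p) {u uI uπ : Plane → ℝ}
    (hu : ∀ k, MemH1 (M.elem k).body u) (hI : M.IsDofInterpolant S p u uI)
    (hπ : M.IsPiecewiseEnriched S p uπ) :
    M.brokenSeminorm (u - uI) ≤ M.brokenSeminorm (u - uπ) := by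
  refine ENNReal.rpow_le_rpow (Finset.sum_le_sum fun k _ => ?_) (by norm_num)
  obtain ⟨f, hf, hfe⟩ := hπ k
  have h1 : M.MemLocal S p k uπ := (H.memLocal_enrichedPoly hf).congr
    ((ae_restrict_iff' (M.elem k).isOpen_body.measurableSet).2
      (Eventually.of_forall fun x hx => (hfe hx).symm))
  exact H.sobolevSeminormSq_le (hu k) (hI.1 k) h1 (hI.2.1 k) fun i => hI.2.2 ⟨k, i⟩

/-- A function that coincides on every element with a given function. -/
lemma exists_glue (M : Mesh Ω ι) (v : ι → Plane → ℝ) :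
    ∃ w : Plane → ℝ, ∀ k, EqOn w (v k) (M.elem k).body := by
  classical
  refine ⟨fun x => if h : ∃ k, x ∈ (M.elem k).body then v h.choose x else 0, fun k x hx => ?_⟩
  have h : ∃ k, x ∈ (M.elem k).body := ⟨k, hx⟩
  have e : h.choose = k := by
    by_contra hne
    exact Set.disjoint_left.1 (M.disjoint_body hne) h.choose_spec hx
  simp only [dif_pos h]
  rw [e]

theorem Admissible.exists_isDofInterpolant [Finite ι] (H : M.Admissible S p) (hp : 1 ≤ p)
    {u : Plane → ℝ} (hu : ∀ k, MemH1 (M.elem k).body u) : ∃ uI, M.IsDofInterpolant S p u uI := by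
  choose G hG using fun k => (hu k).exists_isH1
  choose v h1 h2 h3 using fun k => H.exists_local_interpolant hp k (hG k)
  obtain ⟨w, hw⟩ := M.exists_glue v
  have hae : ∀ k, v k =ᵐ[volume.restrict (M.elem k).body] w := fun k =>
    (ae_restrict_iff' (M.elem k).isOpen_body.measurableSet).2
      (Eventually.of_forall fun x hx => (hw k hx).symm)
  refine ⟨w, fun k => (h1 k).congr (hae k), fun k q hq => ?_, fun ⟨k, i⟩ => ?_⟩
  · rw [← h2 k q hq]
    refine integral_congr_ae ?_
    filter_upwards [hae k] with x hx
    rw [hx]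
  · obtain ⟨t, ht, h4⟩ := h3 k i
    obtain ⟨F, hF⟩ := (h1 k).1.exists_isH1
    exact ⟨t, ht.congr (M.elem k).isOpen_body (M.elem k).isBounded_body ((hG k).sub hF)
      (EventuallyEq.rfl.sub (hae k)) EventuallyEq.rfl, h4⟩

end Mesh

end

section

/-! ## Traces from both sides of an edge -/

lemma gradient_mul {f g : Plane → ℝ} (hf : ContDiff ℝ ∞ f) (hg : ContDiff ℝ ∞ g) (x : Plane) :
    gradient (f * g) x = f x • gradient g x + g x • gradient f x := by
  have h1 := ((hf.differentiable (by simp)) x).hasFDerivAt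
  have h2 := ((hg.differentiable (by simp)) x).hasFDerivAt
  simp only [gradient, (h1.mul h2).fderiv, map_add, map_smul]

lemma exists_enorm_le {E : Type*} [NormedAddCommGroup E] {f : Plane → E} (hf : Continuous f)
    (hc : HasCompactSupport f) : ∃ C : ℝ≥0∞, C ≠ ⊤ ∧ ∀ x, ‖f x‖ₑ ≤ C := by
  obtain ⟨C, hC⟩ := hf.bounded_above_of_compact_support hc
  refine ⟨ENNReal.ofReal C, ENNReal.ofReal_ne_top, fun x => ?_⟩
  rw [← ofReal_norm]
  exact ENNReal.ofReal_le_ofReal (hC x)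

/-- Multiplication by a cut-off function is bounded in `H¹`. -/
lemma exists_h1NormSq_mul_le {K B : Set Plane} (hK : IsOpen K) (hKb : Bornology.IsBounded K)
    (hB : IsOpen B) {χ : Plane → ℝ} (hχ : IsTestFunction B χ) :
    ∃ C : ℝ≥0∞, C ≠ ⊤ ∧ ∀ f : Plane → ℝ, ContDiff ℝ ∞ f →
      h1NormSq K (χ * f) ≤ C * h1NormSq (K ∩ B) f := by
  obtain ⟨C₀, hC₀, h0⟩ := exists_enorm_le hχ.1.continuous hχ.2.1
  have hgs : HasCompactSupport (gradient χ) := by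
    refine (hχ.2.1.fderiv (𝕜 := ℝ)).comp_left (g := (InnerProductSpace.toDual ℝ Plane).symm) ?_
    simp
  obtain ⟨C₁, hC₁, h1⟩ := exists_enorm_le (contDiff_gradient hχ.1).continuous hgs
  refine ⟨C₀ ^ 2 + 4 * (C₀ ^ 2 + C₁ ^ 2), by finiteness, fun f hf => ?_⟩
  have hz : ∀ x ∉ B, χ =ᶠ[𝓝 x] 0 := fun x hx =>
    notMem_tsupport_iff_eventuallyEq.1 fun h => hx (hχ.2.2 h)
  have e1 : ∀ x, ‖(χ * f) x‖ₑ ^ 2 ≤ B.indicator (fun x => C₀ ^ 2 * ‖f x‖ₑ ^ 2) x := by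
    intro x
    by_cases hx : x ∈ B
    · rw [indicator_of_mem hx, Pi.mul_apply, enorm_mul, mul_pow]
      gcongr
      exact h0 x
    · rw [Pi.mul_apply, (hz x hx).eq_of_nhds]
      simp
  have e2 : ∀ x, ‖gradient (χ * f) x‖ₑ ^ 2 ≤
      B.indicator (fun x => 4 * (C₀ ^ 2 * ‖gradient f x‖ₑ ^ 2 + C₁ ^ 2 * ‖f x‖ₑ ^ 2)) x := by
    intro x
    by_cases hx : x ∈ B
    · rw [indicator_of_mem hx, gradient_mul hχ.1 hf]
      calc ‖χ x • gradient f x + f x • gradient χ x‖ₑ ^ 2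
          ≤ (‖χ x • gradient f x‖ₑ + ‖f x • gradient χ x‖ₑ) ^ 2 := by
            gcongr; exact enorm_add_le _ _
        _ ≤ 4 * (‖χ x • gradient f x‖ₑ ^ 2 + ‖f x • gradient χ x‖ₑ ^ 2) := ennreal_add_sq_le _ _
        _ ≤ _ := by
            rw [enorm_smul, enorm_smul, mul_pow, mul_pow, mul_comm (‖f x‖ₑ ^ 2)]
            gcongr
            · exact h0 x
            · exact h1 x
    · have h2 : χ * f =ᶠ[𝓝 x] 0 := by
        filter_upwards [hz x hx] with y hy
        simp [hy]
      have h3 : gradient (χ * f) x = 0 := by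
        rw [gradient, h2.fderiv_eq]
        simp
      simp [h3]
  have hfm : Measurable fun x => ‖f x‖ₑ ^ 2 := (hf.continuous.measurable.enorm).pow_const 2
  have hgm : Measurable fun x => ‖gradient f x‖ₑ ^ 2 :=
    ((contDiff_gradient hf).continuous.measurable.enorm).pow_const 2
  have hs : ContDiff ℝ ∞ (χ * f) := hχ.1.mul hf
  rw [h1NormSq_of_contDiff hK hKb hs, h1NormSq_of_contDiff (hK.inter hB)
    (hKb.subset inter_subset_left) hf]
  have i1 := lintegral_mono (μ := volume.restrict K) e1
  have i2 := lintegral_mono (μ := volume.restrict K) e2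
  rw [lintegral_indicator hB.measurableSet, Measure.restrict_restrict hB.measurableSet,
    inter_comm] at i1 i2
  rw [lintegral_const_mul _ hfm] at i1
  rw [lintegral_const_mul' _ _ (by simp),
    lintegral_add_left (hgm.const_mul _), lintegral_const_mul _ hgm,
    lintegral_const_mul _ hfm] at i2
  refine (add_le_add i1 i2).trans ?_
  set a := ∫⁻ x in K ∩ B, ‖f x‖ₑ ^ 2
  set b := ∫⁻ x in K ∩ B, ‖gradient f x‖ₑ ^ 2
  calc C₀ ^ 2 * a + 4 * (C₀ ^ 2 * b + C₁ ^ 2 * a)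
      ≤ C₀ ^ 2 * a + 4 * (C₀ ^ 2 * b + C₁ ^ 2 * a) + (C₀ ^ 2 * b + 4 * (C₀ ^ 2 * a + C₁ ^ 2 * b)) :=
        le_self_add
    _ = _ := by ring

/-- Approximation by smooth functions in the interior. -/
lemma IsH1.exists_h1Tendsto_ball {D : Set Plane} (hD : IsOpen D) {u : Plane → ℝ}
    {G : Plane → Plane} (hu : IsH1 D u G) {x : Plane} {r : ℝ} (hr : 0 < r)
    (hx : Metric.ball x (2 * r) ⊆ D) : ∃ φ, H1Tendsto (Metric.ball x r) φ u := by
  have hsub : Metric.ball x r ⊆ D := (Metric.ball_subset_ball (by linarith)).trans hx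
  have hδ : Tendsto (fun n : ℕ => r * (1 / ((n : ℝ) + 1 + 1))) atTop (𝓝 0) := by
    have := (tendsto_one_div_add_atTop_nhds_zero_nat (𝕜 := ℝ)).comp (tendsto_add_atTop_nat 1)
    simpa [Function.comp_def] using this.const_mul r
  have hball : ∀ n : ℕ, ∀ y ∈ Metric.ball x r,
      Metric.closedBall ((0 : Plane) + (1 : ℝ) • y) (r * (1 / ((n : ℝ) + 1 + 1))) ⊆ D := by
    intro n y hy w hw
    rw [zero_add, one_smul] at hw
    have h1 : r * (1 / ((n : ℝ) + 1 + 1)) < r := by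
      have : 1 / ((n : ℝ) + 1 + 1) < 1 := by
        rw [div_lt_one (by positivity)]; linarith [n.cast_nonneg (α := ℝ)]
      nlinarith
    have h2 := Metric.mem_closedBall.1 hw
    have h3 := Metric.mem_ball.1 hy
    have h4 := dist_triangle w y x
    exact hx (Metric.mem_ball.2 (by linarith))
  obtain ⟨φ, hφ, hφt⟩ := exists_smooth_approx hD Metric.isBounded_ball
    (Metric.isOpen_ball.measurableSet) hsub (c := fun _ => 0) (s := fun _ => 1)
    tendsto_const_nhds tendsto_const_nhds (fun _ => by norm_num) hδ (fun n => by positivity)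
    hball hu.1
  refine ⟨φ, (h1Tendsto_iff Metric.isOpen_ball Metric.isBounded_ball (hu.mono hsub)).2
    ⟨hφ, ?_, tendsto_eLpNorm_gradient hφ (hu.mono hsub).2.1.1
      (hφt 1 0 _ hu.2.2.1 (memLp_coord hu.2.1 0)) (hφt 0 1 _ hu.2.2.2 (memLp_coord hu.2.1 1))⟩⟩
  simpa only [mixedPartial_zero_zero] using hφt 0 0 u (hasWeakPartial_zero_zero hu.1) hu.1

lemma H1Tendsto.mono {D D' : Set Plane} (hD : IsOpen D) (hb : Bornology.IsBounded D)
    (hD' : IsOpen D') (h : D' ⊆ D) {u : Plane → ℝ} {G : Plane → Plane} (hu : IsH1 D u G)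
    {φ : ℕ → Plane → ℝ} (hφ : H1Tendsto D φ u) : H1Tendsto D' φ u := by
  obtain ⟨h1, h2, h3⟩ := (h1Tendsto_iff hD hb hu).1 hφ
  refine (h1Tendsto_iff hD' (hb.subset h) (hu.mono h)).2 ⟨h1, ?_, ?_⟩
  · exact tendsto_of_tendsto_of_tendsto_of_le_of_le tendsto_const_nhds h2 (fun _ => bot_le)
      fun _ => eLpNorm_mono_measure _ (Measure.restrict_mono_set _ h)
  · exact tendsto_of_tendsto_of_tendsto_of_le_of_le tendsto_const_nhds h3 (fun _ => bot_le)
      fun _ => eLpNorm_mono_measure _ (Measure.restrict_mono_set _ h)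

variable {K : Set Plane} {μ : Measure Plane} {u t : Plane → ℝ} {G : Plane → Plane}

/-- Approximations near a point yield the trace near that point. -/
lemma HasTrace.tendsto_mul (hK : IsOpen K) (hKb : Bornology.IsBounded K) (hμ : TraceBound K μ)
    (hu : IsH1 K u G) (ht : HasTrace K μ u t) {B : Set Plane} (hB : IsOpen B)
    (hBb : Bornology.IsBounded B) {F : Plane → Plane} (huB : IsH1 B u F) {φ : ℕ → Plane → ℝ}
    (hφ : H1Tendsto B φ u) {χ : Plane → ℝ} (hχ : IsTestFunction B χ) :
    Tendsto (fun n => eLpNorm (χ * t - χ * φ n) 2 μ) atTop (𝓝 0) := by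
  obtain ⟨htL, ψ, hψ, h1, h2⟩ := ht
  obtain ⟨C₀, hC₀, h0⟩ := exists_enorm_le hχ.1.continuous hχ.2.1
  obtain ⟨C, hC, hmul⟩ := exists_h1NormSq_mul_le hK hKb hB hχ
  have hKB : IsOpen (K ∩ B) := hK.inter hB
  have hKBb := hKb.subset (inter_subset_left (t := B))
  have h3 : H1Tendsto (K ∩ B) ψ u := H1Tendsto.mono hK hKb hKB inter_subset_left hu ⟨hψ, h1⟩
  have h4 : H1Tendsto (K ∩ B) φ u := H1Tendsto.mono hB hBb hKB inter_subset_right huB hφ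
  -- The two sequences are comparable only on the part of `K` in `B`; the cut-off turns this into
  -- convergence on all of `K`, where the trace bound applies.
  have h5 := H1Tendsto.sub_self hKB hKBb (hu.mono inter_subset_left) h3 h4
  have hs : ∀ n, ContDiff ℝ ∞ (χ * (ψ n - φ n)) := fun n =>
    hχ.1.mul (contDiff_sub_pi (hψ n) (hφ.1 n))
  have h6 : Tendsto (fun n => h1NormSq K (χ * (ψ n - φ n))) atTop (𝓝 0) := by
    have := ENNReal.Tendsto.const_mul (a := C) h5 (Or.inr hC)
    rw [mul_zero] at this
    exact tendsto_of_tendsto_of_tendsto_of_le_of_le tendsto_const_nhds this (fun _ => bot_le)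
      fun n => hmul _ (contDiff_sub_pi (hψ n) (hφ.1 n))
  have h7 := hμ.eLpNorm_tendsto hs h6
  have h8 : Tendsto (fun n => eLpNorm (χ * (t - ψ n)) 2 μ) atTop (𝓝 0) := by
    have := ENNReal.Tendsto.const_mul (a := C₀) h2 (Or.inr hC₀)
    rw [mul_zero] at this
    refine tendsto_of_tendsto_of_tendsto_of_le_of_le tendsto_const_nhds this (fun _ => bot_le)
      fun n => ?_
    have h9 := eLpNorm_le_nnreal_smul_eLpNorm_of_ae_le_mul (μ := μ) (f := χ * (t - ψ n))
      (g := t - ψ n) (c := C₀.toNNReal) (p := 2) (Eventually.of_forall fun x => ?_)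
    · rw [ENNReal.smul_def, ENNReal.coe_toNNReal hC₀] at h9
      exact h9
    · rw [Pi.mul_apply, nnnorm_mul]
      gcongr
      rw [← ENNReal.coe_le_coe, ENNReal.coe_toNNReal hC₀]
      exact h0 x
  have h9 := h8.add h7
  rw [add_zero] at h9
  refine tendsto_of_tendsto_of_tendsto_of_le_of_le tendsto_const_nhds h9 (fun _ => bot_le)
    fun n => ?_
  have e : χ * t - χ * φ n = χ * (t - ψ n) + χ * (ψ n - φ n) := by ring
  rw [e]
  refine eLpNorm_add_le ?_ (hs n).continuous.aestronglyMeasurable one_le_two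
  exact hχ.1.continuous.aestronglyMeasurable.mul
    (htL.1.sub (hψ n).continuous.aestronglyMeasurable)

/-- The traces from two sides agree on the part of the edge that runs in the domain. -/
theorem HasTrace.ae_eq_of_subset {D K' : Set Plane} {t' : Plane → ℝ} (hD : IsOpen D)
    (hu : IsH1 D u G) (hK : IsOpen K) (hKb : Bornology.IsBounded K) (hKD : K ⊆ D)
    (hμ : TraceBound K μ) (hK' : IsOpen K') (hKb' : Bornology.IsBounded K') (hKD' : K' ⊆ D)
    (hμ' : TraceBound K' μ) (ht : HasTrace K μ u t) (ht' : HasTrace K' μ u t')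
    (hμD : ∀ᵐ x ∂μ, x ∈ D) : t =ᵐ[μ] t' := by
  -- Near a point of `D`, mollifications approximate `u` on a full ball, hence on both sides of the
  -- edge at once. Both traces are then limits of the same smooth functions.
  have hloc : ∀ x ∈ D, ∀ᶠ B in (𝓝 x).smallSets, ∀ᵐ y ∂μ, y ∈ B → t y = t' y := by
    intro x hx
    obtain ⟨ε, hε, hball⟩ := Metric.isOpen_iff.1 hD x hx
    set r := ε / 2 with hr
    have hr0 : 0 < r := by positivity
    have hball' : Metric.ball x (2 * r) ⊆ D := by rwa [hr, mul_div_cancel₀ _ two_ne_zero]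
    obtain ⟨φ, hφ⟩ := hu.exists_h1Tendsto_ball hD hr0 hball'
    have huB := hu.mono ((Metric.ball_subset_ball (by linarith)).trans hball' :
      Metric.ball x r ⊆ D)
    let χ : ContDiffBump x := ⟨r / 4, r / 2, by positivity, by linarith⟩
    have hχ : IsTestFunction (Metric.ball x r) χ := by
      refine ⟨χ.contDiff, χ.hasCompactSupport, ?_⟩
      rw [χ.tsupport_eq]
      exact Metric.closedBall_subset_ball (by change r / 2 < r; linarith)
    have h1 := ht.tendsto_mul hK hKb hμ (hu.mono hKD) Metric.isOpen_ball Metric.isBounded_ball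
      huB hφ hχ
    have h2 := ht'.tendsto_mul hK' hKb' hμ' (hu.mono hKD') Metric.isOpen_ball
      Metric.isBounded_ball huB hφ hχ
    have hm : AEStronglyMeasurable (χ * t : Plane → ℝ) μ :=
      hχ.1.continuous.aestronglyMeasurable.mul ht.1.1
    have hm' : AEStronglyMeasurable (χ * t' : Plane → ℝ) μ :=
      hχ.1.continuous.aestronglyMeasurable.mul ht'.1.1
    have hmφ : ∀ n, AEStronglyMeasurable (χ * φ n : Plane → ℝ) μ := fun n =>
      (hχ.1.continuous.mul (hφ.1 n).continuous).aestronglyMeasurable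
    have h3 : eLpNorm (χ * t - χ * t' : Plane → ℝ) 2 μ = 0 := by
      have h4 := h1.add h2
      rw [add_zero] at h4
      refine le_antisymm (ge_of_tendsto' h4 fun n => ?_) bot_le
      have e : (χ * t - χ * t' : Plane → ℝ) = (χ * t - χ * φ n) - (χ * t' - χ * φ n) := by ring
      rw [e]
      exact eLpNorm_sub_le (hm.sub (hmφ n)) (hm'.sub (hmφ n)) one_le_two
    rw [eLpNorm_eq_zero_iff (hm.sub hm') two_ne_zero] at h3
    have h5 : ∀ᵐ y ∂μ, y ∈ Metric.ball x (r / 4) → t y = t' y := by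
      filter_upwards [h3] with y hy hyB
      have : χ y = 1 := χ.one_of_mem_closedBall (Metric.ball_subset_closedBall hyB)
      simp only [Pi.sub_apply, Pi.mul_apply, this, Pi.zero_apply] at hy
      linarith
    rw [eventually_smallSets]
    exact ⟨Metric.ball x (r / 4), Metric.ball_mem_nhds x (by positivity), fun s hs => by
      filter_upwards [h5] with y hy h6 using hy (hs h6)⟩
  -- A set that is null near each of its points is null.
  have h0 : μ (D ∩ {y | t y ≠ t' y}) = 0 := by
    refine measure_null_of_locally_null _ fun x hx => ?_
    obtain ⟨B, hB, h⟩ := eventually_smallSets.1 (hloc x hx.1)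
    refine ⟨B ∩ (D ∩ {y | t y ≠ t' y}), inter_mem (mem_nhdsWithin_of_mem_nhds hB) self_mem_nhdsWithin, ?_⟩
    refine measure_mono_null ?_ (ae_iff.1 (h B subset_rfl))
    rintro y ⟨h1, -, h2⟩ h3
    exact h2 (h3 h1)
  filter_upwards [hμD, measure_eq_zero_iff_ae_notMem.1 h0] with y h1 h2
  by_contra h3
  exact h2 ⟨h1, h3⟩

lemma h1NormSq_mono {D D' : Set Plane} (h : D' ⊆ D) (u : Plane → ℝ) :
    h1NormSq D' u ≤ h1NormSq D u := by
  have hle : ∀ f : Plane → ℝ≥0∞, ∫⁻ x in D', f x ≤ ∫⁻ x in D, f x := fun f =>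
    lintegral_mono_set h
  refine add_le_add (hle _) (Finset.sum_le_sum fun β _ => le_iInf₂ fun g hg => ?_)
  exact (iInf₂_le g (hg.mono h)).trans (hle _)

/-- Functions of `H¹₀` have vanishing traces on the boundary. -/
lemma MemH10.hasTrace_zero {D : Set Plane} (hu : MemH10 D u) (hD : IsOpen D) (hKD : K ⊆ D)
    (hμD : ∀ᵐ x ∂μ, x ∈ frontier D) : HasTrace K μ u 0 := by
  obtain ⟨-, φ, hφ, h⟩ := hu
  refine ⟨MemLp.zero, φ, fun n => (hφ n).1, ?_, ?_⟩
  · exact tendsto_of_tendsto_of_tendsto_of_le_of_le tendsto_const_nhds h (fun _ => bot_le)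
      fun n => h1NormSq_mono hKD _
  · refine tendsto_const_nhds.congr fun n => ?_
    rw [eq_comm, eLpNorm_eq_zero_iff (by
      exact aestronglyMeasurable_const.sub (hφ n).1.continuous.aestronglyMeasurable) two_ne_zero]
    -- Test functions have their support in the open set `D` and vanish on its boundary.
    filter_upwards [hμD] with x hx
    have : φ n x = 0 := by
      by_contra h0
      have h1 := (hφ n).2.2 (subset_tsupport _ h0)
      rw [hD.frontier_eq] at hx
      exact hx.2 h1
    simp [this]

lemma ae_arcLength_mem_openSegment {a b : Plane} (hab : a ≠ b) :
    ∀ᵐ x ∂(arcLength a b), x ∈ openSegment ℝ a b := by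
  filter_upwards [ae_arcLength_mem_segment a b, ae_arcLength_ne hab a, ae_arcLength_ne hab b]
    with x h1 h2 h3
  exact mem_openSegment_of_ne_left_right h2.symm h3.symm h1

namespace Mesh

variable {Ω : Set Plane} {ι : Type} {M : Mesh Ω ι} {S : Enrichment} {p : ℕ} {uI : Plane → ℝ}

lemma Admissible.exists_hasTrace (H : M.Admissible S p) (s : M.Side)
    (hu : IsH1 (M.elem s.1).body u G) :
    ∃ t, HasTrace (M.elem s.1).body (M.sideMeasure s) u t := by
  obtain ⟨z, ρ, hK⟩ := H.star s.1
  obtain ⟨φ, hφ⟩ := hK.exists_h1Tendsto hu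
  exact hφ.exists_hasTrace hK.isOpen hK.isBounded (H.traceBound s) hu

lemma Admissible.integrable_trace (H : M.Admissible S p) (s : M.Side)
    (hu : IsH1 (M.elem s.1).body u G) (ht : HasTrace (M.elem s.1).body (M.sideMeasure s) u t)
    {m : Plane → ℝ} (hm : m ∈ M.enrichedEdge S p s) :
    Integrable (fun x => t x * m x) (M.sideMeasure s) := by
  obtain ⟨z, ρ, hK⟩ := H.star s.1
  obtain ⟨φ, hφ⟩ := hK.exists_h1Tendsto hu
  exact (ht.tendsto_integral hK.isOpen hK.isBounded (H.traceBound s) hu hφ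
    (H.traceMultiplier s hm)).1

/-- The trace of `uI` is that of `u` minus that of `u - uI`. The former does not jump, and the
latter is orthogonal to the edge space from either side. -/
theorem Admissible.memVnFree (H : M.Admissible S p) (hΩ : IsOpen Ω) (hu : MemH1 Ω u)
    (hI : M.IsDofInterpolant S p u uI) : M.MemVnFree S p uI := by
  refine ⟨hI.1, fun s s' hne hss => ?_⟩
  obtain ⟨G, hG⟩ := hu.exists_isH1
  have hO := fun k => (M.elem k).isOpen_body
  have hb := fun k => (M.elem k).isBounded_body
  have hGk := fun k => hG.mono (M.body_subset k)
  choose F hF using fun k => (hI.1 k).1.exists_isH1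
  obtain ⟨τ, hτ⟩ := H.exists_hasTrace s (hGk s.1)
  obtain ⟨τ', hτ'⟩ := H.exists_hasTrace s' (hGk s'.1)
  obtain ⟨t, ht, htm⟩ := hI.2.2 s
  obtain ⟨t', ht', htm'⟩ := hI.2.2 s'
  have hint := fun {m} => H.integrable_trace s ((hGk s.1).sub (hF s.1)) ht (m := m)
  have hint' := fun {m} => H.integrable_trace s' ((hGk s'.1).sub (hF s'.1)) ht' (m := m)
  have hTB' := H.traceBound s'
  rw [← hss.sideMeasure_eq] at hτ' ht' htm' hint' hTB'
  rw [← hss.enrichedEdge_eq] at htm' hint'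
  have hΩs : openSegment ℝ (M.sideA s) (M.sideB s) ⊆ Ω := by
    rcases hss with h | h
    · exact absurd h hne
    · exact h.1
  have hae : ∀ᵐ x ∂(M.sideMeasure s), x ∈ Ω :=
    (ae_arcLength_mem_openSegment (PolygonalCell.vert_ne s.2)).mono fun x hx => hΩs hx
  have heq : τ =ᵐ[M.sideMeasure s] τ' := HasTrace.ae_eq_of_subset hΩ hG (hO s.1) (hb s.1)
    (M.body_subset s.1) (H.traceBound s) (hO s'.1) (hb s'.1) (M.body_subset s'.1) hTB' hτ hτ' hae
  have e : u - (u - uI) = uI := sub_sub_cancel u uI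
  refine ⟨τ - t, τ' - t', ?_, ?_, fun m hm => ?_⟩
  · rw [← e]
    exact hτ.sub (hO _) (hb _) (hGk _) ((hGk _).sub (hF _)) ht
  · rw [← e]
    exact hτ'.sub (hO _) (hb _) (hGk _) ((hGk _).sub (hF _)) ht'
  · have h1 : ∫ x, ((τ - t) x - (τ' - t') x) * m x ∂(M.sideMeasure s) =
        ∫ x, (t' x * m x - t x * m x) ∂(M.sideMeasure s) := by
      refine integral_congr_ae ?_
      filter_upwards [heq] with x hx
      simp only [Pi.sub_apply, hx]
      ring
    rw [h1, integral_sub (hint' hm) (hint hm), htm m hm, htm' m hm, sub_zero]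

theorem Admissible.memVn (H : M.Admissible S p) (hΩ : IsOpen Ω) (hu : MemH10 Ω u)
    (hI : M.IsDofInterpolant S p u uI) : M.MemVn S p uI := by
  refine ⟨H.memVnFree hΩ hu.1 hI, fun s hs => ?_⟩
  obtain ⟨G, hG⟩ := hu.1.exists_isH1
  obtain ⟨F, hF⟩ := (hI.1 s.1).1.exists_isH1
  have hGk := hG.mono (M.body_subset s.1)
  obtain ⟨t, ht, htm⟩ := hI.2.2 s
  have h0 : HasTrace (M.elem s.1).body (M.sideMeasure s) u 0 :=
    hu.hasTrace_zero hΩ (M.body_subset s.1)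
      ((ae_arcLength_mem_openSegment (PolygonalCell.vert_ne s.2)).mono fun x hx => hs hx)
  refine ⟨0 - t, ?_, fun m hm => ?_⟩
  · rw [← sub_sub_cancel u uI]
    exact h0.sub (M.elem s.1).isOpen_body (M.elem s.1).isBounded_body hGk (hGk.sub hF) ht
  · simp only [Pi.sub_apply, Pi.zero_apply, zero_sub, neg_mul, integral_neg, htm m hm, neg_zero]

end Mesh

end

section

/-! ## Approximation by enriched polynomials -/

lemma sobolevSeminormSq_one_congr {D : Set Plane} (hD : IsOpen D) {u v : Plane → ℝ}
    {G : Plane → Plane} (hu : IsH1 D u G) (h : u =ᵐ[volume.restrict D] v) :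
    sobolevSeminormSq 1 D u = sobolevSeminormSq 1 D v := by
  rw [hu.sobolevSeminormSq hD, (hu.congr h EventuallyEq.rfl).sobolevSeminormSq hD]

/-- The numerical factor is $2\cdot4=8\le3^2$; this is the origin of the constant $3/\gamma$. -/
lemma chunkConst_le {K : Set Plane} {γ ρ h : ℝ} (hγ : 0 < γ) (hK : 0 < Metric.diam K)
    (hρ : γ * Metric.diam K ≤ ρ) (hh : Metric.diam K ≤ h) :
    chunkConst K ρ ≤ ENNReal.ofReal (3 / γ * h) ^ 2 := by
  have hρ0 : 0 < ρ := (mul_pos hγ hK).trans_le hρ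
  have h1 : Metric.diam K / ρ ≤ 1 / γ := by
    rw [div_le_div_iff₀ hρ0 hγ]; linarith
  have h0 : 0 ≤ Metric.diam K / ρ := by positivity
  have h2 : Metric.diam K / ρ * Metric.diam K ≤ 1 / γ * h := by gcongr
  have h3 : (Metric.diam K / ρ * Metric.diam K) ^ 2 ≤ (1 / γ * h) ^ 2 := by gcongr
  have e : (2 : ℝ≥0∞) = ENNReal.ofReal 2 := by simp
  rw [chunkConst]
  refine (mul_le_mul_left e.le _).trans ?_
  rw [← ENNReal.ofReal_mul zero_le_two, ← ENNReal.ofReal_pow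
    (mul_nonneg (by positivity) (hK.le.trans hh))]
  refine ENNReal.ofReal_le_ofReal ?_
  have e1 : 2 * (4 * (Metric.diam K / ρ) ^ 2 * Metric.diam K ^ 2) =
      8 * (Metric.diam K / ρ * Metric.diam K) ^ 2 := by ring
  have e2 : (3 / γ * h) ^ 2 = 9 * (1 / γ * h) ^ 2 := by ring
  rw [e1, e2]
  nlinarith [sq_nonneg (1 / γ * h)]

lemma IsStarDomain.exists_poly_of_le {K : Set Plane} {z : Plane} {γ ρ h : ℝ}
    (hK : IsStarDomain K z ρ) (hγ : 0 < γ) (hρ : γ * Metric.diam K ≤ ρ) (hh : Metric.diam K ≤ h)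
    (p : ℕ) {u : Plane → ℝ} {G : Plane → Plane} (hu : IsH1 K u G) :
    ∃ π ∈ polyLT (p + 1), sobolevSeminormSq 1 K (u - π) ≤
      ENNReal.ofReal ((3 / γ) ^ p * h ^ p) ^ 2 * sobolevSeminormSq (p + 1) K u := by
  have hd := hK.diam_pos
  have hh0 : 0 < h := hd.trans_le hh
  by_cases hm : sobolevSeminormSq (p + 1) K u < ⊤
  · obtain ⟨π, hπ, h1⟩ := hK.exists_poly p hu hm
    refine ⟨π, hπ, h1.trans ?_⟩
    have h2 : chunkConst K ρ ^ p ≤ ENNReal.ofReal ((3 / γ) ^ p * h ^ p) ^ 2 := by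
      refine (pow_le_pow_left₀ bot_le (chunkConst_le hγ hd hρ hh) p).trans_eq ?_
      rw [← mul_pow, ENNReal.ofReal_pow (by positivity), ← pow_mul, ← pow_mul,
        mul_comm 2]
    exact mul_le_mul_left h2 _
  -- If the seminorm is infinite, so is the right-hand side, because its other factor is positive.
  · refine ⟨0, Submodule.zero_mem _, ?_⟩
    rw [not_lt_top_iff.1 hm, ENNReal.mul_top]
    · exact le_top
    · have : 0 < (3 / γ) ^ p * h ^ p := by positivity
      simp only [ne_eq, pow_eq_zero_iff two_ne_zero, ENNReal.ofReal_eq_zero, not_le, this]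

namespace Mesh

variable {Ω : Set Plane} {ι : Type} {M : Mesh Ω ι} {S : Enrichment} {p : ℕ}

lemma diam_le_size [Finite ι] (k : ι) : (M.elem k).diam ≤ M.size :=
  le_ciSup (f := fun k => (M.elem k).diam) (Set.finite_range _).bddAbove k

lemma Regular.exists_isStarDomain {γ : ℝ} (hM : M.Regular γ) (hγ : 0 < γ) (k : ι) :
    ∃ z ρ, γ * Metric.diam (M.elem k).body ≤ ρ ∧ IsStarDomain (M.elem k).body z ρ := by
  obtain ⟨z, ρ, h1, h2⟩ := hM.star k
  have hc : ∀ i, (M.elem k).vert i ∈ closure (M.elem k).body := fun i =>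
    frontier_subset_closure (PolygonalCell.segment_subset_frontier i (left_mem_segment ℝ _ _))
  -- Two different vertices in the closure give a positive diameter, and thus a positive radius.
  have hd : 0 < (M.elem k).diam := by
    rw [PolygonalCell.diam, ← Metric.diam_closure]
    exact Metric.diam_pos ⟨_, hc 0, _, hc (0 + 1), PolygonalCell.vert_ne 0⟩
      (M.elem k).isBounded_body.closure
  exact ⟨z, ρ, h1, (M.elem k).isOpen_body, (M.elem k).isBounded_body,
    (M.elem k).isConnected_body.nonempty, (mul_pos hγ hd).trans_le h1, h2⟩

lemma Regular.admissible {γ : ℝ} (hM : M.Regular γ) (hγ : 0 < γ) (hS : IsSingularProfile p S.σ)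
    (hθ : IsPolarAngle S.A (M.firstPatch S) S.θ) : M.Admissible S p :=
  ⟨fun k => by
    obtain ⟨z, ρ, -, h⟩ := hM.exists_isStarDomain hγ k
    exact ⟨z, ρ, h⟩, hS, hθ⟩

/-- Approximation on an element of the first layer. -/
lemma Admissible.exists_enrichedPoly_firstLayer (H : M.Admissible S p) {k : ι} {B : ℝ≥0∞}
    (hB : ∀ (v : Plane → ℝ) (G : Plane → Plane), IsH1 (M.elem k).body v G →
      ∃ π ∈ polyLT (p + 1), sobolevSeminormSq 1 (M.elem k).body (v - π) ≤
        B * sobolevSeminormSq (p + 1) (M.elem k).body v)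
    (hk : k ∈ M.firstLayer S) {u u₀ : Plane → ℝ} {G : Plane → Plane}
    (hu : IsH1 (M.elem k).body u G)
    (h : u =ᵐ[volume.restrict (M.elem k).body] u₀ + S.scaled 1) :
    ∃ f ∈ M.enrichedPoly S p k, sobolevSeminormSq 1 (M.elem k).body (u - f) ≤
      B * sobolevSeminormSq (p + 1) (M.elem k).body u₀ := by
  obtain ⟨z, ρ, hK⟩ := H.star k
  obtain ⟨F, hF⟩ := (H.memLocal_singular hk one_pos).1.exists_isH1
  have hu₀ : IsH1 (M.elem k).body u₀ (G - F) := (hu.sub hF).congr (by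
    filter_upwards [h] with x hx
    simp [hx]) EventuallyEq.rfl
  obtain ⟨π, hπ, h1⟩ := hB u₀ _ hu₀
  -- The decomposition of `u` has the unscaled singular function, and the discrete space has the one
  -- scaled by the diameter; the difference is the polynomial `P`.
  obtain ⟨a, P, hP, e⟩ := H.profile.rescale H.angle one_pos hK.diam_pos
  have hf : (π + P) + a • S.scaled (M.elem k).diam ∈ M.enrichedPoly S p k := by
    refine Submodule.add_mem_sup (Submodule.add_mem _ hπ hP) ?_
    rw [if_pos hk]
    exact Submodule.smul_mem _ _ (Submodule.mem_span_singleton_self _)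
  refine ⟨_, hf, ?_⟩
  have hπ1 := isH1_of_contDiff hK.isOpen hK.isBounded (contDiff_of_mem_polyLT π hπ)
  rw [← sobolevSeminormSq_one_congr hK.isOpen (hu₀.sub hπ1) (v := u - _)]
  · exact h1
  · filter_upwards [h, ae_restrict_mem hK.isOpen.measurableSet] with x hx hxK
    have h2 : S.scaled 1 x = a * S.scaled (M.elem k).diam x + P x :=
      e x (body_subset_firstPatch hk hxK)
    simp only [Pi.sub_apply, Pi.add_apply, Pi.smul_apply, smul_eq_mul] at hx ⊢
    rw [hx, h2]
    ring

/-- On each element, the Bramble–Hilbert lemma is applied to `u₀` or to `u` according to the layer,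
with one constant for the whole mesh. -/
theorem Admissible.exists_isPiecewiseEnriched [Fintype ι] {γ : ℝ} (H : M.Admissible S p)
    (hM : M.Regular γ) (hγ : 0 < γ) {u u₀ : Plane → ℝ} (hu : ∀ k, MemH1 (M.elem k).body u)
    (h : ∀ k ∈ M.firstLayer S, u =ᵐ[volume.restrict (M.elem k).body] u₀ + S.scaled 1) :
    ∃ uπ, M.IsPiecewiseEnriched S p uπ ∧ M.brokenSeminorm (u - uπ) ≤
      ENNReal.ofReal ((3 / γ) ^ p * M.size ^ p) * M.layeredSeminorm S p u₀ u := by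
  classical
  set b := ENNReal.ofReal ((3 / γ) ^ p * M.size ^ p) with hb
  choose z ρ hρ hK using hM.exists_isStarDomain hγ
  choose G hG using fun k => (hu k).exists_isH1
  have hB : ∀ k, ∀ (v : Plane → ℝ) (G : Plane → Plane), IsH1 (M.elem k).body v G →
      ∃ π ∈ polyLT (p + 1), sobolevSeminormSq 1 (M.elem k).body (v - π) ≤
        b ^ 2 * sobolevSeminormSq (p + 1) (M.elem k).body v := fun k v G hv =>
    (hK k).exists_poly_of_le hγ (hρ k) (diam_le_size k) p hv
  have hex : ∀ k, ∃ f ∈ M.enrichedPoly S p k, sobolevSeminormSq 1 (M.elem k).body (u - f) ≤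
      b ^ 2 * if k ∈ M.firstLayer S then sobolevSeminormSq (p + 1) (M.elem k).body u₀
        else sobolevSeminormSq (p + 1) (M.elem k).body u := by
    intro k
    split_ifs with hk
    · exact H.exists_enrichedPoly_firstLayer (hB k) hk (hG k) (h k hk)
    · obtain ⟨π, hπ, h1⟩ := hB k u _ (hG k)
      exact ⟨π, Submodule.mem_sup_left hπ, h1⟩
  choose f hf hfb using hex
  obtain ⟨w, hw⟩ := M.exists_glue f
  refine ⟨w, fun k => ⟨f k, hf k, hw k⟩, ?_⟩
  have hsum : ∑ k, sobolevSeminormSq 1 (M.elem k).body (u - w) ≤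
      b ^ 2 * ((∑ k with k ∈ M.firstLayer S, sobolevSeminormSq (p + 1) (M.elem k).body u₀) +
        ∑ k with k ∉ M.firstLayer S, sobolevSeminormSq (p + 1) (M.elem k).body u) := by
    rw [← Finset.sum_ite, Finset.mul_sum]
    refine Finset.sum_le_sum fun k _ => ?_
    obtain ⟨F, hF⟩ := (H.memLocal_enrichedPoly (hf k)).1.exists_isH1
    rw [← sobolevSeminormSq_one_congr (hK k).isOpen ((hG k).sub hF) (v := u - w)]
    · exact hfb k
    · filter_upwards [ae_restrict_mem (hK k).isOpen.measurableSet] with x hx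
      rw [Pi.sub_apply, Pi.sub_apply, hw k hx]
  -- Subadditivity of the square root separates the contributions of the layers.
  refine (ENNReal.rpow_le_rpow hsum (by norm_num : (0 : ℝ) ≤ 1 / 2)).trans ?_
  rw [ENNReal.mul_rpow_of_nonneg _ _ (by norm_num), ennreal_rpow_half_sq]
  exact mul_le_mul_right (ENNReal.rpow_add_le_add_rpow _ _ (by norm_num) (by norm_num)) _

end Mesh

end

end

end EVEM

/-! ### The theorem -/

theorem proposition4p3 (p : ℕ) (hp : 1 ≤ p) (γ : ℝ) (hγ : 0 < γ) (hγ' : γ < 1) :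
    ∃ c : ℝ, 0 < c ∧
      ∀ (Ω : Set EVEM.Plane) (_ : IsOpen Ω) (ι : Type) [Fintype ι] (M : EVEM.Mesh Ω ι)
        (_ : M.Regular γ) (S : EVEM.Enrichment) (_ : 0 < S.γt)
        (_ : EVEM.IsSingularProfile p S.σ)
        (_ : EVEM.IsPolarAngle S.A (M.firstPatch S) S.θ),
        (∀ u : EVEM.Plane → ℝ, EVEM.MemH1 Ω u →
          (∃ uI, M.IsDofInterpolant S p u uI) ∧
          ∀ uI, M.IsDofInterpolant S p u uI →
            M.MemVnFree S p uI ∧ (EVEM.MemH10 Ω u → M.MemVn S p uI) ∧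
            ∀ uπ, M.IsPiecewiseEnriched S p uπ →
              M.brokenSeminorm (u - uI) ≤ M.brokenSeminorm (u - uπ)) ∧
        (∀ u u₀ : EVEM.Plane → ℝ, EVEM.MemH10 Ω u →
          (∀ k ∈ M.firstLayer S,
            u =ᵐ[volume.restrict (M.elem k).body] u₀ + S.scaled 1) →
          (∃ uπ, M.IsPiecewiseEnriched S p uπ ∧
            M.brokenSeminorm (u - uπ) ≤
              ENNReal.ofReal (c * M.size ^ p) * M.layeredSeminorm S p u₀ u) ∧
          (∃ uI, M.MemVn S p uI ∧ M.IsDofInterpolant S p u uI ∧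
            M.brokenSeminorm (u - uI) ≤
              ENNReal.ofReal (c * M.size ^ p) * M.layeredSeminorm S p u₀ u)) := by
  -- One factor $3/\gamma$ for each of the `p` applications of the Poincaré inequality. The same
  -- constant serves for `uI`, since quasi-optimality has constant one.
  refine ⟨(3 / γ) ^ p, by positivity, ?_⟩
  intro Ω hΩ ι _ M hM S _ hS hθ
  have H := hM.admissible hγ hS hθ
  have hres : ∀ u, EVEM.MemH1 Ω u → ∀ k, EVEM.MemH1 (M.elem k).body u := fun u hu k => by
    obtain ⟨G, hG⟩ := hu.exists_isH1
    exact (hG.mono (M.body_subset k)).memH1 (M.elem k).isOpen_body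
  refine ⟨fun u hu => ⟨H.exists_isDofInterpolant hp (hres u hu), fun uI hI =>
    ⟨H.memVnFree hΩ hu hI, fun hu0 => H.memVn hΩ hu0 hI, fun uπ hπ =>
      H.brokenSeminorm_le (hres u hu) hI hπ⟩⟩, fun u u₀ hu h => ?_⟩
  obtain ⟨uπ, hπ, hle⟩ := H.exists_isPiecewiseEnriched hM hγ (hres u hu.1) h
  obtain ⟨uI, hI⟩ := H.exists_isDofInterpolant hp (hres u hu.1)
  exact ⟨⟨uπ, hπ, hle⟩, uI, H.memVn hΩ hu hI, hI,
    (H.brokenSeminorm_le (hres u hu.1) hI hπ).trans hle⟩
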